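/- **Lemma (A-priori estimates for the relative free energy).** Let $\mathbb T^2=(\mathbb R/\mathbb Z)^2$, $u_k(x)=e^{ik\cdot x}$ for $k\in 2\pi\mathbb Z^2$, let $h=-\Delta+1$ on $\mathfrak H=L^2(\mathbb T^2)$, let $\mathfrak F=\bigoplus_{n\ge 0}L^2_{\rm sym}(\mathbb T^{2n})$ be the bosonic Fock space, $\mathcal N$ the particle number operator, and $\mathrm d\Gamma$ the second quantization. For $\lambda>0$ put $$Z_0(\lambda)=\mathrm{Tr}\,e^{-\lambda\,\mathrm d\Gamma(h)},\qquad \Gamma_0=Z_0(\lambda)^{-1}e^{-\lambda\,\mathrm d\Gamma(h)},\qquad N_0=\mathrm{Tr}[\mathcal N\Gamma_0],\qquad \langle A\rangle_{\Gamma_0}=\mathrm{Tr}[A\Gamma_0].$$ Let $w\in L^1(\mathbb R^2)$ be real-valued with Fourier transform $\widehat w(\xi)=\int w(x)e^{-i\xi\cdot x}\,dx$, such that $$\widehat w(0)=1,\qquad \widehat w\ge 0,\qquad \sum_{k\in2\pi\mathbb Z^2}\widehat w(k)(1+|k|^2)<\infty,$$ and such that, for some $C_w\in\mathbb R$ and $\delta>0$,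 $|w(x)|\le C_w|x|^{-2-\delta}$ for all $x\notin[-\tfrac12,\tfrac12]^2$ (this is no condition if $w$ is an integrable function on the torus, regarded as a function on $\mathbb R^2$ that vanishes outside of $[-\tfrac12,\tfrac12]^2$). For $\varepsilon\in(0,1)$ let $w^\varepsilon(x)=\sum_{k\in2\pi\mathbb Z^2}\widehat w(\varepsilon k)e^{ik\cdot x}$ be the periodization of $\varepsilon^{-2}w(\varepsilon^{-1}\cdot)$, let $G(x)=\sum_{k\in 2\pi\mathbb Z^2}(|k|^2+1)^{-1}e^{ik\cdot x}$ (convergent in $L^2(\mathbb T^2)$) be the Green function of $h$, and put $$\tau^\varepsilon=\int_{\mathbb T^2}w^\varepsilon G,\qquad E^\varepsilon=\int_{\mathbb T^2}w^\varepsilon G^2 ,$$ $$\lambda\mathbb H^\varepsilon_\lambda=\lambda\,\mathrm d\Gamma(h)+\frac{\lambda^2}{2}\sum_{k\in2\pi\mathbb Z^2}\widehat w(\varepsilon k)\,\bigl|\mathrm d\Gamma(e_k)-\langle \mathrm d\Gamma(e_k)\rangle_{\Gamma_0}\bigr|^2-\lambda\tau^\varepsilon(\mathcal N-N_0)-E^\varepsilon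 ,$$ where $e_k$ is the operator of multiplication by $e^{ik\cdot x}$, and $$Z(\lambda)=\mathrm{Tr}\,e^{-\lambda\mathbb H^\varepsilon_\lambda},\qquad \Gamma_\lambda=Z(\lambda)^{-1}e^{-\lambda\mathbb H^\varepsilon_\lambda}.$$ Let $\eta\in(0,1/2)$ and $\lambda_0<1$. There is a constant $C$, depending only on $w$, $\eta$ and $\lambda_0$, such that for all $0<\lambda\le\lambda_0$, with $\varepsilon=\lambda^\eta$, the following holds. 1. $0<Z_0(\lambda)<\infty$, $0<Z(\lambda)<\infty$ and $$\left|\log\frac{Z(\lambda)}{Z_0(\lambda)}\right|\le C|\log\varepsilon|^2 .$$ 2. With the relative entropy $\mathcal H(\Gamma,\Gamma')=\mathrm{Tr}[\Gamma(\log\Gamma-\log\Gamma')]$, $$\mathcal H(\Gamma_\lambda,\Gamma_0)+\lambda^2\,\mathrm{Tr}\bigl[(\mathcal N-N_0)^2\Gamma_\lambda\bigr]\le C|\log\varepsilon|^2 .$$ 3. The one-body density matrices $\Gamma_\lambda^{(1)},\Gamma_0^{(1)}$, that is, the bounded operators on $\mathfrak H$ with $\langle f,\Gamma^{(1)}g\rangle=\mathrm{Tr}[a^\dagger(g)a(f)\Gamma]$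 for all $f,g\in\mathfrak H$, exist and satisfy, in Hilbert–Schmidt norm, $$\lambda\,\bigl\|\sqrt h\,\bigl(\Gamma_\lambda^{(1)}-\Gamma_0^{(1)}\bigr)\sqrt h\,\bigr\|_{\rm HS}\le C|\log\varepsilon|^2 .$$ -/

import Mathlib

open scoped ENNReal ComplexConjugate InnerProductSpace

noncomputable section

namespace BoseGas

/-! ## Operators, states and traces on a complex Hilbert space -/

section Abstract

variable {E : Type*} [NormedAddCommGroup E] [InnerProductSpace ℂ E]

/-- `B = exp (-A)`, where the (unbounded, self-adjoint) operator `A` is given by its graph: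
`A` has an orthonormal eigenbasis `b i` with real eigenvalues `μ i`, and `B` is the bounded
operator with `B (b i) = exp (-μ i) • b i`. For symmetric `A` at most one `B` has this property. -/
def IsExpNeg (A : Set (E × E)) (B : E →L[ℂ] E) : Prop :=
  ∃ (ι : Type) (b : HilbertBasis ι ℂ E) (μ : ι → ℝ),
    (∀ i, (b i, (μ i : ℂ) • b i) ∈ A) ∧ ∀ i, B (b i) = (Real.exp (-μ i) : ℂ) • b i

open Classical in
/-- The bounded operator `exp (-A)` (and `0` if there is none, in which case the partition function
below is `0`). -/
def expNeg (A : Set (E × E)) : E →L[ℂ] E :=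
  if h : ∃ B, IsExpNeg A B then h.choose else 0

/-- A diagonalization `Γ = ∑ i, weight i |basis i⟩⟨basis i|` in an orthonormal basis. Every
self-adjoint compact operator on a Hilbert space has one, in particular every state. -/
structure Diagonalization (Γ : E →L[ℂ] E) where
  ι : Type
  basis : HilbertBasis ι ℂ E
  weight : ι → ℝ
  apply_basis : ∀ i, Γ (basis i) = (weight i : ℂ) • basis i

/-- `Tr Γ = ∑ i, weight i` for `Γ ≥ 0`, as an element of `[0, ∞]`. The sum is the same for all
diagonalizations of `Γ`; the infimum serves to select the common value (it is `∞` if there is no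
diagonalization). -/
def trace (Γ : E →L[ℂ] E) : ℝ≥0∞ :=
  ⨅ d : Diagonalization Γ, ∑' i, ENNReal.ofReal (d.weight i)

/-- `Tr (A Γ) = ∑ i, weight i * q (basis i)` for a state `Γ` and a nonnegative operator `A` with
quadratic form `q x = ⟨x, A x⟩ ∈ [0, ∞]`. Again, the sum does not depend on the diagonalization. -/
def expect (Γ : E →L[ℂ] E) (q : E → ℝ≥0∞) : ℝ≥0∞ :=
  ⨅ d : Diagonalization Γ, ∑' i, ENNReal.ofReal (d.weight i) * q (d.basis i)

open Classical in
/-- `Tr (A Γ)` for a state `Γ` and an operator `A` with complex quadratic form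
`F x = ⟨x, A x⟩`; the sum converges absolutely and does not depend on the diagonalization whenever
`|A| Γ` is of trace class. -/
def expectComplex (Γ : E →L[ℂ] E) (F : E → ℂ) : ℂ :=
  if h : Nonempty (Diagonalization Γ) then
    ∑' i, (h.some.weight i : ℂ) * F (h.some.basis i)
  else 0

/-- `p log p - p log q - p + q ≥ 0` for `p, q ≥ 0`, with `0 log 0 = 0` and with value `∞` if
`q = 0 < p`. -/
def entropyTerm (p q : ℝ) : ℝ≥0∞ :=
  if q = 0 ∧ p ≠ 0 then ⊤
  else ENNReal.ofReal (p * Real.log p - p * Real.log q - p + q)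

/-- The von Neumann relative entropy `Tr (Γ (log Γ - log Γ'))` of two states, in `[0, ∞]`:
for `Γ = ∑ p i |b i⟩⟨b i|` and `Γ' = ∑ q j |c j⟩⟨c j|` it is
`∑ i j, |⟨b i, c j⟩|² (p i log (p i) - p i log (q j) - p i + q j)`; the last two terms cancel after
summation, since both states have trace one, and make all summands nonnegative. The value does not
depend on the diagonalizations. -/
def relEntropy (Γ Γ' : E →L[ℂ] E) : ℝ≥0∞ :=
  ⨅ (d : Diagonalization Γ) (d' : Diagonalization Γ'),
    ∑' i, ∑' j, ENNReal.ofReal (‖⟪d.basis i, d'.basis j⟫_ℂ‖ ^ 2)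
      * entropyTerm (d.weight i) (d'.weight j)

/-- The partition function `Tr exp (-A)`. -/
def partitionFunction (A : Set (E × E)) : ℝ≥0∞ := trace (expNeg A)

/-- The Gibbs state `exp (-A) / Tr exp (-A)`. -/
def gibbsState (A : Set (E × E)) : E →L[ℂ] E :=
  (((partitionFunction A).toReal)⁻¹ : ℂ) • expNeg A

end Abstract

/-! ## The torus and its Fock space -/

/-- The normalized Haar measure on `(ℝ/ℤ)^d`. -/
abbrev torusMeasure (d : Type) [Fintype d] : MeasureTheory.Measure (UnitAddTorus d) :=
  MeasureTheory.Measure.pi fun _ => AddCircle.haarAddCircle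

/-- `L²((ℝ/ℤ)^d)`. -/
abbrev L2Torus (d : Type) [Fintype d] : Type := MeasureTheory.Lp ℂ 2 (torusMeasure d)

/-- The orthonormal basis of plane waves `x ↦ exp (2πi p·x)`, `p ∈ ℤ^d`, of `L²((ℝ/ℤ)^d)`. -/
def planeWaves (d : Type) [Fintype d] : HilbertBasis (d → ℤ) ℂ (L2Torus d) :=
  UnitAddTorus.mFourierBasis

/-- The two-dimensional torus `(ℝ/ℤ)²`. -/
abbrev T2 : Type := UnitAddTorus (Fin 2)

/-- The one-particle Hilbert space `L²(𝕋²)`. -/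
abbrev OneBody : Type := L2Torus (Fin 2)

/-- Configurations of `n` particles on `𝕋²`; `x (j, i)` is the `i`-th coordinate of particle
`j`. -/
abbrev Config (n : ℕ) : Type := UnitAddTorus (Fin n × Fin 2)

/-- The position of the `j`-th particle. -/
def particle {n : ℕ} (x : Config n) (j : Fin n) : T2 := fun i => x (j, i)

/-- Relabelling of the particles. -/
def relabel {n : ℕ} (σ : Equiv.Perm (Fin n)) (x : Config n) : Config n :=
  fun q => x (σ q.1, q.2)

lemma measurePreserving_relabel {n : ℕ} (σ : Equiv.Perm (Fin n)) :
    MeasureTheory.MeasurePreserving (relabel σ)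
      (torusMeasure (Fin n × Fin 2)) (torusMeasure (Fin n × Fin 2)) := by
  have h := MeasureTheory.measurePreserving_piCongrLeft
    (α := fun _ : Fin n × Fin 2 => UnitAddCircle)
    (fun _ => (AddCircle.haarAddCircle : MeasureTheory.Measure UnitAddCircle))
    (Equiv.prodCongr σ.symm (Equiv.refl (Fin 2)))
  convert h using 1
  funext x q
  have e := Equiv.piCongrLeft_apply_apply (fun _ : Fin n × Fin 2 => UnitAddCircle)
    (Equiv.prodCongr σ.symm (Equiv.refl (Fin 2))) x (σ q.1, q.2)
  have hq : (Equiv.prodCongr σ.symm (Equiv.refl (Fin 2))) (σ q.1, q.2) = q := by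
    ext <;> simp
  rw [hq] at e
  exact e.symm

/-- The bosonic `n`-particle space `L²_sym((𝕋²)^n)` of square integrable functions that are
invariant under permutations of the particles. -/
def Sector (n : ℕ) : Submodule ℂ (L2Torus (Fin n × Fin 2)) where
  carrier := {ψ | ∀ σ : Equiv.Perm (Fin n),
    ∀ᵐ x ∂(torusMeasure (Fin n × Fin 2)), ψ (relabel σ x) = ψ x}
  add_mem' := by
    intro ψ φ hψ hφ σ
    have h := MeasureTheory.Lp.coeFn_add ψ φ
    have h' := (measurePreserving_relabel σ).quasiMeasurePreserving.ae h
    filter_upwards [h, h', hψ σ, hφ σ] with x h1 h2 h3 h4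
    simp only [h1, h2, Pi.add_apply, h3, h4]
  zero_mem' := by
    intro σ
    have h := MeasureTheory.Lp.coeFn_zero ℂ 2 (torusMeasure (Fin n × Fin 2))
    have h' := (measurePreserving_relabel σ).quasiMeasurePreserving.ae h
    filter_upwards [h, h'] with x h1 h2
    simp only [h1, h2, Pi.zero_apply]
  smul_mem' := by
    intro c ψ hψ σ
    have h := MeasureTheory.Lp.coeFn_smul c ψ
    have h' := (measurePreserving_relabel σ).quasiMeasurePreserving.ae h
    filter_upwards [h, h', hψ σ] with x h1 h2 h3
    simp only [h1, h2, Pi.smul_apply, h3]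

/-- The bosonic Fock space `⨁ n, L²_sym((𝕋²)^n)` (Hilbert sum). -/
abbrev Fock : Type := lp (fun n : ℕ => Sector n) 2

/-- The `n`-particle component of a Fock space vector, as an element of `L²((𝕋²)^n)`. -/
def component (Ψ : Fock) (n : ℕ) : L2Torus (Fin n × Fin 2) := (Ψ n : L2Torus (Fin n × Fin 2))

/-! ## The free Bose gas -/

/-- The eigenvalue `|2πk|² + 1` of `h = -Δ + 1` on the plane wave `exp (2πi k·x)`, `k ∈ ℤ²`. -/
def oneBodyEnergy (k : Fin 2 → ℤ) : ℝ := (∑ i, (2 * Real.pi * k i) ^ 2) + 1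

/-- The eigenvalue of `∑ j, h_{x_j}` on the plane wave of momenta `(p_1, …, p_n)`. -/
def kineticEnergy {n : ℕ} (p : Fin n × Fin 2 → ℤ) : ℝ := ∑ j, oneBodyEnergy fun i => p (j, i)

/-- The graph of `lam dΓ(h)`, `h = -Δ + 1`, on Fock space. -/
def freeHamiltonian (lam : ℝ) : Set (Fock × Fock) :=
  {ΨΦ | ∀ (n : ℕ) (p : Fin n × Fin 2 → ℤ),
    (planeWaves _).repr (component ΨΦ.2 n) p =
      ((lam * kineticEnergy p : ℝ) : ℂ) * (planeWaves _).repr (component ΨΦ.1 n) p}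

/-- The free Gibbs state `exp (-lam dΓ(h)) / Z₀`. -/
def freeGibbs (lam : ℝ) : Fock →L[ℂ] Fock := gibbsState (freeHamiltonian lam)

/-- The quadratic form of the particle number operator. -/
def numberForm (Ψ : Fock) : ℝ≥0∞ := ∑' n : ℕ, (n : ℝ≥0∞) * ENNReal.ofReal (‖Ψ n‖ ^ 2)

/-- `N₀`, the expected number of particles in the free Gibbs state. -/
def freeNumber (lam : ℝ) : ℝ := (expect (freeGibbs lam) numberForm).toReal

/-- The quadratic form of `(𝒩 - M)²`. -/
def numberVarianceForm (M : ℝ) (Ψ : Fock) : ℝ≥0∞ :=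
  ∑' n : ℕ, ENNReal.ofReal (((n : ℝ) - M) ^ 2) * ENNReal.ofReal (‖Ψ n‖ ^ 2)

/-- `∑ j, exp (2πi k·x_j)`: the operator `dΓ(e_k)` acts on the `n`-particle space as the
multiplication by this function. -/
def densityMode (k : Fin 2 → ℤ) {n : ℕ} (x : Config n) : ℂ :=
  ∑ j, UnitAddTorus.mFourier k (particle x j)

/-- The quadratic form of `dΓ(e_k)`. -/
def densityModeForm (k : Fin 2 → ℤ) (Ψ : Fock) : ℂ :=
  ∑' n : ℕ, ∫ x, densityMode k x * ((‖component Ψ n x‖ ^ 2 : ℝ) : ℂ)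
    ∂(torusMeasure (Fin n × Fin 2))

/-- `⟨dΓ(e_k)⟩₀`, the expectation of `dΓ(e_k)` in the free Gibbs state. -/
def freeDensityMode (lam : ℝ) (k : Fin 2 → ℤ) : ℂ :=
  expectComplex (freeGibbs lam) (densityModeForm k)

/-! ## The interaction -/

/-- The Fourier transform `ŵ(ξ) = ∫ exp (-i ξ·x) w(x) dx` on `ℝ²`. -/
def hat (w : EuclideanSpace ℝ (Fin 2) → ℝ) (ξ : EuclideanSpace ℝ (Fin 2)) : ℂ :=
  ∫ x, Complex.exp (-(Complex.I * ((⟪ξ, x⟫_ℝ : ℝ) : ℂ))) * (w x : ℂ)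

/-- The point `2πs k` of the rescaled dual lattice, `k ∈ ℤ²`. -/
def dualPoint (s : ℝ) (k : Fin 2 → ℤ) : EuclideanSpace ℝ (Fin 2) :=
  WithLp.toLp 2 fun i => 2 * Real.pi * s * k i

/-- The admissible interaction potentials `w`. A function on the torus is a function that vanishes
outside of the cell `[-1/2, 1/2]²`; it satisfies the condition `decay` trivially. -/
structure IsInteraction (w : EuclideanSpace ℝ (Fin 2) → ℝ) : Prop where
  integrable : MeasureTheory.Integrable w
  decay : ∃ C δ : ℝ, 0 < δ ∧ ∀ x, (∃ i, 1 / 2 < |x i|) → |w x| ≤ C * ‖x‖ ^ (-(2 + δ))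
  hat_zero : hat w 0 = 1
  hat_real : ∀ ξ, (hat w ξ).im = 0
  hat_nonneg : ∀ ξ, 0 ≤ (hat w ξ).re
  summable : Summable fun k : Fin 2 → ℤ => (hat w (dualPoint 1 k)).re * oneBodyEnergy k

/-- The Fourier coefficients `ŵ(2πε k)` of `w^ε`. -/
def coupling (w : EuclideanSpace ℝ (Fin 2) → ℝ) (ε : ℝ) (k : Fin 2 → ℤ) : ℝ :=
  (hat w (dualPoint ε k)).re

/-- The periodization `w^ε(x) = ∑ k, ŵ(2πε k) exp (2πi k·x)` of `ε⁻² w(x / ε)`. -/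
def scaledPotential (w : EuclideanSpace ℝ (Fin 2) → ℝ) (ε : ℝ) (x : T2) : ℂ :=
  ∑' k : Fin 2 → ℤ, (coupling w ε k : ℂ) * UnitAddTorus.mFourier k x

lemma memℓp_green :
    Memℓp (fun k : Fin 2 → ℤ => (((oneBodyEnergy k)⁻¹ : ℝ) : ℂ)) 2 := by
  apply memℓp_gen
  refine Summable.of_norm_bounded_eventually
    (EisensteinSeries.summable_one_div_norm_rpow (k := 4) (by norm_num)) ?_
  filter_upwards [(Set.finite_singleton (0 : Fin 2 → ℤ)).compl_mem_cofinite] with k hk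
  have hk0 : 0 < ‖k‖ := norm_pos_iff.mpr hk
  have h1 : ‖k‖ ^ 2 ≤ oneBodyEnergy k := by
    have h2 : (1 : ℝ) ≤ 2 * Real.pi := by linarith [Real.pi_gt_three]
    have hE : 0 ≤ oneBodyEnergy k := by unfold oneBodyEnergy; positivity
    have h3 : ‖k‖ ≤ Real.sqrt (oneBodyEnergy k) := by
      refine (pi_norm_le_iff_of_nonneg (Real.sqrt_nonneg _)).mpr fun i => ?_
      rw [Int.norm_eq_abs]
      refine Real.abs_le_sqrt ?_
      have h4 : (2 * Real.pi * k i) ^ 2 ≤ ∑ i, (2 * Real.pi * k i) ^ 2 :=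
        Finset.single_le_sum (f := fun i => (2 * Real.pi * (k i : ℝ)) ^ 2)
          (fun _ _ => sq_nonneg _) (Finset.mem_univ i)
      have h5 : (k i : ℝ) ^ 2 ≤ (2 * Real.pi * k i) ^ 2 := by
        rw [mul_pow]
        exact le_mul_of_one_le_left (sq_nonneg _) (one_le_pow₀ h2)
      unfold oneBodyEnergy
      linarith
    calc ‖k‖ ^ 2 ≤ Real.sqrt (oneBodyEnergy k) ^ 2 := by gcongr
      _ = oneBodyEnergy k := Real.sq_sqrt hE
  have hpos : 0 < oneBodyEnergy k := lt_of_lt_of_le (by positivity) h1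
  have h6 : ‖k‖ ^ (-4 : ℝ) = ((‖k‖ ^ 2) ^ 2)⁻¹ := by
    rw [Real.rpow_neg hk0.le, ← pow_mul]
    norm_cast
  have h7 : ‖(((oneBodyEnergy k)⁻¹ : ℝ) : ℂ)‖ = (oneBodyEnergy k)⁻¹ := by
    rw [Complex.norm_real, Real.norm_of_nonneg (inv_nonneg.mpr hpos.le)]
  rw [h7, h6]
  simp only [ENNReal.toReal_ofNat, Real.rpow_ofNat]
  rw [Real.norm_of_nonneg (by positivity), inv_pow]
  gcongr

/-- The Green function `G(x) = ∑ k, exp (2πi k·x) / (|2πk|² + 1)` of `-Δ + 1`, a function in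
`L²(𝕋²)`. -/
def green : OneBody := (planeWaves (Fin 2)).repr.symm ⟨_, memℓp_green⟩

/-- `τ^ε = ∫ w^ε G`. -/
def tau (w : EuclideanSpace ℝ (Fin 2) → ℝ) (ε : ℝ) : ℝ :=
  (∫ x, scaledPotential w ε x * green x ∂(torusMeasure (Fin 2))).re

/-- `E^ε = ∫ w^ε G²`. -/
def energyShift (w : EuclideanSpace ℝ (Fin 2) → ℝ) (ε : ℝ) : ℝ :=
  (∫ x, scaledPotential w ε x * green x ^ 2 ∂(torusMeasure (Fin 2))).re

/-- The function by which the renormalized interaction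
`(lam²/2) ∑ k, ŵ^ε(k) |dΓ(e_k) - ⟨dΓ(e_k)⟩₀|² - lam τ^ε (𝒩 - N₀) - E^ε`
acts as a multiplication operator on the `n`-particle space. -/
def renormalizedPotential (w : EuclideanSpace ℝ (Fin 2) → ℝ) (lam ε : ℝ) {n : ℕ}
    (x : Config n) : ℝ :=
  lam ^ 2 / 2 * ∑' k : Fin 2 → ℤ, coupling w ε k * ‖densityMode k x - freeDensityMode lam k‖ ^ 2
    - lam * tau w ε * ((n : ℝ) - freeNumber lam) - energyShift w ε

/-- The graph of the renormalized Hamiltonian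
`lam ℍ = lam dΓ(h) + (lam²/2) ∑ k, ŵ^ε(k) |dΓ(e_k) - ⟨dΓ(e_k)⟩₀|² - lam τ^ε (𝒩 - N₀) - E^ε`,
the direct sum over `n` of the operators `lam ∑ j, h_{x_j}` plus multiplication by the function
`renormalizedPotential`. -/
def interactingHamiltonian (w : EuclideanSpace ℝ (Fin 2) → ℝ) (lam ε : ℝ) : Set (Fock × Fock) :=
  {ΨΦ | ∀ n : ℕ, ∃ Υ : L2Torus (Fin n × Fin 2),
    (∀ᵐ x ∂(torusMeasure (Fin n × Fin 2)),
      Υ x = (renormalizedPotential w lam ε x : ℂ) * component ΨΦ.1 n x) ∧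
    ∀ p : Fin n × Fin 2 → ℤ,
      (planeWaves _).repr (component ΨΦ.2 n) p =
        ((lam * kineticEnergy p : ℝ) : ℂ) * (planeWaves _).repr (component ΨΦ.1 n) p
          + (planeWaves _).repr Υ p}

/-- The interacting Gibbs state `exp (-lam ℍ) / Z`. -/
def interactingGibbs (w : EuclideanSpace ℝ (Fin 2) → ℝ) (lam ε : ℝ) : Fock →L[ℂ] Fock :=
  gibbsState (interactingHamiltonian w lam ε)

/-! ## One-body density matrices -/

/-- Adjoining a particle at `y` to a configuration. -/
def addParticle {n : ℕ} (y : T2) (x : Config n) : Config (n + 1) :=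
  fun q => Fin.cons (α := fun _ => UnitAddCircle) (y q.2) (fun j => x (j, q.2)) q.1

/-- The `n`-particle component of `a(f) Ψ`, i.e. `√(n+1) ∫ conj (f y) Ψ(y, x_1, …, x_n) dy`. -/
def annihilate (f : OneBody) (Ψ : Fock) (n : ℕ) (x : Config n) : ℂ :=
  (Real.sqrt (n + 1) : ℂ) *
    ∫ y, conj (f y) * component Ψ (n + 1) (addParticle y x) ∂(torusMeasure (Fin 2))

/-- `γ` is the one-body density matrix `Γ^{(1)}` of the state `Γ`:
`⟨f, γ g⟩ = Tr (a†(g) a(f) Γ) = Tr (dΓ(|g⟩⟨f|) Γ)` for all `f, g`, where for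
`Γ = ∑ p i |b i⟩⟨b i|` the trace is `∑ i, p i ⟨a(g) b i, a(f) b i⟩`. -/
def IsOneBodyDensityMatrix (Γ : Fock →L[ℂ] Fock) (γ : OneBody →L[ℂ] OneBody) : Prop :=
  Nonempty (Diagonalization Γ) ∧ ∀ (d : Diagonalization Γ) (f g : OneBody),
    HasSum (fun q : d.ι × ℕ => (d.weight q.1 : ℂ) *
        ∫ x, conj (annihilate g (d.basis q.1) q.2 x) * annihilate f (d.basis q.1) q.2 x
          ∂(torusMeasure (Fin q.2 × Fin 2)))
      ⟪f, γ g⟫_ℂ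

/-- The Hilbert-Schmidt norm `‖√h D √h‖_HS ∈ [0, ∞]`, computed in the orthonormal basis of plane
waves, in which `h = -Δ + 1` is diagonal. -/
def weightedHSNorm (D : OneBody →L[ℂ] OneBody) : ℝ≥0∞ :=
  (∑' (k : Fin 2 → ℤ) (l : Fin 2 → ℤ), ENNReal.ofReal (oneBodyEnergy k * oneBodyEnergy l *
    ‖⟪planeWaves (Fin 2) k, D (planeWaves (Fin 2) l)⟫_ℂ‖ ^ 2)) ^ (1 / 2 : ℝ)

end BoseGas

end

open BoseGas

open scoped ENNReal ComplexConjugate InnerProductSpace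

noncomputable section

namespace BoseGas

/-! ## Traces do not depend on the diagonalization -/

section AbstractLemmas

variable {E : Type*} [NormedAddCommGroup E] [InnerProductSpace ℂ E]

/-! The interacting Hamiltonian conserves particle number and total momentum, and on each
`n`-particle space its potential is a bounded function. It therefore has an orthonormal eigenbasis
`b i` of vectors with definite particle number and total momentum (`exists_fockEigenbasis`), while
the free gas is diagonal in the occupation number vectors `m`. Noncommutativity enters only through
the overlaps `|⟨m, b i⟩|²`. They form a doubly stochastic matrix that averages free energies to
kinetic energies of eigenvectors (`FockEigenbasis.hasSum_kinetic`) and eigenvalues to diagonal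
energies of occupation vectors (`FockEigenbasis.hasSum_eigenvalue`). With this matrix the trace
inequalities reduce to Jensen's inequality for double series.

Two facts about the interaction suffice. From below, the mode `k = 0` alone contributes `(λ²/2)(𝒩 -
N₀)²`, and completing the square against the linear counterterm leaves `(λ²/4)(𝒩 - N₀)² - (τ² + E)`
(`le_renormalizedPotential`). From above, its expectation in the free state is computed from
independent geometric occupation numbers; as `λ n_q ≤ 1/h_q`, the pair term is at most `E/2` and is
absorbed by `-E`, which leaves `(λ²/2) N₀ ∑ ŵ(εk)` (`freeExpectation_le`). Let `K` be the sum of `τ²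
+ E` and this last quantity. Jensen's inequality, the Peierls–Bogoliubov inequality and the Gibbs
variational principle bound `|log (Z/Z₀)|` by `K`, and the relative entropy plus a quarter of the
scaled number variance by `K` (`abs_log_div_le`, `tsum_entropy_add_variance_le`).

Total momentum conservation makes both one-body density matrices diagonal in plane waves, with mean
occupation numbers `γ_k` and `n_k`. Testing the interacting state against a free gas with mode
energies `λ h_k (1 - x_k)`, `|x_k| ≤ 1/2`, gives `∑ x_k v_k ≤ 2 ∑ x_k² + K` for `v_k = λ h_k (γ_k -
n_k)` (`sum_gibbsOccupation_le`). The choice `x = v / (2 ‖v‖)` turns this into `‖v‖ ≤ 1 + 2K`, which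
is the Hilbert–Schmidt bound.

It remains to see that `K` is of order `|log ε|²`. Summability of `ŵ` is assumed on the unscaled
dual lattice only, so `∑ ŵ(εk) ≤ A ε⁻²` has to be derived (`exists_sum_coupling_le`): the
periodization of `w` is bounded because its Fourier coefficients are nonnegative and summable, the
decay of `w` controls the images outside the central cell, and pairing `w` with squares of
trigonometric polynomials bounds averages of `ŵ` over boxes. Given this, `τ` and `E` cost one and
two logarithms (`exists_counterterm_le`), and `λ² N₀ ε⁻²` stays bounded because `η < 1/2`. -/

lemma hasSum_sq_norm_inner {ι : Type*} (b : HilbertBasis ι ℂ E) (x : E) :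
    HasSum (fun i => ‖⟪b i, x⟫_ℂ‖ ^ 2) (‖x‖ ^ 2) := by
  have h := b.hasSum_inner_mul_inner x x
  have h2 := Complex.hasSum_re h
  convert h2 using 1
  · funext i
    rw [← inner_conj_symm x (b i), ← Complex.normSq_eq_conj_mul_self, Complex.ofReal_re,
      Complex.normSq_eq_norm_sq]
  · rw [inner_self_eq_norm_sq_to_K]; norm_cast

lemma tsum_ofReal_sq_norm_inner {ι : Type*} (b : HilbertBasis ι ℂ E) (x : E) :
    ∑' i, ENNReal.ofReal (‖⟪b i, x⟫_ℂ‖ ^ 2) = ENNReal.ofReal (‖x‖ ^ 2) := by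
  rw [← (hasSum_sq_norm_inner b x).tsum_eq,
    ENNReal.ofReal_tsum_of_nonneg (fun _ => by positivity) (hasSum_sq_norm_inner b x).summable]

namespace Diagonalization

variable {Γ : E →L[ℂ] E}

lemma hasSum_inner (d : Diagonalization Γ) (y x : E) :
    HasSum (fun j => (d.weight j : ℂ) * (⟪y, d.basis j⟫_ℂ * ⟪d.basis j, x⟫_ℂ)) ⟪y, Γ x⟫_ℂ := by
  have h := ((d.basis.hasSum_repr x).mapL Γ).mapL (innerSL ℂ y)
  refine h.congr_fun fun j => ?_
  simp only [map_smul, d.apply_basis, innerSL_apply_apply, smul_eq_mul,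
    HilbertBasis.repr_apply_apply]
  ring

lemma hasSum_re_inner (d : Diagonalization Γ) (x : E) :
    HasSum (fun j => d.weight j * ‖⟪x, d.basis j⟫_ℂ‖ ^ 2) (⟪x, Γ x⟫_ℂ).re := by
  convert Complex.hasSum_re (d.hasSum_inner x x) using 1
  funext j
  rw [← inner_conj_symm (d.basis j) x, Complex.mul_conj, ← Complex.ofReal_mul, Complex.ofReal_re,
    Complex.normSq_eq_norm_sq]

lemma inner_apply_basis (d : Diagonalization Γ) (j : d.ι) :
    ⟪d.basis j, Γ (d.basis j)⟫_ℂ = d.weight j := by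
  rw [d.apply_basis, inner_smul_right, inner_self_eq_norm_sq_to_K, d.basis.orthonormal.1 j]
  simp

lemma re_inner_nonneg (d : Diagonalization Γ) (hd : ∀ i, 0 ≤ d.weight i) (x : E) :
    0 ≤ (⟪x, Γ x⟫_ℂ).re :=
  (d.hasSum_re_inner x).nonneg fun j => mul_nonneg (hd j) (by positivity)

lemma weight_nonneg (d₀ : Diagonalization Γ) (hd₀ : ∀ i, 0 ≤ d₀.weight i)
    (d : Diagonalization Γ) (j : d.ι) : 0 ≤ d.weight j := by
  have h := d₀.re_inner_nonneg hd₀ (d.basis j)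
  rwa [d.inner_apply_basis, Complex.ofReal_re] at h

/-- The quadratic form `∑ s, |⟨Y s, x⟩|²` of the operator `∑ s, |Y s⟩⟨Y s|`. -/
def frameForm {S : Type*} (Y : S → E) (x : E) : ℝ≥0∞ :=
  ∑' s, ENNReal.ofReal (‖⟪Y s, x⟫_ℂ‖ ^ 2)

/-- By Tonelli the sum over the eigenbasis can be carried out first. What remains are diagonal
matrix elements of `Γ`, in which the diagonalization no longer appears; this is why the infima
defining traces and expectations run over constants. -/
lemma tsum_weight_mul_frameForm (d : Diagonalization Γ) (hd : ∀ i, 0 ≤ d.weight i)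
    {S : Type*} (Y : S → E) :
    ∑' j, ENNReal.ofReal (d.weight j) * frameForm Y (d.basis j)
      = ∑' s, ENNReal.ofReal (⟪Y s, Γ (Y s)⟫_ℂ).re := by
  simp_rw [frameForm, ← ENNReal.tsum_mul_left]
  rw [ENNReal.tsum_comm]
  congr 1 with s
  have h := d.hasSum_re_inner (Y s)
  rw [← h.tsum_eq, ENNReal.ofReal_tsum_of_nonneg (fun j => mul_nonneg (hd j) (by positivity))
    h.summable]
  congr 1 with j
  rw [ENNReal.ofReal_mul (hd j)]

lemma tsum_weight_mul_frameForm_eq (d₀ : Diagonalization Γ) (hd₀ : ∀ i, 0 ≤ d₀.weight i)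
    (d : Diagonalization Γ) {S : Type*} (Y : S → E) :
    ∑' j, ENNReal.ofReal (d.weight j) * frameForm Y (d.basis j)
      = ∑' j, ENNReal.ofReal (d₀.weight j) * frameForm Y (d₀.basis j) := by
  rw [d.tsum_weight_mul_frameForm (d₀.weight_nonneg hd₀ d),
    d₀.tsum_weight_mul_frameForm hd₀]

lemma expect_eq (d₀ : Diagonalization Γ) (hd₀ : ∀ i, 0 ≤ d₀.weight i)
    {S : Type*} (Y : S → E) {q : E → ℝ≥0∞} (hq : ∀ x, q x = frameForm Y x) :
    expect Γ q = ∑' j, ENNReal.ofReal (d₀.weight j) * q (d₀.basis j) := by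
  obtain rfl : q = frameForm Y := funext hq
  refine le_antisymm (iInf_le _ d₀) (le_iInf fun d => ?_)
  rw [d₀.tsum_weight_mul_frameForm_eq hd₀ d]

lemma trace_eq (d₀ : Diagonalization Γ) (hd₀ : ∀ i, 0 ≤ d₀.weight i) :
    trace Γ = ∑' j, ENNReal.ofReal (d₀.weight j) := by
  -- By Parseval the basis of `d₀` is a frame for the identity, so the trace is an instance of the
  -- frame computation.
  have h : ∀ d : Diagonalization Γ, ∀ j, frameForm d₀.basis (d.basis j) = 1 := by
    intro d j
    rw [frameForm, tsum_ofReal_sq_norm_inner, d.basis.orthonormal.1 j]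
    simp
  refine le_antisymm (iInf_le _ d₀) (le_iInf fun d => ?_)
  have := d₀.tsum_weight_mul_frameForm_eq hd₀ d d₀.basis
  simp only [h, mul_one] at this
  rw [this]

/-- The elementary bound `ab ≤ a² + b²` reduces absolute convergence to the two positive forms. It
permits the exchange of sums for forms without a sign, which are needed for density modes and
one-body matrix elements. -/
lemma summable_weight_mul_inner_mul_inner (d : Diagonalization Γ) (hd : ∀ i, 0 ≤ d.weight i)
    {S : Type*} (X Y : S → E)
    (hX : ∑' j, ENNReal.ofReal (d.weight j) * frameForm X (d.basis j) ≠ ⊤)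
    (hY : ∑' j, ENNReal.ofReal (d.weight j) * frameForm Y (d.basis j) ≠ ⊤) :
    Summable fun q : d.ι × S => (d.weight q.1 : ℂ) *
      (⟪d.basis q.1, X q.2⟫_ℂ * ⟪Y q.2, d.basis q.1⟫_ℂ) := by
  have key : ∀ Z : S → E, ∑' j, ENNReal.ofReal (d.weight j) * frameForm Z (d.basis j) ≠ ⊤ →
      Summable fun q : d.ι × S => d.weight q.1 * ‖⟪Z q.2, d.basis q.1⟫_ℂ‖ ^ 2 := by
    intro Z hZ
    refine (ENNReal.summable_toReal (f := fun q : d.ι × S =>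
      ENNReal.ofReal (d.weight q.1 * ‖⟪Z q.2, d.basis q.1⟫_ℂ‖ ^ 2)) ?_).congr fun q => ?_
    · rw [ENNReal.tsum_prod']
      convert hZ using 3 with j
      rw [frameForm, ← ENNReal.tsum_mul_left]
      congr 1 with s
      rw [ENNReal.ofReal_mul (hd j)]
    · rw [ENNReal.toReal_ofReal (mul_nonneg (hd _) (by positivity))]
  refine Summable.of_norm_bounded ((key X hX).add (key Y hY)) fun q => ?_
  rw [norm_mul, norm_mul, Complex.norm_real, Real.norm_of_nonneg (hd _),
    norm_inner_symm _ (X q.2), ← mul_add]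
  refine mul_le_mul_of_nonneg_left ?_ (hd _)
  nlinarith [sq_nonneg (‖⟪X q.2, d.basis q.1⟫_ℂ‖ - ‖⟪Y q.2, d.basis q.1⟫_ℂ‖),
    sq_nonneg ‖⟪X q.2, d.basis q.1⟫_ℂ‖, sq_nonneg ‖⟪Y q.2, d.basis q.1⟫_ℂ‖]

lemma tsum_weight_mul_inner_mul_inner (d : Diagonalization Γ) (hd : ∀ i, 0 ≤ d.weight i)
    {S : Type*} (X Y : S → E)
    (hX : ∑' j, ENNReal.ofReal (d.weight j) * frameForm X (d.basis j) ≠ ⊤)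
    (hY : ∑' j, ENNReal.ofReal (d.weight j) * frameForm Y (d.basis j) ≠ ⊤) :
    ∑' q : d.ι × S, (d.weight q.1 : ℂ) *
      (⟪d.basis q.1, X q.2⟫_ℂ * ⟪Y q.2, d.basis q.1⟫_ℂ) = ∑' s, ⟪Y s, Γ (X s)⟫_ℂ := by
  have h := d.summable_weight_mul_inner_mul_inner hd X Y hX hY
  rw [← (Equiv.prodComm S d.ι).tsum_eq, Summable.tsum_prod]
  · congr 1 with s
    rw [← (d.hasSum_inner (Y s) (X s)).tsum_eq]
    congr 1 with j
    simp [mul_comm]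
  · exact (Equiv.prodComm S d.ι).summable_iff.mpr h

/-- The trace of `∑ s, |X s⟩⟨Y s| Γ` does not depend on the diagonalization of `Γ ≥ 0`. -/
lemma hasSum_weight_mul_inner_mul_inner (d₀ : Diagonalization Γ) (hd₀ : ∀ i, 0 ≤ d₀.weight i)
    (d : Diagonalization Γ) {S : Type*} (X Y : S → E)
    (hX : ∑' j, ENNReal.ofReal (d₀.weight j) * frameForm X (d₀.basis j) ≠ ⊤)
    (hY : ∑' j, ENNReal.ofReal (d₀.weight j) * frameForm Y (d₀.basis j) ≠ ⊤) :
    HasSum (fun q : d.ι × S => (d.weight q.1 : ℂ) *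
      (⟪d.basis q.1, X q.2⟫_ℂ * ⟪Y q.2, d.basis q.1⟫_ℂ))
      (∑' q : d₀.ι × S, (d₀.weight q.1 : ℂ) *
      (⟪d₀.basis q.1, X q.2⟫_ℂ * ⟪Y q.2, d₀.basis q.1⟫_ℂ)) := by
  have hd := d₀.weight_nonneg hd₀ d
  have hX' := hX
  have hY' := hY
  rw [← d₀.tsum_weight_mul_frameForm_eq hd₀ d] at hX' hY'
  rw [d₀.tsum_weight_mul_inner_mul_inner hd₀ X Y hX hY,
    ← d.tsum_weight_mul_inner_mul_inner hd X Y hX' hY']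
  exact (d.summable_weight_mul_inner_mul_inner hd X Y hX' hY').hasSum

end Diagonalization

/-! ## The exponential of a symmetric operator -/

/-- Symmetry gives `(μ - ν i) ⟨b i, x⟩ = 0`, so an eigenvector only has components along basis
vectors of its own eigenvalue. Hence the arbitrary choice made in `expNeg` is harmless and any known
eigenbasis may be used. -/
lemma IsExpNeg.apply_of_mem {A : Set (E × E)} {B : E →L[ℂ] E} (hB : IsExpNeg A B)
    (hA : ∀ u ∈ A, ∀ v ∈ A, ⟪u.1, v.2⟫_ℂ = ⟪u.2, v.1⟫_ℂ) {x : E} {μ : ℝ}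
    (hx : (x, (μ : ℂ) • x) ∈ A) : B x = (Real.exp (-μ) : ℂ) • x := by
  obtain ⟨ι, b, ν, hb, hBb⟩ := hB
  have h1 := (b.hasSum_repr x).mapL B
  have h2 := (b.hasSum_repr x).const_smul (Real.exp (-μ) : ℂ)
  refine h1.unique (h2.congr_fun fun i => ?_)
  rw [map_smul, hBb, smul_comm (Real.exp (-μ) : ℂ), HilbertBasis.repr_apply_apply]
  have h3 := hA _ (hb i) _ hx
  simp only [inner_smul_left, inner_smul_right, Complex.conj_ofReal] at h3
  by_cases h4 : ⟪b i, x⟫_ℂ = 0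
  · simp [h4]
  · have h5 : μ = ν i := by exact_mod_cast mul_right_cancel₀ h4 h3
    rw [h5]

lemma expNeg_apply_of_mem {A : Set (E × E)}
    (hA : ∀ u ∈ A, ∀ v ∈ A, ⟪u.1, v.2⟫_ℂ = ⟪u.2, v.1⟫_ℂ) (h : ∃ B, IsExpNeg A B)
    {x : E} {μ : ℝ} (hx : (x, (μ : ℂ) • x) ∈ A) :
    expNeg A x = (Real.exp (-μ) : ℂ) • x := by
  have : IsExpNeg A (expNeg A) := by
    rw [expNeg, dif_pos h]
    exact h.choose_spec
  exact this.apply_of_mem hA hx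

end AbstractLemmas

/-! ## Diagonal operators -/

section DiagonalOperators

variable {E : Type*} [NormedAddCommGroup E] [InnerProductSpace ℂ E] {ι : Type*}

lemma memℓp_mul_of_bounded {a : ι → ℂ} {M : ℝ} (ha : ∀ i, ‖a i‖ ≤ M) {f : ι → ℂ}
    (hf : Memℓp f 2) : Memℓp (fun i => a i * f i) 2 := by
  refine memℓp_gen ?_
  have h := (hf.summable (by norm_num)).mul_left (M ^ 2)
  refine Summable.of_nonneg_of_le (fun i => by positivity) (fun i => ?_) h
  simp only [ENNReal.toReal_ofNat, Real.rpow_ofNat, norm_mul, mul_pow]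
  gcongr
  exact ha i

/-- The linear map with eigenvalues `a i` on the orthonormal basis `b`. -/
def diagonalLinearMap (b : HilbertBasis ι ℂ E) (a : ι → ℂ) (M : ℝ) (ha : ∀ i, ‖a i‖ ≤ M) :
    E →ₗ[ℂ] E where
  toFun x := b.repr.symm ⟨fun i => a i * b.repr x i,
    memℓp_mul_of_bounded ha (lp.memℓp (b.repr x))⟩
  map_add' x y := by
    rw [← map_add]
    congr 1
    ext i
    simp only [map_add, lp.coeFn_add, Pi.add_apply, mul_add]
  map_smul' c x := by
    rw [RingHom.id_apply, ← map_smul]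
    congr 1
    ext i
    simp [mul_left_comm]

lemma norm_diagonalLinearMap_le (b : HilbertBasis ι ℂ E) {a : ι → ℂ} {M : ℝ}
    (ha : ∀ i, ‖a i‖ ≤ M) (x : E) : ‖diagonalLinearMap b a M ha x‖ ≤ |M| * ‖x‖ := by
  simp only [diagonalLinearMap, LinearMap.coe_mk, AddHom.coe_mk, LinearIsometryEquiv.norm_map]
  have h1 := lp.norm_rpow_eq_tsum (p := 2) (by norm_num)
    (⟨fun i => a i * b.repr x i, memℓp_mul_of_bounded ha (lp.memℓp (b.repr x))⟩ :
      lp (fun _ : ι => ℂ) 2)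
  have h2 := lp.norm_rpow_eq_tsum (p := 2) (by norm_num) (b.repr x)
  have h3 := (lp.memℓp (b.repr x)).summable (p := 2) (by norm_num)
  have h4 := (memℓp_mul_of_bounded ha (lp.memℓp (b.repr x))).summable (p := 2) (by norm_num)
  simp only [ENNReal.toReal_ofNat, Real.rpow_ofNat, LinearIsometryEquiv.norm_map] at h1 h2 h3 h4
  refine le_of_sq_le_sq ?_ (by positivity)
  rw [h1, mul_pow, h2, ← tsum_mul_left]
  refine Summable.tsum_le_tsum (fun i => ?_) h4 (h3.mul_left _)
  rw [norm_mul, mul_pow]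
  have := (ha i).trans (le_abs_self M)
  gcongr

/-- The operator with eigenvalues `a i` on the orthonormal basis `b`. -/
def diagonalOperator (b : HilbertBasis ι ℂ E) (a : ι → ℂ) (M : ℝ) (ha : ∀ i, ‖a i‖ ≤ M) :
    E →L[ℂ] E :=
  (diagonalLinearMap b a M ha).mkContinuous |M| (norm_diagonalLinearMap_le b ha)

variable (b : HilbertBasis ι ℂ E) {a : ι → ℂ} {M : ℝ} (ha : ∀ i, ‖a i‖ ≤ M)

lemma repr_diagonalOperator (x : E) (i : ι) :
    b.repr (diagonalOperator b a M ha x) i = a i * b.repr x i := by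
  simp [diagonalOperator, diagonalLinearMap]

lemma norm_diagonalOperator_le (hM : 0 ≤ M) : ‖diagonalOperator b a M ha‖ ≤ M := by
  have := (diagonalLinearMap b a M ha).mkContinuous_norm_le (abs_nonneg M)
    (norm_diagonalLinearMap_le b ha)
  exact this.trans_eq (abs_of_nonneg hM)

lemma diagonalOperator_apply_basis (i : ι) :
    diagonalOperator b a M ha (b i) = a i • b i := by
  classical
  apply b.repr.injective
  ext j
  rw [repr_diagonalOperator, map_smul, HilbertBasis.repr_self]
  by_cases h : j = i
  · subst h; simp
  · simp [lp.single_apply, h]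

end DiagonalOperators

/-! ## Eigenbases of perturbed operators with compact resolvent -/

section Eigenbasis

variable {E : Type*} [NormedAddCommGroup E] [InnerProductSpace ℂ E]

lemma isCompactOperator_smulRight (y : E) (f : E →L[ℂ] ℂ) :
    IsCompactOperator (f.smulRight y) := by
  refine (isCompactOperator_iff_exists_mem_nhds_image_subset_compact _).mpr
    ⟨f ⁻¹' Metric.closedBall 0 1, f.continuous.continuousAt.preimage_mem_nhds (by
      rw [map_zero]; exact Metric.closedBall_mem_nhds _ one_pos),
      (fun c : ℂ => c • y) '' Metric.closedBall 0 1,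
      (isCompact_closedBall _ _).image (by fun_prop), ?_⟩
  rintro _ ⟨x, hx, rfl⟩
  exact ⟨f x, hx, rfl⟩

/-- It is the norm limit of its finite-rank truncations: outside a large finite set the remaining
eigenvalues, and so the norm of the difference, are small. -/
lemma isCompactOperator_diagonalOperator [CompleteSpace E] {ι : Type*} (b : HilbertBasis ι ℂ E)
    {a : ι → ℂ} {M : ℝ} (ha : ∀ i, ‖a i‖ ≤ M) (h0 : Filter.Tendsto a Filter.cofinite (nhds 0)) :
    IsCompactOperator (diagonalOperator b a M ha) := by
  classical
  let F : Finset ι → E →L[ℂ] E := fun s => ∑ i ∈ s, (innerSL ℂ (b i)).smulRight (a i • b i)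
  have hF : ∀ s, IsCompactOperator (F s) := by
    intro s
    have : F s ∈ compactOperator (RingHom.id ℂ) E E :=
      Submodule.sum_mem _ fun i _ => isCompactOperator_smulRight _ _
    exact this
  refine isCompactOperator_of_tendsto (l := Filter.atTop) (F := F) ?_ (Filter.Eventually.of_forall hF)
  rw [Metric.tendsto_atTop]
  intro r hr
  have h1 : {i | ¬ ‖a i‖ < r / 2}.Finite := by
    have := h0.norm
    rw [norm_zero] at this
    exact this.eventually (gt_mem_nhds (half_pos hr))
  refine ⟨h1.toFinset, fun s hs => ?_⟩
  have h2 : ∀ i, ‖if i ∈ s then 0 else a i‖ ≤ r / 2 := by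
    intro i
    split_ifs with h
    · simpa using (half_pos hr).le
    · by_contra hc
      exact h (hs (by simpa using (not_le.mp hc).le))
  have h3 : diagonalOperator b a M ha - F s = diagonalOperator b _ (r / 2) h2 := by
    ext x
    apply b.repr.injective
    ext i
    rw [repr_diagonalOperator, sub_apply, map_sub, lp.coeFn_sub, Pi.sub_apply,
      repr_diagonalOperator]
    simp only [F, sum_apply, ContinuousLinearMap.smulRight_apply,
      innerSL_apply_apply, HilbertBasis.repr_apply_apply, inner_sum, inner_smul_right,
      orthonormal_iff_ite.mp b.orthonormal]
    by_cases h : i ∈ s <;> simp [h, mul_comm]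
  rw [dist_comm, dist_eq_norm, h3]
  exact (norm_diagonalOperator_le b h2 (half_pos hr).le).trans_lt (half_lt_self hr)

/-- A compact symmetric operator on a Hilbert space has an orthonormal basis of eigenvectors. -/
lemma exists_hilbertBasis_eigenvectors {F : Type} [NormedAddCommGroup F] [InnerProductSpace ℂ F]
    [CompleteSpace F] (T : F →L[ℂ] F) (hT : IsCompactOperator T) (hT' : T.IsSymmetric) :
    ∃ (ι : Type) (b : HilbertBasis ι ℂ F), ∀ i, ∃ r : ℝ, T (b i) = (r : ℂ) • b i := by
  have hcl : ∀ μ : ℂ, IsClosed (Module.End.eigenspace (T : Module.End ℂ F) μ : Set F) := by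
    intro μ
    have : (Module.End.eigenspace (T : Module.End ℂ F) μ : Set F) = {x | T x = μ • x} := by
      ext x
      simp
    rw [this]
    exact isClosed_eq T.continuous (continuous_const_smul μ)
  have : ∀ μ : ℂ, CompleteSpace (Module.End.eigenspace (T : Module.End ℂ F) μ) := fun μ =>
    (hcl μ).completeSpace_coe
  -- Orthonormal bases of all eigenspaces are glued. Orthogonality between them comes from symmetry,
  -- and totality is the spectral theorem for compact symmetric operators.
  choose w b hb using fun μ : ℂ =>
    exists_hilbertBasis ℂ (Module.End.eigenspace (T : Module.End ℂ F) μ)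
  have ho := hT'.orthogonalFamily_eigenspaces.orthonormal_sigma_orthonormal
    (v_family := fun μ i => b μ i) fun μ => (b μ).orthonormal
  refine ⟨Σ μ : ℂ, w μ, HilbertBasis.mkOfOrthogonalEqBot ho ?_, ?_⟩
  · rw [eq_bot_iff, ← ContinuousLinearMap.orthogonalComplement_iSup_eigenspaces_eq_bot hT hT']
    intro x hx
    rw [Submodule.iSup_eq_span, Submodule.mem_orthogonal]
    rw [Submodule.mem_orthogonal] at hx
    intro u hu
    induction hu using Submodule.span_induction with
    | mem u hu =>
      obtain ⟨μ, hu⟩ := Set.mem_iUnion.mp hu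
      have h1 := ((((b μ).hasSum_repr ⟨u, hu⟩).mapL
        (Module.End.eigenspace (T : Module.End ℂ F) μ).subtypeL).mapL (innerSL ℂ x))
      have h2 : ⟪x, u⟫_ℂ = 0 := by
        refine h1.unique ?_
        convert hasSum_zero with i
        have h3 := hx _ (Submodule.subset_span ⟨⟨μ, i⟩, rfl⟩)
        rw [← inner_conj_symm, map_eq_zero] at h3
        simp only [map_smul, Submodule.subtypeL_apply, innerSL_apply_apply] at h3 ⊢
        erw [h3]
        simp
      rw [← inner_conj_symm, h2, map_zero]
    | zero => simp
    | add u v _ _ hu hv => rw [inner_add_left, hu, hv, add_zero]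
    | smul c u _ hu => rw [inner_smul_left, hu, mul_zero]
  · rintro ⟨μ, i⟩
    have h1 : T (b μ i : F) = μ • (b μ i : F) := by
      simpa using Module.End.mem_eigenspace_iff.mp (b μ i).2
    have h2 : (b μ i : F) ≠ 0 := by
      have := (b μ).orthonormal.ne_zero i
      simpa using this
    have h3 : conj μ = μ := by
      refine hT'.conj_eigenvalue_eq_self (Module.End.hasEigenvalue_of_hasEigenvector
        (x := (b μ i : F)) ⟨?_, h2⟩)
      exact Module.End.mem_eigenspace_iff.mpr h1
    refine ⟨μ.re, ?_⟩
    rw [HilbertBasis.coe_mkOfOrthogonalEqBot, Complex.conj_eq_iff_re.mp h3]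
    exact h1

/-- If `S` is compact, symmetric, injective and `V` symmetric with `‖V‖ ‖S‖ < 1`, then `S⁻¹ + V`
has an orthonormal basis of eigenvectors. -/
lemma exists_hilbertBasis_perturbation {F : Type} [NormedAddCommGroup F] [InnerProductSpace ℂ F]
    [CompleteSpace F] (S V : F →L[ℂ] F) (hS : IsCompactOperator S) (hS' : S.IsSymmetric)
    (hV : V.IsSymmetric) (hinj : Function.Injective S) (hVS : ‖V‖ * ‖S‖ < 1) :
    ∃ (ι : Type) (b : HilbertBasis ι ℂ F), ∀ i, ∃ μ : ℝ, b i = S ((μ : ℂ) • b i - V (b i)) := by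
  have hn : ‖-(V * S)‖ < 1 := by
    rw [norm_neg]
    exact (norm_mul_le _ _).trans_lt hVS
  let u := Units.oneSub (-(V * S)) hn
  have hu : (u : F →L[ℂ] F) = 1 + V * S := by simp [u]
  -- `R = S (1 + V S)⁻¹` plays the role of `(S⁻¹ + V)⁻¹`; the inverse is a Neumann series. It is
  -- compact since `S` is, and its symmetry is checked on vectors `x + V S x`, which exhaust the
  -- space.
  let R : F →L[ℂ] F := S * ((u⁻¹ : (F →L[ℂ] F)ˣ) : F →L[ℂ] F)
  have hRu : ∀ x, R (x + V (S x)) = S x := by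
    intro x
    have h1 : ((u⁻¹ : (F →L[ℂ] F)ˣ) : F →L[ℂ] F) * u = 1 := u.inv_mul
    have h2 : ((u⁻¹ : (F →L[ℂ] F)ˣ) : F →L[ℂ] F) ((u : F →L[ℂ] F) x) = x :=
      DFunLike.congr_fun h1 x
    rw [hu] at h2
    exact congrArg S h2
  have hsurj : ∀ y, ∃ x, x + V (S x) = y := by
    intro y
    refine ⟨((u⁻¹ : (F →L[ℂ] F)ˣ) : F →L[ℂ] F) y, ?_⟩
    have h1 : (u : F →L[ℂ] F) * ((u⁻¹ : (F →L[ℂ] F)ˣ) : F →L[ℂ] F) = 1 := u.mul_inv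
    have h2 := congrArg (fun T : F →L[ℂ] F => T y) h1
    rw [hu] at h2
    simpa using h2
  have hRc : IsCompactOperator R := hS.comp_clm _
  have hRs : R.IsSymmetric := by
    intro y₁ y₂
    obtain ⟨x₁, rfl⟩ := hsurj y₁
    obtain ⟨x₂, rfl⟩ := hsurj y₂
    change ⟪R _, _⟫_ℂ = ⟪_, R _⟫_ℂ
    rw [hRu, hRu, inner_add_right, inner_add_left]
    have h1 : ⟪S x₁, x₂⟫_ℂ = ⟪x₁, S x₂⟫_ℂ := hS' x₁ x₂
    have h2 : ⟪V (S x₁), S x₂⟫_ℂ = ⟪S x₁, V (S x₂)⟫_ℂ := hV (S x₁) (S x₂)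
    rw [h1, h2]
  obtain ⟨ι, b, hb⟩ := exists_hilbertBasis_eigenvectors R hRc hRs
  refine ⟨ι, b, fun i => ?_⟩
  obtain ⟨r, hr⟩ := hb i
  obtain ⟨x, hx⟩ := hsurj (b i)
  have h1 : S x = (r : ℂ) • b i := by rw [← hr, ← hx, hRu]
  -- Injectivity of `S` excludes the eigenvalue zero of `R`, so its reciprocal is an eigenvalue of
  -- `S⁻¹ + V`.
  have hr0 : r ≠ 0 := by
    rintro rfl
    have h2 : S x = S 0 := by simpa using h1
    have h3 := hinj h2
    have h4 := b.orthonormal.ne_zero i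
    rw [← hx, h3] at h4
    simp at h4
  have hrc : (r : ℂ) ≠ 0 := by exact_mod_cast hr0
  refine ⟨r⁻¹, ?_⟩
  have h2 : x = b i - (r : ℂ) • V (b i) := by
    rw [h1, map_smul] at hx
    exact eq_sub_of_add_eq hx
  have h3 : ((r⁻¹ : ℝ) : ℂ) • b i - V (b i) = (r : ℂ)⁻¹ • x := by
    rw [h2, smul_sub, smul_smul, inv_mul_cancel₀ hrc, one_smul]
    push_cast
    rfl
  rw [h3, map_smul, h1, smul_smul, inv_mul_cancel₀ hrc, one_smul]

end Eigenbasis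

/-! ## Fourier analysis on tori -/

section TorusFourier

open MeasureTheory UnitAddTorus

variable {d : Type} [Fintype d]

instance : Measure.IsAddHaarMeasure (AddCircle.haarAddCircle : Measure UnitAddCircle) :=
  inferInstance

lemma planeWaves_repr (ψ : L2Torus d) (p : d → ℤ) :
    (planeWaves d).repr ψ p = ∫ x, mFourier (-p) x * ψ x ∂(torusMeasure d) :=
  mFourierBasis_repr ψ p

lemma coeFn_planeWaves (p : d → ℤ) : planeWaves d p =ᵐ[torusMeasure d] mFourier p := by
  have h := coeFn_mFourierLp (d := d) 2 p
  rw [← coe_mFourierBasis] at h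
  exact h

lemma repr_planeWaves [DecidableEq d] (p q : d → ℤ) :
    (planeWaves d).repr (planeWaves d p) q = if q = p then 1 else 0 := by
  rw [HilbertBasis.repr_self, lp.single_apply]
  by_cases h : q = p
  · subst h; simp
  · simp [h]

lemma ext_repr {ψ φ : L2Torus d}
    (h : ∀ p, (planeWaves d).repr ψ p = (planeWaves d).repr φ p) : ψ = φ :=
  (planeWaves d).repr.injective (lp.ext (funext h))

lemma inner_eq_integral (φ ψ : L2Torus d) :
    ⟪φ, ψ⟫_ℂ = ∫ x, conj (φ x) * ψ x ∂(torusMeasure d) := by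
  rw [L2.inner_def]
  simp only [RCLike.inner_apply']

lemma hasSum_conj_repr_mul_repr (φ ψ : L2Torus d) :
    HasSum (fun p => conj ((planeWaves d).repr φ p) * (planeWaves d).repr ψ p) ⟪φ, ψ⟫_ℂ := by
  refine ((planeWaves d).hasSum_inner_mul_inner φ ψ).congr_fun fun p => ?_
  rw [HilbertBasis.repr_apply_apply, HilbertBasis.repr_apply_apply, inner_conj_symm]

lemma hasSum_sq_norm_repr (ψ : L2Torus d) :
    HasSum (fun p => ‖(planeWaves d).repr ψ p‖ ^ 2) (‖ψ‖ ^ 2) := by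
  simpa only [HilbertBasis.repr_apply_apply] using hasSum_sq_norm_inner (planeWaves d) ψ

lemma integrable_sq_norm (ψ : L2Torus d) :
    Integrable (fun x => ‖ψ x‖ ^ 2) (torusMeasure d) :=
  (memLp_two_iff_integrable_sq_norm (Lp.memLp ψ).1).mp (Lp.memLp ψ)

lemma integral_sq_norm (ψ : L2Torus d) :
    ∫ x, ‖ψ x‖ ^ 2 ∂(torusMeasure d) = ‖ψ‖ ^ 2 := by
  have h := inner_eq_integral ψ ψ
  rw [inner_self_eq_norm_sq_to_K] at h
  have h2 : ∀ x, conj (ψ x) * ψ x = ((‖ψ x‖ ^ 2 : ℝ) : ℂ) := fun x => by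
    rw [Complex.conj_mul']; norm_cast
  simp only [h2] at h
  rw [integral_complex_ofReal] at h
  exact Complex.ofReal_injective (h.symm.trans (by push_cast; rfl))

/-! ### Translations -/

lemma measurePreserving_add (v : UnitAddTorus d) :
    MeasurePreserving (fun x => x + v) (torusMeasure d) (torusMeasure d) :=
  measurePreserving_add_right _ v

/-- `ψ ↦ ψ (· + v)`. -/
def translate (v : UnitAddTorus d) (ψ : L2Torus d) : L2Torus d :=
  Lp.compMeasurePreserving _ (measurePreserving_add v) ψ

lemma coeFn_translate (v : UnitAddTorus d) (ψ : L2Torus d) :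
    translate v ψ =ᵐ[torusMeasure d] fun x => ψ (x + v) :=
  Lp.coeFn_compMeasurePreserving ψ (measurePreserving_add v)

lemma mFourier_apply_add (p : d → ℤ) (x v : UnitAddTorus d) :
    mFourier p (x + v) = mFourier p x * mFourier p v := by
  simp only [mFourier, ContinuousMap.coe_mk, Pi.add_apply, fourier_apply, smul_add,
    AddCircle.toCircle_add, Circle.coe_mul, Finset.prod_mul_distrib]

lemma mFourier_neg_mul_self (p : d → ℤ) (v : UnitAddTorus d) :
    mFourier (-p) v * mFourier p v = 1 := by
  rw [← mFourier_add, neg_add_cancel, mFourier_zero, ContinuousMap.one_apply]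

lemma norm_mFourier_apply (p : d → ℤ) (v : UnitAddTorus d) : ‖mFourier p v‖ = 1 := by
  have h := mFourier_neg_mul_self p v
  rw [mFourier_neg, Complex.conj_mul'] at h
  have : ‖mFourier p v‖ ^ 2 = 1 := by exact_mod_cast h
  nlinarith [norm_nonneg (mFourier p v)]

lemma repr_translate (v : UnitAddTorus d) (ψ : L2Torus d) (p : d → ℤ) :
    (planeWaves d).repr (translate v ψ) p = mFourier p v * (planeWaves d).repr ψ p := by
  rw [planeWaves_repr, planeWaves_repr, ← integral_const_mul]
  have h1 : ∫ x, mFourier (-p) x * translate v ψ x ∂(torusMeasure d)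
      = ∫ x, mFourier p v * (mFourier (-p) (x + v) * ψ (x + v)) ∂(torusMeasure d) := by
    refine integral_congr_ae ?_
    filter_upwards [coeFn_translate v ψ] with x hx
    rw [hx, mFourier_apply_add]
    have := mFourier_neg_mul_self p v
    linear_combination (-mFourier (-p) x * ψ (x + v)) * this
  rw [h1]
  exact integral_add_right_eq_self (μ := torusMeasure d)
    (fun x => mFourier p v * (mFourier (-p) x * ψ x)) v

/-! ### Multiplication by bounded functions -/

/-- A bounded measurable real function. -/
structure BoundedFunction (d : Type) [Fintype d] where
  toFun : UnitAddTorus d → ℝ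
  measurable : Measurable toFun
  bound : ℝ
  bound_nonneg : 0 ≤ bound
  le_bound : ∀ x, |toFun x| ≤ bound

variable (g : BoundedFunction d)

lemma BoundedFunction.memLp_mul (ψ : L2Torus d) :
    MemLp (fun x => (g.toFun x : ℂ) * ψ x) 2 (torusMeasure d) := by
  refine MemLp.of_le_mul (c := g.bound) (Lp.memLp ψ) ?_ (Filter.Eventually.of_forall fun x => ?_)
  · exact (Complex.measurable_ofReal.comp g.measurable).aestronglyMeasurable.mul
      (Lp.aestronglyMeasurable ψ)
  · rw [norm_mul, Complex.norm_real]
    exact mul_le_mul_of_nonneg_right (g.le_bound x) (norm_nonneg _)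

/-- The operator of multiplication by a bounded function. -/
def mulOperator : L2Torus d →L[ℂ] L2Torus d :=
  LinearMap.mkContinuous
    { toFun := fun ψ => (g.memLp_mul ψ).toLp
      map_add' := fun ψ φ => by
        refine Lp.ext ?_
        filter_upwards [(g.memLp_mul (ψ + φ)).coeFn_toLp, (g.memLp_mul ψ).coeFn_toLp,
          (g.memLp_mul φ).coeFn_toLp, Lp.coeFn_add ψ φ,
          Lp.coeFn_add (g.memLp_mul ψ).toLp (g.memLp_mul φ).toLp] with x h1 h2 h3 h4 h5
        rw [h1, h5, Pi.add_apply, h2, h3, h4, Pi.add_apply, mul_add]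
      map_smul' := fun c ψ => by
        refine Lp.ext ?_
        filter_upwards [(g.memLp_mul (c • ψ)).coeFn_toLp, (g.memLp_mul ψ).coeFn_toLp,
          Lp.coeFn_smul c ψ, Lp.coeFn_smul c (g.memLp_mul ψ).toLp] with x h1 h2 h3 h4
        rw [RingHom.id_apply, h1, h4, Pi.smul_apply, h2, h3, Pi.smul_apply, smul_eq_mul,
          smul_eq_mul, mul_left_comm] } g.bound fun ψ => by
    refine Lp.norm_le_mul_norm_of_ae_le_mul ?_
    filter_upwards [(g.memLp_mul ψ).coeFn_toLp] with x hx
    simp only [LinearMap.coe_mk, AddHom.coe_mk]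
    rw [hx, norm_mul, Complex.norm_real]
    exact mul_le_mul_of_nonneg_right (g.le_bound x) (norm_nonneg _)

lemma coeFn_mulOperator (ψ : L2Torus d) :
    mulOperator g ψ =ᵐ[torusMeasure d] fun x => (g.toFun x : ℂ) * ψ x :=
  (g.memLp_mul ψ).coeFn_toLp

lemma norm_mulOperator_le : ‖mulOperator g‖ ≤ g.bound :=
  LinearMap.mkContinuous_norm_le _ g.bound_nonneg _

lemma inner_mulOperator (φ ψ : L2Torus d) :
    ⟪φ, mulOperator g ψ⟫_ℂ = ∫ x, (g.toFun x : ℂ) * (conj (φ x) * ψ x) ∂(torusMeasure d) := by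
  rw [inner_eq_integral]
  refine integral_congr_ae ?_
  filter_upwards [coeFn_mulOperator g ψ] with x hx
  rw [hx]; ring

lemma isSymmetric_mulOperator : (mulOperator g).IsSymmetric := by
  intro φ ψ
  change ⟪mulOperator g φ, ψ⟫_ℂ = ⟪φ, mulOperator g ψ⟫_ℂ
  rw [inner_mulOperator, inner_eq_integral]
  refine integral_congr_ae ?_
  filter_upwards [coeFn_mulOperator g φ] with x hx
  rw [hx, map_mul, Complex.conj_ofReal, mul_assoc]

lemma inner_mulOperator_self (ψ : L2Torus d) :
    ⟪ψ, mulOperator g ψ⟫_ℂ = ((∫ x, g.toFun x * ‖ψ x‖ ^ 2 ∂(torusMeasure d) : ℝ) : ℂ) := by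
  rw [inner_mulOperator, ← integral_complex_ofReal]
  congr 1 with x
  rw [Complex.conj_mul']
  push_cast
  rfl

lemma integrable_mul_sq_norm (ψ : L2Torus d) :
    Integrable (fun x => g.toFun x * ‖ψ x‖ ^ 2) (torusMeasure d) :=
  (integrable_sq_norm ψ).bdd_mul g.measurable.aestronglyMeasurable
    (Filter.Eventually.of_forall fun x => g.le_bound x)

lemma le_inner_mulOperator_self {m : ℝ} (hm : ∀ x, m ≤ g.toFun x) (ψ : L2Torus d) :
    m * ‖ψ‖ ^ 2 ≤ (⟪ψ, mulOperator g ψ⟫_ℂ).re := by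
  rw [inner_mulOperator_self, Complex.ofReal_re, ← integral_sq_norm, ← integral_const_mul]
  exact integral_mono ((integrable_sq_norm ψ).const_mul m) (integrable_mul_sq_norm g ψ)
    fun x => mul_le_mul_of_nonneg_right (hm x) (sq_nonneg _)

lemma compMeasurePreserving_mulOperator {f : UnitAddTorus d → UnitAddTorus d}
    (hf : MeasurePreserving f (torusMeasure d) (torusMeasure d))
    (hg : ∀ x, g.toFun (f x) = g.toFun x) (ψ : L2Torus d) :
    Lp.compMeasurePreserving f hf (mulOperator g ψ)
      = mulOperator g (Lp.compMeasurePreserving f hf ψ) := by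
  refine Lp.ext ?_
  filter_upwards [Lp.coeFn_compMeasurePreserving (mulOperator g ψ) hf,
    hf.quasiMeasurePreserving.ae (coeFn_mulOperator g ψ),
    coeFn_mulOperator g (Lp.compMeasurePreserving f hf ψ),
    Lp.coeFn_compMeasurePreserving ψ hf] with x h1 h2 h3 h4
  rw [h1, Function.comp_apply, h2, h3, h4, hg, Function.comp_apply]

/-! ### Permutations of the particles -/

/-- The momenta of relabelled particles. -/
def permute {n : ℕ} (σ : Equiv.Perm (Fin n)) (p : Fin n × Fin 2 → ℤ) : Fin n × Fin 2 → ℤ :=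
  fun q => p (σ q.1, q.2)

lemma mFourier_relabel {n : ℕ} (σ : Equiv.Perm (Fin n)) (p : Fin n × Fin 2 → ℤ) (x : Config n) :
    mFourier (permute σ p) (relabel σ x) = mFourier p x := by
  simp only [mFourier, ContinuousMap.coe_mk, permute, relabel]
  exact Fintype.prod_equiv (Equiv.prodCongr σ (Equiv.refl (Fin 2))) _ _ fun _ => rfl

lemma mFourier_permute_inv {n : ℕ} (σ : Equiv.Perm (Fin n)) (p : Fin n × Fin 2 → ℤ)
    (x : Config n) : mFourier (permute σ⁻¹ p) x = mFourier p (relabel σ x) := by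
  rw [← mFourier_relabel σ]
  congr 2
  funext q
  simp [permute]

lemma repr_compMeasurePreserving_relabel {n : ℕ} (σ : Equiv.Perm (Fin n))
    (ψ : L2Torus (Fin n × Fin 2)) (p : Fin n × Fin 2 → ℤ) :
    (planeWaves _).repr (Lp.compMeasurePreserving _ (measurePreserving_relabel σ) ψ)
      (permute σ⁻¹ p) = (planeWaves _).repr ψ p := by
  rw [planeWaves_repr, planeWaves_repr]
  have h2 : AEStronglyMeasurable (fun x => mFourier (-p) x * ψ x)
      (torusMeasure (Fin n × Fin 2)) :=
    (mFourier (-p)).continuous.aestronglyMeasurable.mul (Lp.aestronglyMeasurable ψ)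
  have h3 := integral_map (measurePreserving_relabel σ).measurable.aemeasurable
    (f := fun x => mFourier (-p) x * ψ x)
    (by rw [(measurePreserving_relabel σ).map_eq]; exact h2)
  rw [(measurePreserving_relabel σ).map_eq] at h3
  rw [h3]
  refine integral_congr_ae ?_
  filter_upwards [Lp.coeFn_compMeasurePreserving ψ (measurePreserving_relabel σ)] with x hx
  rw [hx, Function.comp_apply, ← mFourier_permute_inv]
  rfl

lemma permute_inv_permute {n : ℕ} (σ : Equiv.Perm (Fin n)) (p : Fin n × Fin 2 → ℤ) :
    permute σ⁻¹ (permute σ p) = p := by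
  funext q
  simp [permute]

/-- Relabelling particles permutes the momenta of the Fourier coefficients. In this form bosonic
symmetry is visibly a closed condition and is preserved by operators diagonal in momentum. -/
lemma mem_sector_iff {n : ℕ} {ψ : L2Torus (Fin n × Fin 2)} :
    ψ ∈ Sector n ↔ ∀ (σ : Equiv.Perm (Fin n)) (p : Fin n × Fin 2 → ℤ),
      (planeWaves _).repr ψ (permute σ p) = (planeWaves _).repr ψ p := by
  have h1 : ψ ∈ Sector n ↔ ∀ σ : Equiv.Perm (Fin n),
      Lp.compMeasurePreserving _ (measurePreserving_relabel σ) ψ = ψ := by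
    refine forall_congr' fun σ => ?_
    have h2 := Lp.coeFn_compMeasurePreserving ψ (measurePreserving_relabel σ)
    constructor
    · intro h
      refine Lp.ext ?_
      filter_upwards [h, h2] with x h3 h4
      rw [h4, Function.comp_apply, h3]
    · intro h
      rw [h] at h2
      filter_upwards [h2] with x h3
      exact h3.symm
  rw [h1]
  constructor
  · intro h σ p
    conv_lhs => rw [← h σ⁻¹]
    have h2 := repr_compMeasurePreserving_relabel σ⁻¹ ψ p
    rwa [inv_inv] at h2
  · intro h σ
    refine ext_repr fun p => ?_
    have h2 := repr_compMeasurePreserving_relabel σ ψ (permute σ p)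
    rw [permute_inv_permute] at h2
    rw [h2, h]

/-! ### Blocks of fixed particle number and momentum -/

/-- The momentum of the `j`-th particle. -/
def momentum {n : ℕ} (p : Fin n × Fin 2 → ℤ) (j : Fin n) : Fin 2 → ℤ := fun i => p (j, i)

/-- The total momentum. -/
def totalMomentum {n : ℕ} (p : Fin n × Fin 2 → ℤ) : Fin 2 → ℤ := ∑ j, momentum p j

/-- The `n`-particle states of total momentum `q`. -/
def Block (n : ℕ) (q : Fin 2 → ℤ) : Submodule ℂ (L2Torus (Fin n × Fin 2)) where
  carrier := {ψ | ψ ∈ Sector n ∧ ∀ p, totalMomentum p ≠ q → (planeWaves _).repr ψ p = 0}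
  add_mem' := by
    rintro ψ φ ⟨h1, h2⟩ ⟨h3, h4⟩
    refine ⟨add_mem h1 h3, fun p hp => ?_⟩
    rw [map_add, lp.coeFn_add, Pi.add_apply, h2 p hp, h4 p hp, add_zero]
  zero_mem' := ⟨zero_mem _, fun p _ => by rw [map_zero]; rfl⟩
  smul_mem' := by
    rintro c ψ ⟨h1, h2⟩
    refine ⟨Submodule.smul_mem _ c h1, fun p hp => ?_⟩
    rw [map_smul, lp.coeFn_smul, Pi.smul_apply, h2 p hp, smul_zero]

lemma continuous_repr (p : d → ℤ) : Continuous fun ψ : L2Torus d => (planeWaves d).repr ψ p := by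
  simp only [HilbertBasis.repr_apply_apply]
  fun_prop

lemma isClosed_block (n : ℕ) (q : Fin 2 → ℤ) :
    IsClosed (Block n q : Set (L2Torus (Fin n × Fin 2))) := by
  have h : (Block n q : Set (L2Torus (Fin n × Fin 2))) =
      (⋂ (σ : Equiv.Perm (Fin n)) (p : Fin n × Fin 2 → ℤ),
        {ψ | (planeWaves _).repr ψ (permute σ p) = (planeWaves _).repr ψ p}) ∩
      ⋂ (p : Fin n × Fin 2 → ℤ) (_ : totalMomentum p ≠ q), {ψ | (planeWaves _).repr ψ p = 0} := by
    ext ψ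
    simp only [Set.mem_inter_iff, Set.mem_iInter, Set.mem_ofPred_eq, ← mem_sector_iff]
    rfl
  rw [h]
  refine IsClosed.inter ?_ ?_
  · exact isClosed_iInter fun σ => isClosed_iInter fun p =>
      isClosed_eq (continuous_repr _) (continuous_repr _)
  · exact isClosed_iInter fun p => isClosed_iInter fun _ =>
      isClosed_eq (continuous_repr _) continuous_const

instance (n : ℕ) (q : Fin 2 → ℤ) : CompleteSpace (Block n q) :=
  (isClosed_block n q).completeSpace_coe

/-- The shift of all particles by `a`. -/
def diagonalShift (n : ℕ) (a : T2) : Config n := fun q => a q.2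

lemma mFourier_diagonalShift {n : ℕ} (p : Fin n × Fin 2 → ℤ) (a : T2) :
    mFourier p (diagonalShift n a) = mFourier (totalMomentum p) a := by
  simp only [mFourier, ContinuousMap.coe_mk, diagonalShift, totalMomentum, Finset.sum_apply]
  rw [Fintype.prod_prod_type_right]
  refine Finset.prod_congr rfl fun i _ => ?_
  simp only [momentum]
  induction (Finset.univ : Finset (Fin n)) using Finset.induction with
  | empty => simp
  | insert j s hj h => rw [Finset.prod_insert hj, Finset.sum_insert hj, h, fourier_add]

lemma exists_mFourier_ne {q q' : Fin 2 → ℤ} (h : q ≠ q') :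
    ∃ a : T2, mFourier q a ≠ mFourier q' a := by
  by_contra! hc
  have h2 : planeWaves (Fin 2) q = planeWaves (Fin 2) q' := by
    refine Lp.ext ?_
    filter_upwards [coeFn_planeWaves q, coeFn_planeWaves q'] with x h3 h4
    rw [h3, h4, hc]
  exact h ((planeWaves (Fin 2)).orthonormal.linearIndependent.injective h2)

lemma mulOperator_mem_sector {n : ℕ} (g : BoundedFunction (Fin n × Fin 2))
    (hσ : ∀ (σ : Equiv.Perm (Fin n)) x, g.toFun (relabel σ x) = g.toFun x)
    {ψ : L2Torus (Fin n × Fin 2)} (hψ : ψ ∈ Sector n) : mulOperator g ψ ∈ Sector n := by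
  intro σ
  filter_upwards [(measurePreserving_relabel σ).quasiMeasurePreserving.ae (coeFn_mulOperator g ψ),
    coeFn_mulOperator g ψ, hψ σ] with x h1 h2 h3
  rw [h1, h2, h3, hσ]

/-- On vectors of total momentum `q` a common shift by `a` acts as the scalar `e_q(a)`, and
multiplication by an invariant function commutes with the shift. A nonzero coefficient of another
total momentum would have to scale by the same phase, which a suitable `a` rules out. -/
lemma mulOperator_mem_block {n : ℕ} (g : BoundedFunction (Fin n × Fin 2))
    (hσ : ∀ (σ : Equiv.Perm (Fin n)) x, g.toFun (relabel σ x) = g.toFun x)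
    (ha : ∀ (a : T2) x, g.toFun (x + diagonalShift n a) = g.toFun x) {q : Fin 2 → ℤ}
    {ψ : L2Torus (Fin n × Fin 2)} (hψ : ψ ∈ Block n q) : mulOperator g ψ ∈ Block n q := by
  refine ⟨mulOperator_mem_sector g hσ hψ.1, fun p hp => ?_⟩
  obtain ⟨a, hpa⟩ := exists_mFourier_ne hp
  have h1 : translate (diagonalShift n a) ψ = mFourier q a • ψ := by
    refine ext_repr fun p' => ?_
    rw [repr_translate, mFourier_diagonalShift, map_smul, lp.coeFn_smul, Pi.smul_apply,
      smul_eq_mul]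
    by_cases h : totalMomentum p' = q
    · rw [h]
    · rw [hψ.2 p' h, mul_zero, mul_zero]
  have h2 : translate (diagonalShift n a) (mulOperator g ψ) = mFourier q a • mulOperator g ψ := by
    rw [translate, compMeasurePreserving_mulOperator g _ (ha a), ← translate, h1, map_smul]
  have h3 := repr_translate (diagonalShift n a) (mulOperator g ψ) p
  rw [h2, map_smul, lp.coeFn_smul, Pi.smul_apply, smul_eq_mul, mFourier_diagonalShift] at h3
  by_contra h4
  exact hpa (mul_right_cancel₀ h4 h3).symm

end TorusFourier

/-! ## Occupation numbers -/

section Occupation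

/-- The occupation numbers of a tuple of momenta. -/
def occupation {n : ℕ} (p : Fin n × Fin 2 → ℤ) : (Fin 2 → ℤ) →₀ ℕ :=
  ∑ j, Finsupp.single (momentum p j) 1

/-- Adjoining a particle of momentum `k`. -/
def consMomentum {n : ℕ} (k : Fin 2 → ℤ) (p : Fin n × Fin 2 → ℤ) : Fin (n + 1) × Fin 2 → ℤ :=
  fun q => Fin.cons (α := fun _ => ℤ) (k q.2) (fun j => p (j, q.2)) q.1

lemma ext_momentum {n : ℕ} {p p' : Fin n × Fin 2 → ℤ} (h : ∀ j, momentum p j = momentum p' j) :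
    p = p' := funext fun q => congrFun (h q.1) q.2

@[simp] lemma momentum_permute {n : ℕ} (σ : Equiv.Perm (Fin n)) (p : Fin n × Fin 2 → ℤ)
    (j : Fin n) : momentum (permute σ p) j = momentum p (σ j) := rfl

lemma occupation_consMomentum {n : ℕ} (k : Fin 2 → ℤ) (p : Fin n × Fin 2 → ℤ) :
    occupation (consMomentum k p) = Finsupp.single k 1 + occupation p := by
  rw [occupation, Fin.sum_univ_succ]
  rfl

lemma occupation_apply {n : ℕ} (p : Fin n × Fin 2 → ℤ) (k : Fin 2 → ℤ) :
    occupation p k = Fintype.card {j // momentum p j = k} := by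
  rw [Fintype.card_subtype, occupation, Finsupp.finsetSum_apply, Finset.card_filter]
  simp [Finsupp.single_apply]

lemma occupation_permute {n : ℕ} (σ : Equiv.Perm (Fin n)) (p : Fin n × Fin 2 → ℤ) :
    occupation (permute σ p) = occupation p := by
  simp only [occupation, momentum_permute]
  exact Equiv.sum_comp σ (fun j => Finsupp.single (momentum p j) 1)

/-- Equal occupation numbers mean that the two momentum maps have fibres of equal size; bijections
between the fibres glue to a permutation. -/
lemma exists_permute_of_occupation_eq {n : ℕ} {p p' : Fin n × Fin 2 → ℤ}
    (h : occupation p = occupation p') : ∃ σ : Equiv.Perm (Fin n), permute σ p = p' := by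
  have e : ∀ k, Nonempty ({j // momentum p' j = k} ≃ {j // momentum p j = k}) := fun k => by
    rw [← Fintype.card_eq, ← occupation_apply, ← occupation_apply, h]
  let σ := ((Equiv.sigmaFiberEquiv (momentum p')).symm.trans
    (Equiv.sigmaCongrRight fun k => (e k).some)).trans (Equiv.sigmaFiberEquiv (momentum p))
  refine ⟨σ, ext_momentum fun j => ?_⟩
  rw [momentum_permute]
  exact ((e (momentum p' j)).some ⟨j, rfl⟩).2

lemma sum_momentum {n : ℕ} {M : Type*} [AddCommMonoid M] (f : (Fin 2 → ℤ) → M)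
    (p : Fin n × Fin 2 → ℤ) : ∑ j, f (momentum p j) = (occupation p).sum fun k m => m • f k := by
  rw [occupation, ← Finsupp.sum_finsetSum_index (by simp) (by intros; rw [add_smul])]
  simp

lemma degree_occupation {n : ℕ} (p : Fin n × Fin 2 → ℤ) : (occupation p).degree = n := by
  simp [occupation]

lemma exists_occupation_eq (n : ℕ) (m : (Fin 2 → ℤ) →₀ ℕ) (hm : m.degree = n) :
    ∃ p : Fin n × Fin 2 → ℤ, occupation p = m := by
  induction n generalizing m with
  | zero =>
    refine ⟨0, ?_⟩
    rw [(Finsupp.degree_eq_zero_iff m).mp hm]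
    simp [occupation]
  | succ n ih =>
    have h0 : m ≠ 0 := by
      rintro rfl
      simp at hm
    obtain ⟨k, hk⟩ := Finsupp.ne_iff.mp h0
    have h1 : Finsupp.single k 1 + (m - Finsupp.single k 1) = m := by
      refine add_tsub_cancel_of_le ?_
      rw [Finsupp.single_le_iff]
      exact Nat.one_le_iff_ne_zero.mpr hk
    have h2 : (m - Finsupp.single k 1).degree = n := by
      have := congrArg Finsupp.degree h1
      rw [map_add, Finsupp.degree_single, hm] at this
      omega
    obtain ⟨p, hp⟩ := ih _ h2
    exact ⟨consMomentum k p, by rw [occupation_consMomentum, hp, h1]⟩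

/-- A tuple of momenta with given occupation numbers. -/
def representative (m : (Fin 2 → ℤ) →₀ ℕ) : Fin m.degree × Fin 2 → ℤ :=
  (exists_occupation_eq _ m rfl).choose

@[simp] lemma occupation_representative (m : (Fin 2 → ℤ) →₀ ℕ) :
    occupation (representative m) = m := (exists_occupation_eq _ m rfl).choose_spec

lemma totalMomentum_permute {n : ℕ} (σ : Equiv.Perm (Fin n)) (p : Fin n × Fin 2 → ℤ) :
    totalMomentum (permute σ p) = totalMomentum p := by
  simp only [totalMomentum, momentum_permute]
  exact Equiv.sum_comp σ (fun j => momentum p j)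

lemma totalMomentum_eq_of_occupation_eq {n : ℕ} {p p' : Fin n × Fin 2 → ℤ}
    (h : occupation p = occupation p') : totalMomentum p = totalMomentum p' := by
  obtain ⟨σ, rfl⟩ := exists_permute_of_occupation_eq h
  rw [totalMomentum_permute]

/-- The rearrangements of a tuple of momenta. -/
def orbit {n : ℕ} (p : Fin n × Fin 2 → ℤ) : Finset (Fin n × Fin 2 → ℤ) :=
  Finset.univ.image fun σ : Equiv.Perm (Fin n) => permute σ p

lemma mem_orbit {n : ℕ} {p p' : Fin n × Fin 2 → ℤ} :
    p' ∈ orbit p ↔ occupation p' = occupation p := by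
  simp only [orbit, Finset.mem_image, Finset.mem_univ, true_and]
  constructor
  · rintro ⟨σ, rfl⟩
    exact occupation_permute σ p
  · intro h
    exact exists_permute_of_occupation_eq h.symm

lemma card_orbit_pos {n : ℕ} (p : Fin n × Fin 2 → ℤ) : 0 < (orbit p).card :=
  Finset.card_pos.mpr ⟨p, mem_orbit.mpr rfl⟩

/-- The normalized symmetrized plane wave. -/
def orbitWave {n : ℕ} (p : Fin n × Fin 2 → ℤ) : L2Torus (Fin n × Fin 2) :=
  ((Real.sqrt (orbit p).card)⁻¹ : ℂ) • ∑ p' ∈ orbit p, planeWaves _ p'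

lemma repr_orbitWave {n : ℕ} (p p' : Fin n × Fin 2 → ℤ) :
    (planeWaves _).repr (orbitWave p) p'
      = if occupation p' = occupation p then ((Real.sqrt (orbit p).card)⁻¹ : ℂ) else 0 := by
  classical
  rw [orbitWave, map_smul, map_sum, lp.coeFn_smul, Pi.smul_apply, lp.coeFn_sum, Finset.sum_apply]
  simp only [repr_planeWaves, Finset.sum_ite_eq, smul_eq_mul, mem_orbit]
  split_ifs <;> simp

lemma orbitWave_mem_block {n : ℕ} (p : Fin n × Fin 2 → ℤ) :
    orbitWave p ∈ Block n (totalMomentum p) := by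
  refine ⟨mem_sector_iff.mpr fun σ p' => ?_, fun p' hp' => ?_⟩
  · rw [repr_orbitWave, repr_orbitWave, occupation_permute]
  · rw [repr_orbitWave, if_neg fun h => hp' (totalMomentum_eq_of_occupation_eq h)]

lemma repr_eq_of_occupation_eq {n : ℕ} {ψ : L2Torus (Fin n × Fin 2)} (hψ : ψ ∈ Sector n)
    {p p' : Fin n × Fin 2 → ℤ} (h : occupation p = occupation p') :
    (planeWaves _).repr ψ p = (planeWaves _).repr ψ p' := by
  obtain ⟨σ, rfl⟩ := exists_permute_of_occupation_eq h
  rw [mem_sector_iff.mp hψ]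

/-- A symmetric function has constant Fourier coefficients on an orbit, so its overlap is the orbit
size times one coefficient, divided by the normalization. -/
lemma inner_orbitWave {n : ℕ} (p : Fin n × Fin 2 → ℤ) {ψ : L2Torus (Fin n × Fin 2)}
    (hψ : ψ ∈ Sector n) :
    ⟪orbitWave p, ψ⟫_ℂ = (Real.sqrt (orbit p).card : ℂ) * (planeWaves _).repr ψ p := by
  have h1 : ∀ p' ∈ orbit p, ⟪planeWaves _ p', ψ⟫_ℂ = (planeWaves _).repr ψ p := by
    intro p' hp'
    rw [← HilbertBasis.repr_apply_apply]
    exact repr_eq_of_occupation_eq hψ (mem_orbit.mp hp')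
  rw [orbitWave, inner_smul_left, sum_inner, Finset.sum_congr rfl h1, Finset.sum_const,
    nsmul_eq_mul, map_inv₀, Complex.conj_ofReal, ← mul_assoc]
  congr 1
  have h2 : (Real.sqrt (orbit p).card : ℂ) ≠ 0 := by
    have := card_orbit_pos p
    simp only [ne_eq, Complex.ofReal_eq_zero]
    positivity
  have h3 : ((orbit p).card : ℂ) = (Real.sqrt (orbit p).card : ℂ) ^ 2 := by
    rw [← Complex.ofReal_pow, Real.sq_sqrt (Nat.cast_nonneg _)]
    simp
  rw [h3]
  field_simp

lemma norm_orbitWave {n : ℕ} (p : Fin n × Fin 2 → ℤ) : ‖orbitWave p‖ = 1 := by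
  have h := inner_orbitWave p (orbitWave_mem_block p).1
  have h2 : (Real.sqrt (orbit p).card : ℂ) ≠ 0 := by
    have := card_orbit_pos p
    simp only [ne_eq, Complex.ofReal_eq_zero]
    positivity
  rw [repr_orbitWave, if_pos rfl, mul_inv_cancel₀ h2, inner_self_eq_norm_sq_to_K] at h
  have h3 : ‖orbitWave p‖ ^ 2 = 1 := by
    exact Complex.ofReal_injective (by push_cast; exact h)
  nlinarith [norm_nonneg (orbitWave p)]

end Occupation

/-! ## The Fock space -/

section FockSpace

lemma isClosed_sector (n : ℕ) : IsClosed (Sector n : Set (L2Torus (Fin n × Fin 2))) := by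
  have h : (Sector n : Set (L2Torus (Fin n × Fin 2))) =
      ⋂ (σ : Equiv.Perm (Fin n)) (p : Fin n × Fin 2 → ℤ),
        {ψ | (planeWaves _).repr ψ (permute σ p) = (planeWaves _).repr ψ p} := by
    ext ψ
    simp only [Set.mem_iInter, Set.mem_ofPred_eq, ← mem_sector_iff]
    rfl
  rw [h]
  exact isClosed_iInter fun σ => isClosed_iInter fun p =>
    isClosed_eq (continuous_repr _) (continuous_repr _)

instance (n : ℕ) : CompleteSpace (Sector n) := (isClosed_sector n).completeSpace_coe

/-- The `n`-particle component as a bounded operator. -/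
def componentCLM (n : ℕ) : Fock →L[ℂ] L2Torus (Fin n × Fin 2) :=
  (Sector n).subtypeL ∘L lp.evalCLM ℂ (fun n : ℕ => Sector n) 2 n

@[simp] lemma componentCLM_apply (n : ℕ) (Ψ : Fock) : componentCLM n Ψ = component Ψ n := rfl

/-- The Fock space vector that represents the functional `Ψ ↦ ⟨F, Ψ n⟩`. -/
def lift (n : ℕ) (F : L2Torus (Fin n × Fin 2)) : Fock :=
  ContinuousLinearMap.adjoint (componentCLM n) F

lemma inner_lift (n : ℕ) (F : L2Torus (Fin n × Fin 2)) (Ψ : Fock) :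
    ⟪lift n F, Ψ⟫_ℂ = ⟪F, component Ψ n⟫_ℂ := by
  rw [lift, ContinuousLinearMap.adjoint_inner_left, componentCLM_apply]

lemma component_mem_sector (Ψ : Fock) (n : ℕ) : component Ψ n ∈ Sector n := (Ψ n).2

/-- The Fock space vector with a single nonzero component. -/
def single (n : ℕ) (ψ : Sector n) : Fock := lp.single 2 n ψ

lemma component_single_self (n : ℕ) (ψ : Sector n) : component (single n ψ) n = ψ := by
  simp [component, single]

lemma component_single_of_ne {n n' : ℕ} (ψ : Sector n) (h : n' ≠ n) :
    component (single n ψ) n' = 0 := by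
  simp [component, single, lp.single_apply, h]

lemma inner_single (n : ℕ) (ψ : Sector n) (Ψ : Fock) :
    ⟪single n ψ, Ψ⟫_ℂ = ⟪(ψ : L2Torus (Fin n × Fin 2)), component Ψ n⟫_ℂ :=
  (lp.inner_single_left (𝕜 := ℂ) (G := fun n : ℕ => Sector n) n ψ Ψ).trans
    (Submodule.coe_inner _ _ _)

lemma hasSum_inner_component (Φ Ψ : Fock) :
    HasSum (fun n => ⟪component Φ n, component Ψ n⟫_ℂ) ⟪Φ, Ψ⟫_ℂ := lp.hasSum_inner Φ Ψ

/-- The Fock space vector of given occupation numbers. -/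
def occupationVector (m : (Fin 2 → ℤ) →₀ ℕ) : Fock :=
  single m.degree ⟨orbitWave (representative m), (orbitWave_mem_block _).1⟩

lemma inner_occupationVector (m : (Fin 2 → ℤ) →₀ ℕ) (Ψ : Fock) :
    ⟪occupationVector m, Ψ⟫_ℂ = (Real.sqrt (orbit (representative m)).card : ℂ)
      * (planeWaves _).repr (component Ψ m.degree) (representative m) := by
  rw [occupationVector, inner_single, inner_orbitWave _ (component_mem_sector Ψ _)]

lemma repr_component_occupationVector {m : (Fin 2 → ℤ) →₀ ℕ} {n : ℕ} {p : Fin n × Fin 2 → ℤ}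
    (h : occupation p ≠ m) : (planeWaves _).repr (component (occupationVector m) n) p = 0 := by
  by_cases hn : n = m.degree
  · subst hn
    rw [occupationVector, component_single_self, repr_orbitWave, if_neg]
    rwa [occupation_representative]
  · rw [occupationVector, component_single_of_ne _ hn, map_zero]
    rfl

lemma orthonormal_occupationVector : Orthonormal ℂ occupationVector := by
  classical
  rw [orthonormal_iff_ite]
  intro m m'
  split_ifs with h
  · subst h
    have h1 : ‖occupationVector m‖ = 1 := by
      have h2 := lp.norm_single (E := fun n : ℕ => Sector n) (p := 2) (by norm_num) m.degree
        ⟨orbitWave (representative m), (orbitWave_mem_block _).1⟩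
      exact h2.trans (norm_orbitWave _)
    rw [inner_self_eq_norm_sq_to_K, h1]
    simp
  · rw [inner_occupationVector, repr_component_occupationVector, mul_zero]
    rwa [occupation_representative]

lemma eq_zero_of_inner_occupationVector {Ψ : Fock} (h : ∀ m, ⟪occupationVector m, Ψ⟫_ℂ = 0) :
    Ψ = 0 := by
  ext1
  funext n
  apply Subtype.ext
  refine ext_repr fun p => ?_
  have h1 := h (occupation p)
  rw [inner_occupationVector, mul_eq_zero] at h1
  have h2 : (Real.sqrt (orbit (representative (occupation p))).card : ℂ) ≠ 0 := by
    have := card_orbit_pos (representative (occupation p))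
    simp only [ne_eq, Complex.ofReal_eq_zero]
    positivity
  have h3 := h1.resolve_left h2
  -- The degree of `occupation p` equals `n` only propositionally; quantifying over `n'` replaces a
  -- transport between the dependent types by substitution.
  have h4 : ∀ n' (hn : n' = n) (p' : Fin n' × Fin 2 → ℤ), occupation p' = occupation p →
      (planeWaves _).repr (component Ψ n') p' = 0 →
      (planeWaves _).repr (component Ψ n) p = 0 := by
    rintro n' rfl p' h5 h6
    rw [← h6]
    exact repr_eq_of_occupation_eq (component_mem_sector Ψ _) h5.symm
  have h5 := h4 _ (degree_occupation p) _ (occupation_representative _) h3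
  rw [component] at h5
  rw [h5]
  simp

/-- The orthonormal basis of occupation number vectors. -/
def occupationBasis : HilbertBasis ((Fin 2 → ℤ) →₀ ℕ) ℂ Fock :=
  HilbertBasis.mkOfOrthogonalEqBot orthonormal_occupationVector <| by
    rw [eq_bot_iff]
    intro Ψ hΨ
    rw [Submodule.mem_orthogonal] at hΨ
    exact eq_zero_of_inner_occupationVector fun m => hΨ _ (Submodule.subset_span ⟨m, rfl⟩)

@[simp] lemma coe_occupationBasis (m : (Fin 2 → ℤ) →₀ ℕ) :
    occupationBasis m = occupationVector m :=
  congrFun (HilbertBasis.coe_mkOfOrthogonalEqBot _ _) m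

/-- `∑ |⟨p, Ψ⟩|²` over all momenta `p` of given occupation numbers. -/
lemma tsum_occupation_eq (m : (Fin 2 → ℤ) →₀ ℕ) (Ψ : Fock) :
    ∑' (q : Σ n, Fin n × Fin 2 → ℤ), (if occupation q.2 = m then
      ENNReal.ofReal (‖(planeWaves _).repr (component Ψ q.1) q.2‖ ^ 2) else 0)
      = ENNReal.ofReal (‖⟪occupationVector m, Ψ⟫_ℂ‖ ^ 2) := by
  rw [ENNReal.tsum_sigma', tsum_eq_single m.degree]
  · have h1 : ∀ p : Fin m.degree × Fin 2 → ℤ, (if occupation p = m then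
        ENNReal.ofReal (‖(planeWaves _).repr (component Ψ m.degree) p‖ ^ 2) else 0)
        = if p ∈ orbit (representative m) then
          ENNReal.ofReal (‖(planeWaves _).repr (component Ψ m.degree) (representative m)‖ ^ 2)
          else 0 := by
      intro p
      have h2 : p ∈ orbit (representative m) ↔ occupation p = m := by
        rw [mem_orbit, occupation_representative]
      by_cases h : occupation p = m
      · rw [if_pos h, if_pos (h2.mpr h), repr_eq_of_occupation_eq (component_mem_sector Ψ _)
          (h.trans (occupation_representative m).symm)]
      · rw [if_neg h, if_neg fun h3 => h (h2.mp h3)]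
    simp only [h1]
    rw [tsum_eq_sum (s := orbit (representative m)) (fun p hp => if_neg hp),
      Finset.sum_congr rfl fun p hp => if_pos hp, Finset.sum_const, inner_occupationVector,
      norm_mul, mul_pow, Complex.norm_real, Real.norm_of_nonneg (Real.sqrt_nonneg _),
      Real.sq_sqrt (Nat.cast_nonneg _), ENNReal.ofReal_mul (Nat.cast_nonneg _),
      ENNReal.ofReal_natCast, nsmul_eq_mul]
  · intro n hn
    rw [ENNReal.tsum_eq_zero]
    intro p
    rw [if_neg]
    rintro rfl
    exact hn (degree_occupation p).symm

/-- Sums over momenta of functions of the occupation numbers. -/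
lemma tsum_weighted_occupation (w : ((Fin 2 → ℤ) →₀ ℕ) → ℝ≥0∞) (Ψ : Fock) :
    ∑' (n : ℕ) (p : Fin n × Fin 2 → ℤ), w (occupation p)
      * ENNReal.ofReal (‖(planeWaves _).repr (component Ψ n) p‖ ^ 2)
      = ∑' m, w m * ENNReal.ofReal (‖⟪occupationVector m, Ψ⟫_ℂ‖ ^ 2) := by
  simp only [← tsum_occupation_eq, ← ENNReal.tsum_mul_left]
  rw [ENNReal.tsum_comm, ENNReal.tsum_sigma']
  congr 1 with n
  congr 1 with p
  rw [tsum_eq_single (occupation p)]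
  · simp
  · intro m hm
    rw [if_neg hm.symm, mul_zero]

end FockSpace

/-! ## Eigenbases of Hamiltonians on Fock space -/

section FockEigenbasis

open MeasureTheory UnitAddTorus

lemma one_le_oneBodyEnergy (k : Fin 2 → ℤ) : 1 ≤ oneBodyEnergy k := by
  unfold oneBodyEnergy
  have : 0 ≤ ∑ i, (2 * Real.pi * (k i : ℝ)) ^ 2 := by positivity
  linarith

lemma oneBodyEnergy_pos (k : Fin 2 → ℤ) : 0 < oneBodyEnergy k :=
  one_pos.trans_le (one_le_oneBodyEnergy k)

lemma kineticEnergy_nonneg {n : ℕ} (p : Fin n × Fin 2 → ℤ) : 0 ≤ kineticEnergy p :=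
  Finset.sum_nonneg fun _ _ => (oneBodyEnergy_pos _).le

lemma abs_le_oneBodyEnergy (k : Fin 2 → ℤ) (i : Fin 2) : |(k i : ℝ)| ≤ oneBodyEnergy k := by
  have h1 : (2 * Real.pi * (k i : ℝ)) ^ 2 ≤ ∑ i, (2 * Real.pi * (k i : ℝ)) ^ 2 :=
    Finset.single_le_sum (f := fun i => (2 * Real.pi * (k i : ℝ)) ^ 2)
      (fun _ _ => sq_nonneg _) (Finset.mem_univ i)
  have h2 : (1 : ℝ) ≤ 2 * Real.pi := by linarith [Real.pi_gt_three]
  have h3 : |(k i : ℝ)| ^ 2 ≤ (2 * Real.pi * k i) ^ 2 := by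
    rw [mul_pow, sq_abs]
    exact le_mul_of_one_le_left (sq_nonneg _) (one_le_pow₀ h2)
  unfold oneBodyEnergy
  nlinarith [sq_nonneg (|(k i : ℝ)| - 1), abs_nonneg (k i : ℝ)]

/-- Only finitely many momentum tuples lie below any energy. This is the source of the compact
resolvent at fixed particle number. -/
lemma tendsto_kineticEnergy (n : ℕ) :
    Filter.Tendsto (fun p : Fin n × Fin 2 → ℤ => kineticEnergy p) Filter.cofinite
      Filter.atTop := by
  have h1 : Filter.Tendsto (fun p : Fin n × Fin 2 → ℤ => ‖p‖) Filter.cofinite Filter.atTop := by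
    rw [← Filter.cocompact_eq_cofinite]
    exact tendsto_norm_cocompact_atTop
  refine Filter.tendsto_atTop_mono (fun p => ?_) h1
  refine (pi_norm_le_iff_of_nonneg (kineticEnergy_nonneg p)).mpr fun q => ?_
  rw [Int.norm_eq_abs]
  refine (abs_le_oneBodyEnergy (momentum p q.1) q.2).trans ?_
  exact Finset.single_le_sum (f := fun j => oneBodyEnergy (momentum p j))
    (fun _ _ => (oneBodyEnergy_pos _).le) (Finset.mem_univ q.1)

lemma kineticEnergy_eq_of_occupation {n : ℕ} (p : Fin n × Fin 2 → ℤ) :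
    kineticEnergy p = (occupation p).sum fun k m => m * oneBodyEnergy k := by
  have := sum_momentum oneBodyEnergy p
  simp only [nsmul_eq_mul] at this
  exact this

lemma kineticEnergy_permute {n : ℕ} (σ : Equiv.Perm (Fin n)) (p : Fin n × Fin 2 → ℤ) :
    kineticEnergy (permute σ p) = kineticEnergy p := by
  rw [kineticEnergy_eq_of_occupation, occupation_permute, ← kineticEnergy_eq_of_occupation]

/-- The Hamiltonian `lam ∑ j, h_{x_j} + g` has an orthonormal eigenbasis in every block. -/
lemma exists_block_eigenbasis {n : ℕ} (g : BoundedFunction (Fin n × Fin 2))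
    (hσ : ∀ (σ : Equiv.Perm (Fin n)) x, g.toFun (relabel σ x) = g.toFun x)
    (ha : ∀ (a : T2) x, g.toFun (x + diagonalShift n a) = g.toFun x)
    {lam : ℝ} (hlam : 0 < lam) (q : Fin 2 → ℤ) :
    ∃ (ι : Type) (b : HilbertBasis ι ℂ (Block n q)), ∀ i, ∃ μ : ℝ, ∀ p,
      (μ : ℂ) * (planeWaves _).repr (b i : L2Torus (Fin n × Fin 2)) p
        = ((lam * kineticEnergy p : ℝ) : ℂ) * (planeWaves _).repr (b i : L2Torus _) p
          + (planeWaves _).repr (mulOperator g (b i)) p := by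
  -- The shift by `c` bounds the free resolvent by `1/c`, and `g.bound / c < 1` then makes the
  -- Neumann series converge. It is removed at the end, where the eigenvalue becomes `μ - c`.
  set c : ℝ := g.bound + 1 with hc
  have hcpos : 0 < c := by linarith [g.bound_nonneg]
  let a : (Fin n × Fin 2 → ℤ) → ℂ := fun p => (((lam * kineticEnergy p + c)⁻¹ : ℝ) : ℂ)
  have hden : ∀ p : Fin n × Fin 2 → ℤ, c ≤ lam * kineticEnergy p + c := fun p => by
    have := mul_nonneg hlam.le (kineticEnergy_nonneg p)
    linarith
  have haM : ∀ p, ‖a p‖ ≤ c⁻¹ := by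
    intro p
    rw [Complex.norm_real, Real.norm_of_nonneg (inv_nonneg.mpr (hcpos.le.trans (hden p)))]
    exact inv_anti₀ hcpos (hden p)
  set S₀ := diagonalOperator (planeWaves (Fin n × Fin 2)) a c⁻¹ haM
  have hS₀c : IsCompactOperator S₀ := by
    refine isCompactOperator_diagonalOperator _ haM ?_
    rw [← Complex.ofReal_zero]
    refine (Complex.continuous_ofReal.tendsto 0).comp ?_
    refine Filter.Tendsto.inv_tendsto_atTop ?_
    exact Filter.tendsto_atTop_add_const_right _ _
      ((tendsto_kineticEnergy n).const_mul_atTop hlam)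
  have hS₀s : S₀.IsSymmetric := by
    intro φ ψ
    refine (hasSum_conj_repr_mul_repr (S₀ φ) ψ).unique
      ((hasSum_conj_repr_mul_repr φ (S₀ ψ)).congr_fun fun p => ?_)
    rw [repr_diagonalOperator, repr_diagonalOperator, map_mul, Complex.conj_ofReal]
    ring
  have hS₀m : ∀ ψ ∈ Block n q, S₀ ψ ∈ Block n q := by
    rintro ψ ⟨h1, h2⟩
    refine ⟨mem_sector_iff.mpr fun σ p => ?_, fun p hp => ?_⟩
    · rw [repr_diagonalOperator, repr_diagonalOperator, mem_sector_iff.mp h1]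
      simp only [a, kineticEnergy_permute]
    · rw [repr_diagonalOperator, h2 p hp, mul_zero]
  have hV₀m : ∀ ψ ∈ Block n q, mulOperator g ψ ∈ Block n q := fun ψ hψ =>
    mulOperator_mem_block g hσ ha hψ
  have hrep : ∀ ψ p, ((lam * kineticEnergy p + c : ℝ) : ℂ) * (planeWaves _).repr (S₀ ψ) p
      = (planeWaves _).repr ψ p := by
    intro ψ p
    have h0 : ((lam * kineticEnergy p + c : ℝ) : ℂ) ≠ 0 :=
      Complex.ofReal_ne_zero.mpr (hcpos.trans_le (hden p)).ne'
    rw [repr_diagonalOperator]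
    simp only [a, Complex.ofReal_inv]
    rw [← mul_assoc, mul_inv_cancel₀ h0, one_mul]
  have hS₀n : ‖S₀‖ ≤ c⁻¹ := norm_diagonalOperator_le _ haM (inv_nonneg.mpr hcpos.le)
  clear_value S₀
  have hinj : Function.Injective (S₀.restrict hS₀m) := by
    intro x y hxy
    have h1 : S₀ (x : L2Torus _) = S₀ (y : L2Torus _) :=
      congrArg (fun z : Block n q => (z : L2Torus (Fin n × Fin 2))) hxy
    apply Subtype.ext
    refine ext_repr fun p => ?_
    rw [← hrep, h1, hrep]
  have hnorm : ‖(mulOperator g).restrict hV₀m‖ * ‖S₀.restrict hS₀m‖ < 1 := by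
    have h1 : ‖(mulOperator g).restrict hV₀m‖ ≤ g.bound := by
      refine ContinuousLinearMap.opNorm_le_bound _ g.bound_nonneg fun x => ?_
      exact (mulOperator g).le_of_opNorm_le (norm_mulOperator_le g) x
    have h2 : ‖S₀.restrict hS₀m‖ ≤ c⁻¹ := by
      refine ContinuousLinearMap.opNorm_le_bound _ (inv_nonneg.mpr hcpos.le) fun x => ?_
      exact S₀.le_of_opNorm_le hS₀n x
    calc _ ≤ g.bound * c⁻¹ := mul_le_mul h1 h2 (ContinuousLinearMap.opNorm_nonneg _) g.bound_nonneg
      _ < 1 := by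
        rw [← div_eq_mul_inv, div_lt_one hcpos]
        linarith
  obtain ⟨ι, b, hb⟩ := exists_hilbertBasis_perturbation (S₀.restrict hS₀m)
    ((mulOperator g).restrict hV₀m) (hS₀c.restrict' hS₀m) (hS₀s.restrict_invariant hS₀m)
    ((isSymmetric_mulOperator g).restrict_invariant hV₀m) hinj hnorm
  refine ⟨ι, b, fun i => ?_⟩
  obtain ⟨μ, hμ⟩ := hb i
  refine ⟨μ - c, fun p => ?_⟩
  have h1 : (b i : L2Torus (Fin n × Fin 2))
      = S₀ ((μ : ℂ) • (b i : L2Torus _) - mulOperator g (b i)) := congrArg Subtype.val hμ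
  have h2 := hrep ((μ : ℂ) • (b i : L2Torus _) - mulOperator g (b i)) p
  rw [← h1, map_sub, map_smul, lp.coeFn_sub, Pi.sub_apply, lp.coeFn_smul, Pi.smul_apply,
    smul_eq_mul] at h2
  push_cast at h2 ⊢
  linear_combination -h2

/-- An orthonormal basis of Fock space of eigenvectors of the Hamiltonian
`lam dΓ(h) + g` that have definite particle number and total momentum. -/
structure FockEigenbasis (g : ∀ n, BoundedFunction (Fin n × Fin 2)) (lam : ℝ) where
  ι : Type
  basis : HilbertBasis ι ℂ Fock
  eigenvalue : ι → ℝ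
  number : ι → ℕ
  total : ι → Fin 2 → ℤ
  wave : ∀ i, L2Torus (Fin (number i) × Fin 2)
  wave_mem : ∀ i, wave i ∈ Block (number i) (total i)
  basis_eq : ∀ i, basis i = single (number i) ⟨wave i, (wave_mem i).1⟩
  eigen : ∀ i p, (eigenvalue i : ℂ) * (planeWaves _).repr (wave i) p
    = ((lam * kineticEnergy p : ℝ) : ℂ) * (planeWaves _).repr (wave i) p
      + (planeWaves _).repr (mulOperator (g (number i)) (wave i)) p

/-- The eigenbases of all blocks are put together. They are orthogonal because particle number or
total momentum differs, and total because every occupation number vector lies in a single block.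
Definite total momentum is what later makes the density matrix diagonal. -/
lemma exists_fockEigenbasis (g : ∀ n, BoundedFunction (Fin n × Fin 2))
    (hσ : ∀ n (σ : Equiv.Perm (Fin n)) x, (g n).toFun (relabel σ x) = (g n).toFun x)
    (ha : ∀ n (a : T2) x, (g n).toFun (x + diagonalShift n a) = (g n).toFun x)
    {lam : ℝ} (hlam : 0 < lam) : Nonempty (FockEigenbasis g lam) := by
  classical
  choose κ b μ hμ using fun (s : ℕ × (Fin 2 → ℤ)) =>
    exists_block_eigenbasis (g s.1) (hσ s.1) (ha s.1) hlam s.2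
  let v : (Σ s, κ s) → Fock := fun i => single i.1.1 ⟨b i.1 i.2, (b i.1 i.2).2.1⟩
  have hv : Orthonormal ℂ v := by
    rw [orthonormal_iff_ite]
    rintro ⟨⟨n, q⟩, i⟩ ⟨⟨n', q'⟩, j⟩
    simp only [v]
    rw [inner_single]
    by_cases hn : n = n'
    · subst hn
      rw [component_single_self]
      by_cases hq : q = q'
      · subst hq
        have := orthonormal_iff_ite.mp (b (n, q)).orthonormal i j
        rw [Submodule.coe_inner] at this
        rw [this]
        simp
      · have h1 : (⟨(n, q), i⟩ : Σ s, κ s) ≠ ⟨(n, q'), j⟩ := by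
          intro h
          exact hq (by simpa using congrArg (fun t => t.1.2) h)
        rw [if_neg h1]
        refine (hasSum_conj_repr_mul_repr _ _).unique ?_
        convert hasSum_zero with p
        by_cases hp : totalMomentum p = q
        · rw [(b (n, q') j).2.2 p (fun h => hq (hp.symm.trans h)), mul_zero]
        · rw [(b (n, q) i).2.2 p hp, map_zero, zero_mul]
    · have h1 : (⟨(n, q), i⟩ : Σ s, κ s) ≠ ⟨(n', q'), j⟩ := by
        intro h
        exact hn (by simpa using congrArg (fun t => t.1.1) h)
      rw [if_neg h1, component_single_of_ne _ hn, inner_zero_right]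
  have hspan : (Submodule.span ℂ (Set.range v))ᗮ = ⊥ := by
    rw [eq_bot_iff]
    intro Ψ hΨ
    rw [Submodule.mem_orthogonal] at hΨ
    refine eq_zero_of_inner_occupationVector fun m => ?_
    rw [occupationVector, inner_single]
    let s : ℕ × (Fin 2 → ℤ) := (m.degree, totalMomentum (representative m))
    let x : Block s.1 s.2 := ⟨orbitWave (representative m), orbitWave_mem_block _⟩
    have h1 := (((b s).hasSum_repr x).mapL (Block s.1 s.2).subtypeL).mapL
      (innerSL ℂ (component Ψ s.1))
    have h2 : ⟪component Ψ s.1, (x : L2Torus _)⟫_ℂ = 0 := by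
      refine h1.unique ?_
      convert hasSum_zero with i
      have h3 := hΨ _ (Submodule.subset_span ⟨⟨s, i⟩, rfl⟩)
      simp only [v] at h3
      rw [inner_single, ← inner_conj_symm, map_eq_zero] at h3
      rw [map_smul, map_smul, innerSL_apply_apply, Submodule.subtypeL_apply]
      erw [h3]
      simp
    rw [← inner_conj_symm]
    erw [h2]
    simp
  exact ⟨{
    ι := Σ s, κ s
    basis := HilbertBasis.mkOfOrthogonalEqBot hv hspan
    eigenvalue := fun i => μ i.1 i.2
    number := fun i => i.1.1
    total := fun i => i.1.2
    wave := fun i => b i.1 i.2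
    wave_mem := fun i => (b i.1 i.2).2
    basis_eq := fun i => congrFun (HilbertBasis.coe_mkOfOrthogonalEqBot _ _) i
    eigen := fun i => hμ i.1 i.2 }⟩

end FockEigenbasis

/-! ## Gibbs states in an eigenbasis -/

section GibbsAbstract

lemma hasSum_of_tsum_ofReal {ι : Type*} {f : ι → ℝ} {a : ℝ} (hf : ∀ i, 0 ≤ f i) (ha : 0 ≤ a)
    (h : ∑' i, ENNReal.ofReal (f i) = ENNReal.ofReal a) : HasSum f a := by
  have hs : Summable f := by
    refine (ENNReal.summable_toReal (f := fun i => ENNReal.ofReal (f i)) ?_).congr fun i => ?_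
    · rw [h]; exact ENNReal.ofReal_ne_top
    · rw [ENNReal.toReal_ofReal (hf i)]
  rw [← ENNReal.ofReal_tsum_of_nonneg hf hs] at h
  have h2 := (ENNReal.ofReal_eq_ofReal_iff (tsum_nonneg hf) ha).mp h
  rw [← h2]
  exact hs.hasSum

variable {E : Type*} [NormedAddCommGroup E] [InnerProductSpace ℂ E]

/-- A Hamiltonian `A` given by its graph, together with an orthonormal eigenbasis and a lower
bound. -/
structure EigenSystem (A : Set (E × E)) where
  ι : Type
  basis : HilbertBasis ι ℂ E
  energy : ι → ℝ
  mem : ∀ i, (basis i, (energy i : ℂ) • basis i) ∈ A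
  lower : ℝ
  lower_le : ∀ i, lower ≤ energy i
  symm : ∀ u ∈ A, ∀ v ∈ A, ⟪u.1, v.2⟫_ℂ = ⟪u.2, v.1⟫_ℂ

namespace EigenSystem

variable {A : Set (E × E)} (e : EigenSystem A)

lemma expNeg_apply (i : e.ι) : expNeg A (e.basis i) = (Real.exp (-e.energy i) : ℂ) • e.basis i := by
  refine expNeg_apply_of_mem e.symm ?_ (e.mem i)
  have h : ∀ i, ‖(Real.exp (-e.energy i) : ℂ)‖ ≤ Real.exp (-e.lower) := fun i => by
    rw [Complex.norm_real, Real.norm_of_nonneg (Real.exp_pos _).le]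
    exact Real.exp_le_exp.mpr (neg_le_neg (e.lower_le i))
  exact ⟨diagonalOperator e.basis _ _ h, e.ι, e.basis, e.energy, e.mem,
    diagonalOperator_apply_basis e.basis h⟩

lemma partitionFunction_eq :
    partitionFunction A = ∑' i, ENNReal.ofReal (Real.exp (-e.energy i)) :=
  Diagonalization.trace_eq
    { ι := e.ι
      basis := e.basis
      weight := fun i => Real.exp (-e.energy i)
      apply_basis := e.expNeg_apply } fun _ => (Real.exp_pos _).le

/-- The eigenvalues of the Gibbs state. -/
def weight (i : e.ι) : ℝ := (partitionFunction A).toReal⁻¹ * Real.exp (-e.energy i)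

lemma weight_nonneg (i : e.ι) : 0 ≤ e.weight i := by
  unfold weight
  positivity

/-- The diagonalization of the Gibbs state in the eigenbasis. -/
def diagonalization : Diagonalization (gibbsState A) where
  ι := e.ι
  basis := e.basis
  weight := e.weight
  apply_basis i := by
    rw [gibbsState, smul_apply, e.expNeg_apply, smul_smul, weight]
    push_cast
    rfl

lemma hasSum_exp (h : partitionFunction A ≠ ⊤) :
    HasSum (fun i => Real.exp (-e.energy i)) (partitionFunction A).toReal := by
  refine hasSum_of_tsum_ofReal (fun i => (Real.exp_pos _).le) ENNReal.toReal_nonneg ?_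
  rw [ENNReal.ofReal_toReal h, e.partitionFunction_eq]

lemma hasSum_weight (h : partitionFunction A ≠ ⊤) (h0 : partitionFunction A ≠ 0) :
    HasSum e.weight 1 := by
  have h1 := (e.hasSum_exp h).mul_left (partitionFunction A).toReal⁻¹
  rwa [inv_mul_cancel₀ (ENNReal.toReal_ne_zero.mpr ⟨h0, h⟩)] at h1

end EigenSystem

end GibbsAbstract

/-! ## Hamiltonians on Fock space -/

section FockHamiltonian

open MeasureTheory

/-- The graph of `lam dΓ(h) + g`. -/
def hamiltonianGraph (g : ∀ n, BoundedFunction (Fin n × Fin 2)) (lam : ℝ) : Set (Fock × Fock) :=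
  {ΨΦ | ∀ (n : ℕ) (p : Fin n × Fin 2 → ℤ),
    (planeWaves _).repr (component ΨΦ.2 n) p =
      ((lam * kineticEnergy p : ℝ) : ℂ) * (planeWaves _).repr (component ΨΦ.1 n) p
        + (planeWaves _).repr (mulOperator (g n) (component ΨΦ.1 n)) p}

variable {g : ∀ n, BoundedFunction (Fin n × Fin 2)} {lam : ℝ}

/-- After subtraction of the bounded potential terms, both inner products expand into the same
series with the real kinetic energies. Membership in the graph is the only domain information
needed. -/
lemma hamiltonianGraph_symm (u : Fock × Fock) (hu : u ∈ hamiltonianGraph g lam) (v : Fock × Fock)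
    (hv : v ∈ hamiltonianGraph g lam) : ⟪u.1, v.2⟫_ℂ = ⟪u.2, v.1⟫_ℂ := by
  refine (hasSum_inner_component u.1 v.2).unique
    ((hasSum_inner_component u.2 v.1).congr_fun fun n => ?_)
  have h1 := hasSum_conj_repr_mul_repr (component u.1 n) (component v.2 n)
  have h2 := hasSum_conj_repr_mul_repr (component u.2 n) (component v.1 n)
  have h3 := hasSum_conj_repr_mul_repr (component u.1 n) (mulOperator (g n) (component v.1 n))
  have h4 := hasSum_conj_repr_mul_repr (mulOperator (g n) (component u.1 n)) (component v.1 n)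
  have h5 : ⟪mulOperator (g n) (component u.1 n), component v.1 n⟫_ℂ
      = ⟪component u.1 n, mulOperator (g n) (component v.1 n)⟫_ℂ :=
    isSymmetric_mulOperator (g n) _ _
  rw [h5] at h4
  have h6 := (h1.sub h3).unique ((h2.sub h4).congr_fun fun p => ?_)
  · exact sub_left_injective h6
  · rw [hu n p, hv n p, map_add, map_mul, Complex.conj_ofReal]
    ring

lemma single_mem_hamiltonianGraph {n : ℕ} {ψ φ : Sector n}
    (h : ∀ p, (planeWaves _).repr (φ : L2Torus (Fin n × Fin 2)) p =
      ((lam * kineticEnergy p : ℝ) : ℂ) * (planeWaves _).repr (ψ : L2Torus _) p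
        + (planeWaves _).repr (mulOperator (g n) (ψ : L2Torus _)) p) :
    (single n ψ, single n φ) ∈ hamiltonianGraph g lam := by
  intro n' p
  by_cases hn : n' = n
  · subst hn
    simp only [component_single_self]
    exact h p
  · simp only [component_single_of_ne _ hn, map_zero]
    simp

lemma smul_single (c : ℂ) {n : ℕ} (ψ : Sector n) : c • single n ψ = single n (c • ψ) := by
  rw [single, single, lp.single_smul]

/-- `∑ k, m k * h_k`. -/
def occupationEnergy (m : (Fin 2 → ℤ) →₀ ℕ) : ℝ := m.sum fun k a => a * oneBodyEnergy k

lemma occupationEnergy_nonneg (m : (Fin 2 → ℤ) →₀ ℕ) : 0 ≤ occupationEnergy m :=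
  Finset.sum_nonneg fun k _ => mul_nonneg (Nat.cast_nonneg _) (oneBodyEnergy_pos k).le

namespace FockEigenbasis

variable (B : FockEigenbasis g lam)

lemma mem (i : B.ι) :
    (B.basis i, (B.eigenvalue i : ℂ) • B.basis i) ∈ hamiltonianGraph g lam := by
  rw [B.basis_eq, smul_single]
  refine single_mem_hamiltonianGraph fun p => ?_
  rw [← B.eigen i p]
  change (planeWaves _).repr ((B.eigenvalue i : ℂ) • B.wave i) p = _
  rw [map_smul, lp.coeFn_smul, Pi.smul_apply, smul_eq_mul]

lemma component_basis (i : B.ι) : component (B.basis i) (B.number i) = B.wave i := by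
  rw [B.basis_eq, component_single_self]

lemma norm_wave (i : B.ι) : ‖B.wave i‖ = 1 := by
  have h1 := B.basis.orthonormal.1 i
  have h2 : ⟪B.basis i, B.basis i⟫_ℂ = ⟪B.wave i, B.wave i⟫_ℂ := by
    conv_lhs => rw [B.basis_eq i]
    rw [inner_single, component_single_self]
  rw [inner_self_eq_norm_sq_to_K, inner_self_eq_norm_sq_to_K, h1] at h2
  have h3 : ‖B.wave i‖ ^ 2 = 1 := by
    have h4 : ((‖B.wave i‖ ^ 2 : ℝ) : ℂ) = ((1 : ℝ) : ℂ) := by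
      push_cast
      exact h2.symm.trans (by simp)
    exact Complex.ofReal_injective h4
  nlinarith [norm_nonneg (B.wave i)]

/-- The overlap `|⟨m, b i⟩|²` with occupation number vectors. -/
def overlap (i : B.ι) (m : (Fin 2 → ℤ) →₀ ℕ) : ℝ := ‖⟪occupationVector m, B.basis i⟫_ℂ‖ ^ 2

lemma overlap_nonneg (i : B.ι) (m : (Fin 2 → ℤ) →₀ ℕ) : 0 ≤ B.overlap i m := sq_nonneg _

/-- Parseval for both bases: with `hasSum_overlap_right` this says that the overlaps form a doubly
stochastic matrix, the only link between the two bases used in the trace inequalities. -/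
lemma hasSum_overlap_left (i : B.ι) : HasSum (B.overlap i) 1 := by
  have h := hasSum_sq_norm_inner occupationBasis (B.basis i)
  simp only [coe_occupationBasis, B.basis.orthonormal.1 i] at h
  change HasSum (fun m => ‖⟪occupationVector m, B.basis i⟫_ℂ‖ ^ 2) 1
  simpa using h

lemma hasSum_overlap_right (m : (Fin 2 → ℤ) →₀ ℕ) : HasSum (fun i => B.overlap i m) 1 := by
  have h := hasSum_sq_norm_inner B.basis (occupationVector m)
  simp only [orthonormal_occupationVector.1 m] at h
  simp only [overlap, norm_inner_symm (occupationVector m)]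
  simpa using h

lemma overlap_eq_zero (i : B.ι) {m : (Fin 2 → ℤ) →₀ ℕ} (h : m.degree ≠ B.number i) :
    B.overlap i m = 0 := by
  rw [overlap, B.basis_eq, occupationVector, inner_single, component_single_of_ne _ h,
    inner_zero_right]
  simp

/-- The expectation of the potential in an eigenvector. -/
def potential (i : B.ι) : ℝ := (⟪B.wave i, mulOperator (g (B.number i)) (B.wave i)⟫_ℂ).re

/-- Pairing the eigenvalue equation with the eigenvector isolates its kinetic energy, which is a
positive sum over momenta and can be regrouped by occupation numbers. So averaging the free energies
along a row of the overlap matrix gives the eigenvalue minus the potential energy. -/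
lemma hasSum_kinetic (hlam : 0 ≤ lam) (i : B.ι) :
    HasSum (fun m => B.overlap i m * (lam * occupationEnergy m))
      (B.eigenvalue i - B.potential i) := by
  have h1 := hasSum_conj_repr_mul_repr (B.wave i) (B.wave i)
  have h2 := hasSum_conj_repr_mul_repr (B.wave i) (mulOperator (g (B.number i)) (B.wave i))
  have h3 := Complex.hasSum_re ((h1.mul_left (B.eigenvalue i : ℂ)).sub h2)
  have h4 : HasSum (fun p : Fin (B.number i) × Fin 2 → ℤ =>
      lam * kineticEnergy p * ‖(planeWaves _).repr (B.wave i) p‖ ^ 2)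
      (B.eigenvalue i - B.potential i) := by
    convert h3 using 1
    · funext p
      have h5 : (B.eigenvalue i : ℂ) * (conj ((planeWaves _).repr (B.wave i) p)
          * (planeWaves _).repr (B.wave i) p) - conj ((planeWaves _).repr (B.wave i) p)
          * (planeWaves _).repr (mulOperator (g (B.number i)) (B.wave i)) p
          = ((lam * kineticEnergy p * ‖(planeWaves _).repr (B.wave i) p‖ ^ 2 : ℝ) : ℂ) := by
        push_cast
        rw [← Complex.conj_mul']
        have := B.eigen i p
        push_cast at this
        linear_combination (conj ((planeWaves _).repr (B.wave i) p)) * this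
      rw [h5, Complex.ofReal_re]
    · rw [inner_self_eq_norm_sq_to_K, B.norm_wave]
      simp [potential]
  have hnn : ∀ p : Fin (B.number i) × Fin 2 → ℤ,
      0 ≤ lam * kineticEnergy p * ‖(planeWaves _).repr (B.wave i) p‖ ^ 2 := fun p =>
    mul_nonneg (mul_nonneg hlam (kineticEnergy_nonneg p)) (sq_nonneg _)
  refine hasSum_of_tsum_ofReal (fun m => mul_nonneg (B.overlap_nonneg i m)
    (mul_nonneg hlam (occupationEnergy_nonneg m))) (h4.nonneg hnn) ?_
  rw [← h4.tsum_eq, ENNReal.ofReal_tsum_of_nonneg hnn h4.summable]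
  have h6 := tsum_weighted_occupation (fun m => ENNReal.ofReal (lam * occupationEnergy m))
    (B.basis i)
  calc _ = ∑' m, ENNReal.ofReal (lam * occupationEnergy m)
        * ENNReal.ofReal (‖⟪occupationVector m, B.basis i⟫_ℂ‖ ^ 2) := by
        congr 1 with m
        rw [mul_comm, overlap, ENNReal.ofReal_mul (mul_nonneg hlam (occupationEnergy_nonneg m))]
    _ = _ := by
        rw [← h6, tsum_eq_single (B.number i)]
        · rw [B.component_basis]
          congr 1 with p
          rw [← ENNReal.ofReal_mul (mul_nonneg hlam (occupationEnergy_nonneg _)),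
            kineticEnergy_eq_of_occupation]
          rfl
        · intro n hn
          rw [B.basis_eq, component_single_of_ne _ hn]
          simp

/-- The expectation of the potential in an occupation number vector. -/
def _root_.BoseGas.occupationPotential (g : ∀ n, BoundedFunction (Fin n × Fin 2))
    (m : (Fin 2 → ℤ) →₀ ℕ) : ℝ :=
  (⟪orbitWave (representative m),
    mulOperator (g m.degree) (orbitWave (representative m))⟫_ℂ).re

/-- An occupation number vector lies in the domain because the potential is bounded on its sector
and preserves symmetry. Its energy can therefore be expanded in the eigenbasis, and symmetry of the
graph moves the Hamiltonian onto the eigenvectors. -/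
lemma hasSum_eigenvalue
    (hσ : ∀ n (σ : Equiv.Perm (Fin n)) x, (g n).toFun (relabel σ x) = (g n).toFun x)
    (m : (Fin 2 → ℤ) →₀ ℕ) :
    HasSum (fun i => B.overlap i m * B.eigenvalue i)
      (lam * occupationEnergy m + occupationPotential g m) := by
  let w : L2Torus (Fin m.degree × Fin 2) := orbitWave (representative m)
  have hw : w ∈ Sector m.degree := (orbitWave_mem_block _).1
  let y : Sector m.degree := ⟨((lam * occupationEnergy m : ℝ) : ℂ) • w
    + mulOperator (g m.degree) w, add_mem (Submodule.smul_mem _ _ hw)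
      (mulOperator_mem_sector _ (hσ _) hw)⟩
  have hy : (occupationVector m, single m.degree y) ∈ hamiltonianGraph g lam := by
    refine single_mem_hamiltonianGraph fun p => ?_
    simp only [y, w, map_add, map_smul, lp.coeFn_add, Pi.add_apply, lp.coeFn_smul, Pi.smul_apply,
      smul_eq_mul, repr_orbitWave, occupation_representative]
    split_ifs with h
    · rw [kineticEnergy_eq_of_occupation, h]
      rfl
    · simp
  have h1 := B.basis.hasSum_inner_mul_inner (occupationVector m) (single m.degree y)
  have h2 : ⟪occupationVector m, single m.degree y⟫_ℂ
      = ((lam * occupationEnergy m : ℝ) : ℂ) + ⟪w, mulOperator (g m.degree) w⟫_ℂ := by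
    rw [occupationVector, inner_single, component_single_self]
    simp only [y, inner_add_right, inner_smul_right]
    rw [inner_self_eq_norm_sq_to_K, norm_orbitWave]
    simp [w]
  have h3 := Complex.hasSum_re h1
  rw [h2, Complex.add_re, Complex.ofReal_re] at h3
  refine h3.congr_fun fun i => ?_
  have h4 := hamiltonianGraph_symm _ (B.mem i) _ hy
  simp only [inner_smul_left, Complex.conj_ofReal] at h4
  rw [h4, ← inner_conj_symm (B.basis i) (occupationVector m), mul_left_comm, Complex.mul_conj,
    ← Complex.ofReal_mul, Complex.ofReal_re, Complex.normSq_eq_norm_sq, mul_comm]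
  rfl

end FockEigenbasis

end FockHamiltonian

/-! ## Statistics of independent geometric occupation numbers -/

section Geometric

variable {κ : Type*}

/-- Separating one occupation number from the others. -/
def splitAt (k : κ) : (κ →₀ ℕ) ≃ ℕ × {m : κ →₀ ℕ // m k = 0} where
  toFun m := (m k, ⟨m.erase k, Finsupp.erase_same⟩)
  invFun q := q.2.1.update k q.1
  left_inv m := by simp
  right_inv q := by
    obtain ⟨j, m, hm⟩ := q
    classical
    refine Prod.ext (by simp [Finsupp.update_apply]) (Subtype.ext ?_)
    ext l
    by_cases h : l = k
    · subst h; simp [hm]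
    · simp [h]

lemma tsum_splitAt (k : κ) (F : ℕ → ℝ≥0∞) (G : (κ →₀ ℕ) → ℝ≥0∞) :
    ∑' m : κ →₀ ℕ, F (m k) * G (m.erase k) =
      (∑' j, F j) * ∑' m : {m : κ →₀ ℕ // m k = 0}, G m.1 := by
  rw [← ENNReal.tsum_mul_right]
  simp_rw [← ENNReal.tsum_mul_left]
  rw [← ENNReal.tsum_prod, ← (splitAt k).tsum_eq]
  rfl

/-- The Boltzmann weight of a configuration of occupation numbers. -/
def boltzmann (x : κ → ℝ) (m : κ →₀ ℕ) : ℝ≥0∞ :=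
  ENNReal.ofReal (Real.exp (-(m.sum fun k a => a * x k)))

lemma boltzmann_eq (x : κ → ℝ) (k : κ) (m : κ →₀ ℕ) :
    boltzmann x m = ENNReal.ofReal (Real.exp (-x k)) ^ (m k) * boltzmann x (m.erase k) := by
  rw [boltzmann, boltzmann, ← ENNReal.ofReal_pow (Real.exp_pos _).le,
    ← ENNReal.ofReal_mul (by positivity), ← Real.exp_nat_mul, ← Real.exp_add,
    ← Finsupp.add_sum_erase' m k (fun k a => (a : ℝ) * x k) (by simp)]
  congr 2
  ring

/-- Independence of the modes: the Boltzmann weight factors over them, so a function of `m k` may be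
replaced by its geometric average `c` next to any function of the other modes. -/
lemma tsum_boltzmann_mul (x : κ → ℝ) (k : κ) (F : ℕ → ℝ≥0∞) (c : ℝ≥0∞)
    (hF : ∑' j, F j * ENNReal.ofReal (Real.exp (-x k)) ^ j
      = c * ∑' j, ENNReal.ofReal (Real.exp (-x k)) ^ j) (G : (κ →₀ ℕ) → ℝ≥0∞) :
    ∑' m, F (m k) * G (m.erase k) * boltzmann x m
      = c * ∑' m, G (m.erase k) * boltzmann x m := by
  have h1 := tsum_splitAt k (fun j => F j * ENNReal.ofReal (Real.exp (-x k)) ^ j)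
    (fun m => G m * boltzmann x m)
  have h2 := tsum_splitAt k (fun j => ENNReal.ofReal (Real.exp (-x k)) ^ j)
    (fun m => G m * boltzmann x m)
  calc _ = ∑' m : κ →₀ ℕ, F (m k) * ENNReal.ofReal (Real.exp (-x k)) ^ (m k)
        * (G (m.erase k) * boltzmann x (m.erase k)) := by
        congr 1 with m
        rw [boltzmann_eq x k m]
        ring
    _ = c * ∑' m : κ →₀ ℕ, ENNReal.ofReal (Real.exp (-x k)) ^ (m k)
        * (G (m.erase k) * boltzmann x (m.erase k)) := by
        rw [h1, h2, hF, mul_assoc]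
    _ = _ := by
        congr 2 with m
        conv_rhs => rw [boltzmann_eq x k m]
        ring

/-- The mean occupation number. -/
def bose (x : ℝ) : ℝ := (Real.exp x - 1)⁻¹

lemma bose_pos {x : ℝ} (hx : 0 < x) : 0 < bose x :=
  inv_pos.mpr (sub_pos.mpr (Real.one_lt_exp_iff.mpr hx))

lemma exp_neg_lt_one {x : ℝ} (hx : 0 < x) : Real.exp (-x) < 1 := by
  rw [Real.exp_lt_one_iff]; linarith

lemma bose_eq {x : ℝ} (hx : 0 < x) : bose x = Real.exp (-x) / (1 - Real.exp (-x)) := by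
  have h1 := exp_neg_lt_one hx
  have h2 : Real.exp x * Real.exp (-x) = 1 := by rw [← Real.exp_add]; simp
  have h3 : 1 < Real.exp x := Real.one_lt_exp_iff.mpr hx
  rw [bose, inv_eq_one_div, div_eq_div_iff (by linarith) (by linarith)]
  linarith

lemma one_add_bose {x : ℝ} (hx : 0 < x) : 1 + bose x = (1 - Real.exp (-x))⁻¹ := by
  have h1 := exp_neg_lt_one hx
  have h2 : 1 - Real.exp (-x) ≠ 0 := by linarith
  rw [bose_eq hx]
  field_simp
  ring

lemma tsum_geometric {x : ℝ} (hx : 0 < x) :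
    ∑' j : ℕ, ENNReal.ofReal (Real.exp (-x)) ^ j = ENNReal.ofReal (1 + bose x) := by
  rw [ENNReal.tsum_geometric, one_add_bose hx,
    ENNReal.ofReal_inv_of_pos (sub_pos.mpr (exp_neg_lt_one hx)),
    ENNReal.ofReal_sub _ (Real.exp_pos _).le, ENNReal.ofReal_one]

lemma tsum_geometric_mul {x : ℝ} (hx : 0 < x) :
    ∑' j : ℕ, (j : ℝ≥0∞) * ENNReal.ofReal (Real.exp (-x)) ^ j
      = ENNReal.ofReal (bose x) * ∑' j : ℕ, ENNReal.ofReal (Real.exp (-x)) ^ j := by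
  have h1 := exp_neg_lt_one hx
  have h0 := Real.exp_pos (-x)
  have h := hasSum_coe_mul_geometric_of_norm_lt_one (𝕜 := ℝ) (r := Real.exp (-x))
    (by rwa [Real.norm_of_nonneg h0.le])
  rw [tsum_geometric hx, ← ENNReal.ofReal_mul (bose_pos hx).le, one_add_bose hx, bose_eq hx]
  have h2 : Real.exp (-x) / (1 - Real.exp (-x)) * (1 - Real.exp (-x))⁻¹
      = Real.exp (-x) / (1 - Real.exp (-x)) ^ 2 := by
    field_simp
  rw [h2, ← h.tsum_eq, ENNReal.ofReal_tsum_of_nonneg (fun j => by positivity) h.summable]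
  congr 1 with j
  rw [ENNReal.ofReal_mul (Nat.cast_nonneg _), ENNReal.ofReal_natCast, ENNReal.ofReal_pow h0.le]

lemma tsum_geometric_mul_sq {x : ℝ} (hx : 0 < x) :
    ∑' j : ℕ, ((j : ℝ≥0∞) * j) * ENNReal.ofReal (Real.exp (-x)) ^ j
      = ENNReal.ofReal (bose x * bose x + (bose x + bose x ^ 2))
        * ∑' j : ℕ, ENNReal.ofReal (Real.exp (-x)) ^ j := by
  have h1 := exp_neg_lt_one hx
  have h0 := Real.exp_pos (-x)
  have hn : ‖Real.exp (-x)‖ < 1 := by rwa [Real.norm_of_nonneg h0.le]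
  have hb := (bose_pos hx).le
  -- The second moment is assembled from known series by `j² = 2 (j+2 choose 2) - 3 j - 2`.
  have ha := (((hasSum_choose_mul_geometric_of_norm_lt_one (𝕜 := ℝ) 2 hn).mul_left 2).sub
    ((hasSum_coe_mul_geometric_of_norm_lt_one hn).mul_left 3)).sub
    ((hasSum_geometric_of_norm_lt_one hn).mul_left 2)
  have hc : HasSum (fun j : ℕ => ((j : ℝ) * j) * Real.exp (-x) ^ j)
      ((bose x * bose x + (bose x + bose x ^ 2)) * (1 + bose x)) := by
    convert! ha using 1
    · funext j
      have h3 : ((j + 2).choose 2 : ℝ) = (j + 2) * (j + 1) / 2 := by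
        rw [Nat.cast_choose_two]
        push_cast
        ring
      rw [h3]
      ring
    · have h2 : 1 - Real.exp (-x) ≠ 0 := by linarith
      rw [one_add_bose hx, bose_eq hx]
      field_simp
      ring
  rw [tsum_geometric hx, ← ENNReal.ofReal_mul (by positivity), ← hc.tsum_eq,
    ENNReal.ofReal_tsum_of_nonneg (fun j => by positivity) hc.summable]
  congr 1 with j
  rw [ENNReal.ofReal_mul (by positivity), ENNReal.ofReal_mul (Nat.cast_nonneg _),
    ENNReal.ofReal_natCast, ENNReal.ofReal_pow h0.le]

variable {x : κ → ℝ}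

lemma tsum_boltzmann_mul_apply (hx : ∀ k, 0 < x k) (k : κ) :
    ∑' m : κ →₀ ℕ, (m k : ℝ≥0∞) * boltzmann x m
      = ENNReal.ofReal (bose (x k)) * ∑' m, boltzmann x m := by
  simpa using tsum_boltzmann_mul x k (fun j => (j : ℝ≥0∞)) _ (tsum_geometric_mul (hx k))
    (fun _ => 1)

/-- Different modes are independent, and the additional diagonal term is the variance of a geometric
variable of mean `bose`. This plays the role of Wick's theorem for two occupation numbers. -/
lemma tsum_boltzmann_mul_apply_mul_apply [DecidableEq κ] (hx : ∀ k, 0 < x k) (k l : κ) :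
    ∑' m : κ →₀ ℕ, ((m k : ℝ≥0∞) * m l) * boltzmann x m
      = (ENNReal.ofReal (bose (x k)) * ENNReal.ofReal (bose (x l))
        + if k = l then ENNReal.ofReal (bose (x k) + bose (x k) ^ 2) else 0)
          * ∑' m, boltzmann x m := by
  have hb := (bose_pos (hx k)).le
  by_cases h : k = l
  · subst h
    have h1 := tsum_boltzmann_mul x k (fun j => (j : ℝ≥0∞) * j) _ (tsum_geometric_mul_sq (hx k))
      (fun _ => 1)
    simp only [mul_one, one_mul] at h1
    rw [h1, if_pos rfl, ← ENNReal.ofReal_mul hb,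
      ← ENNReal.ofReal_add (by positivity) (by positivity)]
  · have h1 := tsum_boltzmann_mul x k (fun j => (j : ℝ≥0∞)) _ (tsum_geometric_mul (hx k))
      (fun m => (m l : ℝ≥0∞))
    simp only [Finsupp.erase_ne (Ne.symm h)] at h1
    rw [h1, tsum_boltzmann_mul_apply hx l, if_neg h, add_zero, mul_assoc]

lemma natCast_degree (m : κ →₀ ℕ) : (m.degree : ℝ≥0∞) = ∑' k, (m k : ℝ≥0∞) := by
  rw [Finsupp.degree_apply, Nat.cast_sum,
    tsum_eq_sum (s := m.support) fun k hk => by rw [Finsupp.notMem_support_iff.mp hk, Nat.cast_zero]]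

lemma tsum_boltzmann_mul_degree (hx : ∀ k, 0 < x k) :
    ∑' m : κ →₀ ℕ, (m.degree : ℝ≥0∞) * boltzmann x m
      = (∑' k, ENNReal.ofReal (bose (x k))) * ∑' m, boltzmann x m := by
  simp_rw [natCast_degree, ← ENNReal.tsum_mul_right]
  rw [ENNReal.tsum_comm]
  simp_rw [tsum_boltzmann_mul_apply hx]

lemma tsum_boltzmann_mul_degree_sq (hx : ∀ k, 0 < x k) :
    ∑' m : κ →₀ ℕ, ((m.degree : ℝ≥0∞) * m.degree) * boltzmann x m
      = ((∑' k, ENNReal.ofReal (bose (x k))) * (∑' k, ENNReal.ofReal (bose (x k)))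
        + ∑' k, ENNReal.ofReal (bose (x k) + bose (x k) ^ 2)) * ∑' m, boltzmann x m := by
  classical
  have h1 : ∀ m : κ →₀ ℕ, ((m.degree : ℝ≥0∞) * m.degree) * boltzmann x m
      = ∑' k, ∑' l, ((m k : ℝ≥0∞) * m l) * boltzmann x m := by
    intro m
    simp_rw [ENNReal.tsum_mul_right, ENNReal.tsum_mul_left, ENNReal.tsum_mul_right,
      ← natCast_degree]
  simp_rw [h1]
  rw [ENNReal.tsum_comm]
  have h2 : ∀ k, ∑' (m : κ →₀ ℕ) (l : κ), ((m k : ℝ≥0∞) * m l) * boltzmann x m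
      = (ENNReal.ofReal (bose (x k)) * (∑' l, ENNReal.ofReal (bose (x l)))
        + ENNReal.ofReal (bose (x k) + bose (x k) ^ 2)) * ∑' m, boltzmann x m := by
    intro k
    rw [ENNReal.tsum_comm]
    simp_rw [tsum_boltzmann_mul_apply_mul_apply hx, ENNReal.tsum_mul_right, ENNReal.tsum_add,
      ENNReal.tsum_mul_left]
    congr 2
    rw [tsum_eq_single k fun l hl => if_neg hl.symm, if_pos rfl]
  simp_rw [h2, ENNReal.tsum_mul_right, ENNReal.tsum_add, ENNReal.tsum_mul_right]

lemma tsum_boltzmann_mul_shift [AddGroup κ] (hx : ∀ k, 0 < x k) {q : κ} (hq : q ≠ 0) :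
    ∑' m : κ →₀ ℕ, (∑' k, (m k : ℝ≥0∞) * m (k + q)) * boltzmann x m
      = (∑' k, ENNReal.ofReal (bose (x k)) * ENNReal.ofReal (bose (x (k + q))))
        * ∑' m, boltzmann x m := by
  classical
  simp_rw [← ENNReal.tsum_mul_right]
  rw [ENNReal.tsum_comm]
  congr 1 with k
  rw [tsum_boltzmann_mul_apply_mul_apply hx, if_neg (by simpa using hq), add_zero]

/-- The grand canonical product formula for finitely many modes. Splitting off one mode contributes
its geometric series, so induction on `S` applies. -/
lemma tsum_boltzmann_support_subset [DecidableEq κ] (hx : ∀ k, 0 < x k) (S : Finset κ) :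
    ∑' m : κ →₀ ℕ, (if m.support ⊆ S then 1 else 0) * boltzmann x m
      = ∏ k ∈ S, ENNReal.ofReal (1 + bose (x k)) := by
  induction S using Finset.induction with
  | empty =>
    rw [tsum_eq_single 0]
    · simp [boltzmann]
    · intro m hm
      rw [if_neg (by simpa using hm), zero_mul]
  | insert k S hk ih =>
    rw [Finset.prod_insert hk, ← ih]
    have h1 := tsum_splitAt k (fun j => ENNReal.ofReal (Real.exp (-x k)) ^ j)
      (fun m => (if m.support ⊆ S then 1 else 0) * boltzmann x m)
    rw [tsum_geometric (hx k)] at h1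
    have h2 : ∑' m : {m : κ →₀ ℕ // m k = 0}, (if m.1.support ⊆ S then 1 else 0) * boltzmann x m.1
        = ∑' m : κ →₀ ℕ, (if m.support ⊆ S then 1 else 0) * boltzmann x m := by
      refine tsum_subtype_eq_of_support_subset (s := {m : κ →₀ ℕ | m k = 0})
        (f := fun m => (if m.support ⊆ S then 1 else 0) * boltzmann x m) fun m hm => ?_
      by_contra h
      refine hm ?_
      have : ¬ m.support ⊆ S := fun hs => hk (hs (Finsupp.mem_support_iff.mpr h))
      simp [this]
    rw [h2] at h1
    rw [← h1]
    congr 1 with m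
    have h3 : m.support ⊆ insert k S ↔ (m.erase k).support ⊆ S := by
      rw [Finsupp.support_erase, Finset.subset_insert_iff]
    simp only [h3]
    rw [boltzmann_eq x k m]
    ring

/-- The grand canonical partition function is finite. -/
lemma tsum_boltzmann_ne_top (hx : ∀ k, 0 < x k) (hs : Summable fun k => bose (x k)) :
    ∑' m, boltzmann x m ≠ ⊤ := by
  classical
  refine ne_top_of_le_ne_top (b := ENNReal.ofReal (Real.exp (∑' k, bose (x k))))
    ENNReal.ofReal_ne_top ?_
  rw [ENNReal.tsum_eq_iSup_sum]
  refine iSup_le fun M => ?_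
  -- Finitely many configurations occupy finitely many modes. The product over these modes is at
  -- most the exponential of the sum of all mean occupation numbers, a bound uniform in `M`.
  let S := M.biUnion Finsupp.support
  calc ∑ m ∈ M, boltzmann x m
      ≤ ∑ m ∈ M, (if m.support ⊆ S then 1 else 0) * boltzmann x m := by
        refine Finset.sum_le_sum fun m hm => ?_
        rw [if_pos (Finset.subset_biUnion_of_mem _ hm), one_mul]
    _ ≤ ∑' m : κ →₀ ℕ, (if m.support ⊆ S then 1 else 0) * boltzmann x m :=
        ENNReal.sum_le_tsum M
    _ = ENNReal.ofReal (∏ k ∈ S, (1 + bose (x k))) := by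
        rw [tsum_boltzmann_support_subset hx, ENNReal.ofReal_prod_of_nonneg]
        exact fun k _ => by have := (bose_pos (hx k)).le; positivity
    _ ≤ _ := by
        refine ENNReal.ofReal_le_ofReal ?_
        calc ∏ k ∈ S, (1 + bose (x k)) ≤ ∏ k ∈ S, Real.exp (bose (x k)) :=
              Finset.prod_le_prod (fun k _ => by have := (bose_pos (hx k)).le; positivity)
                fun k _ => by rw [add_comm]; exact Real.add_one_le_exp _
          _ = Real.exp (∑ k ∈ S, bose (x k)) := (Real.exp_sum _ _).symm
          _ ≤ _ := Real.exp_le_exp.mpr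
              (hs.sum_le_tsum S fun k _ => (bose_pos (hx k)).le)

/-- Changing finitely many one-particle energies. -/
lemma tsum_boltzmann_piecewise [DecidableEq κ] (hx : ∀ k, 0 < x k) {y : κ → ℝ} (hy : ∀ k, 0 < y k)
    (S : Finset κ) :
    (∑' m, boltzmann (S.piecewise y x) m) * ∏ k ∈ S, ENNReal.ofReal (1 + bose (x k))
      = (∑' m, boltzmann x m) * ∏ k ∈ S, ENNReal.ofReal (1 + bose (y k)) := by
  induction S using Finset.induction with
  | empty => simp
  | insert k S hk ih =>
    rw [Finset.prod_insert hk, Finset.prod_insert hk]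
    set z := S.piecewise y x with hz
    have hzk : z k = x k := Finset.piecewise_eq_of_notMem _ _ _ hk
    have h0 : (insert k S).piecewise y x = Function.update z k (y k) := Finset.piecewise_insert _ _ _ _
    have key : ∀ u : κ → ℝ, 0 < u k → ∑' m, boltzmann u m
        = ENNReal.ofReal (1 + bose (u k)) * ∑' m : {m : κ →₀ ℕ // m k = 0}, boltzmann u m.1 := by
      intro u hu
      rw [← tsum_geometric hu, ← tsum_splitAt]
      congr 1 with m
      exact boltzmann_eq u k m
    have h1 : ∀ m : {m : κ →₀ ℕ // m k = 0},
        boltzmann (Function.update z k (y k)) m.1 = boltzmann z m.1 := by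
      intro m
      unfold boltzmann
      congr 3
      refine Finsupp.sum_congr fun l hl => ?_
      rw [Function.update_of_ne]
      rintro rfl
      exact (Finsupp.mem_support_iff.mp hl) m.2
    rw [h0, key _ (by simpa using hy k)]
    rw [key z (by rw [hzk]; exact hx k), hzk] at ih
    simp only [h1, Function.update_self]
    calc _ = ENNReal.ofReal (1 + bose (y k)) * (ENNReal.ofReal (1 + bose (x k))
        * (∑' m : {m : κ →₀ ℕ // m k = 0}, boltzmann z m.1)
        * ∏ k ∈ S, ENNReal.ofReal (1 + bose (x k))) := by ring
      _ = _ := by rw [ih]; ring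

end Geometric

/-! ## Number statistics and density modes -/

section NumberForms

open MeasureTheory UnitAddTorus

/-- Functions of the particle number in the occupation number basis. -/
lemma tsum_number_weight (F : ℕ → ℝ≥0∞) (Ψ : Fock) :
    ∑' n : ℕ, F n * ENNReal.ofReal (‖Ψ n‖ ^ 2)
      = ∑' m, F m.degree * ENNReal.ofReal (‖⟪occupationVector m, Ψ⟫_ℂ‖ ^ 2) := by
  rw [← tsum_weighted_occupation (fun m => F m.degree) Ψ]
  congr 1 with n
  simp only [degree_occupation]
  rw [ENNReal.tsum_mul_left]
  have h := hasSum_sq_norm_repr (component Ψ n)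
  rw [← ENNReal.ofReal_tsum_of_nonneg (fun _ => sq_nonneg _) h.summable, h.tsum_eq]
  rfl

/-- Functions of the particle number are diagonal in occupation numbers, hence are the form of the
frame `√F |m⟩`; finiteness of `F` makes these genuine vectors. -/
lemma expect_number_weight {Γ : Fock →L[ℂ] Fock} (d₀ : Diagonalization Γ)
    (hd₀ : ∀ i, 0 ≤ d₀.weight i) {F : ℕ → ℝ≥0∞} (hF : ∀ n, F n ≠ ⊤) :
    expect Γ (fun Ψ => ∑' n : ℕ, F n * ENNReal.ofReal (‖Ψ n‖ ^ 2))
      = ∑' j, ENNReal.ofReal (d₀.weight j)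
        * ∑' n : ℕ, F n * ENNReal.ofReal (‖d₀.basis j n‖ ^ 2) := by
  refine d₀.expect_eq hd₀
    (fun m => (Real.sqrt (F m.degree).toReal : ℂ) • occupationVector m) fun Ψ => ?_
  rw [tsum_number_weight, Diagonalization.frameForm]
  congr 1 with m
  rw [inner_smul_left, Complex.conj_ofReal, norm_mul, mul_pow, Complex.norm_real,
    Real.norm_of_nonneg (Real.sqrt_nonneg _), Real.sq_sqrt ENNReal.toReal_nonneg,
    ENNReal.ofReal_mul ENNReal.toReal_nonneg, ENNReal.ofReal_toReal (hF _)]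

/-- The momenta of a state in which only the particle `j` moves, with momentum `k`. -/
def kick {n : ℕ} (j : Fin n) (k : Fin 2 → ℤ) : Fin n × Fin 2 → ℤ :=
  fun q => if q.1 = j then k q.2 else 0

lemma momentum_kick {n : ℕ} (j : Fin n) (k : Fin 2 → ℤ) (i : Fin n) :
    momentum (kick j k) i = if i = j then k else 0 := by
  funext a
  simp only [momentum, kick]
  split_ifs <;> rfl

lemma mFourier_kick {n : ℕ} (j : Fin n) (k : Fin 2 → ℤ) (x : Config n) :
    mFourier (kick j k) x = mFourier k (particle x j) := by
  simp only [mFourier, ContinuousMap.coe_mk, kick, particle]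
  rw [Fintype.prod_prod_type, Finset.prod_eq_single j]
  · simp
  · intro i _ hi
    simp [hi]
  · simp

lemma totalMomentum_sub {n : ℕ} (p q : Fin n × Fin 2 → ℤ) :
    totalMomentum (p - q) = totalMomentum p - totalMomentum q := by
  rw [totalMomentum, totalMomentum, totalMomentum, ← Finset.sum_sub_distrib]
  rfl

lemma totalMomentum_kick {n : ℕ} (j : Fin n) (k : Fin 2 → ℤ) : totalMomentum (kick j k) = k := by
  simp [totalMomentum, momentum_kick]

variable {d : Type} [Fintype d]

/-- Multiplication by a plane wave shifts the Fourier coefficients. -/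
lemma hasSum_mFourier_mul_sq_norm (q : d → ℤ) (ψ : L2Torus d) :
    HasSum (fun p => conj ((planeWaves d).repr ψ p) * (planeWaves d).repr ψ (p - q))
      (∫ x, mFourier q x * ((‖ψ x‖ ^ 2 : ℝ) : ℂ) ∂(torusMeasure d)) := by
  have hm : MemLp (fun x => mFourier q x * ψ x) 2 (torusMeasure d) := by
    refine (Lp.memLp ψ).congr_norm ((mFourier q).continuous.aestronglyMeasurable.mul
      (Lp.aestronglyMeasurable ψ)) (Filter.Eventually.of_forall fun x => ?_)
    rw [norm_mul, norm_mFourier_apply, one_mul]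
  have h := hasSum_conj_repr_mul_repr ψ hm.toLp
  have h1 : ⟪ψ, hm.toLp⟫_ℂ = ∫ x, mFourier q x * ((‖ψ x‖ ^ 2 : ℝ) : ℂ) ∂(torusMeasure d) := by
    rw [inner_eq_integral]
    refine integral_congr_ae ?_
    filter_upwards [hm.coeFn_toLp] with x hx
    rw [hx, mul_left_comm, Complex.conj_mul']
    push_cast
    rfl
  rw [← h1]
  refine h.congr_fun fun p => ?_
  congr 1
  rw [planeWaves_repr, planeWaves_repr]
  refine integral_congr_ae ?_
  filter_upwards [hm.coeFn_toLp] with x hx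
  rw [hx, ← mul_assoc, ← mFourier_add]
  congr 3
  abel

lemma integrable_mFourier_mul_sq_norm (q : d → ℤ) (ψ : L2Torus d) :
    Integrable (fun x => mFourier q x * ((‖ψ x‖ ^ 2 : ℝ) : ℂ)) (torusMeasure d) := by
  refine (integrable_sq_norm ψ).ofReal.bdd_mul (c := 1)
    (mFourier q).continuous.aestronglyMeasurable (Filter.Eventually.of_forall fun x => ?_)
  rw [norm_mFourier_apply]

lemma integral_densityMode_mul_sq_norm {n : ℕ} (k : Fin 2 → ℤ) (ψ : L2Torus (Fin n × Fin 2)) :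
    ∫ x, densityMode k x * ((‖ψ x‖ ^ 2 : ℝ) : ℂ) ∂(torusMeasure (Fin n × Fin 2))
      = ∑ j, ∑' p, conj ((planeWaves _).repr ψ p) * (planeWaves _).repr ψ (p - kick j k) := by
  simp only [densityMode, ← mFourier_kick, Finset.sum_mul]
  rw [integral_finsetSum _ fun j _ => integrable_mFourier_mul_sq_norm _ ψ]
  refine Finset.sum_congr rfl fun j _ => ?_
  exact (hasSum_mFourier_mul_sq_norm _ ψ).tsum_eq.symm

/-- The shifted plane waves in which the density modes are evaluated. -/
def densityFrame (k : Fin 2 → ℤ) (s : Σ n, Fin n × (Fin n × Fin 2 → ℤ)) : Fock :=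
  lift s.1 (planeWaves _ (s.2.2 - kick s.2.1 k))

lemma inner_densityFrame (k : Fin 2 → ℤ) (s : Σ n, Fin n × (Fin n × Fin 2 → ℤ)) (Ψ : Fock) :
    ⟪densityFrame k s, Ψ⟫_ℂ
      = (planeWaves _).repr (component Ψ s.1) (s.2.2 - kick s.2.1 k) := by
  rw [densityFrame, inner_lift, HilbertBasis.repr_apply_apply]

/-- The operator `dΓ(e_k)` is `∑ |Y⁰_s⟩⟨Yᵏ_s|` with frames that differ by a momentum shift of one
particle. Each shift permutes the plane waves, so every particle contributes the full norm and a
finite mean particle number suffices for absolute convergence. -/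
lemma frameForm_densityFrame (k : Fin 2 → ℤ) (Ψ : Fock) :
    Diagonalization.frameForm (densityFrame k) Ψ = numberForm Ψ := by
  rw [Diagonalization.frameForm, numberForm, ENNReal.tsum_sigma']
  congr 1 with n
  simp only [inner_densityFrame]
  rw [ENNReal.tsum_prod', tsum_fintype]
  have h : ∀ j : Fin n, ∑' p : Fin n × Fin 2 → ℤ,
      ENNReal.ofReal (‖(planeWaves _).repr (component Ψ n) (p - kick j k)‖ ^ 2)
      = ENNReal.ofReal (‖Ψ n‖ ^ 2) := by
    intro j
    refine ((Equiv.subRight (kick j k)).tsum_eq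
      (fun p => ENNReal.ofReal (‖(planeWaves _).repr (component Ψ n) p‖ ^ 2))).trans ?_
    have h := hasSum_sq_norm_repr (component Ψ n)
    rw [← ENNReal.ofReal_tsum_of_nonneg (fun _ => sq_nonneg _) h.summable, h.tsum_eq]
    rfl
  simp only [h]
  simp

lemma tsum_densityFrame (k : Fin 2 → ℤ) {Ψ : Fock}
    (hs : Summable fun s => ⟪Ψ, densityFrame 0 s⟫_ℂ * ⟪densityFrame k s, Ψ⟫_ℂ) :
    ∑' s, ⟪Ψ, densityFrame 0 s⟫_ℂ * ⟪densityFrame k s, Ψ⟫_ℂ = densityModeForm k Ψ := by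
  rw [hs.tsum_sigma, densityModeForm]
  congr 1 with n
  rw [integral_densityMode_mul_sq_norm, (hs.sigma_factor n).tsum_prod, tsum_fintype]
  refine Finset.sum_congr rfl fun j _ => ?_
  congr 1 with p
  rw [← inner_conj_symm, inner_densityFrame, inner_densityFrame]
  have h : p - kick j 0 = p := by
    funext q
    simp [kick]
  simp only [h]

/-- The expectation of a density mode in a state that is diagonal in the occupation number
vectors. -/
lemma tsum_weight_mul_densityModeForm {Γ : Fock →L[ℂ] Fock} (d₀ : Diagonalization Γ)
    (hd₀ : ∀ i, 0 ≤ d₀.weight i)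
    (hN : ∑' j, ENNReal.ofReal (d₀.weight j) * numberForm (d₀.basis j) ≠ ⊤)
    (hocc : ∀ j, ∃ m, d₀.basis j = occupationVector m) (d : Diagonalization Γ)
    {k : Fin 2 → ℤ} (hk : k ≠ 0) :
    ∑' j, (d.weight j : ℂ) * densityModeForm k (d.basis j) = 0 := by
  have h := d₀.hasSum_weight_mul_inner_mul_inner hd₀ d (densityFrame 0) (densityFrame k)
    (by simpa only [frameForm_densityFrame]) (by simpa only [frameForm_densityFrame])
  have h0 : ∀ q : d₀.ι × (Σ n, Fin n × (Fin n × Fin 2 → ℤ)), (d₀.weight q.1 : ℂ) *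
      (⟪d₀.basis q.1, densityFrame 0 q.2⟫_ℂ * ⟪densityFrame k q.2, d₀.basis q.1⟫_ℂ) = 0 := by
    rintro ⟨j, n, i, p⟩
    obtain ⟨m, hm⟩ := hocc j
    simp only [hm]
    rw [← inner_conj_symm, inner_densityFrame, inner_densityFrame]
    -- Both coefficients are nonzero only if the two momentum tuples have the same occupation
    -- numbers, hence the same total momentum; but the latter differ by `k ≠ 0`.
    by_cases h1 : occupation (p - kick i 0) = m
    · by_cases h2 : occupation (p - kick i k) = m
      · exfalso
        have h3 := totalMomentum_eq_of_occupation_eq (h1.trans h2.symm)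
        simp only [totalMomentum_sub, totalMomentum_kick] at h3
        rw [sub_zero] at h3
        exact hk (sub_eq_self.mp h3.symm)
      · rw [repr_component_occupationVector h2, mul_zero, mul_zero]
    · rw [repr_component_occupationVector h1, map_zero, zero_mul, mul_zero]
  simp only [h0, tsum_zero] at h
  rw [← h.tsum_eq, h.summable.tsum_prod]
  congr 1 with j
  by_cases hj : d.weight j = 0
  · simp [hj]
  · dsimp only
    rw [tsum_mul_left, tsum_densityFrame]
    exact (summable_mul_left_iff (Complex.ofReal_ne_zero.mpr hj)).mp (h.summable.prod_factor j)

lemma densityModeForm_zero (Ψ : Fock) : densityModeForm 0 Ψ = ((numberForm Ψ).toReal : ℂ) := by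
  rw [densityModeForm, numberForm, ENNReal.tsum_toReal_eq, Complex.ofReal_tsum]
  · congr 1 with n
    rw [ENNReal.toReal_mul, ENNReal.toReal_natCast, ENNReal.toReal_ofReal (sq_nonneg _)]
    have h : ∀ x : Config n, densityMode 0 x = n := fun x => by simp [densityMode, mFourier_zero]
    simp only [h]
    rw [integral_const_mul, integral_complex_ofReal, integral_sq_norm]
    push_cast
    rfl
  · exact fun n => ENNReal.mul_ne_top (ENNReal.natCast_ne_top n) ENNReal.ofReal_ne_top

end NumberForms

/-! ## The free Bose gas -/

section FreeGas

variable {lam : ℝ}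

/-- The vanishing potential. -/
def BoundedFunction.zero (d : Type) [Fintype d] : BoundedFunction d where
  toFun _ := 0
  measurable := measurable_const
  bound := 0
  bound_nonneg := le_rfl
  le_bound _ := by simp

lemma mulOperator_zero {d : Type} [Fintype d] (ψ : L2Torus d) :
    mulOperator (BoundedFunction.zero d) ψ = 0 := by
  refine MeasureTheory.Lp.ext ?_
  filter_upwards [coeFn_mulOperator (BoundedFunction.zero d) ψ,
    MeasureTheory.Lp.coeFn_zero ℂ 2 (torusMeasure d)] with x h1 h2
  rw [h1, h2]
  simp [BoundedFunction.zero]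

lemma freeHamiltonian_eq :
    freeHamiltonian lam = hamiltonianGraph (fun _ => BoundedFunction.zero _) lam := by
  ext ΨΦ
  simp only [freeHamiltonian, hamiltonianGraph, mulOperator_zero, map_zero, lp.coeFn_zero,
    Pi.zero_apply, add_zero]

/-- The free Bose gas in the occupation number basis. -/
def freeSystem (hlam : 0 ≤ lam) : EigenSystem (freeHamiltonian lam) where
  ι := (Fin 2 → ℤ) →₀ ℕ
  basis := occupationBasis
  energy m := lam * occupationEnergy m
  mem m := by
    intro n p
    have h1 : component (((lam * occupationEnergy m : ℝ) : ℂ) • occupationVector m) n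
        = ((lam * occupationEnergy m : ℝ) : ℂ) • component (occupationVector m) n :=
      (componentCLM n).map_smul _ _
    simp only [coe_occupationBasis, h1]
    rw [map_smul, lp.coeFn_smul, Pi.smul_apply, smul_eq_mul]
    by_cases h : occupation p = m
    · rw [kineticEnergy_eq_of_occupation, h]
      rfl
    · rw [repr_component_occupationVector h, mul_zero, mul_zero]
  lower := 0
  lower_le m := mul_nonneg hlam (occupationEnergy_nonneg m)
  symm u hu v hv := by
    rw [freeHamiltonian_eq] at hu hv
    exact hamiltonianGraph_symm u hu v hv

lemma boltzmann_oneBodyEnergy (lam : ℝ) (m : (Fin 2 → ℤ) →₀ ℕ) :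
    boltzmann (fun k => lam * oneBodyEnergy k) m
      = ENNReal.ofReal (Real.exp (-(lam * occupationEnergy m))) := by
  rw [boltzmann, occupationEnergy, Finsupp.mul_sum]
  congr 4
  funext k a
  ring

lemma freePartition_eq (hlam : 0 ≤ lam) : partitionFunction (freeHamiltonian lam)
    = ∑' m, boltzmann (fun k => lam * oneBodyEnergy k) m := by
  simp_rw [boltzmann_oneBodyEnergy]
  exact (freeSystem hlam).partitionFunction_eq

lemma summable_inv_oneBodyEnergy_sq : Summable fun k => (oneBodyEnergy k)⁻¹ ^ 2 := by
  refine (memℓp_green.summable (by norm_num)).congr fun k => ?_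
  rw [Complex.norm_real, ENNReal.toReal_ofNat, Real.rpow_ofNat,
    Real.norm_of_nonneg (inv_nonneg.mpr (oneBodyEnergy_pos k).le)]

lemma bose_le_inv {x : ℝ} (hx : 0 < x) : bose x ≤ x⁻¹ :=
  inv_anti₀ hx (by linarith [Real.add_one_le_exp x])

lemma bose_le_inv_sq {x : ℝ} (hx : 0 < x) : bose x ≤ 2 * x⁻¹ ^ 2 := by
  have h := Real.quadratic_le_exp_of_nonneg hx.le
  have h2 : bose x ≤ (x ^ 2 / 2)⁻¹ := inv_anti₀ (by positivity) (by linarith)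
  calc _ ≤ _ := h2
    _ = _ := by field_simp

/-- The bound `1/x` is not enough here, since `∑ 1/h_k` diverges logarithmically in two dimensions;
the quadratic bound uses the high-energy cutoff of the Bose function. -/
lemma summable_bose (hlam : 0 < lam) : Summable fun k => bose (lam * oneBodyEnergy k) := by
  have h := fun k => mul_pos hlam (oneBodyEnergy_pos k)
  refine Summable.of_nonneg_of_le (fun k => (bose_pos (h k)).le) (fun k => bose_le_inv_sq (h k)) ?_
  simp only [mul_inv, mul_pow]
  exact (summable_inv_oneBodyEnergy_sq.mul_left _).mul_left _

lemma freePartition_ne_top (hlam : 0 < lam) : partitionFunction (freeHamiltonian lam) ≠ ⊤ := by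
  rw [freePartition_eq hlam.le]
  exact tsum_boltzmann_ne_top (fun k => mul_pos hlam (oneBodyEnergy_pos k)) (summable_bose hlam)

lemma freePartition_ne_zero (hlam : 0 ≤ lam) : partitionFunction (freeHamiltonian lam) ≠ 0 := by
  rw [freePartition_eq hlam]
  intro h
  have h1 := ENNReal.tsum_eq_zero.mp h 0
  simp [boltzmann] at h1

lemma ofReal_inv_mul_ofReal {Z : ℝ≥0∞} (h0 : Z ≠ 0) (h : Z ≠ ⊤) (x : ℝ) :
    ENNReal.ofReal (Z.toReal⁻¹ * x) = ENNReal.ofReal x / Z := by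
  rw [ENNReal.ofReal_mul (inv_nonneg.mpr ENNReal.toReal_nonneg),
    ENNReal.ofReal_inv_of_pos (ENNReal.toReal_pos h0 h), ENNReal.ofReal_toReal h, mul_comm]
  rfl

/-- The eigenvalues of the free Gibbs state. -/
def freeWeight (lam : ℝ) (m : (Fin 2 → ℤ) →₀ ℕ) : ℝ :=
  (partitionFunction (freeHamiltonian lam)).toReal⁻¹ * Real.exp (-(lam * occupationEnergy m))

/-- The diagonalization of the free Gibbs state in the occupation number basis. -/
def freeDiagonalization (hlam : 0 ≤ lam) : Diagonalization (freeGibbs lam) :=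
  (freeSystem hlam).diagonalization

lemma freeWeight_nonneg (hlam : 0 ≤ lam) (j : (freeDiagonalization hlam).ι) :
    0 ≤ (freeDiagonalization hlam).weight j := (freeSystem hlam).weight_nonneg j

lemma tsum_freeDiagonalization (hlam : 0 ≤ lam) (q : Fock → ℝ≥0∞) :
    ∑' j, ENNReal.ofReal ((freeDiagonalization hlam).weight j) * q ((freeDiagonalization hlam).basis j)
      = ∑' m, ENNReal.ofReal (freeWeight lam m) * q (occupationVector m) := by
  simp_rw [← coe_occupationBasis]
  rfl

lemma ofReal_freeWeight (hlam : 0 < lam) (m : (Fin 2 → ℤ) →₀ ℕ) :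
    ENNReal.ofReal (freeWeight lam m)
      = boltzmann (fun k => lam * oneBodyEnergy k) m / partitionFunction (freeHamiltonian lam) := by
  rw [boltzmann_oneBodyEnergy]
  exact ofReal_inv_mul_ofReal (freePartition_ne_zero hlam.le) (freePartition_ne_top hlam) _

/-- Moments of the occupation numbers in the free Gibbs state. -/
lemma tsum_freeWeight_mul (hlam : 0 < lam) {F : ((Fin 2 → ℤ) →₀ ℕ) → ℝ≥0∞} {c : ℝ≥0∞}
    (h : ∑' m, F m * boltzmann (fun k => lam * oneBodyEnergy k) m
      = c * ∑' m, boltzmann (fun k => lam * oneBodyEnergy k) m) :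
    ∑' m, ENNReal.ofReal (freeWeight lam m) * F m = c := by
  simp_rw [ofReal_freeWeight hlam, ENNReal.div_eq_inv_mul, mul_assoc, ENNReal.tsum_mul_left,
    mul_comm (boltzmann _ _), h, ← freePartition_eq hlam.le]
  rw [mul_left_comm, ENNReal.inv_mul_cancel (freePartition_ne_zero hlam.le)
    (freePartition_ne_top hlam), mul_one]

lemma numberForm_occupationVector (m : (Fin 2 → ℤ) →₀ ℕ) :
    numberForm (occupationVector m) = m.degree := by
  rw [numberForm, tsum_number_weight (fun n => (n : ℝ≥0∞)), tsum_eq_single m]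
  · rw [inner_self_eq_norm_sq_to_K, orthonormal_occupationVector.1 m]
    simp
  · intro m' hm
    rw [orthonormal_occupationVector.2 hm]
    simp

lemma mul_oneBodyEnergy_pos (hlam : 0 < lam) (k : Fin 2 → ℤ) : 0 < lam * oneBodyEnergy k :=
  mul_pos hlam (oneBodyEnergy_pos k)

lemma ofReal_tsum_bose (hlam : 0 < lam) : ∑' k, ENNReal.ofReal (bose (lam * oneBodyEnergy k))
    = ENNReal.ofReal (∑' k, bose (lam * oneBodyEnergy k)) :=
  (ENNReal.ofReal_tsum_of_nonneg (fun k => (bose_pos (mul_oneBodyEnergy_pos hlam k)).le)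
    (summable_bose hlam)).symm

lemma tsum_freeDiagonalization_numberForm (hlam : 0 < lam) :
    ∑' j, ENNReal.ofReal ((freeDiagonalization hlam.le).weight j)
      * numberForm ((freeDiagonalization hlam.le).basis j)
      = ENNReal.ofReal (∑' k, bose (lam * oneBodyEnergy k)) := by
  rw [← ofReal_tsum_bose hlam, tsum_freeDiagonalization]
  simp only [numberForm_occupationVector]
  exact tsum_freeWeight_mul hlam (tsum_boltzmann_mul_degree (mul_oneBodyEnergy_pos hlam))

lemma expect_freeGibbs_numberForm (hlam : 0 < lam) : expect (freeGibbs lam) numberForm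
    = ENNReal.ofReal (∑' k, bose (lam * oneBodyEnergy k)) := by
  rw [← tsum_freeDiagonalization_numberForm hlam]
  exact expect_number_weight (freeDiagonalization hlam.le) (freeWeight_nonneg hlam.le)
    (F := fun n => (n : ℝ≥0∞)) ENNReal.natCast_ne_top

lemma freeNumber_eq (hlam : 0 < lam) : freeNumber lam = ∑' k, bose (lam * oneBodyEnergy k) := by
  rw [freeNumber, expect_freeGibbs_numberForm hlam, ENNReal.toReal_ofReal]
  exact tsum_nonneg fun k => (bose_pos (mul_oneBodyEnergy_pos hlam k)).le

lemma freeDensityMode_of_ne (hlam : 0 < lam) {k : Fin 2 → ℤ} (hk : k ≠ 0) :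
    freeDensityMode lam k = 0 := by
  rw [freeDensityMode, expectComplex]
  split_ifs with h
  · refine tsum_weight_mul_densityModeForm (freeDiagonalization hlam.le)
      (freeWeight_nonneg hlam.le) ?_ (fun m => ⟨m, coe_occupationBasis m⟩) _ hk
    rw [tsum_freeDiagonalization_numberForm hlam]
    exact ENNReal.ofReal_ne_top
  · rfl

lemma freeDensityMode_zero (hlam : 0 < lam) : freeDensityMode lam 0 = freeNumber lam := by
  have h : Nonempty (Diagonalization (freeGibbs lam)) := ⟨freeDiagonalization hlam.le⟩
  rw [freeDensityMode, expectComplex, dif_pos h]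
  have h1 : ∑' j, ENNReal.ofReal (h.some.weight j) * numberForm (h.some.basis j)
      = ENNReal.ofReal (freeNumber lam) := by
    rw [freeNumber_eq hlam, ← tsum_freeDiagonalization_numberForm hlam]
    simp only [← frameForm_densityFrame 0]
    exact Diagonalization.tsum_weight_mul_frameForm_eq _ (freeWeight_nonneg hlam.le) _ _
  have hw := Diagonalization.weight_nonneg (freeDiagonalization hlam.le)
    (freeWeight_nonneg hlam.le) h.some
  have h2 : ∀ j, (h.some.weight j : ℂ) * densityModeForm 0 (h.some.basis j)
      = ((ENNReal.ofReal (h.some.weight j) * numberForm (h.some.basis j)).toReal : ℂ) := by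
    intro j
    rw [densityModeForm_zero, ENNReal.toReal_mul, ENNReal.toReal_ofReal (hw j)]
    push_cast
    rfl
  simp only [h2]
  rw [← Complex.ofReal_tsum, ← ENNReal.tsum_toReal_eq, h1, ENNReal.toReal_ofReal]
  · exact ENNReal.toReal_nonneg
  · exact fun j => ENNReal.ne_top_of_tsum_ne_top (h1 ▸ ENNReal.ofReal_ne_top) j

end FreeGas

/-! ## The renormalized interaction -/

section Interaction

open MeasureTheory UnitAddTorus

variable {w : EuclideanSpace ℝ (Fin 2) → ℝ} {lam ε : ℝ}

lemma coupling_zero (hw : IsInteraction w) (ε : ℝ) : coupling w ε 0 = 1 := by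
  have h : dualPoint ε 0 = 0 := by
    ext i
    simp [dualPoint]
  rw [coupling, h, hw.hat_zero, Complex.one_re]

lemma coupling_nonneg (hw : IsInteraction w) (ε : ℝ) (k : Fin 2 → ℤ) : 0 ≤ coupling w ε k :=
  hw.hat_nonneg _

lemma densityMode_relabel {n : ℕ} (k : Fin 2 → ℤ) (σ : Equiv.Perm (Fin n)) (x : Config n) :
    densityMode k (relabel σ x) = densityMode k x :=
  Equiv.sum_comp σ (fun j => mFourier k (particle x j))

lemma densityMode_add_diagonalShift {n : ℕ} (k : Fin 2 → ℤ) (a : T2) (x : Config n) :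
    densityMode k (x + diagonalShift n a) = mFourier k a * densityMode k x := by
  have h : ∀ j, particle (x + diagonalShift n a) j = particle x j + a := fun j => rfl
  simp only [densityMode, h, mFourier_apply_add, Finset.mul_sum, mul_comm]

lemma densityMode_zero {n : ℕ} (x : Config n) : densityMode 0 x = n := by
  simp [densityMode, mFourier_zero]

lemma norm_densityMode_le {n : ℕ} (k : Fin 2 → ℤ) (x : Config n) : ‖densityMode k x‖ ≤ n := by
  refine (norm_sum_le _ _).trans ?_
  simp [norm_mFourier_apply]

lemma continuous_densityMode {n : ℕ} (k : Fin 2 → ℤ) :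
    Continuous (densityMode k : Config n → ℂ) := by
  have h : (densityMode k : Config n → ℂ) = fun x => ∑ j : Fin n, mFourier (kick j k) x := by
    funext x
    simp only [densityMode, mFourier_kick]
  rw [h]
  exact continuous_finsetSum _ fun j _ => (mFourier _).continuous

/-- `‖ρ_k - ⟨ρ_k⟩‖²`. -/
def fluctuation (lam : ℝ) (k : Fin 2 → ℤ) {n : ℕ} (x : Config n) : ℝ :=
  ‖densityMode k x - freeDensityMode lam k‖ ^ 2

lemma fluctuation_zero (hlam : 0 < lam) {n : ℕ} (x : Config n) :
    fluctuation lam 0 x = ((n : ℝ) - freeNumber lam) ^ 2 := by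
  have h : (n : ℂ) - (freeNumber lam : ℂ) = (((n : ℝ) - freeNumber lam : ℝ) : ℂ) := by push_cast; rfl
  rw [fluctuation, densityMode_zero, freeDensityMode_zero hlam, h, Complex.norm_real,
    Real.norm_eq_abs, sq_abs]

lemma fluctuation_of_ne (hlam : 0 < lam) {k : Fin 2 → ℤ} (hk : k ≠ 0) {n : ℕ} (x : Config n) :
    fluctuation lam k x = ‖densityMode k x‖ ^ 2 := by
  rw [fluctuation, freeDensityMode_of_ne hlam hk, sub_zero]

lemma fluctuation_le (hlam : 0 < lam) (k : Fin 2 → ℤ) {n : ℕ} (x : Config n) :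
    fluctuation lam k x ≤ (n + |freeNumber lam|) ^ 2 := by
  by_cases hk : k = 0
  · subst hk
    rw [fluctuation_zero hlam, ← sq_abs]
    have := abs_sub (n : ℝ) (freeNumber lam)
    rw [Nat.abs_cast] at this
    gcongr
  · rw [fluctuation_of_ne hlam hk]
    have := norm_densityMode_le k x
    gcongr
    linarith [abs_nonneg (freeNumber lam)]

lemma continuous_fluctuation (lam : ℝ) (k : Fin 2 → ℤ) {n : ℕ} :
    Continuous (fluctuation lam k : Config n → ℝ) :=
  ((continuous_densityMode k).sub continuous_const).norm.pow 2

lemma fluctuation_nonneg (lam : ℝ) (k : Fin 2 → ℤ) {n : ℕ} (x : Config n) :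
    0 ≤ fluctuation lam k x := sq_nonneg _

lemma summable_coupling_mul_fluctuation (hw : IsInteraction w) (hs : Summable (coupling w ε))
    (hlam : 0 < lam) {n : ℕ} (x : Config n) :
    Summable fun k => coupling w ε k * fluctuation lam k x :=
  Summable.of_nonneg_of_le
    (fun k => mul_nonneg (coupling_nonneg hw ε k) (fluctuation_nonneg lam k x))
    (fun k => mul_le_mul_of_nonneg_left (fluctuation_le hlam k x) (coupling_nonneg hw ε k))
    (hs.mul_right _)

/-- The series converges uniformly. By compactness of the torus the potential is then bounded at
each particle number; the bound may grow with `n`, which is harmless because eigenbases are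
constructed block by block. -/
lemma continuous_renormalizedPotential (hw : IsInteraction w) (hs : Summable (coupling w ε))
    (hlam : 0 < lam) (n : ℕ) : Continuous (renormalizedPotential w lam ε : Config n → ℝ) := by
  have h : Continuous fun x : Config n => ∑' k, coupling w ε k * fluctuation lam k x := by
    refine continuous_tsum (u := fun k => coupling w ε k * (n + |freeNumber lam|) ^ 2)
      (fun k => continuous_const.mul (continuous_fluctuation lam k)) (hs.mul_right _) fun k x => ?_
    rw [Real.norm_of_nonneg (mul_nonneg (coupling_nonneg hw ε k) (fluctuation_nonneg lam k x))]
    exact mul_le_mul_of_nonneg_left (fluctuation_le hlam k x) (coupling_nonneg hw ε k)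
  exact ((continuous_const.mul h).sub continuous_const).sub continuous_const

/-- The renormalized interaction as a bounded function on the `n`-particle configurations. -/
def interactionFunction (hw : IsInteraction w) (hs : Summable (coupling w ε)) (hlam : 0 < lam)
    (n : ℕ) : BoundedFunction (Fin n × Fin 2) where
  toFun := renormalizedPotential w lam ε
  measurable := (continuous_renormalizedPotential hw hs hlam n).measurable
  bound := ‖(⟨_, continuous_renormalizedPotential hw hs hlam n⟩ : C(Config n, ℝ))‖
  bound_nonneg := norm_nonneg _
  le_bound x := ContinuousMap.norm_coe_le_norm
    (⟨_, continuous_renormalizedPotential hw hs hlam n⟩ : C(Config n, ℝ)) x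

lemma renormalizedPotential_relabel {n : ℕ} (σ : Equiv.Perm (Fin n)) (x : Config n) :
    renormalizedPotential w lam ε (relabel σ x) = renormalizedPotential w lam ε x := by
  simp only [renormalizedPotential, densityMode_relabel]

/-- A common shift multiplies each density mode by a phase. Nothing is subtracted from the modes `k
≠ 0`, and for `k = 0` the phase is trivial. -/
lemma renormalizedPotential_add_diagonalShift (hlam : 0 < lam) {n : ℕ} (a : T2) (x : Config n) :
    renormalizedPotential w lam ε (x + diagonalShift n a) = renormalizedPotential w lam ε x := by
  have h : ∀ k, ‖densityMode k (x + diagonalShift n a) - freeDensityMode lam k‖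
      = ‖densityMode k x - freeDensityMode lam k‖ := by
    intro k
    rw [densityMode_add_diagonalShift]
    by_cases hk : k = 0
    · subst hk
      rw [mFourier_zero, ContinuousMap.one_apply, one_mul]
    · rw [freeDensityMode_of_ne hlam hk, sub_zero, sub_zero, norm_mul, norm_mFourier_apply, one_mul]
  simp only [renormalizedPotential, h]

lemma interactingHamiltonian_eq (hw : IsInteraction w) (hs : Summable (coupling w ε))
    (hlam : 0 < lam) :
    interactingHamiltonian w lam ε = hamiltonianGraph (interactionFunction hw hs hlam) lam := by
  ext ΨΦ
  refine forall_congr' fun n => ⟨?_, fun h => ⟨_, coeFn_mulOperator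
    (interactionFunction hw hs hlam n) _, h⟩⟩
  rintro ⟨Υ, h1, h2⟩
  have h3 : Υ = mulOperator (interactionFunction hw hs hlam n) (component ΨΦ.1 n) := by
    refine Lp.ext ?_
    filter_upwards [h1, coeFn_mulOperator (interactionFunction hw hs hlam n)
      (component ΨΦ.1 n)] with x h4 h5
    rw [h4, h5]
    rfl
  rw [← h3]
  exact h2

/-- The interaction is bounded below by a multiple of the variance of the particle number. -/
lemma le_renormalizedPotential (hw : IsInteraction w) (hs : Summable (coupling w ε))
    (hlam : 0 < lam) {n : ℕ} (x : Config n) :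
    lam ^ 2 / 4 * ((n : ℝ) - freeNumber lam) ^ 2 - (tau w ε ^ 2 + energyShift w ε)
      ≤ renormalizedPotential w lam ε x := by
  have h := (summable_coupling_mul_fluctuation hw hs hlam x).le_tsum 0
    fun k _ => mul_nonneg (coupling_nonneg hw ε k) (fluctuation_nonneg lam k x)
  rw [coupling_zero hw, one_mul, fluctuation_zero hlam] at h
  have h2 := mul_le_mul_of_nonneg_left h (by positivity : 0 ≤ lam ^ 2 / 2)
  have h3 : renormalizedPotential w lam ε x
      = lam ^ 2 / 2 * ∑' k : Fin 2 → ℤ, coupling w ε k * fluctuation lam k x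
    - lam * tau w ε * ((n : ℝ) - freeNumber lam) - energyShift w ε := rfl
  rw [h3]
  -- Completing the square gives up half of the mode `k = 0`: with `X = n - N₀`, the square `(λX/2 -
  -- τ)²` bounds `-λτX` from below by `-λ²X²/4 - τ²`.
  nlinarith [sq_nonneg (lam * ((n : ℝ) - freeNumber lam) / 2 - tau w ε)]

/-! ### Expectations in occupation number vectors -/

/-- `∑ q, m_q m_{q+k}`. -/
def pairCount (m : (Fin 2 → ℤ) →₀ ℕ) (k : Fin 2 → ℤ) : ℕ := m.sum fun q a => a * m (q + k)

lemma sum_ite_momentum {n : ℕ} (p : Fin n × Fin 2 → ℤ) (k : Fin 2 → ℤ) :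
    ∑ i, ∑ j, (if momentum p i = momentum p j + k then 1 else 0) = pairCount (occupation p) k := by
  have h := sum_momentum (fun q => occupation p (q + k)) p
  simp only [smul_eq_mul] at h
  rw [pairCount, ← h, Finset.sum_comm]
  refine Finset.sum_congr rfl fun j _ => ?_
  rw [occupation_apply, Fintype.card_subtype, Finset.card_filter]

lemma pairCount_le (m : (Fin 2 → ℤ) →₀ ℕ) (k : Fin 2 → ℤ) : pairCount m k ≤ m.degree * m.degree := by
  rw [Finsupp.degree_apply, Finset.sum_mul]
  refine Finset.sum_le_sum fun q _ => Nat.mul_le_mul_left _ ?_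
  by_cases h : q + k ∈ m.support
  · exact Finset.single_le_sum (f := m) (fun _ _ => Nat.zero_le _) h
  · rw [Finsupp.notMem_support_iff.mp h]
    exact Nat.zero_le _

/-- If a transfer of momentum between two particles does not change the occupation numbers, then it
exchanges their momenta. -/
lemma eq_add_of_occupation_kick {n : ℕ} {p : Fin n × Fin 2 → ℤ} {i j : Fin n} (hij : i ≠ j)
    {k : Fin 2 → ℤ} (hk : k ≠ 0)
    (h : occupation (p - (kick i k - kick j k)) = occupation p) :
    momentum p i = momentum p j + k := by
  classical
  have h1 : ∀ l, momentum (p - (kick i k - kick j k)) l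
      = if l = i then momentum p i - k else if l = j then momentum p j + k else momentum p l := by
    intro l
    have h2 : momentum (p - (kick i k - kick j k)) l
        = momentum p l - (momentum (kick i k) l - momentum (kick j k) l) := rfl
    rw [h2, momentum_kick, momentum_kick]
    by_cases hi : l = i
    · subst hi
      simp [hij]
    · by_cases hj : l = j
      · subst hj
        simp [hi]
      · simp [hi, hj]
  -- All particles other than `i` and `j` cancel, so the two momenta before and after the transfer
  -- agree as multisets. This is tested below on the indicator function of the momentum of particle
  -- `i`.
  have h3 : ∀ f : (Fin 2 → ℤ) → ℤ, f (momentum p i - k) + f (momentum p j + k)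
      = f (momentum p i) + f (momentum p j) := by
    intro f
    have h4 := sum_momentum f p
    rw [← h, ← sum_momentum f] at h4
    have hi : i ∈ (Finset.univ : Finset (Fin n)) := Finset.mem_univ i
    have hj : j ∈ Finset.univ.erase i := Finset.mem_erase.mpr ⟨hij.symm, Finset.mem_univ j⟩
    rw [← Finset.add_sum_erase _ _ hi, ← Finset.add_sum_erase _ _ hj,
      ← Finset.add_sum_erase _ (fun l => f (momentum (p - (kick i k - kick j k)) l)) hi,
      ← Finset.add_sum_erase _ (fun l => f (momentum (p - (kick i k - kick j k)) l)) hj] at h4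
    have h5 : ∀ l ∈ (Finset.univ.erase i).erase j,
        f (momentum (p - (kick i k - kick j k)) l) = f (momentum p l) := by
      intro l hl
      simp only [Finset.mem_erase, Finset.mem_univ, and_true] at hl
      rw [h1, if_neg hl.2, if_neg hl.1]
    rw [Finset.sum_congr rfl h5, h1 i, h1 j, if_pos rfl, if_neg hij.symm, if_pos rfl] at h4
    linarith
  by_contra hne
  have h6 := h3 fun q => if q = momentum p i then 1 else 0
  simp only [if_pos, sub_eq_self, hk, if_false, Ne.symm hne] at h6
  split_ifs at h6 <;> omega

lemma sq_norm_densityMode {n : ℕ} (k : Fin 2 → ℤ) (x : Config n) :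
    ((‖densityMode k x‖ ^ 2 : ℝ) : ℂ) = ∑ i, ∑ j, mFourier (kick i k - kick j k) x := by
  have h : ∀ i j : Fin n, mFourier (kick i k - kick j k) x
      = mFourier (kick i k) x * conj (mFourier (kick j k) x) := fun i j => by
    rw [sub_eq_add_neg, mFourier_add, mFourier_neg]
  simp only [h]
  rw [← Finset.sum_mul_sum, ← map_sum]
  simp only [mFourier_kick]
  rw [Complex.mul_conj']
  push_cast
  rfl

/-- The square of the density mode is a sum over pairs `i, j` of momentum transfers. The pairs `i =
j` give `n`; a pair `i ≠ j` contributes to a diagonal element only if the transfer exchanges the two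
momenta, and such pairs are counted by `pairCount`. -/
lemma integral_sq_norm_densityMode_le {k : Fin 2 → ℤ} (hk : k ≠ 0) {n : ℕ}
    (p₀ : Fin n × Fin 2 → ℤ) :
    ∫ x, ‖densityMode k x‖ ^ 2 * ‖orbitWave p₀ x‖ ^ 2 ∂(torusMeasure (Fin n × Fin 2))
      ≤ n + pairCount (occupation p₀) k := by
  classical
  set ψ := orbitWave p₀ with hψ
  have hcard : (0 : ℝ) < (orbit p₀).card := Nat.cast_pos.mpr (card_orbit_pos p₀)
  have h1 : ∀ q : Fin n × Fin 2 → ℤ,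
      ∫ x, mFourier q x * ((‖ψ x‖ ^ 2 : ℝ) : ℂ) ∂(torusMeasure (Fin n × Fin 2))
      = (((orbit p₀).card : ℝ)⁻¹ * ∑ p ∈ orbit p₀,
          (if occupation (p - q) = occupation p₀ then 1 else 0) : ℝ) := by
    intro q
    rw [← (hasSum_mFourier_mul_sq_norm q ψ).tsum_eq, tsum_eq_sum (s := orbit p₀)]
    · push_cast
      rw [Finset.mul_sum]
      refine Finset.sum_congr rfl fun p hp => ?_
      rw [hψ, repr_orbitWave, repr_orbitWave, if_pos (mem_orbit.mp hp)]
      split_ifs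
      · rw [map_inv₀, Complex.conj_ofReal, ← mul_inv, ← Complex.ofReal_mul,
          Real.mul_self_sqrt hcard.le]
        simp
      · simp
    · intro p hp
      rw [hψ, repr_orbitWave, if_neg fun h => hp (mem_orbit.mpr h), map_zero, zero_mul]
  have h2 : ((∫ x, ‖densityMode k x‖ ^ 2 * ‖ψ x‖ ^ 2 ∂(torusMeasure (Fin n × Fin 2)) : ℝ) : ℂ)
      = ((∑ i, ∑ j, (((orbit p₀).card : ℝ)⁻¹ * ∑ p ∈ orbit p₀,
          (if occupation (p - (kick i k - kick j k)) = occupation p₀ then 1 else 0)) : ℝ) : ℂ) := by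
    rw [← integral_complex_ofReal]
    simp only [Complex.ofReal_mul, sq_norm_densityMode, Finset.sum_mul]
    rw [integral_finsetSum _ fun i _ => integrable_finsetSum _ fun j _ =>
      integrable_mFourier_mul_sq_norm _ ψ, Complex.ofReal_sum]
    refine Finset.sum_congr rfl fun i _ => ?_
    rw [integral_finsetSum _ fun j _ => integrable_mFourier_mul_sq_norm _ ψ, Complex.ofReal_sum]
    exact Finset.sum_congr rfl fun j _ => h1 _
  rw [Complex.ofReal_injective h2]
  have h3 : ∀ p ∈ orbit p₀, ∑ i : Fin n, ∑ j : Fin n,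
      (if occupation (p - (kick i k - kick j k)) = occupation p₀ then (1 : ℝ) else 0)
      ≤ n + pairCount (occupation p₀) k := by
    intro p hp
    rw [mem_orbit] at hp
    have h4 : ∀ i j : Fin n,
        (if occupation (p - (kick i k - kick j k)) = occupation p₀ then (1 : ℝ) else 0)
        ≤ (if i = j then 1 else 0) + if momentum p i = momentum p j + k then 1 else 0 := by
      intro i j
      by_cases hij : i = j
      · rw [if_pos hij]
        split_ifs <;> norm_num
      · rw [if_neg hij, zero_add]
        split_ifs with h5 h6 h6
        · exact le_rfl
        · exact absurd (eq_add_of_occupation_kick hij hk (h5.trans hp.symm)) h6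
        · exact zero_le_one
        · exact le_rfl
    refine (Finset.sum_le_sum fun i _ => Finset.sum_le_sum fun j _ => h4 i j).trans_eq ?_
    simp only [Finset.sum_add_distrib]
    rw [← hp, ← sum_ite_momentum]
    push_cast
    simp
  calc _ = ((orbit p₀).card : ℝ)⁻¹ * ∑ p ∈ orbit p₀, ∑ i : Fin n, ∑ j : Fin n,
      (if occupation (p - (kick i k - kick j k)) = occupation p₀ then (1 : ℝ) else 0) := by
        simp only [← Finset.mul_sum]
        congr 1
        rw [Finset.sum_congr rfl fun i _ => Finset.sum_comm, Finset.sum_comm]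
    _ ≤ ((orbit p₀).card : ℝ)⁻¹ * ((orbit p₀).card • ((n : ℝ) + pairCount (occupation p₀) k)) := by
        gcongr
        exact Finset.sum_le_card_nsmul _ _ _ h3
    _ = _ := by
        rw [nsmul_eq_mul, inv_mul_cancel_left₀ hcard.ne']

/-- An upper bound for the expectation of `‖ρ_k - ⟨ρ_k⟩‖²` in an occupation number vector. -/
def occupationFluctuation (lam : ℝ) (m : (Fin 2 → ℤ) →₀ ℕ) (k : Fin 2 → ℤ) : ℝ :=
  if k = 0 then ((m.degree : ℝ) - freeNumber lam) ^ 2 else m.degree + pairCount m k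

lemma occupationFluctuation_nonneg (lam : ℝ) (m : (Fin 2 → ℤ) →₀ ℕ) (k : Fin 2 → ℤ) :
    0 ≤ occupationFluctuation lam m k := by
  unfold occupationFluctuation
  split_ifs <;> positivity

lemma summable_coupling_mul_occupationFluctuation (hw : IsInteraction w)
    (hs : Summable (coupling w ε)) (m : (Fin 2 → ℤ) →₀ ℕ) :
    Summable fun k => coupling w ε k * occupationFluctuation lam m k := by
  refine Summable.of_nonneg_of_le
    (fun k => mul_nonneg (coupling_nonneg hw ε k) (occupationFluctuation_nonneg lam m k))
    (fun k => mul_le_mul_of_nonneg_left (b := occupationFluctuation lam m k)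
      (c := ((m.degree : ℝ) - freeNumber lam) ^ 2 + (m.degree + m.degree * m.degree)) ?_
      (coupling_nonneg hw ε k)) (hs.mul_right _)
  unfold occupationFluctuation
  have h : (pairCount m k : ℝ) ≤ m.degree * m.degree := by exact_mod_cast pairCount_le m k
  split_ifs
  · have : (0 : ℝ) ≤ m.degree + m.degree * m.degree := by positivity
    linarith
  · linarith [sq_nonneg ((m.degree : ℝ) - freeNumber lam)]

/-- An upper bound for the expectation of the interaction in an occupation number vector. -/
def potentialBound (w : EuclideanSpace ℝ (Fin 2) → ℝ) (lam ε : ℝ) (m : (Fin 2 → ℤ) →₀ ℕ) : ℝ :=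
  lam ^ 2 / 2 * ∑' k, coupling w ε k * occupationFluctuation lam m k
    - lam * tau w ε * ((m.degree : ℝ) - freeNumber lam) - energyShift w ε

/-- The integral is exchanged with the sum over modes; the bounds on the individual modes that give
the result also provide the absolute convergence. -/
lemma occupationPotential_le (hw : IsInteraction w) (hs : Summable (coupling w ε))
    (hlam : 0 < lam) (m : (Fin 2 → ℤ) →₀ ℕ) :
    occupationPotential (interactionFunction hw hs hlam) m ≤ potentialBound w lam ε m := by
  set ψ := orbitWave (representative m) with hψ
  have hnorm : ∫ x, ‖ψ x‖ ^ 2 ∂(torusMeasure (Fin m.degree × Fin 2)) = 1 := by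
    rw [integral_sq_norm, norm_orbitWave, one_pow]
  have hint : ∀ k, Integrable (fun x => fluctuation lam k x * ‖ψ x‖ ^ 2)
      (torusMeasure (Fin m.degree × Fin 2)) := fun k => by
    refine (integrable_sq_norm ψ).bdd_mul (c := (m.degree + |freeNumber lam|) ^ 2)
      (continuous_fluctuation lam k).aestronglyMeasurable (Filter.Eventually.of_forall fun x => ?_)
    rw [Real.norm_of_nonneg (fluctuation_nonneg lam k x)]
    exact fluctuation_le hlam k x
  have hI : ∀ k, ∫ x, fluctuation lam k x * ‖ψ x‖ ^ 2 ∂(torusMeasure (Fin m.degree × Fin 2))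
      ≤ occupationFluctuation lam m k := by
    intro k
    unfold occupationFluctuation
    split_ifs with hk
    · subst hk
      simp only [fluctuation_zero hlam]
      rw [integral_const_mul, hnorm, mul_one]
    · simp only [fluctuation_of_ne hlam hk]
      have h := integral_sq_norm_densityMode_le hk (representative m)
      rwa [occupation_representative] at h
  have h1 : HasSum (fun k => ∫ x, coupling w ε k * (fluctuation lam k x * ‖ψ x‖ ^ 2)
        ∂(torusMeasure (Fin m.degree × Fin 2)))
      (∫ x, ∑' k, coupling w ε k * (fluctuation lam k x * ‖ψ x‖ ^ 2)
        ∂(torusMeasure (Fin m.degree × Fin 2))) := by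
    refine hasSum_integral_of_summable_integral_norm (fun k => (hint k).const_mul _) ?_
    refine Summable.of_nonneg_of_le (fun k => integral_nonneg fun x => norm_nonneg _) (fun k => ?_)
      (summable_coupling_mul_occupationFluctuation (lam := lam) hw hs m)
    have h2 : ∀ x, ‖coupling w ε k * (fluctuation lam k x * ‖ψ x‖ ^ 2)‖
        = coupling w ε k * (fluctuation lam k x * ‖ψ x‖ ^ 2) := fun x =>
      Real.norm_of_nonneg (mul_nonneg (coupling_nonneg hw ε k)
        (mul_nonneg (fluctuation_nonneg lam k x) (sq_nonneg _)))
    simp only [h2]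
    rw [integral_const_mul]
    exact mul_le_mul_of_nonneg_left (hI k) (coupling_nonneg hw ε k)
  have h3 : occupationPotential (interactionFunction hw hs hlam) m
      = lam ^ 2 / 2 * (∫ x, ∑' k, coupling w ε k * (fluctuation lam k x * ‖ψ x‖ ^ 2)
        ∂(torusMeasure (Fin m.degree × Fin 2)))
        - (lam * tau w ε * ((m.degree : ℝ) - freeNumber lam) + energyShift w ε) := by
    rw [occupationPotential, inner_mulOperator_self, Complex.ofReal_re]
    have h4 : ∀ x : Config m.degree, (interactionFunction hw hs hlam m.degree).toFun x * ‖ψ x‖ ^ 2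
        = lam ^ 2 / 2 * (∑' k, coupling w ε k * (fluctuation lam k x * ‖ψ x‖ ^ 2))
        - (lam * tau w ε * ((m.degree : ℝ) - freeNumber lam) + energyShift w ε) * ‖ψ x‖ ^ 2 := by
      intro x
      simp only [← mul_assoc (coupling w ε _), tsum_mul_right]
      change (lam ^ 2 / 2 * ∑' k : Fin 2 → ℤ, coupling w ε k * fluctuation lam k x
        - lam * tau w ε * ((m.degree : ℝ) - freeNumber lam) - energyShift w ε) * ‖ψ x‖ ^ 2 = _
      ring
    have h6 := ((integrable_sq_norm ψ).const_mul
      (lam * tau w ε * ((m.degree : ℝ) - freeNumber lam) + energyShift w ε))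
    have h5 : Integrable (fun x => lam ^ 2 / 2 *
        (∑' k, coupling w ε k * (fluctuation lam k x * ‖ψ x‖ ^ 2)))
        (torusMeasure (Fin m.degree × Fin 2)) := by
      refine ((integrable_mul_sq_norm (interactionFunction hw hs hlam m.degree) ψ).add h6).congr
        (Filter.Eventually.of_forall fun x => ?_)
      simp only [Pi.add_apply, h4]
      ring
    simp only [← hψ, h4]
    rw [integral_sub h5 h6, integral_const_mul, integral_const_mul, hnorm, mul_one]
  rw [h3, ← h1.tsum_eq, potentialBound]
  simp only [integral_const_mul] at h1 ⊢
  have h7 := h1.summable.tsum_le_tsum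
    (fun k => mul_le_mul_of_nonneg_left (hI k) (coupling_nonneg hw ε k))
    (summable_coupling_mul_occupationFluctuation hw hs m)
  have h8 := mul_le_mul_of_nonneg_left h7 (by positivity : 0 ≤ lam ^ 2 / 2)
  linarith

end Interaction

/-! ### The expectation of the interaction in the free Gibbs state -/

section FreeExpectation

variable {w : EuclideanSpace ℝ (Fin 2) → ℝ} {lam ε : ℝ}

lemma freeWeight_nonneg' (lam : ℝ) (m : (Fin 2 → ℤ) →₀ ℕ) : 0 ≤ freeWeight lam m := by
  unfold freeWeight
  positivity

lemma hasSum_freeWeight_mul {f : ((Fin 2 → ℤ) →₀ ℕ) → ℝ} (hf : ∀ m, 0 ≤ f m)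
    {a : ℝ} (ha : 0 ≤ a) (h : ∑' m, ENNReal.ofReal (freeWeight lam m) * ENNReal.ofReal (f m)
      = ENNReal.ofReal a) : HasSum (fun m => freeWeight lam m * f m) a := by
  refine hasSum_of_tsum_ofReal (fun m => mul_nonneg (freeWeight_nonneg' lam m) (hf m)) ha ?_
  rw [← h]
  congr 1 with m
  rw [ENNReal.ofReal_mul (freeWeight_nonneg' lam m)]

lemma hasSum_freeWeight (hlam : 0 < lam) : HasSum (freeWeight lam) 1 := by
  have h := hasSum_freeWeight_mul (f := fun _ => 1) (fun _ => zero_le_one) zero_le_one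
    (tsum_freeWeight_mul hlam (by simp))
  simpa using h

lemma freeNumber_nonneg (lam : ℝ) : 0 ≤ freeNumber lam := ENNReal.toReal_nonneg

lemma hasSum_freeWeight_mul_degree (hlam : 0 < lam) :
    HasSum (fun m => freeWeight lam m * m.degree) (freeNumber lam) := by
  refine hasSum_freeWeight_mul (fun _ => Nat.cast_nonneg _) (freeNumber_nonneg lam) ?_
  rw [freeNumber_eq hlam, ← ofReal_tsum_bose hlam]
  simp only [ENNReal.ofReal_natCast]
  exact tsum_freeWeight_mul hlam (tsum_boltzmann_mul_degree (mul_oneBodyEnergy_pos hlam))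

/-- The covariance of the density modes. -/
def freeFluctuation (lam : ℝ) (k : Fin 2 → ℤ) : ℝ :=
  freeNumber lam + ∑' q, bose (lam * oneBodyEnergy q) * bose (lam * oneBodyEnergy (q + k))

lemma bose_le_freeNumber (hlam : 0 < lam) (k : Fin 2 → ℤ) :
    bose (lam * oneBodyEnergy k) ≤ freeNumber lam := by
  rw [freeNumber_eq hlam]
  exact (summable_bose hlam).le_tsum k fun q _ => (bose_pos (mul_oneBodyEnergy_pos hlam q)).le

lemma bose_mul_bose_nonneg (hlam : 0 < lam) (q k : Fin 2 → ℤ) :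
    0 ≤ bose (lam * oneBodyEnergy q) * bose (lam * oneBodyEnergy k) :=
  mul_nonneg (bose_pos (mul_oneBodyEnergy_pos hlam q)).le (bose_pos (mul_oneBodyEnergy_pos hlam k)).le

lemma summable_bose_mul_bose (hlam : 0 < lam) (k : Fin 2 → ℤ) :
    Summable fun q => bose (lam * oneBodyEnergy q) * bose (lam * oneBodyEnergy (q + k)) :=
  Summable.of_nonneg_of_le (fun _ => bose_mul_bose_nonneg hlam _ _)
    (fun q => mul_le_mul_of_nonneg_left (bose_le_freeNumber hlam (q + k))
      (bose_pos (mul_oneBodyEnergy_pos hlam q)).le) ((summable_bose hlam).mul_right _)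

lemma freeFluctuation_nonneg (hlam : 0 < lam) (k : Fin 2 → ℤ) : 0 ≤ freeFluctuation lam k :=
  add_nonneg (freeNumber_nonneg lam) (tsum_nonneg fun _ => bose_mul_bose_nonneg hlam _ _)

lemma freeFluctuation_le (hlam : 0 < lam) (k : Fin 2 → ℤ) :
    freeFluctuation lam k ≤ freeNumber lam + freeNumber lam * freeNumber lam := by
  refine add_le_add_right ?_ _
  calc _ ≤ ∑' q, bose (lam * oneBodyEnergy q) * freeNumber lam :=
        (summable_bose_mul_bose hlam k).tsum_le_tsum (fun q => mul_le_mul_of_nonneg_left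
          (bose_le_freeNumber hlam (q + k)) (bose_pos (mul_oneBodyEnergy_pos hlam q)).le)
          ((summable_bose hlam).mul_right _)
    _ = _ := by rw [tsum_mul_right, ← freeNumber_eq hlam]

lemma natCast_pairCount (m : (Fin 2 → ℤ) →₀ ℕ) (k : Fin 2 → ℤ) :
    (pairCount m k : ℝ≥0∞) = ∑' q, (m q : ℝ≥0∞) * m (q + k) := by
  rw [pairCount, Finsupp.sum, tsum_eq_sum (s := m.support)]
  · push_cast
    rfl
  · intro q hq
    rw [Finsupp.notMem_support_iff.mp hq, Nat.cast_zero, zero_mul]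

lemma hasSum_freeWeight_mul_degree_sq (hlam : 0 < lam) :
    HasSum (fun m => freeWeight lam m * (m.degree * m.degree))
      (freeNumber lam * freeNumber lam + freeFluctuation lam 0) := by
  refine hasSum_freeWeight_mul (fun _ => by positivity) (add_nonneg
    (mul_self_nonneg _) (freeFluctuation_nonneg hlam 0)) ?_
  have h1 := tsum_freeWeight_mul hlam (tsum_boltzmann_mul_degree_sq (mul_oneBodyEnergy_pos hlam))
  simp only [ENNReal.ofReal_mul (Nat.cast_nonneg _), ENNReal.ofReal_natCast]
  rw [h1, ofReal_tsum_bose hlam, ← freeNumber_eq hlam,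
    ENNReal.ofReal_add (mul_self_nonneg _) (freeFluctuation_nonneg hlam 0),
    ENNReal.ofReal_mul (freeNumber_nonneg lam)]
  congr 1
  have hb := fun k => (bose_pos (mul_oneBodyEnergy_pos hlam k)).le
  have hs := summable_bose_mul_bose hlam 0
  simp only [add_zero] at hs
  rw [freeFluctuation, freeNumber_eq hlam]
  simp only [add_zero, pow_two]
  rw [← (summable_bose hlam).tsum_add hs, ENNReal.ofReal_tsum_of_nonneg
    (fun k => add_nonneg (hb k) (mul_self_nonneg _)) ((summable_bose hlam).add hs)]

/-- Both cases lead to the same formula. For `k = 0` the variance of the particle number is the sum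
of the geometric variances `n + n²`, and for `k ≠ 0` the mean of `pairCount` factors because `q` and
`q + k` are different modes. -/
lemma hasSum_freeWeight_mul_occupationFluctuation (hlam : 0 < lam) (k : Fin 2 → ℤ) :
    HasSum (fun m => freeWeight lam m * occupationFluctuation lam m k) (freeFluctuation lam k) := by
  by_cases hk : k = 0
  · subst hk
    have h := ((hasSum_freeWeight_mul_degree_sq hlam).sub
      ((hasSum_freeWeight_mul_degree hlam).mul_left (2 * freeNumber lam))).add
      ((hasSum_freeWeight hlam).mul_left (freeNumber lam * freeNumber lam))
    convert! h using 1
    · funext m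
      rw [occupationFluctuation, if_pos rfl]
      ring
    · ring
  · have h : HasSum (fun m => freeWeight lam m * pairCount m k)
        (∑' q, bose (lam * oneBodyEnergy q) * bose (lam * oneBodyEnergy (q + k))) := by
      refine hasSum_freeWeight_mul (fun _ => Nat.cast_nonneg _)
        (tsum_nonneg fun _ => bose_mul_bose_nonneg hlam _ _) ?_
      simp only [ENNReal.ofReal_natCast, natCast_pairCount]
      rw [tsum_freeWeight_mul hlam (tsum_boltzmann_mul_shift (mul_oneBodyEnergy_pos hlam) hk),
        ENNReal.ofReal_tsum_of_nonneg (fun _ => bose_mul_bose_nonneg hlam _ _)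
          (summable_bose_mul_bose hlam k)]
      congr 1 with q
      rw [ENNReal.ofReal_mul (bose_pos (mul_oneBodyEnergy_pos hlam q)).le]
    refine ((hasSum_freeWeight_mul_degree hlam).add h).congr_fun fun m => ?_
    rw [occupationFluctuation, if_neg hk]
    ring

/-- The counterterm linear in `𝒩 - N₀` has mean zero in the free state, so `τ` drops out and only
the quadratic part and the constant remain. -/
lemma hasSum_freeWeight_mul_potentialBound (hw : IsInteraction w) (hs : Summable (coupling w ε))
    (hlam : 0 < lam) : HasSum (fun m => freeWeight lam m * potentialBound w lam ε m)
      (lam ^ 2 / 2 * (∑' k, coupling w ε k * freeFluctuation lam k) - energyShift w ε) := by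
  have hsF : Summable fun k => coupling w ε k * freeFluctuation lam k :=
    Summable.of_nonneg_of_le
      (fun k => mul_nonneg (coupling_nonneg hw ε k) (freeFluctuation_nonneg hlam k))
      (fun k => mul_le_mul_of_nonneg_left (freeFluctuation_le hlam k) (coupling_nonneg hw ε k))
      (hs.mul_right _)
  have hJ : ∀ m k, 0 ≤ coupling w ε k * occupationFluctuation lam m k := fun m k =>
    mul_nonneg (coupling_nonneg hw ε k) (occupationFluctuation_nonneg lam m k)
  have h : HasSum (fun m => freeWeight lam m * ∑' k, coupling w ε k * occupationFluctuation lam m k)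
      (∑' k, coupling w ε k * freeFluctuation lam k) := by
    refine hasSum_freeWeight_mul (fun m => tsum_nonneg (hJ m)) (tsum_nonneg fun k =>
      mul_nonneg (coupling_nonneg hw ε k) (freeFluctuation_nonneg hlam k)) ?_
    rw [ENNReal.ofReal_tsum_of_nonneg (fun k =>
      mul_nonneg (coupling_nonneg hw ε k) (freeFluctuation_nonneg hlam k)) hsF]
    simp_rw [fun m => ENNReal.ofReal_tsum_of_nonneg (hJ m)
      (summable_coupling_mul_occupationFluctuation hw hs m), ← ENNReal.tsum_mul_left]
    rw [ENNReal.tsum_comm]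
    congr 1 with k
    have h2 := hasSum_freeWeight_mul_occupationFluctuation hlam k
    rw [ENNReal.ofReal_mul (coupling_nonneg hw ε k), ← h2.tsum_eq, ENNReal.ofReal_tsum_of_nonneg
      (fun m => mul_nonneg (freeWeight_nonneg' lam m) (occupationFluctuation_nonneg lam m k))
      h2.summable, ← ENNReal.tsum_mul_left]
    congr 1 with m
    rw [ENNReal.ofReal_mul (coupling_nonneg hw ε k), ENNReal.ofReal_mul (freeWeight_nonneg' lam m)]
    ring
  have h2 := ((h.mul_left (lam ^ 2 / 2)).sub (((hasSum_freeWeight_mul_degree hlam).sub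
    ((hasSum_freeWeight hlam).mul_left (freeNumber lam))).mul_left (lam * tau w ε))).sub
    ((hasSum_freeWeight hlam).mul_left (energyShift w ε))
  convert! h2 using 1
  · funext m
    rw [potentialBound]
    ring
  · ring

end FreeExpectation

/-! ## The counterterms in momentum space -/

section Counterterms

open MeasureTheory UnitAddTorus

variable {w : EuclideanSpace ℝ (Fin 2) → ℝ} {lam ε : ℝ}

lemma oneBodyEnergy_neg (k : Fin 2 → ℤ) : oneBodyEnergy (-k) = oneBodyEnergy k := by
  simp [oneBodyEnergy]

lemma repr_green (k : Fin 2 → ℤ) :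
    (planeWaves (Fin 2)).repr green k = (((oneBodyEnergy k)⁻¹ : ℝ) : ℂ) := by
  rw [green, LinearIsometryEquiv.apply_symm_apply]

lemma integral_mFourier_mul_green (k : Fin 2 → ℤ) :
    ∫ x, mFourier k x * green x ∂(torusMeasure (Fin 2)) = (((oneBodyEnergy k)⁻¹ : ℝ) : ℂ) := by
  rw [← oneBodyEnergy_neg, ← repr_green, planeWaves_repr, neg_neg]

/-- The Fourier coefficients are real and even. Realness identifies `G²` with `|G|²`, whose Fourier
coefficients are given by Parseval. -/
lemma conj_green : ∀ᵐ x ∂(torusMeasure (Fin 2)), conj (green x) = green x := by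
  have hm : MemLp (fun x => conj (green x)) 2 (torusMeasure (Fin 2)) :=
    (Lp.memLp green).star
  have h : hm.toLp = green := by
    refine ext_repr fun p => ?_
    rw [planeWaves_repr, repr_green, ← oneBodyEnergy_neg, ← Complex.conj_ofReal, ← repr_green,
      planeWaves_repr, ← integral_conj, neg_neg]
    refine integral_congr_ae ?_
    filter_upwards [hm.coeFn_toLp] with x hx
    rw [hx, map_mul, mFourier_neg]
  filter_upwards [hm.coeFn_toLp] with x hx
  rw [← hx, h]

lemma integrable_green : Integrable green (torusMeasure (Fin 2)) :=
  (Lp.memLp green).integrable one_le_two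

lemma hasSum_integral_scaledPotential_mul (hw : IsInteraction w) (hs : Summable (coupling w ε))
    {f : T2 → ℂ} (hf : Integrable f (torusMeasure (Fin 2))) :
    HasSum (fun k => (coupling w ε k : ℂ) * ∫ x, mFourier k x * f x ∂(torusMeasure (Fin 2)))
      (∫ x, scaledPotential w ε x * f x ∂(torusMeasure (Fin 2))) := by
  have h1 : ∀ k, Integrable (fun x => (coupling w ε k : ℂ) * (mFourier k x * f x))
      (torusMeasure (Fin 2)) := fun k => by
    refine Integrable.const_mul (hf.bdd_mul (c := 1)
      (mFourier k).continuous.aestronglyMeasurable (Filter.Eventually.of_forall fun x => ?_)) _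
    rw [norm_mFourier_apply]
  have h2 := hasSum_integral_of_summable_integral_norm h1 (by
    refine (hs.mul_right (∫ x, ‖f x‖ ∂(torusMeasure (Fin 2)))).congr fun k => ?_
    rw [← integral_const_mul]
    congr 1 with x
    rw [norm_mul, norm_mul, norm_mFourier_apply, one_mul, Complex.norm_real,
      Real.norm_of_nonneg (coupling_nonneg hw ε k)])
  have h3 : ∀ x, ∑' k, (coupling w ε k : ℂ) * (mFourier k x * f x) = scaledPotential w ε x * f x := by
    intro x
    simp only [← mul_assoc]
    rw [tsum_mul_right]
    rfl
  simp only [h3] at h2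
  refine h2.congr_fun fun k => ?_
  rw [integral_const_mul]

lemma hasSum_tau (hw : IsInteraction w) (hs : Summable (coupling w ε)) :
    HasSum (fun k => coupling w ε k * (oneBodyEnergy k)⁻¹) (tau w ε) := by
  have h := Complex.hasSum_re (hasSum_integral_scaledPotential_mul hw hs integrable_green)
  refine h.congr_fun fun k => ?_
  rw [integral_mFourier_mul_green, ← Complex.ofReal_mul, Complex.ofReal_re]

/-- `∑ p, 1 / (h_p h_{p+k})`. -/
def bubble (k : Fin 2 → ℤ) : ℝ := ∑' p, (oneBodyEnergy p)⁻¹ * (oneBodyEnergy (p + k))⁻¹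

lemma inv_oneBodyEnergy_pos (k : Fin 2 → ℤ) : 0 < (oneBodyEnergy k)⁻¹ :=
  inv_pos.mpr (oneBodyEnergy_pos k)

lemma summable_bubble (k : Fin 2 → ℤ) :
    Summable fun p => (oneBodyEnergy p)⁻¹ * (oneBodyEnergy (p + k))⁻¹ := by
  have h1 := summable_inv_oneBodyEnergy_sq
  have h2 := (Equiv.addRight k).summable_iff.mpr h1
  refine Summable.of_nonneg_of_le (fun p => (mul_pos (inv_oneBodyEnergy_pos _)
    (inv_oneBodyEnergy_pos _)).le) (fun p => ?_) (h1.add h2)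
  simp only [Function.comp_apply, Equiv.coe_addRight]
  nlinarith [sq_nonneg ((oneBodyEnergy p)⁻¹ - (oneBodyEnergy (p + k))⁻¹),
    sq_nonneg (oneBodyEnergy p)⁻¹, sq_nonneg (oneBodyEnergy (p + k))⁻¹]

lemma bubble_nonneg (k : Fin 2 → ℤ) : 0 ≤ bubble k :=
  tsum_nonneg fun _ => (mul_pos (inv_oneBodyEnergy_pos _) (inv_oneBodyEnergy_pos _)).le

lemma integral_mFourier_mul_green_sq (k : Fin 2 → ℤ) :
    ∫ x, mFourier k x * green x ^ 2 ∂(torusMeasure (Fin 2)) = (bubble k : ℂ) := by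
  have h1 : ∫ x, mFourier k x * green x ^ 2 ∂(torusMeasure (Fin 2))
      = ∫ x, mFourier k x * ((‖green x‖ ^ 2 : ℝ) : ℂ) ∂(torusMeasure (Fin 2)) := by
    refine integral_congr_ae ?_
    filter_upwards [conj_green] with x hx
    have h2 := Complex.conj_mul' (green x)
    rw [hx] at h2
    rw [pow_two, h2]
    push_cast
    rfl
  rw [h1, ← (hasSum_mFourier_mul_sq_norm k green).tsum_eq, bubble, Complex.ofReal_tsum,
    ← (Equiv.addRight k).tsum_eq]
  congr 1 with p
  simp only [Equiv.coe_addRight, add_sub_cancel_right, repr_green, Complex.conj_ofReal]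
  push_cast
  ring

lemma hasSum_energyShift (hw : IsInteraction w) (hs : Summable (coupling w ε)) :
    HasSum (fun k => coupling w ε k * bubble k) (energyShift w ε) := by
  have hi : Integrable (fun x => green x ^ 2) (torusMeasure (Fin 2)) := by
    refine ((integrable_sq_norm green).ofReal (𝕜 := ℂ)).congr ?_
    filter_upwards [conj_green] with x hx
    have h2 := Complex.conj_mul' (green x)
    rw [hx] at h2
    rw [pow_two (green x), h2]
    push_cast
    rfl
  have h := Complex.hasSum_re (hasSum_integral_scaledPotential_mul hw hs hi)
  refine h.congr_fun fun k => ?_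
  rw [integral_mFourier_mul_green_sq, ← Complex.ofReal_mul, Complex.ofReal_re]

lemma energyShift_nonneg (hw : IsInteraction w) (hs : Summable (coupling w ε)) :
    0 ≤ energyShift w ε :=
  (hasSum_energyShift hw hs).nonneg fun k => mul_nonneg (coupling_nonneg hw ε k) (bubble_nonneg k)

/-- The expectation of the interaction in the free Gibbs state. -/
lemma freeExpectation_le (hw : IsInteraction w) (hs : Summable (coupling w ε)) (hlam : 0 < lam) :
    lam ^ 2 / 2 * (∑' k, coupling w ε k * freeFluctuation lam k) - energyShift w ε
      ≤ lam ^ 2 / 2 * (freeNumber lam * ∑' k, coupling w ε k) := by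
  have hE := hasSum_energyShift hw hs
  have h1 : ∀ k, lam ^ 2 * (coupling w ε k * freeFluctuation lam k)
      ≤ lam ^ 2 * freeNumber lam * coupling w ε k + coupling w ε k * bubble k := by
    intro k
    -- Since `λ bose(λh) ≤ 1/h`, the pair term is dominated by the bubble. With its prefactor `1/2`
    -- it amounts to at most half of the energy shift, which is then absorbed by the subtracted full
    -- shift.
    have h2 : lam ^ 2 * ∑' q, bose (lam * oneBodyEnergy q) * bose (lam * oneBodyEnergy (q + k))
        ≤ bubble k := by
      rw [← tsum_mul_left]
      refine ((summable_bose_mul_bose hlam k).mul_left _).tsum_le_tsum (fun q => ?_)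
        (summable_bubble k)
      have h3 : ∀ q, lam * bose (lam * oneBodyEnergy q) ≤ (oneBodyEnergy q)⁻¹ := fun q => by
        have h4 := mul_le_mul_of_nonneg_left (bose_le_inv (mul_oneBodyEnergy_pos hlam q)) hlam.le
        rwa [mul_inv, mul_inv_cancel_left₀ hlam.ne'] at h4
      have h5 := mul_le_mul (h3 q) (h3 (q + k))
        (mul_pos hlam (bose_pos (mul_oneBodyEnergy_pos hlam _))).le (inv_oneBodyEnergy_pos q).le
      linarith
    have h6 := mul_le_mul_of_nonneg_left h2 (coupling_nonneg hw ε k)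
    rw [freeFluctuation]
    linarith
  have hsF : Summable fun k => lam ^ 2 * (coupling w ε k * freeFluctuation lam k) :=
    Summable.of_nonneg_of_le (fun k => mul_nonneg (sq_nonneg _)
      (mul_nonneg (coupling_nonneg hw ε k) (freeFluctuation_nonneg hlam k))) h1
      ((hs.mul_left _).add hE.summable)
  have h7 := hsF.tsum_le_tsum h1 ((hs.mul_left _).add hE.summable)
  rw [(hs.mul_left _).tsum_add hE.summable, tsum_mul_left, tsum_mul_left, hE.tsum_eq] at h7
  have := energyShift_nonneg hw hs
  linarith

end Counterterms

/-! ## Periodization -/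

section Periodization

open MeasureTheory UnitAddTorus

/-- The projection of the plane to the torus. -/
def toTorus (x : Fin 2 → ℝ) : T2 := fun i => (x i : UnitAddCircle)

lemma measurable_toTorus : Measurable toTorus :=
  measurable_pi_lambda _ fun i => AddCircle.measurable_mk'.comp (measurable_pi_apply i)

lemma continuous_toTorus : Continuous toTorus :=
  continuous_pi fun i => (AddCircle.continuous_mk' 1).comp (continuous_apply i)

/-- The unit square with lower left corner `a`. -/
def square (a : Fin 2 → ℝ) : Set (Fin 2 → ℝ) := Set.univ.pi fun i => Set.Ioc (a i) (a i + 1)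

lemma measurableSet_square (a : Fin 2 → ℝ) : MeasurableSet (square a) :=
  MeasurableSet.univ_pi fun _ => measurableSet_Ioc

lemma measurePreserving_toTorus (a : Fin 2 → ℝ) :
    MeasurePreserving toTorus (volume.restrict (square a)) (torusMeasure (Fin 2)) := by
  have h0 : (volume : Measure UnitAddCircle) = AddCircle.haarAddCircle := by
    rw [AddCircle.volume_eq_smul_haarAddCircle, ENNReal.ofReal_one, one_smul]
  have h := measurePreserving_pi (fun i => volume.restrict (Set.Ioc (a i) (a i + 1)))
    (fun _ : Fin 2 => (volume : Measure UnitAddCircle))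
    fun i => UnitAddCircle.measurePreserving_mk (a i)
  rw [← Measure.restrict_pi_pi, h0] at h
  exact h

lemma lintegral_square (a : Fin 2 → ℝ) {F : T2 → ℝ≥0∞} (hF : Measurable F) :
    ∫⁻ x in square a, F (toTorus x) = ∫⁻ y, F y ∂(torusMeasure (Fin 2)) :=
  (measurePreserving_toTorus a).lintegral_comp hF

/-- Scaling by `ε ≤ 1` maps the unit square with corner `a` into the unit square with corner `ε a`,
so the only loss is the Jacobian. -/
lemma lintegral_square_smul_le (a : Fin 2 → ℝ) {F : T2 → ℝ≥0∞} (hF : Measurable F) {ε : ℝ}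
    (h0 : 0 < ε) (h1 : ε ≤ 1) :
    ∫⁻ x in square a, F (toTorus (ε • x))
      ≤ ENNReal.ofReal (ε ^ 2)⁻¹ * ∫⁻ y, F y ∂(torusMeasure (Fin 2)) := by
  have h2 := Measure.map_addHaar_smul (volume : Measure (Fin 2 → ℝ)) h0.ne'
  rw [Module.finrank_fin_fun, abs_of_pos (by positivity)] at h2
  have hG : Measurable ((square (ε • a)).indicator fun x => F (toTorus x)) :=
    (hF.comp measurable_toTorus).indicator (measurableSet_square _)
  have h3 : ∫⁻ x in square a, F (toTorus (ε • x))
      ≤ ∫⁻ x, (square (ε • a)).indicator (fun x => F (toTorus x)) (ε • x) := by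
    rw [← lintegral_indicator (measurableSet_square a)]
    refine lintegral_mono fun x => ?_
    by_cases hx : x ∈ square a
    · rw [Set.indicator_of_mem hx, Set.indicator_of_mem]
      intro i _
      have h4 := hx i trivial
      simp only [Pi.smul_apply, smul_eq_mul, Set.mem_Ioc] at h4 ⊢
      constructor <;> nlinarith
    · rw [Set.indicator_of_notMem hx]
      exact zero_le
  refine h3.trans_eq ?_
  rw [← lintegral_square (ε • a) hF, ← lintegral_indicator (measurableSet_square _),
    ← smul_eq_mul, ← lintegral_smul_measure, ← h2, lintegral_map hG (measurable_const_smul ε)]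

/-- Two integrable functions with the same Fourier coefficients. -/
lemma integral_eq_of_fourier {α β : Type} [MeasurableSpace α] [MeasurableSpace β]
    {μ : Measure α} {ν : Measure β} {q : α → T2} {q' : β → T2} (hq : Measurable q)
    (hq' : Measurable q') {f : α → ℂ} {g : β → ℂ} (hf : Integrable f μ) (hg : Integrable g ν)
    (h : ∀ k : Fin 2 → ℤ, ∫ x, mFourier k (q x) * f x ∂μ = ∫ y, mFourier k (q' y) * g y ∂ν)
    (φ : C(T2, ℂ)) : ∫ x, φ (q x) * f x ∂μ = ∫ y, φ (q' y) * g y ∂ν := by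
  have key : ∀ {γ : Type} [MeasurableSpace γ] (ρ : Measure γ) (r : γ → T2) (_ : Measurable r)
      (F : γ → ℂ) (_ : Integrable F ρ),
      ∃ T : C(T2, ℂ) →L[ℂ] ℂ, ∀ φ, T φ = ∫ x, φ (r x) * F x ∂ρ := by
    intro γ _ ρ r hr F hF
    have hi : ∀ φ : C(T2, ℂ), Integrable (fun x => φ (r x) * F x) ρ := fun φ =>
      hF.bdd_mul (c := ‖φ‖) (φ.continuous.measurable.comp hr).aestronglyMeasurable
        (Filter.Eventually.of_forall fun x => φ.norm_coe_le_norm _)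
    refine ⟨LinearMap.mkContinuous
      { toFun := fun φ => ∫ x, φ (r x) * F x ∂ρ
        map_add' := fun φ ψ => by
          rw [← integral_add (hi φ) (hi ψ)]
          congr 1 with x
          simp [add_mul]
        map_smul' := fun c φ => by
          rw [RingHom.id_apply, smul_eq_mul, ← integral_const_mul]
          congr 1 with x
          simp [mul_assoc] } (∫ x, ‖F x‖ ∂ρ) fun φ => ?_, fun φ => rfl⟩
    rw [mul_comm, ← integral_const_mul]
    refine norm_integral_le_of_norm_le (hF.norm.const_mul _)
      (Filter.Eventually.of_forall fun x => ?_)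
    rw [norm_mul]
    exact mul_le_mul_of_nonneg_right (φ.norm_coe_le_norm _) (norm_nonneg _)
  obtain ⟨T, hT⟩ := key μ q hq f hf
  obtain ⟨T', hT'⟩ := key ν q' hq' g hg
  have hTT : T = T' := by
    refine ContinuousLinearMap.ext_on (s := Set.range mFourier)
      (Submodule.dense_iff_topologicalClosure_eq_top.mpr span_mFourier_closure_eq_top) ?_
    rintro _ ⟨k, rfl⟩
    rw [hT, hT', h]
  rw [← hT, ← hT', hTT]

lemma integral_mFourier (k : Fin 2 → ℤ) :
    ∫ y, mFourier k y ∂(torusMeasure (Fin 2)) = if k = 0 then 1 else 0 := by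
  have h1 := repr_planeWaves k 0
  rw [planeWaves_repr] at h1
  simp only [eq_comm (a := (0 : Fin 2 → ℤ))] at h1
  rw [← h1]
  refine integral_congr_ae ?_
  filter_upwards [coeFn_planeWaves k] with y hy
  rw [hy, neg_zero, mFourier_zero, ContinuousMap.one_apply, one_mul]

/-- If the periodization of `f` has nonnegative summable Fourier coefficients, then its positive part is
bounded by its negative part plus a constant. -/
lemma lintegral_pos_le_of_fourier {f : (Fin 2 → ℝ) → ℝ} (hf : Integrable f) {s : (Fin 2 → ℤ) → ℝ}
    (hs : Summable s) (hs0 : ∀ k, 0 ≤ s k)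
    (h : ∀ k, ∫ x, mFourier k (toTorus x) * (f x : ℂ) = s k) {g : T2 → ℝ≥0∞} (hg : Measurable g) :
    ∫⁻ x, ENNReal.ofReal (f x) * g (toTorus x)
      ≤ (∫⁻ x, ENNReal.ofReal (-f x) * g (toTorus x))
        + ENNReal.ofReal (∑' k, s k) * ∫⁻ y, g y ∂(torusMeasure (Fin 2)) := by
  -- This is the periodization of `f`, rebuilt as an absolutely convergent Fourier series. It is
  -- therefore continuous and bounded by `∑ s k`.
  let u : T2 → ℂ := fun y => ∑' k, (s k : ℂ) * mFourier (-k) y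
  have hnorm : ∀ k y, ‖(s k : ℂ) * mFourier (-k) y‖ = s k := fun k y => by
    rw [norm_mul, norm_mFourier_apply, mul_one, Complex.norm_real, Real.norm_of_nonneg (hs0 k)]
  have hu : Continuous u := continuous_tsum (fun k => continuous_const.mul (mFourier (-k)).continuous)
    hs fun k y => (hnorm k y).le
  have hule : ∀ y, ‖u y‖ ≤ ∑' k, s k := fun y =>
    tsum_of_norm_bounded hs.hasSum fun k => (hnorm k y).le
  have hui : Integrable u (torusMeasure (Fin 2)) :=
    (integrable_const (∑' k, s k)).mono' hu.aestronglyMeasurable (Filter.Eventually.of_forall hule)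
  have hcoef : ∀ k, ∫ y, mFourier k y * u y ∂(torusMeasure (Fin 2)) = s k := by
    intro k
    have h1 := hasSum_integral_of_summable_integral_norm (μ := torusMeasure (Fin 2))
      (F := fun j y => (s j : ℂ) * mFourier (k - j) y)
      (fun j => Integrable.const_mul ((integrable_const (1 : ℝ)).mono'
        (mFourier (k - j)).continuous.aestronglyMeasurable
        (Filter.Eventually.of_forall fun y => (norm_mFourier_apply _ y).le)) _) (by
      refine hs.congr fun j => ?_
      simp [norm_mFourier_apply, abs_of_nonneg (hs0 j)])
    have h2 : ∀ y, ∑' j, (s j : ℂ) * mFourier (k - j) y = mFourier k y * u y := by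
      intro y
      rw [← tsum_mul_left]
      congr 1 with j
      rw [sub_eq_add_neg, mFourier_add]
      ring
    simp only [h2] at h1
    rw [← h1.tsum_eq, tsum_eq_single k]
    · rw [integral_const_mul, integral_mFourier, sub_self, if_pos rfl, mul_one]
    · intro j hj
      rw [integral_const_mul, integral_mFourier, if_neg (sub_ne_zero.mpr hj.symm), mul_zero]
  have hphi := integral_eq_of_fourier (q' := id) measurable_toTorus measurable_id hf.ofReal hui
    (fun k => (h k).trans (hcoef k).symm)
  have hre : ∀ φ : BoundedContinuousFunction T2 ℝ, ∫ x, φ (toTorus x) * f x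
      = ∫ y, φ y * (u y).re ∂(torusMeasure (Fin 2)) := by
    intro φ
    have h1 := hphi ⟨fun y => (φ y : ℂ), Complex.continuous_ofReal.comp φ.continuous⟩
    have h2 : Integrable (fun y => (φ y : ℂ) * u y) (torusMeasure (Fin 2)) :=
      hui.bdd_mul (c := ‖φ‖) (Complex.continuous_ofReal.comp φ.continuous).aestronglyMeasurable
        (Filter.Eventually.of_forall fun y => by
          rw [Complex.norm_real]
          exact φ.norm_coe_le_norm y)
    have h3 := congrArg Complex.re h1
    simp only [ContinuousMap.coe_mk, id_eq] at h3
    have h4 : (∫ y, (φ y : ℂ) * u y ∂(torusMeasure (Fin 2))).re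
        = ∫ y, ((φ y : ℂ) * u y).re ∂(torusMeasure (Fin 2)) := (integral_re h2).symm
    have h5 : ∫ x, (φ (toTorus x) : ℂ) * (f x : ℂ) = ((∫ x, φ (toTorus x) * f x : ℝ) : ℂ) := by
      rw [← integral_complex_ofReal]
      congr 1 with x
      push_cast
      rfl
    rw [h4] at h3
    simp only [Complex.re_ofReal_mul] at h3
    rw [← h3]
    exact (congrArg Complex.re h5).symm
  set S := ∑' k, s k with hS
  have hS0 : 0 ≤ S := tsum_nonneg hs0
  -- The identity "periodized `f⁺ - f⁻` equals `u`" is rearranged into an equality of finite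
  -- positive measures, `f⁺ + (S - u) = f⁻ + S`. Equality on continuous test functions then extends
  -- to the merely measurable `g`, and dropping `S - u ≥ 0` gives the inequality.
  let μ₁ := (volume.withDensity fun x => ENNReal.ofReal (f x)).map toTorus
  let μ₂ := (torusMeasure (Fin 2)).withDensity fun y => ENNReal.ofReal (S - (u y).re)
  let ν₁ := (volume.withDensity fun x => ENNReal.ofReal (-f x)).map toTorus
  let ν₂ := ENNReal.ofReal S • torusMeasure (Fin 2)
  have hm1 : AEMeasurable (fun x => ENNReal.ofReal (f x)) := hf.aemeasurable.ennreal_ofReal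
  have hm2 : AEMeasurable (fun x => ENNReal.ofReal (-f x)) := hf.neg.aemeasurable.ennreal_ofReal
  have hm3 : Measurable fun y => ENNReal.ofReal (S - (u y).re) :=
    (measurable_const.sub (Complex.measurable_re.comp hu.measurable)).ennreal_ofReal
  have hSr : ∀ y, 0 ≤ S - (u y).re := fun y =>
    sub_nonneg.mpr ((Complex.re_le_norm _).trans (hule y))
  have hSi : Integrable (fun y => S - (u y).re) (torusMeasure (Fin 2)) :=
    (integrable_const S).sub hui.re
  have : IsFiniteMeasure (volume.withDensity fun x => ENNReal.ofReal (f x)) :=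
    isFiniteMeasure_withDensity_ofReal hf.2
  have : IsFiniteMeasure (volume.withDensity fun x => ENNReal.ofReal (-f x)) :=
    isFiniteMeasure_withDensity_ofReal hf.neg.2
  have : IsFiniteMeasure μ₁ := Measure.isFiniteMeasure_map _ _
  have : IsFiniteMeasure ν₁ := Measure.isFiniteMeasure_map _ _
  have : IsFiniteMeasure μ₂ := isFiniteMeasure_withDensity_ofReal hSi.2
  have : IsFiniteMeasure ν₂ := Measure.smul_finite _ ENNReal.ofReal_ne_top
  have hμν : μ₁ + μ₂ = ν₁ + ν₂ := by
    refine ext_of_forall_integral_eq_of_IsFiniteMeasure fun φ => ?_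
    have hb : ∀ x, ‖φ (toTorus x)‖ ≤ ‖φ‖ := fun x => φ.norm_coe_le_norm _
    have hφm : AEStronglyMeasurable (fun x => φ (toTorus x)) volume :=
      (φ.continuous.comp continuous_toTorus).aestronglyMeasurable
    rw [integral_add_measure (φ.integrable _) (φ.integrable _),
      integral_add_measure (φ.integrable _) (φ.integrable _)]
    have e1 : ∫ y, φ y ∂μ₁ = ∫ x, max (f x) 0 * φ (toTorus x) := by
      rw [integral_map measurable_toTorus.aemeasurable φ.continuous.aestronglyMeasurable,
        integral_withDensity_eq_integral_toReal_smul₀ hm1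
          (Filter.Eventually.of_forall fun _ => ENNReal.ofReal_lt_top)]
      simp only [ENNReal.toReal_ofReal', smul_eq_mul]
    have e2 : ∫ y, φ y ∂ν₁ = ∫ x, max (-f x) 0 * φ (toTorus x) := by
      rw [integral_map measurable_toTorus.aemeasurable φ.continuous.aestronglyMeasurable,
        integral_withDensity_eq_integral_toReal_smul₀ hm2
          (Filter.Eventually.of_forall fun _ => ENNReal.ofReal_lt_top)]
      simp only [ENNReal.toReal_ofReal', smul_eq_mul]
    have e3 : ∫ y, φ y ∂μ₂ = ∫ y, (S - (u y).re) * φ y ∂(torusMeasure (Fin 2)) := by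
      rw [integral_withDensity_eq_integral_toReal_smul hm3
          (Filter.Eventually.of_forall fun _ => ENNReal.ofReal_lt_top)]
      simp only [ENNReal.toReal_ofReal (hSr _), smul_eq_mul]
    have e4 : ∫ y, φ y ∂ν₂ = S * ∫ y, φ y ∂(torusMeasure (Fin 2)) := by
      rw [integral_smul_measure, ENNReal.toReal_ofReal hS0, smul_eq_mul]
    have i1 : Integrable (fun x => max (f x) 0 * φ (toTorus x)) :=
      hf.pos_part.mul_bdd (c := ‖φ‖) hφm (Filter.Eventually.of_forall hb)
    have i2 : Integrable (fun x => max (-f x) 0 * φ (toTorus x)) :=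
      hf.neg_part.mul_bdd (c := ‖φ‖) hφm (Filter.Eventually.of_forall hb)
    have i3 : Integrable (fun y => φ y * (u y).re) (torusMeasure (Fin 2)) :=
      hui.re.bdd_mul (c := ‖φ‖) φ.continuous.aestronglyMeasurable
        (Filter.Eventually.of_forall fun y => φ.norm_coe_le_norm y)
    have e5 : ∫ x, φ (toTorus x) * f x
        = (∫ x, max (f x) 0 * φ (toTorus x)) - ∫ x, max (-f x) 0 * φ (toTorus x) := by
      rw [← integral_sub i1 i2]
      congr 1 with x
      rw [← sub_mul, mul_comm]
      congr 1
      rcases le_total (f x) 0 with h0 | h0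
      · rw [max_eq_right h0, max_eq_left (by linarith)]
        ring
      · rw [max_eq_left h0, max_eq_right (by linarith)]
        ring
    have e6 : ∫ y, (S - (u y).re) * φ y ∂(torusMeasure (Fin 2))
        = S * (∫ y, φ y ∂(torusMeasure (Fin 2))) - ∫ y, φ y * (u y).re ∂(torusMeasure (Fin 2)) := by
      rw [← integral_const_mul, ← integral_sub ((φ.integrable _).const_mul S) i3]
      congr 1 with y
      ring
    have := hre φ
    rw [e1, e2, e3, e4, e6]
    linarith
  have l1 : ∫⁻ y, g y ∂μ₁ = ∫⁻ x, ENNReal.ofReal (f x) * g (toTorus x) := 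
    (lintegral_map hg measurable_toTorus).trans (lintegral_withDensity_eq_lintegral_mul₀ hm1
      (hg.comp measurable_toTorus).aemeasurable)
  have l2 : ∫⁻ y, g y ∂ν₁ = ∫⁻ x, ENNReal.ofReal (-f x) * g (toTorus x) := 
    (lintegral_map hg measurable_toTorus).trans (lintegral_withDensity_eq_lintegral_mul₀ hm2
      (hg.comp measurable_toTorus).aemeasurable)
  rw [← l1, ← l2, ← smul_eq_mul, ← lintegral_smul_measure, ← lintegral_add_measure]
  change _ ≤ ∫⁻ y, g y ∂(ν₁ + ν₂)
  rw [← hμν]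
  exact lintegral_mono' (Measure.le_add_right le_rfl) le_rfl

end Periodization

/-! ## Sums of the interaction over rescaled lattices -/

section LatticeSums

open MeasureTheory UnitAddTorus

/-- The unit squares centred at the lattice points. -/
def cell (z : Fin 2 → ℤ) : Set (Fin 2 → ℝ) := square fun i => z i - 1 / 2

lemma measurableSet_cell (z : Fin 2 → ℤ) : MeasurableSet (cell z) := measurableSet_square _

lemma mem_cell {z : Fin 2 → ℤ} {x : Fin 2 → ℝ} :
    x ∈ cell z ↔ ∀ i, (z i : ℝ) - 1 / 2 < x i ∧ x i ≤ z i + 1 / 2 := by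
  simp only [cell, square, Set.mem_univ_pi, Set.mem_Ioc]
  refine forall_congr' fun i => and_congr_right fun _ => ?_
  ring_nf

lemma compl_cell_zero_subset : (cell 0)ᶜ ⊆ ⋃ z : {z : Fin 2 → ℤ // z ≠ 0}, cell z.1 := by
  intro x hx
  let z : Fin 2 → ℤ := fun i => ⌈x i - 1 / 2⌉
  have hz : x ∈ cell z := by
    rw [mem_cell]
    intro i
    have h1 := Int.le_ceil (x i - 1 / 2)
    have h2 := Int.ceil_lt_add_one (x i - 1 / 2)
    constructor <;> simp only [z] <;> linarith
  refine Set.mem_iUnion.mpr ⟨⟨z, fun h => hx ?_⟩, hz⟩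
  rwa [h] at hz

/-- The representative of a point of the torus in the central cell. -/
def torusRep (y : T2) : Fin 2 → ℝ := fun i => (AddCircle.equivIoc (1 : ℝ) (-(1 / 2)) (y i)).1

lemma measurable_torusRep : Measurable torusRep :=
  measurable_pi_lambda _ fun i => measurable_subtype_coe.comp
    ((AddCircle.measurableEquivIoc (1 : ℝ) (-(1 / 2))).measurable.comp (measurable_pi_apply i))

lemma torusRep_toTorus {x : Fin 2 → ℝ} (hx : x ∈ cell 0) : torusRep (toTorus x) = x := by
  funext i
  have h := mem_cell.mp hx i
  simp only [Pi.zero_apply, Int.cast_zero] at h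
  have h2 : x i ∈ Set.Ioc (-(1 / 2) : ℝ) (-(1 / 2) + 1) := ⟨by linarith, by linarith⟩
  simp only [torusRep, toTorus, AddCircle.equivIoc_coe_eq h2]

/-- Integrals of `f` against rescaled periodic functions. -/
lemma integral_mul_periodic_le {f : (Fin 2 → ℝ) → ℝ} (hf : Integrable f) {s : (Fin 2 → ℤ) → ℝ}
    (hs : Summable s) (hs0 : ∀ k, 0 ≤ s k)
    (h : ∀ k, ∫ x, mFourier k (toTorus x) * (f x : ℂ) = s k)
    {a : (Fin 2 → ℤ) → ℝ} (ha : Summable a) (ha0 : ∀ z, 0 ≤ a z)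
    (hfa : ∀ z ≠ 0, ∀ᵐ x, x ∈ cell z → |f x| ≤ a z)
    {F : T2 → ℝ} (hF : Continuous F) (hF0 : ∀ y, 0 ≤ F y) {ε : ℝ} (h0 : 0 < ε) (h1 : ε ≤ 1) :
    ∫ x, F (toTorus (ε • x)) * f x
      ≤ (∑' k, s k + 2 * ∑' z, a z) * ((ε ^ 2)⁻¹ * ∫ y, F y ∂(torusMeasure (Fin 2))) := by
  let φ : (Fin 2 → ℝ) → ℝ≥0∞ := fun x => ENNReal.ofReal (F (toTorus (ε • x)))
  -- The rescaled function `φ` is not periodic with period one. Its restriction to the central cell,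
  -- continued periodically, is, and to this `g` the periodization bound applies.
  let g : T2 → ℝ≥0∞ := fun y => φ (torusRep y)
  have hFm : Measurable fun y => ENNReal.ofReal (F y) := hF.measurable.ennreal_ofReal
  have hφ : Measurable φ := hFm.comp (measurable_toTorus.comp (measurable_const_smul ε))
  have hg : Measurable g := hφ.comp measurable_torusRep
  have hFi : Integrable F (torusMeasure (Fin 2)) :=
    (BoundedContinuousFunction.mkOfCompact ⟨F, hF⟩).integrable _
  have hFint : 0 ≤ ∫ y, F y ∂(torusMeasure (Fin 2)) := integral_nonneg hF0
  set I := ENNReal.ofReal ((ε ^ 2)⁻¹ * ∫ y, F y ∂(torusMeasure (Fin 2))) with hI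
  have hIφ : ∀ z, ∫⁻ x in cell z, φ x ≤ I := fun z => by
    refine (lintegral_square_smul_le _ hFm h0 h1).trans_eq ?_
    rw [hI, ENNReal.ofReal_mul (by positivity), ofReal_integral_eq_lintegral_ofReal hFi
      (Filter.Eventually.of_forall hF0)]
  have hgφ : ∀ x ∈ cell 0, g (toTorus x) = φ x := fun x hx => by
    simp only [g, torusRep_toTorus hx]
  have hg0 : ∫⁻ y, g y ∂(torusMeasure (Fin 2)) ≤ I := by
    rw [← lintegral_square (fun i => ((0 : Fin 2 → ℤ) i : ℝ) - 1 / 2) hg]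
    exact (setLIntegral_congr_fun (measurableSet_cell 0) hgφ).trans_le (hIφ 0)
  have hIg : ∀ z, ∫⁻ x in cell z, g (toTorus x) ≤ I := fun z =>
    (lintegral_square _ hg).trans_le hg0
  have hfm : AEMeasurable (fun x => ENNReal.ofReal (f x)) := hf.aemeasurable.ennreal_ofReal
  have hfm' : AEMeasurable (fun x => ENNReal.ofReal (-f x)) := hf.neg.aemeasurable.ennreal_ofReal
  -- Outside the central cell only the decay of `f` is used. This is needed twice, for the negative
  -- part of `f` against the periodic continuation and for the positive part against `φ`, whence the
  -- coefficient `2` of `∑ a z`.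
  have hout : ∀ (G : (Fin 2 → ℝ) → ℝ≥0∞), (∀ z, ∫⁻ x in cell z, G x ≤ I) →
      ∀ (u : (Fin 2 → ℝ) → ℝ), (∀ x, u x ≤ |f x|) →
      ∫⁻ x in (cell 0)ᶜ, ENNReal.ofReal (u x) * G x ≤ ENNReal.ofReal (∑' z, a z) * I := by
    intro G hG u hu
    calc ∫⁻ x in (cell 0)ᶜ, ENNReal.ofReal (u x) * G x
        ≤ ∫⁻ x in ⋃ z : {z : Fin 2 → ℤ // z ≠ 0}, cell z.1, ENNReal.ofReal (u x) * G x :=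
          lintegral_mono_set compl_cell_zero_subset
      _ ≤ ∑' z : {z : Fin 2 → ℤ // z ≠ 0}, ∫⁻ x in cell z.1, ENNReal.ofReal (u x) * G x :=
          lintegral_iUnion_le _ _
      _ ≤ ∑' z : {z : Fin 2 → ℤ // z ≠ 0}, ENNReal.ofReal (a z.1) * I := by
          refine ENNReal.tsum_le_tsum fun z => ?_
          calc _ ≤ ∫⁻ x in cell z.1, ENNReal.ofReal (a z.1) * G x := by
                refine lintegral_mono_ae ?_
                filter_upwards [ae_restrict_of_ae (hfa z.1 z.2),
                  ae_restrict_mem (measurableSet_cell z.1)] with x h2 h3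
                gcongr
                exact (hu x).trans (h2 h3)
            _ = ENNReal.ofReal (a z.1) * ∫⁻ x in cell z.1, G x :=
                lintegral_const_mul' _ _ ENNReal.ofReal_ne_top
            _ ≤ _ := by gcongr; exact hG _
      _ ≤ ∑' z, ENNReal.ofReal (a z) * I :=
          ENNReal.tsum_comp_le_tsum_of_injective Subtype.val_injective _
      _ = _ := by rw [ENNReal.tsum_mul_right, ENNReal.ofReal_tsum_of_nonneg ha0 ha]
  set S := ENNReal.ofReal (∑' k, s k)
  set A := ENNReal.ofReal (∑' z, a z)
  have hmain : ∫⁻ x, ENNReal.ofReal (f x) * φ x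
      ≤ (∫⁻ x, ENNReal.ofReal (-f x) * φ x) + (S + 2 * A) * I := by
    have e1 : ∫⁻ x in cell 0, ENNReal.ofReal (f x) * φ x
        ≤ (∫⁻ x in cell 0, ENNReal.ofReal (-f x) * φ x) + A * I + S * I := by
      calc _ = ∫⁻ x in cell 0, ENNReal.ofReal (f x) * g (toTorus x) :=
            setLIntegral_congr_fun (measurableSet_cell 0) fun x hx => by rw [hgφ x hx]
        _ ≤ ∫⁻ x, ENNReal.ofReal (f x) * g (toTorus x) := setLIntegral_le_lintegral _ _
        _ ≤ _ := lintegral_pos_le_of_fourier hf hs hs0 h hg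
        _ = ((∫⁻ x in cell 0, ENNReal.ofReal (-f x) * g (toTorus x))
            + ∫⁻ x in (cell 0)ᶜ, ENNReal.ofReal (-f x) * g (toTorus x))
            + S * ∫⁻ y, g y ∂(torusMeasure (Fin 2)) := by
            rw [lintegral_add_compl _ (measurableSet_cell 0)]
        _ ≤ _ := by
            refine add_le_add (add_le_add (setLIntegral_congr_fun (measurableSet_cell 0)
              fun x hx => ?_).le (hout _ hIg _ fun x => neg_le_abs _)) (by gcongr)
            simp only [hgφ x hx]
    calc _ = (∫⁻ x in cell 0, ENNReal.ofReal (f x) * φ x)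
          + ∫⁻ x in (cell 0)ᶜ, ENNReal.ofReal (f x) * φ x :=
          (lintegral_add_compl _ (measurableSet_cell 0)).symm
      _ ≤ ((∫⁻ x in cell 0, ENNReal.ofReal (-f x) * φ x) + A * I + S * I) + A * I :=
          add_le_add e1 (hout _ hIφ _ fun x => le_abs_self _)
      _ = (∫⁻ x in cell 0, ENNReal.ofReal (-f x) * φ x) + (S + 2 * A) * I := by ring
      _ ≤ _ := add_le_add (setLIntegral_le_lintegral _ _) le_rfl
  have hFb : ∃ M, ∀ y, F y ≤ M := by
    refine ⟨‖(⟨F, hF⟩ : C(T2, ℝ))‖, fun y => ?_⟩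
    exact (le_abs_self _).trans ((⟨F, hF⟩ : C(T2, ℝ)).norm_coe_le_norm y)
  obtain ⟨M, hM⟩ := hFb
  have hfi : Integrable fun x => F (toTorus (ε • x)) * f x := by
    refine hf.bdd_mul (c := M) (hF.measurable.comp (measurable_toTorus.comp
      (measurable_const_smul ε))).aestronglyMeasurable (Filter.Eventually.of_forall fun x => ?_)
    rw [Real.norm_of_nonneg (hF0 _)]
    exact hM _
  have hp : ∀ x, ENNReal.ofReal (F (toTorus (ε • x)) * f x) = ENNReal.ofReal (f x) * φ x := fun x => by
    rw [ENNReal.ofReal_mul (hF0 _), mul_comm]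
  have hn : ∀ x, ENNReal.ofReal (-(F (toTorus (ε • x)) * f x)) = ENNReal.ofReal (-f x) * φ x :=
    fun x => by rw [← mul_neg, ENNReal.ofReal_mul (hF0 _), mul_comm]
  have hfin : ∫⁻ x, ENNReal.ofReal (-(F (toTorus (ε • x)) * f x)) ≠ ⊤ :=
    hfi.neg.lintegral_lt_top.ne
  rw [integral_eq_lintegral_pos_part_sub_lintegral_neg_part hfi, sub_le_iff_le_add']
  have hS0 : 0 ≤ ∑' k, s k := tsum_nonneg hs0
  have hA0 : 0 ≤ ∑' z, a z := tsum_nonneg ha0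
  have hR : ENNReal.ofReal ((∑' k, s k + 2 * ∑' z, a z)
      * ((ε ^ 2)⁻¹ * ∫ y, F y ∂(torusMeasure (Fin 2)))) = (S + 2 * A) * I := by
    rw [ENNReal.ofReal_mul (by positivity), ENNReal.ofReal_add hS0 (by positivity),
      ENNReal.ofReal_mul (by norm_num), ENNReal.ofReal_ofNat]
  refine ENNReal.toReal_le_of_le_ofReal (by positivity) ?_
  rw [ENNReal.ofReal_add ENNReal.toReal_nonneg (by positivity), ENNReal.ofReal_toReal hfin, hR]
  simp only [hp, hn]
  exact hmain

variable {w : EuclideanSpace ℝ (Fin 2) → ℝ}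

lemma integrable_comp_toLp (hw : Integrable w) :
    Integrable fun x : Fin 2 → ℝ => w (WithLp.toLp 2 x) :=
  (PiLp.volume_preserving_toLp (Fin 2)).integrable_comp_of_integrable hw

lemma hat_dualPoint (ε : ℝ) (k : Fin 2 → ℤ) : hat w (dualPoint ε k)
    = ∫ x : Fin 2 → ℝ, mFourier (-k) (toTorus (ε • x)) * (w (WithLp.toLp 2 x) : ℂ) := by
  rw [hat, ← (PiLp.volume_preserving_toLp (Fin 2)).integral_comp
    (MeasurableEquiv.toLp 2 (Fin 2 → ℝ)).measurableEmbedding]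
  congr 1 with x
  congr 1
  rw [mFourier]
  simp only [ContinuousMap.coe_mk, toTorus, fourier_coe_apply, ← Complex.exp_sum]
  congr 1
  simp only [dualPoint, PiLp.inner_apply, Pi.smul_apply, Pi.neg_apply]
  simp
  ring

lemma summable_coupling_one (hw : IsInteraction w) : Summable (coupling w 1) :=
  Summable.of_nonneg_of_le (coupling_nonneg hw 1) (fun k =>
    le_mul_of_one_le_right (coupling_nonneg hw 1 k) (one_le_oneBodyEnergy k)) hw.summable

/-- The double sum is the integral of `w` against `|∑_{i ∈ B} e_i(εx)|²`, a nonnegative function of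
`εx` with mean `B.card` on the torus. Nonnegative summable coefficients at `ε = 1` together with the
decay of `w` bound such an integral by a constant times `ε⁻²` times this mean. -/
lemma sum_coupling_sub_le (hw : IsInteraction w) : ∃ A, 0 ≤ A ∧ ∀ ε, 0 < ε → ε ≤ 1 →
    ∀ B : Finset (Fin 2 → ℤ), ∑ i ∈ B, ∑ j ∈ B, coupling w ε (j - i) ≤ A * (ε ^ 2)⁻¹ * B.card := by
  obtain ⟨C, δ, hδ, hdec⟩ := hw.decay
  set f : (Fin 2 → ℝ) → ℝ := fun x => w (WithLp.toLp 2 x) with hf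
  -- Every point of the cell around `z ≠ 0` has norm at least `‖z‖/2`; the exponent exceeds the
  -- dimension two, so these bounds are summable.
  let a : (Fin 2 → ℤ) → ℝ := fun z => |C| * (‖z‖ / 2) ^ (-(2 + δ))
  have hs : Summable fun k => coupling w 1 (-k) := (Equiv.neg _).summable_iff.mpr
    (summable_coupling_one hw)
  have hs0 : ∀ k, 0 ≤ coupling w 1 (-k) := fun k => coupling_nonneg hw 1 _
  have hfi : Integrable f := integrable_comp_toLp hw.integrable
  have hhat : ∀ ε k, hat w (dualPoint ε k) = coupling w ε k := fun ε k =>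
    Complex.ext (by simp [coupling]) (by simp [hw.hat_real])
  have hcoef : ∀ k, ∫ x, mFourier k (toTorus x) * (f x : ℂ) = coupling w 1 (-k) := fun k => by
    rw [← hhat, hat_dualPoint]
    simp only [neg_neg, one_smul, hf]
  have ha0 : ∀ z, 0 ≤ a z := fun z => mul_nonneg (abs_nonneg C)
    (Real.rpow_nonneg (by positivity) _)
  have ha : Summable a := by
    refine Summable.mul_left _ ?_
    have h := EisensteinSeries.summable_one_div_norm_rpow (k := 2 + δ) (by linarith)
    refine (h.mul_right ((2 : ℝ) ^ (2 + δ))).congr fun z => ?_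
    rw [Real.div_rpow (norm_nonneg _) (by norm_num), Real.rpow_neg (by norm_num : (0 : ℝ) ≤ 2),
      div_inv_eq_mul]
  have hfa : ∀ z ≠ 0, ∀ᵐ x, x ∈ cell z → |f x| ≤ a z := by
    intro z hz
    -- Cells are closed on the right, while decay is assumed only where some coordinate exceeds
    -- `1/2` strictly. The common faces have measure zero and are discarded.
    have hne : ∀ᵐ x : Fin 2 → ℝ, ∀ i, x i ≠ -(1 / 2) :=
      ae_all_iff.mpr fun i => Measure.ae_eval_ne (fun _ : Fin 2 => (volume : Measure ℝ)) i _
    filter_upwards [hne] with x hx hxz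
    have hnz : 0 < ‖z‖ := norm_pos_iff.mpr hz
    obtain ⟨i, hi⟩ : ∃ i, ‖z‖ = |(z i : ℝ)| := by
      obtain ⟨i, hi⟩ := Finite.exists_max fun i => ‖z i‖
      refine ⟨i, le_antisymm ?_ ?_⟩
      · rw [← Int.norm_eq_abs]
        exact (pi_norm_le_iff_of_nonneg (norm_nonneg _)).mpr hi
      · rw [← Int.norm_eq_abs]
        exact norm_le_pi_norm z i
    have hzi : z i ≠ 0 := by
      rintro h0
      rw [hi, h0] at hnz
      simp at hnz
    have hx1 := mem_cell.mp hxz i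
    have hx2 : 1 / 2 < |x i| ∧ |(z i : ℝ)| / 2 ≤ |x i| := by
      rcases lt_or_gt_of_ne hzi with h0 | h0
      · have h2 : (z i : ℝ) ≤ -1 := by exact_mod_cast Int.le_sub_one_of_lt h0
        have h3 : x i < -(1 / 2) := lt_of_le_of_ne (by linarith) (hx i)
        rw [abs_of_neg (by linarith : x i < 0), abs_of_neg (by linarith : (z i : ℝ) < 0)]
        constructor <;> linarith
      · have h2 : (1 : ℝ) ≤ z i := by exact_mod_cast h0
        rw [abs_of_pos (by linarith : 0 < x i), abs_of_pos (by linarith : 0 < (z i : ℝ))]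
        constructor <;> linarith
    have h4 := hdec (WithLp.toLp 2 x) ⟨i, hx2.1⟩
    have h5 : ‖z‖ / 2 ≤ ‖WithLp.toLp 2 x‖ := by
      rw [hi]
      refine hx2.2.trans ?_
      have := PiLp.norm_apply_le (WithLp.toLp 2 x) i
      rwa [Real.norm_eq_abs] at this
    refine h4.trans ((mul_le_mul_of_nonneg_right (le_abs_self C)
      (Real.rpow_nonneg (norm_nonneg _) _)).trans ?_)
    exact mul_le_mul_of_nonneg_left (Real.rpow_le_rpow_of_nonpos (by positivity) h5 (by linarith))
      (abs_nonneg C)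
  refine ⟨∑' k, coupling w 1 (-k) + 2 * ∑' z, a z,
    add_nonneg (tsum_nonneg hs0) (mul_nonneg zero_le_two (tsum_nonneg ha0)), fun ε h0 h1 B => ?_⟩
  have hFc : ∀ y, ((‖∑ i ∈ B, mFourier i y‖ ^ 2 : ℝ) : ℂ) = ∑ i ∈ B, ∑ j ∈ B, mFourier (i - j) y := by
    intro y
    simp only [sub_eq_add_neg, mFourier_add, mFourier_neg]
    rw [← Finset.sum_mul_sum, ← map_sum, Complex.mul_conj']
    push_cast
    rfl
  have hF : Continuous fun y => ‖∑ i ∈ B, mFourier i y‖ ^ 2 :=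
    (continuous_finsetSum _ fun i _ => (mFourier i).continuous).norm.pow 2
  have h := integral_mul_periodic_le hfi hs hs0 hcoef ha ha0 hfa hF (fun y => sq_nonneg _) h0 h1
  have e1 : ∫ y, ‖∑ i ∈ B, mFourier i y‖ ^ 2 ∂(torusMeasure (Fin 2)) = B.card := by
    apply Complex.ofReal_injective
    rw [← integral_complex_ofReal]
    simp only [hFc]
    have hi : ∀ k : Fin 2 → ℤ, Integrable (fun y => mFourier k y) (torusMeasure (Fin 2)) := fun k =>
      (integrable_const (1 : ℝ)).mono' (mFourier k).continuous.aestronglyMeasurable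
        (Filter.Eventually.of_forall fun y => (norm_mFourier_apply _ y).le)
    rw [integral_finsetSum _ fun i _ => integrable_finsetSum _ fun j _ => hi _]
    simp only [integral_finsetSum _ fun j _ => hi _, integral_mFourier, sub_eq_zero]
    simp
  have e2 : ∫ x, ‖∑ i ∈ B, mFourier i (toTorus (ε • x))‖ ^ 2 * f x
      = ∑ i ∈ B, ∑ j ∈ B, coupling w ε (j - i) := by
    apply Complex.ofReal_injective
    rw [← integral_complex_ofReal]
    have hi : ∀ k : Fin 2 → ℤ, Integrable (fun x => mFourier k (toTorus (ε • x)) * (f x : ℂ)) :=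
      fun k => hfi.ofReal.bdd_mul (c := 1) ((mFourier k).continuous.comp
        (continuous_toTorus.comp (continuous_const_smul ε))).aestronglyMeasurable
        (Filter.Eventually.of_forall fun y => (norm_mFourier_apply _ _).le)
    simp only [Complex.ofReal_mul, hFc, Finset.sum_mul]
    rw [integral_finsetSum _ fun i _ => integrable_finsetSum _ fun j _ => hi _]
    simp only [integral_finsetSum _ fun j _ => hi _]
    push_cast
    refine Finset.sum_congr rfl fun i _ => Finset.sum_congr rfl fun j _ => ?_
    rw [← hhat, hat_dualPoint, neg_sub]
  rw [e1, e2] at h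
  linarith

/-- If `S` lies in the box `Q N`, all its translates by points of `Q N` lie in `Q (2N)`. Hence `|Q
N|` copies of the sum over `S` fit into the double sum over `Q (2N)`, whose cardinality is at most
four times larger. The bound is uniform in `S` and yields summability as well. -/
lemma exists_sum_coupling_le (hw : IsInteraction w) : ∃ A, 0 ≤ A ∧ ∀ ε, 0 < ε → ε ≤ 1 →
    Summable (coupling w ε) ∧ ∑' k, coupling w ε k ≤ A * (ε ^ 2)⁻¹ := by
  obtain ⟨A, hA, h⟩ := sum_coupling_sub_le hw
  refine ⟨4 * A, by positivity, fun ε h0 h1 => ?_⟩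
  have key : ∀ S : Finset (Fin 2 → ℤ), ∑ k ∈ S, coupling w ε k ≤ 4 * A * (ε ^ 2)⁻¹ := by
    intro S
    obtain ⟨N, hN⟩ : ∃ N : ℕ, ∀ k ∈ S, ∀ i, |k i| ≤ N := by
      refine ⟨∑ k ∈ S, ∑ i, (k i).natAbs, fun k hk i => ?_⟩
      rw [Int.abs_eq_natAbs]
      have e1 : (k i).natAbs ≤ ∑ i, (k i).natAbs :=
        Finset.single_le_sum (f := fun i => (k i).natAbs) (fun _ _ => Nat.zero_le _)
          (Finset.mem_univ i)
      have e2 : ∑ i, (k i).natAbs ≤ ∑ k ∈ S, ∑ i, (k i).natAbs :=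
        Finset.single_le_sum (f := fun k : Fin 2 → ℤ => ∑ i, (k i).natAbs)
          (fun _ _ => Nat.zero_le _) hk
      exact_mod_cast e1.trans e2
    let Q : ℕ → Finset (Fin 2 → ℤ) := fun n => Finset.Icc (fun _ => -(n : ℤ)) (fun _ => (n : ℤ))
    have hQ : ∀ n, ((Q n).card : ℝ) = (2 * n + 1) ^ 2 := fun n => by
      have : (Q n).card = (2 * n + 1) ^ 2 := by
        simp only [Q, Pi.card_Icc, Int.card_Icc, Finset.prod_const, Finset.card_univ,
          Fintype.card_fin]
        congr 1
        omega
      rw [this]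
      push_cast
      ring
    have hmem : ∀ n (k : Fin 2 → ℤ), k ∈ Q n ↔ ∀ i, |k i| ≤ n := fun n k => by
      simp only [Q, Finset.mem_Icc, Pi.le_def, abs_le, forall_and]
    have hS : S ⊆ Q N := fun k hk => (hmem N k).mpr (hN k hk)
    have e1 : ((Q N).card : ℝ) * ∑ k ∈ S, coupling w ε k
        ≤ ∑ i ∈ Q (2 * N), ∑ j ∈ Q (2 * N), coupling w ε (j - i) := by
      rw [← nsmul_eq_mul, ← Finset.sum_const]
      refine (Finset.sum_le_sum fun i hi => ?_).trans (Finset.sum_le_sum_of_subset_of_nonneg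
        (s := Q N) (fun k hk => ?_) fun i _ _ => Finset.sum_nonneg fun j _ => coupling_nonneg hw ε _)
      · have e4 : ∑ k ∈ S, coupling w ε k
            = ∑ j ∈ S.map (addRightEmbedding i), coupling w ε (j - i) := by simp
        rw [e4]
        refine Finset.sum_le_sum_of_subset_of_nonneg (fun j hj => ?_) fun j _ _ =>
          coupling_nonneg hw ε _
        obtain ⟨k, hk, rfl⟩ := Finset.mem_map.mp hj
        rw [addRightEmbedding_apply, hmem]
        intro l
        have e5 := hN k hk l
        have e6 := (hmem N i).mp hi l
        have e7 := abs_add_le (k l) (i l)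
        push_cast
        rw [Pi.add_apply]
        linarith
      · rw [hmem] at hk ⊢
        intro i
        have := hk i
        push_cast
        linarith [abs_nonneg (k i)]
    have e2 := e1.trans (h ε h0 h1 (Q (2 * N)))
    rw [hQ, hQ] at e2
    have e3 : A * (ε ^ 2)⁻¹ * (2 * ((2 * N : ℕ) : ℝ) + 1) ^ 2
        ≤ (2 * (N : ℝ) + 1) ^ 2 * (4 * A * (ε ^ 2)⁻¹) := by
      have : (2 * ((2 * N : ℕ) : ℝ) + 1) ^ 2 ≤ 4 * (2 * (N : ℝ) + 1) ^ 2 := by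
        push_cast
        nlinarith [Nat.cast_nonneg (α := ℝ) N]
      calc _ ≤ A * (ε ^ 2)⁻¹ * (4 * (2 * (N : ℝ) + 1) ^ 2) := by gcongr
        _ = _ := by ring
    exact le_of_mul_le_mul_left (e2.trans e3) (by positivity)
  have hs := summable_of_sum_le (coupling_nonneg hw ε) key
  exact ⟨hs, hs.tsum_le_of_sum_le key⟩

end LatticeSums

/-! ## Logarithmic bounds -/

section LogBounds

lemma summable_and_tsum_le_of_ofReal {ι : Type*} {f : ι → ℝ} (hf : ∀ i, 0 ≤ f i) {c : ℝ} (hc : 0 ≤ c)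
    (h : ∑' i, ENNReal.ofReal (f i) ≤ ENNReal.ofReal c) : Summable f ∧ ∑' i, f i ≤ c := by
  have hs : Summable f := by
    refine (ENNReal.summable_toReal (f := fun i => ENNReal.ofReal (f i))
      (ne_top_of_le_ne_top ENNReal.ofReal_ne_top h)).congr fun i => ?_
    rw [ENNReal.toReal_ofReal (hf i)]
  rw [← ENNReal.ofReal_tsum_of_nonneg hf hs] at h
  exact ⟨hs, (ENNReal.ofReal_le_ofReal_iff hc).mp h⟩

lemma tsum_natAbs_le (F : ℕ → ℝ≥0∞) : ∑' a : ℤ, F a.natAbs ≤ 2 * ∑' n, F n := by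
  have h1 : HasSum (fun n : ℕ => F (n : ℤ).natAbs) (∑' n, F n) := by
    simpa using ENNReal.summable.hasSum
  have h2 : HasSum (fun n : ℕ => F (-((n : ℤ) + 1)).natAbs) (∑' n, F (n + 1)) := by
    have : ∀ n : ℕ, (-((n : ℤ) + 1)).natAbs = n + 1 := fun n => by omega
    simp only [this]
    exact ENNReal.summable.hasSum
  rw [(HasSum.of_nat_of_neg_add_one (f := fun a : ℤ => F a.natAbs) h1 h2).tsum_eq, two_mul]
  exact add_le_add le_rfl (ENNReal.tsum_comp_le_tsum_of_injective (add_left_injective 1) F)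

/-- Sums over the plane lattice of functions of the `ℓ¹` norm. -/
lemma tsum_lattice_le (g : ℕ → ℝ≥0∞) :
    ∑' k : Fin 2 → ℤ, g ((k 0).natAbs + (k 1).natAbs) ≤ 4 * ∑' n : ℕ, (n + 1) * g n := by
  calc ∑' k : Fin 2 → ℤ, g ((k 0).natAbs + (k 1).natAbs)
      = ∑' (a : ℤ) (b : ℤ), g (a.natAbs + b.natAbs) := by
        rw [← (finTwoArrowEquiv ℤ).symm.tsum_eq, ENNReal.tsum_prod']
        rfl
    _ ≤ ∑' a : ℤ, 2 * ∑' n, g (a.natAbs + n) :=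
        ENNReal.tsum_le_tsum fun a => tsum_natAbs_le fun n => g (a.natAbs + n)
    _ ≤ 2 * ∑' m : ℕ, 2 * ∑' n, g (m + n) := tsum_natAbs_le fun m => 2 * ∑' n, g (m + n)
    _ = 4 * ∑' (m : ℕ) (n : ℕ), g (m + n) := by
        rw [ENNReal.tsum_mul_left, ← mul_assoc]
        norm_num
    _ = _ := by
        rw [← ENNReal.tsum_prod,
          ← Finset.HasAntidiagonal.sigmaAntidiagonalEquivProd.tsum_eq, ENNReal.tsum_sigma']
        congr 2
        funext n
        rw [tsum_fintype]
        have h : ∀ q : {q : ℕ × ℕ // q ∈ Finset.HasAntidiagonal.antidiagonal n},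
            g (q.1.1 + q.1.2) = g n := fun q => by
          rw [Finset.HasAntidiagonal.mem_antidiagonal.mp q.2]
        simp only [Finset.HasAntidiagonal.sigmaAntidiagonalEquivProd_apply, h]
        simp

/-- The comparison of a sum with an integral in telescoping form, obtained from `log u ≤ u - 1` and
`exp v ≥ 1 + v`. It makes the constant `1/s` explicit, which matters since `s` will tend to zero. -/
lemma rpow_neg_le_sub {x s : ℝ} (hx : 0 < x) (hs : 0 < s) :
    (x + 1) ^ (-(1 + s)) ≤ (x ^ (-s) - (x + 1) ^ (-s)) / s := by
  have hx1 : 0 < x + 1 := by linarith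
  rw [le_div_iff₀ hs]
  have h1 : x ^ (-s) = (x + 1) ^ (-s) * (x / (x + 1)) ^ (-s) := by
    rw [← Real.mul_rpow hx1.le (by positivity)]
    congr 1
    field_simp
  have h2 : 1 + s / (x + 1) ≤ (x / (x + 1)) ^ (-s) := by
    rw [Real.rpow_def_of_pos (by positivity)]
    have h3 : Real.log (x / (x + 1)) ≤ -(1 / (x + 1)) := by
      have := Real.log_le_sub_one_of_pos (show 0 < x / (x + 1) by positivity)
      have h4 : x / (x + 1) - 1 = -(1 / (x + 1)) := by field_simp; ring
      linarith
    have h5 := Real.add_one_le_exp (Real.log (x / (x + 1)) * -s)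
    have h6 : s / (x + 1) ≤ Real.log (x / (x + 1)) * -s := by
      have := mul_le_mul_of_nonneg_right h3 hs.le
      have h7 : s / (x + 1) = 1 / (x + 1) * s := by ring
      linarith
    linarith
  have h3 : (x + 1) ^ (-(1 + s)) = (x + 1) ^ (-s) / (x + 1) := by
    have h4 : -(1 + s) = -s - 1 := by ring
    rw [h4, Real.rpow_sub_one hx1.ne']
  have h4 := mul_le_mul_of_nonneg_left h2 (Real.rpow_nonneg hx1.le (-s))
  rw [h1, h3]
  have h5 : (x + 1) ^ (-s) / (x + 1) * s = (x + 1) ^ (-s) * (1 + s / (x + 1)) - (x + 1) ^ (-s) := by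
    ring
  linarith

lemma tsum_rpow_le {s : ℝ} (hs : 0 < s) :
    ∑' n : ℕ, ENNReal.ofReal (((n : ℝ) + 1) ^ (-(1 + s))) ≤ ENNReal.ofReal (1 + 1 / s) := by
  refine ENNReal.tsum_le_of_sum_range_le fun N => ?_
  rw [← ENNReal.ofReal_sum_of_nonneg fun n _ => by positivity]
  refine ENNReal.ofReal_le_ofReal ?_
  have key : ∀ N : ℕ, ∑ n ∈ Finset.range (N + 1), ((n : ℝ) + 1) ^ (-(1 + s))
      ≤ 1 + (1 - ((N : ℝ) + 1) ^ (-s)) / s := by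
    intro N
    induction N with
    | zero => simp
    | succ N ih =>
      rw [Finset.sum_range_succ]
      have h := rpow_neg_le_sub (x := (N : ℝ) + 1) (by positivity) hs
      push_cast
      have h2 : (1 - ((N : ℝ) + 1 + 1) ^ (-s)) / s = (1 - ((N : ℝ) + 1) ^ (-s)) / s
          + (((N : ℝ) + 1) ^ (-s) - ((N : ℝ) + 1 + 1) ^ (-s)) / s := by ring
      linarith
  calc _ ≤ ∑ n ∈ Finset.range (N + 1), ((n : ℝ) + 1) ^ (-(1 + s)) :=
        Finset.sum_le_sum_of_subset_of_nonneg (Finset.range_mono (Nat.le_succ N))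
          fun n _ _ => by positivity
    _ ≤ _ := key N
    _ ≤ _ := by
      gcongr
      have : 0 ≤ ((N : ℝ) + 1) ^ (-s) := by positivity
      linarith

lemma sq_le_oneBodyEnergy (k : Fin 2 → ℤ) :
    ((((k 0).natAbs + (k 1).natAbs : ℕ) : ℝ) + 1) ^ 2 ≤ 3 * oneBodyEnergy k := by
  have hπ : (1 : ℝ) ≤ (2 * Real.pi) ^ 2 := by nlinarith [Real.pi_gt_three]
  have h0 : ∀ i, (((k i).natAbs : ℝ)) ^ 2 = (k i : ℝ) ^ 2 := fun i => by
    rw [Nat.cast_natAbs, Int.cast_abs, sq_abs]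
  have h1 : oneBodyEnergy k = (2 * Real.pi) ^ 2 * ((k 0 : ℝ) ^ 2 + (k 1 : ℝ) ^ 2) + 1 := by
    rw [oneBodyEnergy, Fin.sum_univ_two]
    ring
  have h2 : (k 0 : ℝ) ^ 2 + (k 1 : ℝ) ^ 2
      ≤ (2 * Real.pi) ^ 2 * ((k 0 : ℝ) ^ 2 + (k 1 : ℝ) ^ 2) :=
    le_mul_of_one_le_left (by positivity) hπ
  rw [← h0, ← h0] at h2 h1
  push_cast
  nlinarith [sq_nonneg (((k 0).natAbs : ℝ) - (k 1).natAbs), sq_nonneg (((k 0).natAbs : ℝ) - 1),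
    sq_nonneg (((k 1).natAbs : ℝ) - 1)]

/-- `∑ k, h_k^{-1-δ}` diverges at most like `1 / δ`. -/
lemma summable_rpow_oneBodyEnergy {δ : ℝ} (h0 : 0 < δ) (h1 : δ ≤ 1) :
    Summable (fun k => oneBodyEnergy k ^ (-(1 + δ))) ∧
      ∑' k, oneBodyEnergy k ^ (-(1 + δ)) ≤ 54 / δ := by
  refine summable_and_tsum_le_of_ofReal (fun k => Real.rpow_nonneg (oneBodyEnergy_pos k).le _)
    (by positivity) ?_
  let g : ℕ → ℝ≥0∞ := fun n => ENNReal.ofReal (9 * ((n : ℝ) + 1) ^ (-(2 + 2 * δ)))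
  have hk : ∀ k, ENNReal.ofReal (oneBodyEnergy k ^ (-(1 + δ)))
      ≤ g ((k 0).natAbs + (k 1).natAbs) := by
    intro k
    refine ENNReal.ofReal_le_ofReal ?_
    set N : ℝ := (((k 0).natAbs + (k 1).natAbs : ℕ) : ℝ) + 1 with hN
    have hNp : 0 < N := by positivity
    have h2 : N ^ 2 / 3 ≤ oneBodyEnergy k := by
      have := sq_le_oneBodyEnergy k
      linarith
    calc oneBodyEnergy k ^ (-(1 + δ)) ≤ (N ^ 2 / 3) ^ (-(1 + δ)) :=
          Real.rpow_le_rpow_of_nonpos (by positivity) h2 (by linarith)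
      _ = 3 ^ (1 + δ) * N ^ (-(2 + 2 * δ)) := by
          rw [Real.div_rpow (by positivity) (by norm_num), Real.rpow_neg (by norm_num : (0 : ℝ) ≤ 3),
            div_inv_eq_mul, mul_comm, ← Real.rpow_natCast, ← Real.rpow_mul hNp.le]
          congr 2
          push_cast
          ring
      _ ≤ 9 * N ^ (-(2 + 2 * δ)) := by
          gcongr
          calc (3 : ℝ) ^ (1 + δ) ≤ 3 ^ (2 : ℝ) :=
                Real.rpow_le_rpow_of_exponent_le (by norm_num) (by linarith)
            _ = 9 := by norm_num
  have hn : ∀ n : ℕ, ((n : ℝ≥0∞) + 1) * g n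
      = 9 * ENNReal.ofReal (((n : ℝ) + 1) ^ (-(1 + 2 * δ))) := by
    intro n
    have e1 : ((n : ℝ≥0∞) + 1) = ENNReal.ofReal ((n : ℝ) + 1) := by
      rw [ENNReal.ofReal_add (Nat.cast_nonneg n) zero_le_one, ENNReal.ofReal_natCast,
        ENNReal.ofReal_one]
    have e2 : (9 : ℝ≥0∞) = ENNReal.ofReal 9 := by simp
    rw [e1, e2, ← ENNReal.ofReal_mul (by positivity), ← ENNReal.ofReal_mul (by norm_num)]
    congr 1
    have e3 : -(1 + 2 * δ) = -(2 + 2 * δ) + 1 := by ring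
    rw [e3, Real.rpow_add_one (by positivity)]
    ring
  calc _ ≤ ∑' k : Fin 2 → ℤ, g ((k 0).natAbs + (k 1).natAbs) := ENNReal.tsum_le_tsum hk
    _ ≤ 4 * ∑' n : ℕ, (n + 1) * g n := tsum_lattice_le g
    _ = 4 * (9 * ∑' n : ℕ, ENNReal.ofReal (((n : ℝ) + 1) ^ (-(1 + 2 * δ)))) := by
        simp only [hn, ENNReal.tsum_mul_left]
    _ ≤ 4 * (9 * ENNReal.ofReal (1 + 1 / (2 * δ))) := by
        gcongr
        exact tsum_rpow_le (by linarith)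
    _ = ENNReal.ofReal (36 * (1 + 1 / (2 * δ))) := by
        rw [ENNReal.ofReal_mul (by norm_num), ← mul_assoc]
        congr 1
        norm_num
    _ ≤ _ := by
        refine ENNReal.ofReal_le_ofReal ?_
        rw [div_eq_mul_inv, div_eq_mul_inv, mul_inv]
        have : 1 ≤ δ⁻¹ := (one_le_inv₀ h0).mpr h1
        linarith

lemma oneBodyEnergy_le (p k : Fin 2 → ℤ) :
    oneBodyEnergy k ≤ 2 * oneBodyEnergy p + 2 * oneBodyEnergy (p + k) := by
  simp only [oneBodyEnergy, Fin.sum_univ_two, Pi.add_apply, Int.cast_add]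
  nlinarith [sq_nonneg (2 * Real.pi * p 0 + 2 * Real.pi * (p 0 + k 0)),
    sq_nonneg (2 * Real.pi * p 1 + 2 * Real.pi * (p 1 + k 1))]

/-- The larger of `x` and `y` is at least `z/4`. Of its inverse, the power `1 - δ` is converted into
decay in `z`, and the remaining `δ` is given to the smaller one to make its sum over the lattice
converge. -/
lemma inv_mul_inv_le {x y z δ : ℝ} (hx : 1 ≤ x) (hy : 1 ≤ y) (hz : 0 < z) (hxyz : z ≤ 2 * x + 2 * y)
    (h0 : 0 < δ) (h1 : δ ≤ 1) :
    x⁻¹ * y⁻¹ ≤ 4 * z ^ (-(1 - δ)) * (x ^ (-(1 + δ)) + y ^ (-(1 + δ))) := by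
  have key : ∀ x y : ℝ, 1 ≤ x → 1 ≤ y → z ≤ 2 * x + 2 * y → y ≤ x →
      x⁻¹ * y⁻¹ ≤ 4 * z ^ (-(1 - δ)) * y ^ (-(1 + δ)) := by
    intro x y hx hy hxyz hyx
    have hx0 : 0 < x := by linarith
    have hy0 : 0 < y := by linarith
    have e1 : x⁻¹ = x ^ (-(1 - δ)) * x ^ (-δ) := by
      rw [← Real.rpow_add hx0, ← Real.rpow_neg_one]
      congr 1
      ring
    have e2 : y ^ (-(1 + δ)) = y ^ (-δ) * y⁻¹ := by
      rw [← Real.rpow_neg_one, ← Real.rpow_add hy0]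
      congr 1
      ring
    have e3 : x ^ (-(1 - δ)) ≤ 4 * z ^ (-(1 - δ)) := by
      calc x ^ (-(1 - δ)) ≤ (z / 4) ^ (-(1 - δ)) :=
            Real.rpow_le_rpow_of_nonpos (by positivity) (by linarith) (by linarith)
        _ = 4 ^ (1 - δ) * z ^ (-(1 - δ)) := by
            rw [Real.div_rpow hz.le (by norm_num), Real.rpow_neg (by norm_num : (0 : ℝ) ≤ 4),
              div_inv_eq_mul, mul_comm]
        _ ≤ _ := by
            gcongr
            calc (4 : ℝ) ^ (1 - δ) ≤ 4 ^ (1 : ℝ) :=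
                  Real.rpow_le_rpow_of_exponent_le (by norm_num) (by linarith)
              _ = 4 := by norm_num
    have e4 : x ^ (-δ) ≤ y ^ (-δ) := Real.rpow_le_rpow_of_nonpos hy0 hyx (by linarith)
    rw [e1, e2, mul_assoc, mul_assoc (4 : ℝ)]
    have hz' : 0 ≤ z ^ (-(1 - δ)) := Real.rpow_nonneg hz.le _
    calc _ ≤ (4 * z ^ (-(1 - δ))) * (y ^ (-δ) * y⁻¹) := by gcongr
      _ = _ := by ring
  have hz' : 0 ≤ 4 * z ^ (-(1 - δ)) := by positivity
  have hx' : 0 ≤ x ^ (-(1 + δ)) := Real.rpow_nonneg (by linarith) _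
  have hy' : 0 ≤ y ^ (-(1 + δ)) := Real.rpow_nonneg (by linarith) _
  rw [mul_add]
  rcases le_total y x with h | h
  · have := key x y hx hy hxyz h
    have h2 := mul_nonneg hz' hx'
    linarith
  · have := key y x hy hx (by linarith) h
    have h2 := mul_nonneg hz' hy'
    rw [mul_comm]
    linarith

/-- The two-dimensional logarithm is traded for the factors `1/δ` and `h^δ`, with `δ` left free; at
`δ ~ 1/|log ε|` they cost one logarithm at energies up to order `ε⁻²`. -/
lemma bubble_le {δ : ℝ} (h0 : 0 < δ) (h1 : δ ≤ 1) (k : Fin 2 → ℤ) :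
    bubble k ≤ 432 / δ * oneBodyEnergy k ^ (-(1 - δ)) := by
  obtain ⟨hs, hle⟩ := summable_rpow_oneBodyEnergy h0 h1
  have hs' : Summable fun p => oneBodyEnergy (p + k) ^ (-(1 + δ)) :=
    (Equiv.addRight k).summable_iff.mpr hs
  have h2 := (summable_bubble k).tsum_le_tsum (fun p => inv_mul_inv_le (one_le_oneBodyEnergy p)
    (one_le_oneBodyEnergy (p + k)) (oneBodyEnergy_pos k) (oneBodyEnergy_le p k) h0 h1)
    ((hs.add hs').mul_left _)
  rw [tsum_mul_left, hs.tsum_add hs'] at h2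
  have h3 : ∑' p, oneBodyEnergy (p + k) ^ (-(1 + δ)) = ∑' p, oneBodyEnergy p ^ (-(1 + δ)) :=
    (Equiv.addRight k).tsum_eq (fun p => oneBodyEnergy p ^ (-(1 + δ)))
  change bubble k ≤ _ at h2
  rw [h3] at h2
  have hk : 0 ≤ 4 * oneBodyEnergy k ^ (-(1 - δ)) :=
    mul_nonneg (by norm_num) (Real.rpow_nonneg (oneBodyEnergy_pos k).le _)
  calc _ ≤ _ := h2
    _ ≤ 4 * oneBodyEnergy k ^ (-(1 - δ)) * (54 / δ + 54 / δ) := by gcongr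
    _ = _ := by ring

variable {w : EuclideanSpace ℝ (Fin 2) → ℝ} {lam ε : ℝ}

lemma exists_coupling_le (w : EuclideanSpace ℝ (Fin 2) → ℝ) : ∃ W, 0 ≤ W ∧ ∀ ε k, coupling w ε k ≤ W := by
  refine ⟨∫ x, ‖w x‖, MeasureTheory.integral_nonneg fun x => norm_nonneg _, fun ε k => ?_⟩
  refine (Complex.re_le_norm _).trans ((MeasureTheory.norm_integral_le_integral_norm _).trans_eq ?_)
  congr 1 with x
  rw [norm_mul, Complex.norm_real, Complex.norm_exp]
  simp

/-- Logarithmic bounds for the counterterms. -/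
lemma exists_counterterm_le (hw : IsInteraction w) : ∃ C, 0 ≤ C ∧ ∀ t, 0 ≤ t →
    tau w (Real.exp (-t)) ^ 2 + energyShift w (Real.exp (-t)) ≤ C * (1 + t) ^ 2 := by
  obtain ⟨A, hA, hAle⟩ := exists_sum_coupling_le hw
  obtain ⟨W, hW, hWle⟩ := exists_coupling_le w
  set M := Real.exp 4 with hM
  have hM0 : 0 < M := Real.exp_pos 4
  refine ⟨(54 * W * M + M * A) ^ 2 + 432 * (54 * W * M + M * A), by positivity, fun t ht => ?_⟩
  set ε := Real.exp (-t) with hε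
  -- With `t = |log ε|`, powers such as `ε^{-4δ}` stay bounded by a constant while each factor `1/δ`
  -- is exactly one logarithm.
  set δ := (1 + t)⁻¹ with hδ
  have h0 : 0 < δ := by positivity
  have h1 : δ ≤ 1 := inv_le_one_of_one_le₀ (by linarith)
  have htδ : t * δ ≤ 1 := by
    rw [hδ, ← div_eq_mul_inv, div_le_one (by linarith)]
    linarith
  have hε0 : 0 < ε := Real.exp_pos _
  obtain ⟨hs, hAε⟩ := hAle ε hε0 (Real.exp_le_one_iff.mpr (by linarith))
  obtain ⟨hsL, hL⟩ := summable_rpow_oneBodyEnergy h0 h1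
  have hε2 : (ε ^ 2)⁻¹ = Real.exp (2 * t) := by
    rw [hε, ← Real.exp_nat_mul, ← Real.exp_neg]
    congr 1
    push_cast
    ring
  -- The split is at energy `ε⁻² = exp (2t)`. Below it the missing power `h^{2δ}` is at most `e⁴`,
  -- which leaves a sum of size `1/δ`; above it the term is at most `e⁴ ε²`, matched to `∑ ŵ(εk) ≤ A
  -- ε⁻²`.
  have hpt : ∀ k, oneBodyEnergy k ^ (-(1 - δ))
      ≤ M * oneBodyEnergy k ^ (-(1 + δ)) + M * ε ^ 2 := by
    intro k
    have hk := oneBodyEnergy_pos k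
    by_cases hle : oneBodyEnergy k ≤ Real.exp (2 * t)
    · have e1 : oneBodyEnergy k ^ (-(1 - δ))
          = oneBodyEnergy k ^ (2 * δ) * oneBodyEnergy k ^ (-(1 + δ)) := by
        rw [← Real.rpow_add hk]
        congr 1
        ring
      have e2 : oneBodyEnergy k ^ (2 * δ) ≤ M := by
        calc _ ≤ Real.exp (2 * t) ^ (2 * δ) := Real.rpow_le_rpow hk.le hle (by positivity)
          _ = Real.exp (2 * t * (2 * δ)) := by rw [← Real.exp_mul]
          _ ≤ _ := Real.exp_le_exp.mpr (by linarith)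
      rw [e1]
      have e3 := mul_le_mul_of_nonneg_right e2 (Real.rpow_nonneg hk.le (-(1 + δ)))
      have : 0 ≤ M * ε ^ 2 := by positivity
      linarith
    · push Not at hle
      have e1 : oneBodyEnergy k ^ (-(1 - δ)) ≤ Real.exp (2 * t) ^ (-(1 - δ)) :=
        Real.rpow_le_rpow_of_nonpos (Real.exp_pos _) hle.le (by linarith)
      have e2 : Real.exp (2 * t) ^ (-(1 - δ)) ≤ M * ε ^ 2 := by
        rw [← Real.exp_mul, hM, hε, ← Real.exp_nat_mul, ← Real.exp_add]
        refine Real.exp_le_exp.mpr ?_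
        push_cast
        linarith
      have e3 : 0 ≤ M * oneBodyEnergy k ^ (-(1 + δ)) :=
        mul_nonneg hM0.le (Real.rpow_nonneg hk.le _)
      linarith
  have hX : ∀ k, coupling w ε k * oneBodyEnergy k ^ (-(1 - δ))
      ≤ W * M * oneBodyEnergy k ^ (-(1 + δ)) + M * ε ^ 2 * coupling w ε k := by
    intro k
    have e1 := mul_le_mul_of_nonneg_left (hpt k) (coupling_nonneg hw ε k)
    have e2 := mul_le_mul_of_nonneg_right (hWle ε k)
      (mul_nonneg hM0.le (Real.rpow_nonneg (oneBodyEnergy_pos k).le (-(1 + δ))))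
    linarith
  have hsX := (hsL.mul_left (W * M)).add (hs.mul_left (M * ε ^ 2))
  have hsY : Summable fun k => coupling w ε k * oneBodyEnergy k ^ (-(1 - δ)) :=
    Summable.of_nonneg_of_le (fun k => mul_nonneg (coupling_nonneg hw ε k)
      (Real.rpow_nonneg (oneBodyEnergy_pos k).le _)) hX hsX
  have hY : ∑' k, coupling w ε k * oneBodyEnergy k ^ (-(1 - δ))
      ≤ (54 * W * M + M * A) * (1 + t) := by
    refine (hsY.tsum_le_tsum hX hsX).trans ?_
    rw [(hsL.mul_left (W * M)).tsum_add (hs.mul_left (M * ε ^ 2)), tsum_mul_left, tsum_mul_left]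
    have e1 : W * M * ∑' k, oneBodyEnergy k ^ (-(1 + δ)) ≤ W * M * (54 / δ) := by gcongr
    have e2 : M * ε ^ 2 * ∑' k, coupling w ε k ≤ M * ε ^ 2 * (A * (ε ^ 2)⁻¹) := by gcongr
    have e3 : M * ε ^ 2 * (A * (ε ^ 2)⁻¹) = M * A := by
      field_simp
    have e4 : W * M * (54 / δ) = 54 * W * M * (1 + t) := by
      rw [hδ, div_inv_eq_mul]
      ring
    have e5 : M * A ≤ M * A * (1 + t) := le_mul_of_one_le_right (by positivity) (by linarith)
    linarith
  have hτ := hasSum_tau hw hs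
  have hE := hasSum_energyShift hw hs
  have hτ0 : 0 ≤ tau w ε := hτ.nonneg fun k =>
    mul_nonneg (coupling_nonneg hw ε k) (inv_oneBodyEnergy_pos k).le
  have hτle : tau w ε ≤ (54 * W * M + M * A) * (1 + t) := by
    refine le_trans (hasSum_le (fun k => ?_) hτ hsY.hasSum) hY
    refine mul_le_mul_of_nonneg_left ?_ (coupling_nonneg hw ε k)
    rw [← Real.rpow_neg_one]
    exact Real.rpow_le_rpow_of_exponent_le (one_le_oneBodyEnergy k) (by linarith)
  have hEle : energyShift w ε ≤ 432 / δ * ((54 * W * M + M * A) * (1 + t)) := by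
    refine le_trans (hasSum_le (fun k => ?_) hE (hsY.mul_left (432 / δ)).hasSum) ?_
    · have := mul_le_mul_of_nonneg_left (bubble_le h0 h1 k) (coupling_nonneg hw ε k)
      linarith
    · rw [tsum_mul_left]
      gcongr
  have e1 : 432 / δ = 432 * (1 + t) := by rw [hδ, div_inv_eq_mul]
  rw [e1] at hEle
  have e2 : tau w ε ^ 2 ≤ ((54 * W * M + M * A) * (1 + t)) ^ 2 := by gcongr
  linarith

lemma bose_le_rpow {x s : ℝ} (hx : 0 < x) (h1 : 1 ≤ s) (h2 : s ≤ 2) : bose x ≤ 2 * x ^ (-s) := by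
  rcases le_total x 1 with h | h
  · have e1 : x⁻¹ ≤ x ^ (-s) := by
      rw [← Real.rpow_neg_one]
      exact Real.rpow_le_rpow_of_exponent_ge hx h (by linarith)
    have e2 := bose_le_inv hx
    have e3 : 0 ≤ x ^ (-s) := Real.rpow_nonneg hx.le _
    linarith
  · have e1 : x⁻¹ ^ 2 ≤ x ^ (-s) := by
      have : x⁻¹ ^ 2 = x ^ (-2 : ℝ) := by
        rw [Real.rpow_neg hx.le, inv_pow]
        norm_cast
      rw [this]
      exact Real.rpow_le_rpow_of_exponent_le h (by linarith)
    have e2 := bose_le_inv_sq hx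
    linarith

/-- Interpolation between `bose x ≤ 1/x` and `bose x ≤ 2/x²` gives the power `1 + δ`, whose lattice
sum converges. The spare power of `λ` is affordable because `η < 1/2` strictly. -/
lemma rpow_mul_freeNumber_le (hlam : 0 < lam) {δ : ℝ} (h0 : 0 < δ) (h1 : δ ≤ 1) :
    lam ^ (1 + δ) * freeNumber lam ≤ 108 / δ := by
  obtain ⟨hs, hle⟩ := summable_rpow_oneBodyEnergy h0 h1
  rw [freeNumber_eq hlam, ← tsum_mul_left]
  have hk : ∀ k, lam ^ (1 + δ) * bose (lam * oneBodyEnergy k)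
      ≤ 2 * oneBodyEnergy k ^ (-(1 + δ)) := by
    intro k
    have e1 := mul_le_mul_of_nonneg_left (bose_le_rpow (mul_oneBodyEnergy_pos hlam k)
      (by linarith : 1 ≤ 1 + δ) (by linarith)) (Real.rpow_nonneg hlam.le (1 + δ))
    refine e1.trans_eq ?_
    rw [Real.mul_rpow hlam.le (oneBodyEnergy_pos k).le, mul_left_comm, ← mul_assoc (lam ^ (1 + δ)),
      ← Real.rpow_add hlam]
    simp
  refine (((summable_bose hlam).mul_left _).tsum_le_tsum hk (hs.mul_left 2)).trans ?_
  rw [tsum_mul_left]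
  calc 2 * ∑' k, oneBodyEnergy k ^ (-(1 + δ)) ≤ 2 * (54 / δ) := by gcongr
    _ = 108 / δ := by ring

end LogBounds

/-! ## Gibbs weights and doubly stochastic matrices -/

section Stochastic

lemma tsum_ofReal_of_hasSum {ι : Type*} {f : ι → ℝ} {a : ℝ} (hf : ∀ i, 0 ≤ f i)
    (h : HasSum f a) : ∑' i, ENNReal.ofReal (f i) = ENNReal.ofReal a := by
  rw [← h.tsum_eq, ENNReal.ofReal_tsum_of_nonneg hf h.summable]

lemma exp_neg_mul_one_add_le (x y : ℝ) : Real.exp (-x) * (1 + x - y) ≤ Real.exp (-y) := by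
  have h : Real.exp (-y) = Real.exp (-x) * Real.exp (x - y) := by
    rw [← Real.exp_add]
    ring_nf
  rw [h]
  refine mul_le_mul_of_nonneg_left ?_ (Real.exp_pos _).le
  linarith [Real.add_one_le_exp (x - y)]

variable {ι κ : Type*} {O : ι → κ → ℝ}

/-- Jensen's inequality. -/
lemma ofReal_exp_neg_le {o a : κ → ℝ} (ho : ∀ m, 0 ≤ o m) (h1 : HasSum o 1) {K : ℝ}
    (hK : HasSum (fun m => o m * a m) K) :
    ENNReal.ofReal (Real.exp (-K))
      ≤ ∑' m, ENNReal.ofReal (o m) * ENNReal.ofReal (Real.exp (-a m)) := by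
  by_cases h : ∑' m, ENNReal.ofReal (o m) * ENNReal.ofReal (Real.exp (-a m)) = ⊤
  · rw [h]
    exact le_top
  simp only [← ENNReal.ofReal_mul (ho _)] at h ⊢
  have h0 : ∀ m, 0 ≤ o m * Real.exp (-a m) := fun m => mul_nonneg (ho m) (Real.exp_pos _).le
  have h2 : Summable fun m => o m * Real.exp (-a m) := by
    have := ENNReal.summable_toReal h
    simpa only [ENNReal.toReal_ofReal (h0 _)] using this
  rw [tsum_ofReal_of_hasSum h0 h2.hasSum]
  refine ENNReal.ofReal_le_ofReal ?_
  have h3 : HasSum (fun m => Real.exp (-K) * (o m * (1 + K) - o m * a m))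
      (Real.exp (-K) * (1 * (1 + K) - K)) := ((h1.mul_right _).sub hK).mul_left _
  have h4 := hasSum_le (fun m => ?_) h3 h2.hasSum
  · linarith
  have h5 := mul_le_mul_of_nonneg_left (exp_neg_mul_one_add_le K (a m)) (ho m)
  linarith

/-- Jensen's inequality in each row, followed by summation over the columns: averaging energies with
a doubly stochastic matrix can only decrease the partition function. -/
lemma tsum_exp_neg_le (hO : ∀ i m, 0 ≤ O i m) (h1 : ∀ i, HasSum (O i) 1)
    (h2 : ∀ m, HasSum (fun i => O i m) 1) {a : κ → ℝ} {K : ι → ℝ}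
    (hK : ∀ i, HasSum (fun m => O i m * a m) (K i)) :
    ∑' i, ENNReal.ofReal (Real.exp (-K i)) ≤ ∑' m, ENNReal.ofReal (Real.exp (-a m)) := by
  refine (ENNReal.tsum_le_tsum fun i => ofReal_exp_neg_le (hO i) (h1 i) (hK i)).trans ?_
  rw [ENNReal.tsum_comm]
  refine ENNReal.tsum_le_tsum fun m => ?_
  rw [ENNReal.tsum_mul_right, tsum_ofReal_of_hasSum (fun i => hO i m) (h2 m)]
  simp

lemma tsum_exp_neg_le_of_lower_bound (hO : ∀ i m, 0 ≤ O i m) (h1 : ∀ i, HasSum (O i) 1)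
    (h2 : ∀ m, HasSum (fun i => O i m) 1) {a : κ → ℝ} {K μ : ι → ℝ}
    (hK : ∀ i, HasSum (fun m => O i m * a m) (K i)) {c : ℝ} (hμ : ∀ i, K i - c ≤ μ i) :
    ∑' i, ENNReal.ofReal (Real.exp (-μ i))
      ≤ ENNReal.ofReal (Real.exp c) * ∑' m, ENNReal.ofReal (Real.exp (-a m)) := by
  refine le_trans ?_ (mul_le_mul_right (tsum_exp_neg_le hO h1 h2 hK) _)
  rw [← ENNReal.tsum_mul_left]
  refine ENNReal.tsum_le_tsum fun i => ?_
  rw [← ENNReal.ofReal_mul (Real.exp_pos _).le, ← Real.exp_add]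
  exact ENNReal.ofReal_le_ofReal (Real.exp_le_exp.mpr (by linarith [hμ i]))

/-- The Peierls–Bogoliubov inequality. -/
lemma le_tsum_exp_neg (hO : ∀ i m, 0 ≤ O i m) (h1 : ∀ i, HasSum (O i) 1)
    (h2 : ∀ m, HasSum (fun i => O i m) 1) {a V U : κ → ℝ} {μ : ι → ℝ}
    (hμ : ∀ m, HasSum (fun i => O i m * μ i) (a m + V m)) (hV : ∀ m, V m ≤ U m) {q : κ → ℝ}
    {Z u : ℝ} (hZ : 0 < Z) (hq : ∀ m, q m = Z⁻¹ * Real.exp (-a m)) (hq1 : HasSum q 1)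
    (hu : HasSum (fun m => q m * U m) u) :
    ENNReal.ofReal (Z * Real.exp (-u)) ≤ ∑' i, ENNReal.ofReal (Real.exp (-μ i)) := by
  -- Jensen is used twice: here with the transposed matrix, to pass from eigenvalues to diagonal
  -- energies, and then for the free Gibbs weights `q`, to pull out the mean of `U`.
  refine le_trans ?_ (tsum_exp_neg_le (fun m i => hO i m) h2 h1 hμ)
  have hq0 : ∀ m, 0 ≤ q m := fun m => by
    rw [hq]
    positivity
  have h3 := mul_le_mul_right (ofReal_exp_neg_le hq0 hq1 hu) (ENNReal.ofReal Z)
  rw [← ENNReal.ofReal_mul hZ.le, ← ENNReal.tsum_mul_left] at h3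
  refine h3.trans (ENNReal.tsum_le_tsum fun m => ?_)
  rw [← ENNReal.ofReal_mul (hq0 m), ← ENNReal.ofReal_mul hZ.le, hq]
  refine ENNReal.ofReal_le_ofReal ?_
  have h4 : Z * (Z⁻¹ * Real.exp (-a m) * Real.exp (-U m)) = Real.exp (-a m + -U m) := by
    rw [Real.exp_add]
    field_simp
  rw [h4]
  exact Real.exp_le_exp.mpr (by linarith [hV m])

lemma log_inv_mul_exp {Z : ℝ} (hZ : 0 < Z) (x : ℝ) :
    Real.log (Z⁻¹ * Real.exp (-x)) = -Real.log Z - x := by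
  rw [Real.log_mul (inv_ne_zero hZ.ne') (Real.exp_ne_zero _), Real.log_inv, Real.log_exp]
  ring

/-- The Gibbs variational principle in the form of a bound on the relative entropy. -/
lemma tsum_entropyTerm_le (hO : ∀ i m, 0 ≤ O i m) (h1 : ∀ i, HasSum (O i) 1)
    (h2 : ∀ m, HasSum (fun i => O i m) 1) {a : κ → ℝ} {K D μ : ι → ℝ} {c c' Z Z₀ : ℝ}
    (hK : ∀ i, HasSum (fun m => O i m * a m) (K i)) (hD : ∀ i, 0 ≤ D i)
    (hμ : ∀ i, K i + D i - c ≤ μ i) (hZ : 0 < Z) (hZ₀ : 0 < Z₀)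
    (hc' : Real.log Z₀ - Real.log Z ≤ c') {p : ι → ℝ} {q : κ → ℝ}
    (hp : ∀ i, p i = Z⁻¹ * Real.exp (-μ i)) (hq : ∀ m, q m = Z₀⁻¹ * Real.exp (-a m))
    (hp1 : HasSum p 1) (hq1 : HasSum q 1) :
    ∑' i, ∑' m, ENNReal.ofReal (O i m) * entropyTerm (p i) (q m)
      + ∑' i, ENNReal.ofReal (p i) * ENNReal.ofReal (D i) ≤ ENNReal.ofReal (c + c') := by
  have hp0 : ∀ i, 0 < p i := fun i => by
    rw [hp]
    positivity
  have hq0 : ∀ m, 0 < q m := fun m => by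
    rw [hq]
    positivity
  have hOq : ∀ i, Summable fun m => O i m * q m := fun i => by
    refine Summable.of_nonneg_of_le (fun m => mul_nonneg (hO i m) (hq0 m).le) (fun m => ?_)
      hq1.summable
    exact mul_le_of_le_one_left (hq0 m).le
      ((le_hasSum (h1 i) m fun _ _ => hO i _).trans le_rfl)
  have hOq0 : ∀ i, 0 ≤ ∑' m, O i m * q m := fun i =>
    tsum_nonneg fun m => mul_nonneg (hO i m) (hq0 m).le
  have hQ : ∑' i, ENNReal.ofReal (∑' m, O i m * q m) = 1 := by
    calc ∑' i, ENNReal.ofReal (∑' m, O i m * q m)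
        = ∑' i, ∑' m, ENNReal.ofReal (O i m) * ENNReal.ofReal (q m) := by
          congr 1
          funext i
          rw [ENNReal.ofReal_tsum_of_nonneg (fun m => mul_nonneg (hO i m) (hq0 m).le) (hOq i)]
          simp only [ENNReal.ofReal_mul (hO i _)]
      _ = ∑' m, (∑' i, ENNReal.ofReal (O i m)) * ENNReal.ofReal (q m) := by
          rw [ENNReal.tsum_comm]
          simp only [ENNReal.tsum_mul_right]
      _ = 1 := by
          simp only [fun m => tsum_ofReal_of_hasSum (fun i => hO i m) (h2 m), ENNReal.ofReal_one,
            one_mul]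
          rw [tsum_ofReal_of_hasSum (fun m => (hq0 m).le) hq1, ENNReal.ofReal_one]
  have hterm : ∀ i m, entropyTerm (p i) (q m)
      = ENNReal.ofReal (p i * (a m - μ i + Real.log Z₀ - Real.log Z - 1) + q m) := fun i m => by
    rw [entropyTerm, if_neg fun h => (hq0 m).ne' h.1]
    congr 1
    nth_rw 2 [hp]
    nth_rw 1 [hq]
    rw [log_inv_mul_exp hZ, log_inv_mul_exp hZ₀]
    ring
  have hterm0 : ∀ i m, 0 ≤ p i * (a m - μ i + Real.log Z₀ - Real.log Z - 1) + q m := fun i m => by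
    have h3 : Real.log (q m / p i) = μ i - a m + Real.log Z - Real.log Z₀ := by
      rw [Real.log_div (hq0 m).ne' (hp0 i).ne', hp, hq, log_inv_mul_exp hZ, log_inv_mul_exp hZ₀]
      ring
    have h4 := Real.log_le_sub_one_of_pos (div_pos (hq0 m) (hp0 i))
    have h5 := mul_le_mul_of_nonneg_left h4 (hp0 i).le
    have h6 : p i * (q m / p i - 1) = q m - p i := by
      have := (hp0 i).ne'
      field_simp
    rw [h3, h6] at h5
    linarith
  -- The terms `-p + q` of the entropy are kept as `p i` on the left and `∑ m, O i m * q m` on the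
  -- right, so nothing is subtracted in `[0, ∞]`. Both sum to one over `i` and cancel at the end.
  have hrow : ∀ i, ∑' m, ENNReal.ofReal (O i m) * entropyTerm (p i) (q m)
      + ENNReal.ofReal (p i) * ENNReal.ofReal (D i) + ENNReal.ofReal (p i)
      ≤ ENNReal.ofReal (c + c') * ENNReal.ofReal (p i)
        + ENNReal.ofReal (∑' m, O i m * q m) := fun i => by
    have h3 : HasSum (fun m => O i m * (p i * (a m - μ i + Real.log Z₀ - Real.log Z - 1) + q m))
        (p i * (K i - μ i + Real.log Z₀ - Real.log Z - 1) + ∑' m, O i m * q m) := by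
      have h4 := (((hK i).mul_left (p i)).add
        ((h1 i).mul_left (p i * (-μ i + Real.log Z₀ - Real.log Z - 1)))).add (hOq i).hasSum
      convert! h4 using 1
      · funext m
        ring
      · ring
    have h5 : ∀ m, 0 ≤ O i m * (p i * (a m - μ i + Real.log Z₀ - Real.log Z - 1) + q m) :=
      fun m => mul_nonneg (hO i m) (hterm0 i m)
    simp only [hterm, ← ENNReal.ofReal_mul (hO i _)]
    rw [tsum_ofReal_of_hasSum h5 h3, ← ENNReal.ofReal_mul (hp0 i).le,
      ← ENNReal.ofReal_add (h3.nonneg h5) (mul_nonneg (hp0 i).le (hD i)),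
      ← ENNReal.ofReal_add (add_nonneg (h3.nonneg h5) (mul_nonneg (hp0 i).le (hD i))) (hp0 i).le,
      ← ENNReal.ofReal_mul' (hp0 i).le]
    refine le_trans (ENNReal.ofReal_le_ofReal ?_) ENNReal.ofReal_add_le
    have h6 := mul_le_mul_of_nonneg_left (show K i + D i - μ i + Real.log Z₀ - Real.log Z ≤ c + c'
      by linarith [hμ i]) (hp0 i).le
    linarith
  have hsum := ENNReal.tsum_le_tsum hrow
  rw [ENNReal.tsum_add, ENNReal.tsum_add, ENNReal.tsum_add, ENNReal.tsum_mul_left, hQ,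
    tsum_ofReal_of_hasSum (fun i => (hp0 i).le) hp1, ENNReal.ofReal_one, mul_one] at hsum
  exact (ENNReal.add_le_add_iff_right ENNReal.one_ne_top).mp hsum

/-- The Gibbs weights `p` are compared with the reference weights `exp(-K i)/Z'`, whose total is at
most one by `tsum_exp_neg_le`. The pointwise bound `e^u ≥ 1 + u` for the ratio, multiplied by `p`
and summed, bounds the mean of the test observable `A`. -/
lemma hasSum_variational_le (hO : ∀ i m, 0 ≤ O i m) (h1 : ∀ i, HasSum (O i) 1)
    (h2 : ∀ m, HasSum (fun i => O i m) 1) {a : κ → ℝ} {A K μ : ι → ℝ} {c Z Z' s : ℝ}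
    (hK : ∀ i, HasSum (fun m => O i m * a m) (K i)) (hμ : ∀ i, K i + A i - c ≤ μ i)
    (hZ : 0 < Z) (hZ' : 0 < Z')
    (ha : ∑' m, ENNReal.ofReal (Real.exp (-a m)) ≤ ENNReal.ofReal Z') {p : ι → ℝ}
    (hp : ∀ i, p i = Z⁻¹ * Real.exp (-μ i)) (hp1 : HasSum p 1)
    (hs : HasSum (fun i => p i * A i) s) : s ≤ c + Real.log Z' - Real.log Z := by
  have h3 := summable_and_tsum_le_of_ofReal (fun i => (Real.exp_pos (-K i)).le) hZ'.le
    ((tsum_exp_neg_le hO h1 h2 hK).trans ha)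
  have h4 : HasSum (fun i => p i * A i + p i * (1 - c - Real.log Z' + Real.log Z))
      (s + 1 * (1 - c - Real.log Z' + Real.log Z)) := hs.add (hp1.mul_right _)
  have h5 : HasSum (fun i => Z'⁻¹ * Real.exp (-K i)) (Z'⁻¹ * ∑' i, Real.exp (-K i)) :=
    h3.1.hasSum.mul_left _
  have h6 := hasSum_le (fun i => ?_) h4 h5
  · have h7 : Z'⁻¹ * ∑' i, Real.exp (-K i) ≤ 1 := by
      rw [inv_mul_le_iff₀ hZ', mul_one]
      exact h3.2
    linarith
  have h7 : Z'⁻¹ * Real.exp (-K i)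
      = p i * Real.exp (μ i - K i - Real.log Z' + Real.log Z) := by
    rw [hp, Real.exp_add, Real.exp_sub, Real.exp_sub, Real.exp_log hZ, Real.exp_log hZ',
      Real.exp_neg, Real.exp_neg]
    have := Real.exp_pos (μ i)
    have := Real.exp_pos (K i)
    field_simp
  have hp0 : 0 ≤ p i := by
    rw [hp]
    positivity
  rw [h7, ← mul_add]
  refine mul_le_mul_of_nonneg_left ?_ hp0
  have := Real.add_one_le_exp (μ i - K i - Real.log Z' + Real.log Z)
  linarith [hμ i]

end Stochastic

/-! ## The change of the free partition function under a perturbation of the mode energies -/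

section ModePerturbation

/-- The remainder series starts at order two, so each of its terms contains `x²` and the remaining
powers of `x` are at most one. -/
lemma exp_sub_one_sub_le {x y : ℝ} (hy : 0 ≤ y) (hx : |x| ≤ 1) :
    Real.exp (x * y) - 1 - x * y ≤ x ^ 2 * (Real.exp y - 1 - y) := by
  have h : ∀ z : ℝ, HasSum (fun n : ℕ => z ^ (n + 2) / (n + 2).factorial) (Real.exp z - 1 - z) := by
    intro z
    have h1 := NormedSpace.expSeries_div_hasSum_exp (𝔸 := ℝ) z
    rw [← Real.exp_eq_exp_ℝ, ← hasSum_nat_add_iff' 2] at h1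
    simpa [Finset.sum_range_succ, sub_sub] using h1
  refine hasSum_le (fun n => ?_) (h (x * y)) ((h y).mul_left (x ^ 2))
  rw [← mul_div_assoc]
  refine div_le_div_of_nonneg_right ?_ (Nat.cast_nonneg _)
  have h1 : x ^ n ≤ 1 := (le_abs_self _).trans (by
    rw [abs_pow]
    exact pow_le_one₀ (abs_nonneg x) hx)
  calc (x * y) ^ (n + 2) = x ^ n * (x ^ 2 * y ^ (n + 2)) := by ring
    _ ≤ 1 * (x ^ 2 * y ^ (n + 2)) := by gcongr
    _ = _ := one_mul _

lemma neg_log_one_sub_le {z : ℝ} (hz : |z| ≤ 1 / 2) : -Real.log (1 - z) ≤ z + z ^ 2 := by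
  have h := abs_le.mp hz
  have h1 : (1 - z)⁻¹ ≤ Real.exp (z + z ^ 2) := by
    rw [inv_le_iff_one_le_mul₀ (by linarith)]
    -- For `z ≥ 0` the quadratic term of the exponential is needed; for `z ≤ 0` the linear lower
    -- bound suffices.
    rcases le_total 0 z with h0 | h0
    · have h2 := Real.quadratic_le_exp_of_nonneg (show 0 ≤ z + z ^ 2 by positivity)
      have h3 : 0 ≤ z ^ 2 * ((1 - 2 * z) * (1 + z)) / 2 + (1 - z) * z ^ 4 / 2 := by
        have h4 : 0 ≤ 1 - 2 * z := by linarith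
        have h5 : 0 ≤ 1 - z := by linarith
        positivity
      have h4 := mul_le_mul_of_nonneg_right h2 (show 0 ≤ 1 - z by linarith)
      nlinarith
    · have h2 := mul_le_mul_of_nonneg_right (Real.add_one_le_exp (z + z ^ 2))
        (show 0 ≤ 1 - z by linarith)
      have h3 : z * z ^ 2 ≤ 0 := mul_nonpos_of_nonpos_of_nonneg h0 (sq_nonneg z)
      nlinarith
  rw [← Real.log_inv]
  exact (Real.log_le_log (inv_pos.mpr (by linarith)) h1).trans (Real.log_exp _).le

/-- With `z = bose y (e^{xy} - 1)` the ratio of mode partition functions is `(1 - z)⁻¹`. The bound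
`y bose y ≤ 1` gives `|z| ≤ |x|`, and expanding the exponential and the logarithm costs `x²` each.
The error does not depend on `y`, which is what allows a sum over all modes. -/
lemma log_one_add_bose_sub_le {x y : ℝ} (hy : 0 < y) (hx : |x| ≤ 1 / 2) :
    Real.log (1 + bose (y - x * y)) - Real.log (1 + bose y) ≤ x * y * bose y + 2 * x ^ 2 := by
  have hx' := abs_le.mp hx
  have hy' : 0 < y - x * y := by nlinarith
  have hb := bose_pos hy
  have hbe : bose y * (Real.exp y - 1) = 1 := by
    rw [bose]
    exact inv_mul_cancel₀ (by linarith [Real.add_one_lt_exp hy.ne'])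
  set z := bose y * (Real.exp (x * y) - 1) with hz
  have h1 := exp_sub_one_sub_le hy.le (hx.trans (by norm_num : (1 : ℝ) / 2 ≤ 1))
  have h2 : bose y * (Real.exp (x * y) - 1 - x * y) ≤ x ^ 2 := by
    have h3 := mul_le_mul_of_nonneg_left h1 hb.le
    have h4 : bose y * (x ^ 2 * (Real.exp y - 1 - y)) = x ^ 2 - x ^ 2 * (bose y * y) := by
      linear_combination x ^ 2 * hbe
    have h5 : 0 ≤ x ^ 2 * (bose y * y) := by positivity
    linarith
  have hby : bose y * y ≤ 1 := by
    have h3 : y ≤ Real.exp y - 1 := by linarith [Real.add_one_le_exp y]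
    calc bose y * y ≤ bose y * (Real.exp y - 1) := by gcongr
      _ = 1 := hbe
  have hzx : |z| ≤ |x| := by
    have h3 : z = x * (bose y * y) + bose y * (Real.exp (x * y) - 1 - x * y) := by
      rw [hz]
      ring
    have h4 : 0 ≤ bose y * (Real.exp (x * y) - 1 - x * y) :=
      mul_nonneg hb.le (by linarith [Real.add_one_le_exp (x * y)])
    have h5 : bose y * (Real.exp (x * y) - 1 - x * y) ≤ |x| * (1 - bose y * y) := by
      have h6 := mul_le_mul_of_nonneg_left h1 hb.le
      have h7 : bose y * (x ^ 2 * (Real.exp y - 1 - y)) = x ^ 2 * (1 - bose y * y) := by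
        linear_combination x ^ 2 * hbe
      have h8 : x ^ 2 ≤ |x| := by
        rw [← sq_abs]
        nlinarith [abs_nonneg x]
      rw [h7] at h6
      exact h6.trans (mul_le_mul_of_nonneg_right h8 (by linarith))
    rw [h3]
    refine (abs_add_le _ _).trans ?_
    rw [abs_mul, abs_of_nonneg h4, abs_of_nonneg (show 0 ≤ bose y * y by positivity)]
    linarith
  have h3 : 1 + bose (y - x * y) = (1 + bose y) * (1 - z)⁻¹ := by
    rw [one_add_bose hy', one_add_bose hy, ← mul_inv]
    congr 1
    rw [hz, bose_eq hy, show -(y - x * y) = -y + x * y by ring, Real.exp_add]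
    have := exp_neg_lt_one hy
    have h4 : 1 - Real.exp (-y) ≠ 0 := by linarith
    field_simp
    ring
  have hz1 := abs_le.mp (hzx.trans hx)
  rw [h3, Real.log_mul (by linarith) (inv_ne_zero (by linarith)), Real.log_inv]
  have h4 := neg_log_one_sub_le (hzx.trans hx)
  have h5 : z ^ 2 ≤ x ^ 2 := sq_le_sq.mpr hzx
  have h6 : z = x * y * bose y + bose y * (Real.exp (x * y) - 1 - x * y) := by
    rw [hz]
    ring
  linarith

end ModePerturbation

/-! ## Estimates for the interacting Gibbs state -/

section GibbsEstimates

variable {w : EuclideanSpace ℝ (Fin 2) → ℝ} {lam ε : ℝ}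

/-- The lower bound for the renormalized potential is the negative of this number. -/
def counterterm (w : EuclideanSpace ℝ (Fin 2) → ℝ) (ε : ℝ) : ℝ := tau w ε ^ 2 + energyShift w ε

/-- An upper bound for the expectation of the renormalized potential in the free Gibbs state. -/
def meanInteraction (w : EuclideanSpace ℝ (Fin 2) → ℝ) (lam ε : ℝ) : ℝ :=
  lam ^ 2 / 2 * (freeNumber lam * ∑' k, coupling w ε k)

lemma counterterm_nonneg (hw : IsInteraction w) (hs : Summable (coupling w ε)) :
    0 ≤ counterterm w ε :=
  add_nonneg (sq_nonneg _) (energyShift_nonneg hw hs)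

lemma meanInteraction_nonneg (hw : IsInteraction w) : 0 ≤ meanInteraction w lam ε :=
  mul_nonneg (by positivity)
    (mul_nonneg (freeNumber_nonneg lam) (tsum_nonneg (coupling_nonneg hw ε)))

lemma freePartition_toReal_pos (hlam : 0 < lam) :
    0 < (partitionFunction (freeHamiltonian lam)).toReal :=
  ENNReal.toReal_pos (freePartition_ne_zero hlam.le) (freePartition_ne_top hlam)

lemma tsum_exp_neg_occupationEnergy (hlam : 0 < lam) :
    ∑' m, ENNReal.ofReal (Real.exp (-(lam * occupationEnergy m)))
      = partitionFunction (freeHamiltonian lam) :=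
  ((freeSystem hlam.le).partitionFunction_eq).symm

namespace FockEigenbasis

section Number

variable {g : ∀ n, BoundedFunction (Fin n × Fin 2)} (B : FockEigenbasis g lam)

lemma tsum_mul_sq_norm (F : ℕ → ℝ≥0∞) (i : B.ι) :
    ∑' n : ℕ, F n * ENNReal.ofReal (‖B.basis i n‖ ^ 2) = F (B.number i) := by
  rw [tsum_eq_single (B.number i)]
  · have h : ‖B.basis i (B.number i)‖ = 1 := by
      change ‖component (B.basis i) (B.number i)‖ = 1
      rw [B.component_basis, B.norm_wave]
    rw [h]
    simp
  · intro n hn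
    have h : ‖B.basis i n‖ = 0 := by
      change ‖component (B.basis i) n‖ = 0
      rw [B.basis_eq, component_single_of_ne _ hn, norm_zero]
    rw [h]
    simp

lemma numberVarianceForm_basis (M : ℝ) (i : B.ι) :
    numberVarianceForm M (B.basis i) = ENNReal.ofReal (((B.number i : ℝ) - M) ^ 2) :=
  B.tsum_mul_sq_norm (fun n => ENNReal.ofReal (((n : ℝ) - M) ^ 2)) i

/-- The mean occupation number of the mode `k` in an eigenvector. -/
def meanOccupation (i : B.ι) (k : Fin 2 → ℤ) : ℝ := ∑' m, B.overlap i m * m k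

lemma overlap_mul_le (i : B.ι) (k : Fin 2 → ℤ) (m : (Fin 2 → ℤ) →₀ ℕ) :
    B.overlap i m * m k ≤ B.overlap i m * B.number i := by
  by_cases h : m.degree = B.number i
  · refine mul_le_mul_of_nonneg_left ?_ (B.overlap_nonneg i m)
    rw [← h]
    exact_mod_cast Finsupp.le_degree k m
  · rw [B.overlap_eq_zero i h, zero_mul, zero_mul]

lemma hasSum_meanOccupation (i : B.ι) (k : Fin 2 → ℤ) :
    HasSum (fun m => B.overlap i m * m k) (B.meanOccupation i k) :=
  (Summable.of_nonneg_of_le (fun m => mul_nonneg (B.overlap_nonneg i m) (Nat.cast_nonneg _))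
    (B.overlap_mul_le i k) ((B.hasSum_overlap_left i).summable.mul_right _)).hasSum

lemma meanOccupation_nonneg (i : B.ι) (k : Fin 2 → ℤ) : 0 ≤ B.meanOccupation i k :=
  tsum_nonneg fun m => mul_nonneg (B.overlap_nonneg i m) (Nat.cast_nonneg _)

lemma meanOccupation_le (i : B.ι) (k : Fin 2 → ℤ) : B.meanOccupation i k ≤ B.number i := by
  have h := hasSum_le (B.overlap_mul_le i k) (B.hasSum_meanOccupation i k)
    ((B.hasSum_overlap_left i).mul_right (B.number i : ℝ))
  rwa [one_mul] at h

end Number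

variable {hw : IsInteraction w} {hs : Summable (coupling w ε)} {hlam : 0 < lam}

lemma le_potential (B : FockEigenbasis (interactionFunction hw hs hlam) lam) (i : B.ι) :
    lam ^ 2 / 4 * ((B.number i : ℝ) - freeNumber lam) ^ 2 - counterterm w ε ≤ B.potential i := by
  have h := le_inner_mulOperator_self (interactionFunction hw hs hlam (B.number i))
    (fun x => le_renormalizedPotential hw hs hlam x) (B.wave i)
  rw [B.norm_wave, one_pow, mul_one] at h
  exact h

lemma kinetic_nonneg (B : FockEigenbasis (interactionFunction hw hs hlam) lam)
    (i : B.ι) : 0 ≤ B.eigenvalue i - B.potential i :=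
  (B.hasSum_kinetic hlam.le i).nonneg fun m =>
    mul_nonneg (B.overlap_nonneg i m) (mul_nonneg hlam.le (occupationEnergy_nonneg m))

lemma le_eigenvalue (B : FockEigenbasis (interactionFunction hw hs hlam) lam)
    (i : B.ι) : B.eigenvalue i - B.potential i
    + lam ^ 2 / 4 * ((B.number i : ℝ) - freeNumber lam) ^ 2 - counterterm w ε
      ≤ B.eigenvalue i := by
  linarith [B.le_potential i]

/-- The eigenvectors of the interacting Hamiltonian. -/
def system (B : FockEigenbasis (interactionFunction hw hs hlam) lam)
    : EigenSystem (interactingHamiltonian w lam ε) where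
  ι := B.ι
  basis := B.basis
  energy := B.eigenvalue
  mem i := by
    rw [interactingHamiltonian_eq hw hs hlam]
    exact B.mem i
  lower := -counterterm w ε
  lower_le i := by
    have h1 := B.le_eigenvalue i
    have h2 := B.kinetic_nonneg i
    have h3 : 0 ≤ lam ^ 2 / 4 * ((B.number i : ℝ) - freeNumber lam) ^ 2 := by positivity
    linarith
  symm u hu v hv := by
    rw [interactingHamiltonian_eq hw hs hlam] at hu hv
    exact hamiltonianGraph_symm u hu v hv

lemma partitionFunction_eq (B : FockEigenbasis (interactionFunction hw hs hlam) lam)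
    : partitionFunction (interactingHamiltonian w lam ε)
    = ∑' i, ENNReal.ofReal (Real.exp (-B.eigenvalue i)) :=
  B.system.partitionFunction_eq

lemma partitionFunction_le (B : FockEigenbasis (interactionFunction hw hs hlam) lam)
    : partitionFunction (interactingHamiltonian w lam ε)
    ≤ ENNReal.ofReal (Real.exp (counterterm w ε))
      * partitionFunction (freeHamiltonian lam) := by
  rw [B.partitionFunction_eq, ← tsum_exp_neg_occupationEnergy hlam]
  refine tsum_exp_neg_le_of_lower_bound B.overlap_nonneg B.hasSum_overlap_left
    B.hasSum_overlap_right (B.hasSum_kinetic hlam.le) fun i => ?_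
  have h1 := B.le_eigenvalue i
  have h3 : 0 ≤ lam ^ 2 / 4 * ((B.number i : ℝ) - freeNumber lam) ^ 2 := by positivity
  linarith

/-- The Peierls–Bogoliubov inequality with the free state as trial state. An upper bound on the
diagonal matrix elements of the interaction in occupation vectors is all that it requires. -/
lemma le_partitionFunction (B : FockEigenbasis (interactionFunction hw hs hlam) lam) :
    ENNReal.ofReal ((partitionFunction (freeHamiltonian lam)).toReal
      * Real.exp (-meanInteraction w lam ε))
      ≤ partitionFunction (interactingHamiltonian w lam ε) := by
  rw [B.partitionFunction_eq]
  refine le_trans (ENNReal.ofReal_le_ofReal ?_) (le_tsum_exp_neg B.overlap_nonneg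
    B.hasSum_overlap_left B.hasSum_overlap_right
    (B.hasSum_eigenvalue fun n σ x => renormalizedPotential_relabel σ x)
    (occupationPotential_le hw hs hlam) (freePartition_toReal_pos hlam)
    (fun m => rfl) (hasSum_freeWeight hlam) (hasSum_freeWeight_mul_potentialBound hw hs hlam))
  refine mul_le_mul_of_nonneg_left (Real.exp_le_exp.mpr (neg_le_neg ?_)) ENNReal.toReal_nonneg
  exact freeExpectation_le hw hs hlam

lemma partitionFunction_ne_top (B : FockEigenbasis (interactionFunction hw hs hlam) lam)
    : partitionFunction (interactingHamiltonian w lam ε) ≠ ⊤ :=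
  ne_top_of_le_ne_top (ENNReal.mul_ne_top ENNReal.ofReal_ne_top (freePartition_ne_top hlam))
    B.partitionFunction_le

lemma partitionFunction_ne_zero (B : FockEigenbasis (interactionFunction hw hs hlam) lam)
    : partitionFunction (interactingHamiltonian w lam ε) ≠ 0 := by
  refine ne_of_gt (lt_of_lt_of_le (ENNReal.ofReal_pos.mpr ?_) B.le_partitionFunction)
  exact mul_pos (freePartition_toReal_pos hlam) (Real.exp_pos _)

lemma partitionFunction_toReal_pos (B : FockEigenbasis (interactionFunction hw hs hlam) lam) :
    0 < (partitionFunction (interactingHamiltonian w lam ε)).toReal :=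
  ENNReal.toReal_pos B.partitionFunction_ne_zero B.partitionFunction_ne_top

lemma log_partitionFunction_le (B : FockEigenbasis (interactionFunction hw hs hlam) lam) :
    Real.log (partitionFunction (interactingHamiltonian w lam ε)).toReal
      ≤ counterterm w ε + Real.log (partitionFunction (freeHamiltonian lam)).toReal := by
  have h := ENNReal.toReal_mono
    (ENNReal.mul_ne_top ENNReal.ofReal_ne_top (freePartition_ne_top hlam)) B.partitionFunction_le
  rw [ENNReal.toReal_mul, ENNReal.toReal_ofReal (Real.exp_pos _).le] at h
  refine (Real.log_le_log B.partitionFunction_toReal_pos h).trans ?_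
  rw [Real.log_mul (Real.exp_ne_zero _) (freePartition_toReal_pos hlam).ne', Real.log_exp]

lemma le_log_partitionFunction (B : FockEigenbasis (interactionFunction hw hs hlam) lam) :
    Real.log (partitionFunction (freeHamiltonian lam)).toReal
      - Real.log (partitionFunction (interactingHamiltonian w lam ε)).toReal
        ≤ meanInteraction w lam ε := by
  have h0 := mul_pos (freePartition_toReal_pos hlam) (Real.exp_pos (-meanInteraction w lam ε))
  have h := ENNReal.toReal_mono B.partitionFunction_ne_top B.le_partitionFunction
  rw [ENNReal.toReal_ofReal h0.le] at h
  have h1 := Real.log_le_log h0 h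
  rw [Real.log_mul (freePartition_toReal_pos hlam).ne' (Real.exp_ne_zero _), Real.log_exp] at h1
  linarith

lemma abs_log_div_le (B : FockEigenbasis (interactionFunction hw hs hlam) lam) :
    |Real.log ((partitionFunction (interactingHamiltonian w lam ε)).toReal
      / (partitionFunction (freeHamiltonian lam)).toReal)|
      ≤ counterterm w ε + meanInteraction w lam ε := by
  rw [Real.log_div B.partitionFunction_toReal_pos.ne' (freePartition_toReal_pos hlam).ne', abs_le]
  have h1 := B.log_partitionFunction_le
  have h2 := B.le_log_partitionFunction
  have h3 := counterterm_nonneg hw hs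
  have h4 := meanInteraction_nonneg hw (lam := lam) (ε := ε)
  constructor <;> linarith

/-- The eigenvalues of the interacting Gibbs state. -/
def gibbsWeight (B : FockEigenbasis (interactionFunction hw hs hlam) lam) (i : B.ι) : ℝ :=
  (partitionFunction (interactingHamiltonian w lam ε)).toReal⁻¹ * Real.exp (-B.eigenvalue i)

lemma gibbsWeight_nonneg (B : FockEigenbasis (interactionFunction hw hs hlam) lam)
    (i : B.ι) : 0 ≤ B.gibbsWeight i := B.system.weight_nonneg i

lemma hasSum_gibbsWeight (B : FockEigenbasis (interactionFunction hw hs hlam) lam)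
    : HasSum B.gibbsWeight 1 :=
  B.system.hasSum_weight B.partitionFunction_ne_top B.partitionFunction_ne_zero

/-- The diagonalization of the interacting Gibbs state. -/
def gibbsDiagonalization (B : FockEigenbasis (interactionFunction hw hs hlam) lam)
    : Diagonalization (interactingGibbs w lam ε) := B.system.diagonalization

lemma tsum_entropy_add_variance_le (B : FockEigenbasis (interactionFunction hw hs hlam) lam) :
    ∑' i, ∑' m, ENNReal.ofReal (B.overlap i m) * entropyTerm (B.gibbsWeight i) (freeWeight lam m)
      + ∑' i, ENNReal.ofReal (B.gibbsWeight i)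
        * ENNReal.ofReal (lam ^ 2 / 4 * ((B.number i : ℝ) - freeNumber lam) ^ 2)
      ≤ ENNReal.ofReal (counterterm w ε + meanInteraction w lam ε) :=
  tsum_entropyTerm_le B.overlap_nonneg B.hasSum_overlap_left B.hasSum_overlap_right
    (B.hasSum_kinetic hlam.le) (fun i => by positivity) B.le_eigenvalue
    B.partitionFunction_toReal_pos (freePartition_toReal_pos hlam) B.le_log_partitionFunction
    (fun i => rfl) (fun m => rfl) B.hasSum_gibbsWeight (hasSum_freeWeight hlam)

lemma relEntropy_le (B : FockEigenbasis (interactionFunction hw hs hlam) lam)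
    : relEntropy (interactingGibbs w lam ε) (freeGibbs lam)
    ≤ ∑' i, ∑' m, ENNReal.ofReal (B.overlap i m)
      * entropyTerm (B.gibbsWeight i) (freeWeight lam m) := by
  refine (iInf₂_le B.gibbsDiagonalization (freeDiagonalization hlam.le)).trans (le_of_eq ?_)
  change ∑' (i : B.ι) (m : (Fin 2 → ℤ) →₀ ℕ),
    ENNReal.ofReal (‖⟪B.basis i, occupationBasis m⟫_ℂ‖ ^ 2)
      * entropyTerm (B.gibbsWeight i) (freeWeight lam m) = _
  simp only [coe_occupationBasis, overlap, norm_inner_symm (B.basis _)]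

lemma expect_numberVarianceForm (B : FockEigenbasis (interactionFunction hw hs hlam) lam) (M : ℝ) :
    expect (interactingGibbs w lam ε) (numberVarianceForm M)
      = ∑' i, ENNReal.ofReal (B.gibbsWeight i) * ENNReal.ofReal (((B.number i : ℝ) - M) ^ 2) := by
  refine (expect_number_weight B.gibbsDiagonalization B.gibbsWeight_nonneg
    fun n => ENNReal.ofReal_ne_top).trans ?_
  change ∑' i : B.ι, ENNReal.ofReal (B.gibbsWeight i) * numberVarianceForm M (B.basis i) = _
  simp only [numberVarianceForm_basis]

lemma relEntropy_add_variance_le (B : FockEigenbasis (interactionFunction hw hs hlam) lam) :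
    relEntropy (interactingGibbs w lam ε) (freeGibbs lam)
      + ENNReal.ofReal (lam ^ 2)
        * expect (interactingGibbs w lam ε) (numberVarianceForm (freeNumber lam))
      ≤ ENNReal.ofReal (4 * (counterterm w ε + meanInteraction w lam ε)) := by
  -- The factor `4` restores the full variance from the quarter that survives completing the square.
  rw [ENNReal.ofReal_mul (by norm_num : (0 : ℝ) ≤ 4)]
  refine le_trans ?_ (mul_le_mul_right B.tsum_entropy_add_variance_le _)
  rw [mul_add]
  refine add_le_add (B.relEntropy_le.trans ?_) (le_of_eq ?_)
  · refine le_mul_of_one_le_left' ?_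
    rw [ENNReal.one_le_ofReal]
    norm_num
  · rw [B.expect_numberVarianceForm, ← ENNReal.tsum_mul_left, ← ENNReal.tsum_mul_left]
    congr 1
    funext i
    have h1 : lam ^ 2 = 4 * (lam ^ 2 / 4) := by ring
    have h2 : (0 : ℝ) ≤ lam ^ 2 / 4 := by positivity
    rw [ENNReal.ofReal_mul h2]
    conv_lhs => rw [h1, ENNReal.ofReal_mul (by norm_num : (0 : ℝ) ≤ 4)]
    ring

/-- The variance bound controls the mean particle number through `n ≤ (n - N₀)² + N₀ + 1`. This
makes the mean occupation numbers finite. -/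
lemma summable_gibbsWeight_mul_number (B : FockEigenbasis (interactionFunction hw hs hlam) lam) :
    Summable fun i => B.gibbsWeight i * B.number i := by
  have h1 : ∑' i, ENNReal.ofReal (B.gibbsWeight i
      * (lam ^ 2 / 4 * ((B.number i : ℝ) - freeNumber lam) ^ 2))
      ≤ ENNReal.ofReal (counterterm w ε + meanInteraction w lam ε) := by
    simp only [ENNReal.ofReal_mul (B.gibbsWeight_nonneg _)]
    exact le_add_self.trans B.tsum_entropy_add_variance_le
  have h2 := (summable_and_tsum_le_of_ofReal (fun i => mul_nonneg (B.gibbsWeight_nonneg i)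
    (by positivity)) (add_nonneg (counterterm_nonneg hw hs) (meanInteraction_nonneg hw)) h1).1
  refine Summable.of_nonneg_of_le
    (fun i => mul_nonneg (B.gibbsWeight_nonneg i) (Nat.cast_nonneg _)) (fun i => ?_)
    ((h2.mul_left (4 / lam ^ 2)).add (B.hasSum_gibbsWeight.summable.mul_right (freeNumber lam + 1)))
  have h3 : 4 / lam ^ 2 * (B.gibbsWeight i
      * (lam ^ 2 / 4 * ((B.number i : ℝ) - freeNumber lam) ^ 2))
      = B.gibbsWeight i * ((B.number i : ℝ) - freeNumber lam) ^ 2 := by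
    field_simp
  rw [h3, ← mul_add]
  refine mul_le_mul_of_nonneg_left ?_ (B.gibbsWeight_nonneg i)
  nlinarith [sq_nonneg ((B.number i : ℝ) - freeNumber lam - 1)]

/-- The mean occupation number of the mode `k` in the interacting Gibbs state. -/
def gibbsOccupation (B : FockEigenbasis (interactionFunction hw hs hlam) lam)
    (k : Fin 2 → ℤ) : ℝ := ∑' i, B.gibbsWeight i * B.meanOccupation i k

lemma hasSum_gibbsOccupation (B : FockEigenbasis (interactionFunction hw hs hlam) lam) (k : Fin 2 → ℤ) :
    HasSum (fun i => B.gibbsWeight i * B.meanOccupation i k) (B.gibbsOccupation k) :=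
  (Summable.of_nonneg_of_le
    (fun i => mul_nonneg (B.gibbsWeight_nonneg i) (B.meanOccupation_nonneg i k))
    (fun i => mul_le_mul_of_nonneg_left (B.meanOccupation_le i k) (B.gibbsWeight_nonneg i))
    B.summable_gibbsWeight_mul_number).hasSum

end FockEigenbasis

end GibbsEstimates

/-! ## Mean occupation numbers -/

section MeanOccupation

variable {w : EuclideanSpace ℝ (Fin 2) → ℝ} {lam ε : ℝ}

lemma boltzmann_piecewise (lam : ℝ) (S : Finset (Fin 2 → ℤ)) (c : (Fin 2 → ℤ) → ℝ)
    (m : (Fin 2 → ℤ) →₀ ℕ) :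
    boltzmann (S.piecewise (fun k => lam * oneBodyEnergy k - c k) fun k => lam * oneBodyEnergy k) m
      = ENNReal.ofReal (Real.exp (-(lam * occupationEnergy m - ∑ k ∈ S, c k * m k))) := by
  rw [boltzmann]
  congr 3
  have h1 : ∑ k ∈ S, c k * m k = ∑ k ∈ m.support, if k ∈ S then c k * m k else 0 := by
    rw [← Finset.sum_filter, Finset.filter_mem_eq_inter]
    symm
    refine Finset.sum_subset Finset.inter_subset_right fun k hk hk' => ?_
    have : k ∉ m.support := fun h => hk' (Finset.mem_inter.mpr ⟨h, hk⟩)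
    rw [Finsupp.notMem_support_iff.mp this]
    simp
  rw [occupationEnergy, Finsupp.sum, Finsupp.sum, h1, Finset.mul_sum, ← Finset.sum_sub_distrib]
  refine Finset.sum_congr rfl fun k _ => ?_
  by_cases hk : k ∈ S
  · rw [Finset.piecewise_eq_of_mem _ _ _ hk, if_pos hk]
    ring
  · rw [Finset.piecewise_eq_of_notMem _ _ _ hk, if_neg hk]
    ring

/-- The free partition function for modified mode energies. -/
lemma tsum_boltzmann_perturbed (hlam : 0 < lam) {S : Finset (Fin 2 → ℤ)}
    {c : (Fin 2 → ℤ) → ℝ} (hc : ∀ k ∈ S, c k < lam * oneBodyEnergy k) :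
    ∑' m : (Fin 2 → ℤ) →₀ ℕ,
      ENNReal.ofReal (Real.exp (-(lam * occupationEnergy m - ∑ k ∈ S, c k * m k)))
      = ENNReal.ofReal ((partitionFunction (freeHamiltonian lam)).toReal
        * ∏ k ∈ S, ((1 + bose (lam * oneBodyEnergy k - c k))
          / (1 + bose (lam * oneBodyEnergy k)))) := by
  set y : (Fin 2 → ℤ) → ℝ := fun k => if k ∈ S then lam * oneBodyEnergy k - c k else 1 with hy
  have hypos : ∀ k, 0 < y k := fun k => by
    rw [hy]
    dsimp only
    split_ifs with hk
    · linarith [hc k hk]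
    · exact one_pos
  have h1 := tsum_boltzmann_piecewise (mul_oneBodyEnergy_pos hlam) hypos S
  have h2 : S.piecewise y (fun k => lam * oneBodyEnergy k)
      = S.piecewise (fun k => lam * oneBodyEnergy k - c k) fun k => lam * oneBodyEnergy k := by
    funext k
    by_cases hk : k ∈ S
    · rw [Finset.piecewise_eq_of_mem _ _ _ hk, Finset.piecewise_eq_of_mem _ _ _ hk, hy]
      exact if_pos hk
    · rw [Finset.piecewise_eq_of_notMem _ _ _ hk, Finset.piecewise_eq_of_notMem _ _ _ hk]
  have h3 : ∏ k ∈ S, ENNReal.ofReal (1 + bose (y k))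
      = ENNReal.ofReal (∏ k ∈ S, (1 + bose (lam * oneBodyEnergy k - c k))) := by
    rw [ENNReal.ofReal_prod_of_nonneg]
    · refine Finset.prod_congr rfl fun k hk => ?_
      rw [hy]
      simp only [if_pos hk]
    · intro k hk
      have := bose_pos (show 0 < lam * oneBodyEnergy k - c k by linarith [hc k hk])
      linarith
  have hpos : ∀ k, 0 < 1 + bose (lam * oneBodyEnergy k) := fun k => by
    have := bose_pos (mul_oneBodyEnergy_pos hlam k)
    linarith
  have hP : 0 < ∏ k ∈ S, (1 + bose (lam * oneBodyEnergy k)) := Finset.prod_pos fun k _ => hpos k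
  rw [h2, h3, ← freePartition_eq hlam.le,
    ← ENNReal.ofReal_prod_of_nonneg (fun k _ => (hpos k).le)] at h1
  simp only [boltzmann_piecewise] at h1
  rw [Finset.prod_div_distrib, ← mul_div_assoc, ENNReal.ofReal_div_of_pos hP,
    ENNReal.ofReal_mul ENNReal.toReal_nonneg, ENNReal.ofReal_toReal (freePartition_ne_top hlam),
    ENNReal.eq_div_iff (ENNReal.ofReal_pos.mpr hP).ne' ENNReal.ofReal_ne_top, ← h1, mul_comm]

namespace FockEigenbasis

variable {hw : IsInteraction w} {hs : Summable (coupling w ε)} {hlam : 0 < lam}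

/-- The reference system is a free gas in which each mode `k ∈ S` has energy `λ h_k (1 - x_k)`,
positive because `|x_k| ≤ 1/2`. The variational principle bounds the mean of `∑ x_k λ h_k m_k` by a
ratio of partition functions; its free part is a product over `S`, whose logarithm has the linear
term `x_k λ h_k n_k` and error `2 x_k²`. -/
lemma sum_gibbsOccupation_le (B : FockEigenbasis (interactionFunction hw hs hlam) lam)
    (S : Finset (Fin 2 → ℤ)) {x : (Fin 2 → ℤ) → ℝ} (hx : ∀ k ∈ S, |x k| ≤ 1 / 2) :
    ∑ k ∈ S, x k * (lam * oneBodyEnergy k * (B.gibbsOccupation k - bose (lam * oneBodyEnergy k)))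
      ≤ 2 * ∑ k ∈ S, x k ^ 2 + (counterterm w ε + meanInteraction w lam ε) := by
  set c : (Fin 2 → ℤ) → ℝ := fun k => x k * (lam * oneBodyEnergy k) with hc
  have hpos := mul_oneBodyEnergy_pos hlam
  have hcS : ∀ k ∈ S, c k < lam * oneBodyEnergy k := fun k hk => by
    have h1 := (le_abs_self _).trans (hx k hk)
    have h2 := hpos k
    simp only [hc]
    nlinarith
  have hfac : ∀ k ∈ S, 0 < (1 + bose (lam * oneBodyEnergy k - c k))
      / (1 + bose (lam * oneBodyEnergy k)) := fun k hk => by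
    have h1 := bose_pos (show 0 < lam * oneBodyEnergy k - c k by linarith [hcS k hk])
    have h2 := bose_pos (hpos k)
    positivity
  have hK : ∀ i, HasSum (fun m => B.overlap i m * (lam * occupationEnergy m - ∑ k ∈ S, c k * m k))
      (B.eigenvalue i - B.potential i - ∑ k ∈ S, c k * B.meanOccupation i k) := fun i => by
    have h1 := (B.hasSum_kinetic hlam.le i).sub
      (hasSum_sum fun k (_ : k ∈ S) => (B.hasSum_meanOccupation i k).mul_left (c k))
    convert! h1 using 1
    funext m
    rw [mul_sub, Finset.mul_sum]
    congr 1
    exact Finset.sum_congr rfl fun k _ => by ring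
  have hA : HasSum (fun i => B.gibbsWeight i * ∑ k ∈ S, c k * B.meanOccupation i k)
      (∑ k ∈ S, c k * B.gibbsOccupation k) := by
    have h1 := hasSum_sum fun k (_ : k ∈ S) => (B.hasSum_gibbsOccupation k).mul_left (c k)
    convert! h1 using 1
    funext i
    rw [Finset.mul_sum]
    exact Finset.sum_congr rfl fun k _ => by ring
  have h := hasSum_variational_le (A := fun i => ∑ k ∈ S, c k * B.meanOccupation i k)
    (c := counterterm w ε) B.overlap_nonneg B.hasSum_overlap_left
    B.hasSum_overlap_right hK (fun i => ?_) B.partitionFunction_toReal_pos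
    (mul_pos (freePartition_toReal_pos hlam) (Finset.prod_pos hfac))
    (tsum_boltzmann_perturbed hlam hcS).le (fun i => rfl) B.hasSum_gibbsWeight hA
  · rw [Real.log_mul (freePartition_toReal_pos hlam).ne' (Finset.prod_pos hfac).ne',
      Real.log_prod fun k hk => (hfac k hk).ne'] at h
    have h1 : ∑ k ∈ S, Real.log ((1 + bose (lam * oneBodyEnergy k - c k))
        / (1 + bose (lam * oneBodyEnergy k)))
        ≤ ∑ k ∈ S, (c k * bose (lam * oneBodyEnergy k) + 2 * x k ^ 2) := by
      refine Finset.sum_le_sum fun k hk => ?_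
      have h2 := bose_pos (show 0 < lam * oneBodyEnergy k - c k by linarith [hcS k hk])
      have h3 := bose_pos (hpos k)
      rw [Real.log_div (by positivity) (by positivity)]
      exact log_one_add_bose_sub_le (hpos k) (hx k hk)
    have h2 : ∑ k ∈ S, x k * (lam * oneBodyEnergy k
        * (B.gibbsOccupation k - bose (lam * oneBodyEnergy k)))
        = ∑ k ∈ S, c k * B.gibbsOccupation k - ∑ k ∈ S, c k * bose (lam * oneBodyEnergy k) := by
      rw [← Finset.sum_sub_distrib]
      exact Finset.sum_congr rfl fun k _ => by simp only [hc]; ring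
    rw [Finset.sum_add_distrib, ← Finset.mul_sum] at h1
    have h3 := B.le_log_partitionFunction
    linarith
  · have h1 := B.le_eigenvalue i
    have h3 : 0 ≤ lam ^ 2 / 4 * ((B.number i : ℝ) - freeNumber lam) ^ 2 := by positivity
    linarith

/-- Duality with `x = v / (2T)`, where `T` is the ℓ² norm of `v` on `S`. Then `|x_k| ≤ 1/2`, `∑ x_k
v_k = T/2` and `2 ∑ x_k² = 1/2`, so the linear estimate becomes a bound on `T` that is uniform in
`S`. -/
lemma sum_sq_gibbsOccupation_sub_le (B : FockEigenbasis (interactionFunction hw hs hlam) lam)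
    (S : Finset (Fin 2 → ℤ)) :
    ∑ k ∈ S, (lam * oneBodyEnergy k * (B.gibbsOccupation k - bose (lam * oneBodyEnergy k))) ^ 2
      ≤ (1 + 2 * (counterterm w ε + meanInteraction w lam ε)) ^ 2 := by
  set v : (Fin 2 → ℤ) → ℝ := fun k =>
    lam * oneBodyEnergy k * (B.gibbsOccupation k - bose (lam * oneBodyEnergy k)) with hv
  change ∑ k ∈ S, v k ^ 2 ≤ _
  have hK : 0 ≤ counterterm w ε + meanInteraction w lam ε :=
    add_nonneg (counterterm_nonneg hw hs) (meanInteraction_nonneg hw)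
  set T := Real.sqrt (∑ k ∈ S, v k ^ 2) with hT
  have hsum : 0 ≤ ∑ k ∈ S, v k ^ 2 := Finset.sum_nonneg fun k _ => sq_nonneg _
  have hT2 : T ^ 2 = ∑ k ∈ S, v k ^ 2 := Real.sq_sqrt hsum
  rw [← hT2]
  have hT0 : 0 ≤ T := Real.sqrt_nonneg _
  refine pow_le_pow_left₀ hT0 ?_ 2
  rcases hT0.eq_or_lt with h0 | h0
  · rw [← h0]
    linarith
  have hx : ∀ k ∈ S, |v k / (2 * T)| ≤ 1 / 2 := fun k hk => by
    have h1 : |v k| ≤ T := by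
      refine Real.abs_le_sqrt ?_
      exact Finset.single_le_sum (f := fun k => v k ^ 2) (fun _ _ => sq_nonneg _) hk
    rw [abs_div, abs_of_pos (show 0 < 2 * T by linarith), div_le_div_iff₀ (by linarith) two_pos]
    linarith
  have h := B.sum_gibbsOccupation_le S hx
  change ∑ k ∈ S, v k / (2 * T) * v k ≤ _ at h
  have h1 : ∑ k ∈ S, v k / (2 * T) * v k = T / 2 := by
    have : ∀ k ∈ S, v k / (2 * T) * v k = v k ^ 2 / (2 * T) := fun k _ => by ring
    rw [Finset.sum_congr rfl this, ← Finset.sum_div, ← hT2]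
    field_simp
  have h2 : ∑ k ∈ S, (v k / (2 * T)) ^ 2 = 1 / 4 := by
    simp only [div_pow]
    rw [← Finset.sum_div, ← hT2]
    field_simp
    norm_num
  rw [h1, h2] at h
  linarith

end FockEigenbasis

end MeanOccupation

/-! ## Annihilation operators -/

section Annihilation

open MeasureTheory UnitAddTorus

/-- The positions of all but the first particle. -/
def removeParticle {n : ℕ} (x : Config (n + 1)) : Config n := fun q => x (q.1.succ, q.2)

lemma particle_addParticle {n : ℕ} (y : T2) (x : Config n) :
    particle (addParticle y x) 0 = y := rfl

lemma removeParticle_addParticle {n : ℕ} (y : T2) (x : Config n) :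
    removeParticle (addParticle y x) = x := rfl

lemma continuous_addParticle {n : ℕ} :
    Continuous fun z : T2 × Config n => addParticle z.1 z.2 := by
  refine continuous_pi fun q => ?_
  obtain ⟨j, i⟩ := q
  refine Fin.cases ?_ (fun j => ?_) j
  · exact (continuous_apply i).comp continuous_fst
  · exact (continuous_apply (j, i)).comp continuous_snd

lemma continuous_removeParticle {n : ℕ} : Continuous (removeParticle : Config (n + 1) → Config n) :=
  continuous_pi fun q => continuous_apply (q.1.succ, q.2)

lemma continuous_particle {n : ℕ} (j : Fin n) :
    Continuous fun x : Config n => particle x j :=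
  continuous_pi fun i => continuous_apply (j, i)

lemma measurePreserving_addParticle (n : ℕ) :
    MeasurePreserving (fun z : T2 × Config n => addParticle z.1 z.2)
      ((torusMeasure (Fin 2)).prod (torusMeasure (Fin n × Fin 2)))
      (torusMeasure (Fin (n + 1) × Fin 2)) := by
  refine ⟨continuous_addParticle.measurable, (Measure.pi_eq fun s hs => ?_).symm⟩
  have h : (fun z : T2 × Config n => addParticle z.1 z.2) ⁻¹' Set.univ.pi s
      = (Set.univ.pi fun i => s (0, i)) ×ˢ (Set.univ.pi fun q => s (q.1.succ, q.2)) := by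
    ext z
    simp only [Set.mem_preimage, Set.mem_pi, Set.mem_univ, forall_const, Set.mem_prod, Prod.forall]
    rw [Fin.forall_fin_succ]
    rfl
  have h1 : ∏ q, AddCircle.haarAddCircle (s q) = (∏ i, AddCircle.haarAddCircle (s (0, i)))
      * ∏ q : Fin n × Fin 2, AddCircle.haarAddCircle (s (q.1.succ, q.2)) := by
    rw [Fintype.prod_prod_type, Fin.prod_univ_succ, Fintype.prod_prod_type]
  rw [Measure.map_apply continuous_addParticle.measurable (MeasurableSet.univ_pi hs), h,
    Measure.prod_prod, Measure.pi_pi, Measure.pi_pi, h1]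

lemma mFourier_consMomentum {n : ℕ} (k : Fin 2 → ℤ) (p : Fin n × Fin 2 → ℤ) (y : T2)
    (x : Config n) :
    mFourier (consMomentum k p) (addParticle y x) = mFourier k y * mFourier p x := by
  simp only [mFourier, ContinuousMap.coe_mk, Fintype.prod_prod_type, Fin.prod_univ_succ]
  rfl

variable {n : ℕ} (f g : OneBody) (p : Fin n × Fin 2 → ℤ)

lemma memLp_tensorWave :
    MemLp (fun x : Config (n + 1) => f (particle x 0) * mFourier p (removeParticle x)) 2
      (torusMeasure (Fin (n + 1) × Fin 2)) := by
  have h0 : StronglyMeasurable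
      (fun x : Config (n + 1) => f (particle x 0) * mFourier p (removeParticle x)) :=
    ((Lp.stronglyMeasurable f).comp_measurable (continuous_particle 0).measurable).mul
      (((mFourier p).continuous.comp continuous_removeParticle).stronglyMeasurable)
  rw [← (measurePreserving_addParticle n).map_eq,
    memLp_map_measure_iff h0.aestronglyMeasurable (measurePreserving_addParticle n).aemeasurable]
  have h1 : MemLp (fun z : T2 × Config n => f z.1) 2
      ((torusMeasure (Fin 2)).prod (torusMeasure (Fin n × Fin 2))) :=
    (Lp.memLp f).comp_measurePreserving measurePreserving_fst
  refine h1.of_le (h0.comp_measurable continuous_addParticle.measurable).aestronglyMeasurable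
    (Filter.Eventually.of_forall fun z => ?_)
  simp only [Function.comp_apply, particle_addParticle, removeParticle_addParticle, norm_mul,
    norm_mFourier_apply, mul_one, le_refl]

/-- The function `f(x_0) exp (2πi p·(x_1, …, x_n))`. -/
def tensorWave : L2Torus (Fin (n + 1) × Fin 2) := (memLp_tensorWave f p).toLp _

lemma coeFn_tensorWave : tensorWave f p =ᵐ[torusMeasure (Fin (n + 1) × Fin 2)]
    fun x => f (particle x 0) * mFourier p (removeParticle x) := MemLp.coeFn_toLp _

lemma integral_addParticle {F : Config (n + 1) → ℂ}
    (hF : AEStronglyMeasurable F (torusMeasure (Fin (n + 1) × Fin 2))) :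
    ∫ x, F x ∂(torusMeasure (Fin (n + 1) × Fin 2))
      = ∫ z, F (addParticle z.1 z.2)
        ∂((torusMeasure (Fin 2)).prod (torusMeasure (Fin n × Fin 2))) := by
  rw [← (measurePreserving_addParticle n).map_eq] at hF ⊢
  exact integral_map (measurePreserving_addParticle n).aemeasurable hF

lemma repr_tensorWave (k : Fin 2 → ℤ) (p' : Fin n × Fin 2 → ℤ) :
    (planeWaves _).repr (tensorWave f p) (consMomentum k p')
      = if p' = p then (planeWaves _).repr f k else 0 := by
  have h0 : consMomentum (-k) (-p') = -consMomentum k p' := by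
    refine ext_momentum fun j => ?_
    refine Fin.cases rfl (fun j => rfl) j
  have h1 : ∫ x, mFourier (-p') x * mFourier p x ∂(torusMeasure (Fin n × Fin 2))
      = if p' = p then 1 else 0 := by
    rw [← repr_planeWaves, planeWaves_repr]
    refine integral_congr_ae ?_
    filter_upwards [coeFn_planeWaves p] with x hx
    rw [hx]
  have h2 : ∫ x, mFourier (-consMomentum k p') x * tensorWave f p x
        ∂(torusMeasure (Fin (n + 1) × Fin 2))
      = ∫ x, mFourier (-consMomentum k p') x * (f (particle x 0) * mFourier p (removeParticle x))
        ∂(torusMeasure (Fin (n + 1) × Fin 2)) := by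
    refine integral_congr_ae ?_
    filter_upwards [coeFn_tensorWave f p] with x hx
    rw [hx]
  rw [planeWaves_repr, h2, integral_addParticle (F := fun x => mFourier (-consMomentum k p') x
    * (f (particle x 0) * mFourier p (removeParticle x))) ((mFourier _).continuous.aestronglyMeasurable.mul
    (memLp_tensorWave f p).aestronglyMeasurable)]
  have h3 : ∀ z : T2 × Config n, mFourier (-consMomentum k p') (addParticle z.1 z.2)
      * (f (particle (addParticle z.1 z.2) 0)
        * mFourier p (removeParticle (addParticle z.1 z.2)))
      = (mFourier (-k) z.1 * f z.1) * (mFourier (-p') z.2 * mFourier p z.2) := fun z => by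
    rw [← h0, mFourier_consMomentum, particle_addParticle, removeParticle_addParticle]
    ring
  simp only [h3]
  rw [integral_prod_mul (fun y => mFourier (-k) y * f y)
    (fun x => mFourier (-p') x * mFourier p x), h1, planeWaves_repr]
  split_ifs <;> simp

lemma integrable_conj_tensorWave_mul (φ : L2Torus (Fin (n + 1) × Fin 2)) :
    Integrable (fun z : T2 × Config n => conj (f z.1 * mFourier p z.2) * φ (addParticle z.1 z.2))
      ((torusMeasure (Fin 2)).prod (torusMeasure (Fin n × Fin 2))) := by
  have h : Integrable (fun x : Config (n + 1) =>
      conj (f (particle x 0) * mFourier p (removeParticle x)) * φ x)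
      (torusMeasure (Fin (n + 1) × Fin 2)) := by
    have h1 := L2.integrable_inner (𝕜 := ℂ) (tensorWave f p) φ
    refine h1.congr ?_
    filter_upwards [coeFn_tensorWave f p] with x hx
    rw [hx, RCLike.inner_apply']
  exact (measurePreserving_addParticle n).integrable_comp_of_integrable h

lemma inner_tensorWave (φ : L2Torus (Fin (n + 1) × Fin 2)) :
    ⟪tensorWave f p, φ⟫_ℂ = ∫ z, conj (f z.1 * mFourier p z.2) * φ (addParticle z.1 z.2)
      ∂((torusMeasure (Fin 2)).prod (torusMeasure (Fin n × Fin 2))) := by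
  have h : ∫ x, conj (tensorWave f p x) * φ x ∂(torusMeasure (Fin (n + 1) × Fin 2))
      = ∫ x, conj (f (particle x 0) * mFourier p (removeParticle x)) * φ x
        ∂(torusMeasure (Fin (n + 1) × Fin 2)) := by
    refine integral_congr_ae ?_
    filter_upwards [coeFn_tensorWave f p] with x hx
    rw [hx]
  rw [inner_eq_integral, h, integral_addParticle (F := fun x =>
    conj (f (particle x 0) * mFourier p (removeParticle x)) * φ x)
    ((Complex.continuous_conj.comp_aestronglyMeasurable
      (memLp_tensorWave f p).aestronglyMeasurable).mul (Lp.aestronglyMeasurable φ))]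
  rfl

/-- Cauchy–Schwarz in the removed coordinate, then Tonelli in the others. -/
lemma memLp_annihilate (Ψ : Fock) (n : ℕ) :
    MemLp (annihilate f Ψ n) 2 (torusMeasure (Fin n × Fin 2)) := by
  set φ := component Ψ (n + 1) with hφ
  have hm : StronglyMeasurable fun z : T2 × Config n => conj (f z.1) * φ (addParticle z.1 z.2) :=
    (Complex.continuous_conj.comp_stronglyMeasurable
      ((Lp.stronglyMeasurable f).comp_measurable measurable_fst)).mul
      ((Lp.stronglyMeasurable φ).comp_measurable continuous_addParticle.measurable)
  refine MemLp.const_mul ?_ (Real.sqrt (n + 1) : ℂ)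
  have hG : StronglyMeasurable fun x : Config n =>
      ∫ y, conj (f y) * φ (addParticle y x) ∂(torusMeasure (Fin 2)) :=
    StronglyMeasurable.integral_prod_left
      (f := fun (y : T2) (x : Config n) => conj (f y) * φ (addParticle y x)) hm
  refine ⟨hG.aestronglyMeasurable, ?_⟩
  rw [eLpNorm_lt_top_iff_lintegral_rpow_enorm_lt_top two_ne_zero ENNReal.ofNat_ne_top]
  have hf := (eLpNorm_lt_top_iff_lintegral_rpow_enorm_lt_top two_ne_zero
    ENNReal.ofNat_ne_top).mp (Lp.memLp f).2
  have hφ' := (eLpNorm_lt_top_iff_lintegral_rpow_enorm_lt_top two_ne_zero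
    ENNReal.ofNat_ne_top).mp (Lp.memLp φ).2
  simp only [ENNReal.toReal_ofNat] at hf hφ' ⊢
  have hmeas : Measurable fun z : T2 × Config n => ‖φ (addParticle z.1 z.2)‖ₑ ^ (2 : ℝ) :=
    (((Lp.stronglyMeasurable φ).comp_measurable continuous_addParticle.measurable).enorm).pow_const _
  have hbound : ∀ x : Config n,
      ‖∫ y, conj (f y) * φ (addParticle y x) ∂(torusMeasure (Fin 2))‖ₑ ^ (2 : ℝ)
      ≤ (∫⁻ y, ‖f y‖ₑ ^ (2 : ℝ) ∂(torusMeasure (Fin 2)))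
        * ∫⁻ y, ‖φ (addParticle y x)‖ₑ ^ (2 : ℝ) ∂(torusMeasure (Fin 2)) := fun x => by
    have h1 : ‖∫ y, conj (f y) * φ (addParticle y x) ∂(torusMeasure (Fin 2))‖ₑ
        ≤ ∫⁻ y, ‖f y‖ₑ * ‖φ (addParticle y x)‖ₑ ∂(torusMeasure (Fin 2)) := by
      refine (enorm_integral_le_lintegral_enorm _).trans (le_of_eq ?_)
      refine lintegral_congr fun y => ?_
      rw [enorm_mul, RCLike.enorm_conj]
    have h2 := ENNReal.lintegral_mul_le_Lp_mul_Lq (torusMeasure (Fin 2))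
      (Real.HolderConjugate.two_two) (f := fun y => ‖f y‖ₑ)
      (g := fun y => ‖φ (addParticle y x)‖ₑ) (Lp.stronglyMeasurable f).enorm.aemeasurable
      (((Lp.stronglyMeasurable φ).comp_measurable (continuous_addParticle.measurable.comp
        (measurable_id.prodMk measurable_const))).enorm.aemeasurable)
    have h3 := ENNReal.rpow_le_rpow (h1.trans h2) (show (0 : ℝ) ≤ 2 by norm_num)
    rw [ENNReal.mul_rpow_of_nonneg _ _ (by norm_num : (0 : ℝ) ≤ 2), ← ENNReal.rpow_mul,
      ← ENNReal.rpow_mul] at h3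
    norm_num at h3
    norm_num
    exact h3
  refine (lintegral_mono hbound).trans_lt ?_
  rw [lintegral_const_mul _ (hmeas.lintegral_prod_left')]
  refine ENNReal.mul_lt_top hf ?_
  rw [← lintegral_prod_symm' _ hmeas]
  rw [← (measurePreserving_addParticle n).lintegral_comp
    ((Lp.stronglyMeasurable φ).enorm.pow_const _)] at hφ'
  exact hφ'

/-- The vectors representing the Fourier coefficients of `a(f) Ψ`. -/
def annihilationFrame (s : Σ n, Fin n × Fin 2 → ℤ) : Fock :=
  (Real.sqrt (s.1 + 1) : ℂ) • lift (s.1 + 1) (tensorWave f s.2)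

lemma inner_annihilationFrame (s : Σ n, Fin n × Fin 2 → ℤ) (Ψ : Fock) :
    ⟪annihilationFrame f s, Ψ⟫_ℂ
      = (Real.sqrt (s.1 + 1) : ℂ) * ⟪tensorWave f s.2, component Ψ (s.1 + 1)⟫_ℂ := by
  rw [annihilationFrame, inner_smul_left, inner_lift, Complex.conj_ofReal]

/-- The Fourier coefficients of `a(f) Ψ` are inner products of `Ψ` with fixed Fock vectors. So
`⟨a(g) ·, a(f) ·⟩` is of frame type and its trace against a state does not depend on the
diagonalization. -/
lemma repr_annihilate (Ψ : Fock) :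
    (planeWaves _).repr ((memLp_annihilate f Ψ n).toLp _) p
      = ⟪annihilationFrame f ⟨n, p⟩, Ψ⟫_ℂ := by
  have h1 : ∫ x, mFourier (-p) x * (memLp_annihilate f Ψ n).toLp _ x
        ∂(torusMeasure (Fin n × Fin 2))
      = ∫ x, (Real.sqrt (n + 1) : ℂ) * ∫ y, conj (f y * mFourier p x)
        * component Ψ (n + 1) (addParticle y x) ∂(torusMeasure (Fin 2))
          ∂(torusMeasure (Fin n × Fin 2)) := by
    refine integral_congr_ae ?_
    filter_upwards [(memLp_annihilate f Ψ n).coeFn_toLp] with x hx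
    rw [hx, annihilate, mul_left_comm, ← integral_const_mul]
    congr 1
    refine integral_congr_ae (Filter.Eventually.of_forall fun y => ?_)
    simp only [mFourier_neg, map_mul]
    ring
  rw [planeWaves_repr, h1, integral_const_mul, inner_annihilationFrame, inner_tensorWave,
    integral_prod_symm _ (integrable_conj_tensorWave_mul f p _)]

lemma hasSum_annihilationFrame (Ψ : Fock) (n : ℕ) :
    HasSum (fun p : Fin n × Fin 2 → ℤ =>
      ⟪Ψ, annihilationFrame g ⟨n, p⟩⟫_ℂ * ⟪annihilationFrame f ⟨n, p⟩, Ψ⟫_ℂ)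
      (∫ x, conj (annihilate g Ψ n x) * annihilate f Ψ n x ∂(torusMeasure (Fin n × Fin 2))) := by
  have h := hasSum_conj_repr_mul_repr ((memLp_annihilate g Ψ n).toLp _)
    ((memLp_annihilate f Ψ n).toLp _)
  have h1 : ∫ x, conj (annihilate g Ψ n x) * annihilate f Ψ n x ∂(torusMeasure (Fin n × Fin 2))
      = ⟪(memLp_annihilate g Ψ n).toLp _, (memLp_annihilate f Ψ n).toLp _⟫_ℂ := by
    rw [inner_eq_integral]
    refine integral_congr_ae ?_
    filter_upwards [(memLp_annihilate f Ψ n).coeFn_toLp, (memLp_annihilate g Ψ n).coeFn_toLp]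
      with x hx hx'
    rw [hx, hx']
  rw [h1]
  refine h.congr_fun fun p => ?_
  rw [repr_annihilate, repr_annihilate, inner_conj_symm]

end Annihilation

/-! ## One-body density matrices of translation invariant states -/

section DensityMatrix

/-- Momenta of `n + 1` particles as a pair. -/
def consMomentumEquiv (n : ℕ) :
    (Fin 2 → ℤ) × (Fin n × Fin 2 → ℤ) ≃ (Fin (n + 1) × Fin 2 → ℤ) where
  toFun z := consMomentum z.1 z.2
  invFun p := (momentum p 0, fun q => p (q.1.succ, q.2))
  left_inv _ := rfl
  right_inv _ := ext_momentum fun j => Fin.cases rfl (fun _ => rfl) j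

lemma totalMomentum_consMomentum {n : ℕ} (k : Fin 2 → ℤ) (p : Fin n × Fin 2 → ℤ) :
    totalMomentum (consMomentum k p) = k + totalMomentum p := by
  rw [totalMomentum, Fin.sum_univ_succ]
  rfl

/-- Once the momenta of the other particles are given, a definite total momentum leaves a single
possibility for the added one. -/
lemma inner_tensorWave_of_totalMomentum {n : ℕ} (f : OneBody) (p : Fin n × Fin 2 → ℤ)
    {φ : L2Torus (Fin (n + 1) × Fin 2)} {q : Fin 2 → ℤ}
    (hφ : ∀ p', totalMomentum p' ≠ q → (planeWaves _).repr φ p' = 0) :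
    ⟪tensorWave f p, φ⟫_ℂ = conj ((planeWaves _).repr f (q - totalMomentum p))
      * (planeWaves _).repr φ (consMomentum (q - totalMomentum p) p) := by
  refine (hasSum_conj_repr_mul_repr (tensorWave f p) φ).unique ?_
  have h := hasSum_single (f := fun p' => conj ((planeWaves _).repr (tensorWave f p) p')
    * (planeWaves _).repr φ p') (consMomentum (q - totalMomentum p) p) fun p' hp' => ?_
  · rwa [repr_tensorWave, if_pos rfl] at h
  · obtain ⟨⟨k, p'⟩, rfl⟩ := (consMomentumEquiv n).surjective p'
    change conj ((planeWaves _).repr (tensorWave f p) (consMomentum k p'))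
      * (planeWaves _).repr φ (consMomentum k p') = 0
    rw [repr_tensorWave]
    split_ifs with h
    · subst h
      rw [hφ, mul_zero]
      intro hq
      rw [totalMomentum_consMomentum] at hq
      exact hp' (by rw [← hq, add_sub_cancel_right]; rfl)
    · rw [map_zero, zero_mul]

/-- The quadratic form of the occupation number of the mode `k`. -/
def occupationForm (k : Fin 2 → ℤ) (Ψ : Fock) : ℝ≥0∞ :=
  ∑' m : (Fin 2 → ℤ) →₀ ℕ, (m k : ℝ≥0∞) * ENNReal.ofReal (‖⟪occupationVector m, Ψ⟫_ℂ‖ ^ 2)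

/-- Permutations of momenta. -/
def permuteEquiv {n : ℕ} (σ : Equiv.Perm (Fin n)) :
    (Fin n × Fin 2 → ℤ) ≃ (Fin n × Fin 2 → ℤ) where
  toFun := permute σ
  invFun := permute σ⁻¹
  left_inv p := ext_momentum fun j => by
    rw [momentum_permute, momentum_permute]
    simp
  right_inv p := ext_momentum fun j => by
    rw [momentum_permute, momentum_permute]
    simp

/-- The occupation number counts the particles with momentum `k`; by symmetry of `G` each of the `n
+ 1` particles may be exchanged with the first one. -/
lemma tsum_occupation_mul {n : ℕ} (k : Fin 2 → ℤ) {G : (Fin (n + 1) × Fin 2 → ℤ) → ℝ≥0∞}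
    (hG : ∀ σ p, G (permute σ p) = G p) :
    ∑' p, (occupation p k : ℝ≥0∞) * G p = ∑' p, ((n : ℝ≥0∞) + 1) * G (consMomentum k p) := by
  have h1 : ∀ p : Fin (n + 1) × Fin 2 → ℤ, (occupation p k : ℝ≥0∞) * G p
      = ∑ j, if momentum p j = k then G p else 0 := fun p => by
    rw [occupation_apply, Fintype.card_subtype, Finset.card_filter]
    push_cast
    rw [Finset.sum_mul]
    refine Finset.sum_congr rfl fun j _ => ?_
    split_ifs <;> simp
  have h2 : ∀ j : Fin (n + 1), ∑' p, (if momentum p j = k then G p else 0)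
      = ∑' p, G (consMomentum k p) := fun j => by
    rw [← (permuteEquiv (Equiv.swap 0 j)).tsum_eq]
    change ∑' p, (if momentum (permute (Equiv.swap 0 j) p) j = k
      then G (permute (Equiv.swap 0 j) p) else 0) = _
    simp only [momentum_permute, Equiv.swap_apply_right, hG]
    rw [← (consMomentumEquiv n).tsum_eq, ENNReal.tsum_prod']
    change ∑' (k' : Fin 2 → ℤ) (p : Fin n × Fin 2 → ℤ),
      (if k' = k then G (consMomentum k' p) else 0) = _
    rw [tsum_eq_single k fun k' hk' => by simp only [if_neg hk', tsum_zero]]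
    simp only [if_true]
  simp only [h1]
  rw [Summable.tsum_finsetSum fun _ _ => ENNReal.summable]
  simp only [h2, Finset.sum_const, Finset.card_univ, Fintype.card_fin, nsmul_eq_mul,
    ENNReal.tsum_mul_left]
  push_cast
  rfl

/-- The contribution of the momenta `s` to the occupation number of the mode `k`. -/
def occupationDensity (Ψ : Fock) (s : Σ n, Fin n × Fin 2 → ℤ) (k : Fin 2 → ℤ) : ℝ :=
  ((s.1 : ℝ) + 1) * ‖(planeWaves _).repr (component Ψ (s.1 + 1)) (consMomentum k s.2)‖ ^ 2

lemma occupationDensity_nonneg (Ψ : Fock) (s : Σ n, Fin n × Fin 2 → ℤ) (k : Fin 2 → ℤ) :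
    0 ≤ occupationDensity Ψ s k := by
  unfold occupationDensity
  positivity

lemma tsum_occupationDensity (k : Fin 2 → ℤ) (Ψ : Fock) :
    ∑' s, ENNReal.ofReal (occupationDensity Ψ s k) = occupationForm k Ψ := by
  rw [occupationForm, ← tsum_weighted_occupation (fun m => (m k : ℝ≥0∞)),
    tsum_eq_zero_add' ENNReal.summable, ENNReal.tsum_sigma']
  have h0 : ∑' p : Fin 0 × Fin 2 → ℤ, (occupation p k : ℝ≥0∞)
      * ENNReal.ofReal (‖(planeWaves _).repr (component Ψ 0) p‖ ^ 2) = 0 := by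
    rw [ENNReal.tsum_eq_zero]
    intro p
    rw [occupation_apply, Fintype.card_eq_zero]
    simp
  rw [h0, zero_add]
  congr 1
  funext n
  rw [tsum_occupation_mul (G := fun p =>
    ENNReal.ofReal (‖(planeWaves _).repr (component Ψ (n + 1)) p‖ ^ 2)) k]
  · congr 1
    funext p
    rw [occupationDensity, ENNReal.ofReal_mul (by positivity),
      ENNReal.ofReal_add (by positivity) zero_le_one, ENNReal.ofReal_natCast, ENNReal.ofReal_one]
  · intro σ p
    rw [repr_eq_of_occupation_eq (component_mem_sector Ψ (n + 1)) (occupation_permute σ p)]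

section TotalMomentum

variable {Ψ : Fock} {q : Fin 2 → ℤ}

lemma occupationDensity_eq_zero
    (hΨ : ∀ (n : ℕ) (p : Fin n × Fin 2 → ℤ), totalMomentum p ≠ q →
      (planeWaves _).repr (component Ψ n) p = 0) {s : Σ n, Fin n × Fin 2 → ℤ}
    {k : Fin 2 → ℤ} (hk : k ≠ q - totalMomentum s.2) : occupationDensity Ψ s k = 0 := by
  rw [occupationDensity, hΨ]
  · simp
  · intro h
    rw [totalMomentum_consMomentum] at h
    exact hk (by rw [← h, add_sub_cancel_right])

/-- For a given `s`, momentum conservation selects the same mode `q - totalMomentum s.2` in both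
factors. No products of coefficients of `f` and `g` at different modes occur, which is why the
density matrix is diagonal. -/
lemma hasSum_occupationDensity
    (hΨ : ∀ (n : ℕ) (p : Fin n × Fin 2 → ℤ), totalMomentum p ≠ q →
      (planeWaves _).repr (component Ψ n) p = 0) (f g : OneBody)
    (s : Σ n, Fin n × Fin 2 → ℤ) :
    HasSum (fun k => conj ((planeWaves _).repr f k) * (planeWaves _).repr g k
      * (occupationDensity Ψ s k : ℂ))
      (⟪Ψ, annihilationFrame g s⟫_ℂ * ⟪annihilationFrame f s, Ψ⟫_ℂ) := by
  have h := hasSum_single (f := fun k => conj ((planeWaves _).repr f k) * (planeWaves _).repr g k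
      * (occupationDensity Ψ s k : ℂ)) (q - totalMomentum s.2) fun k hk => by
    rw [occupationDensity_eq_zero hΨ hk, Complex.ofReal_zero, mul_zero]
  convert! h using 1
  have h1 : ((Real.sqrt (s.1 + 1) : ℝ) : ℂ) * (Real.sqrt (s.1 + 1) : ℝ) = (s.1 : ℂ) + 1 := by
    rw [← Complex.ofReal_mul, Real.mul_self_sqrt (by positivity)]
    push_cast
    rfl
  rw [← inner_conj_symm Ψ, inner_annihilationFrame, inner_annihilationFrame,
    inner_tensorWave_of_totalMomentum f s.2 (hΨ _), inner_tensorWave_of_totalMomentum g s.2 (hΨ _),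
    occupationDensity]
  push_cast
  rw [← Complex.conj_mul', map_mul, map_mul, Complex.conj_ofReal, Complex.conj_conj, ← h1]
  ring

lemma ofReal_sq_norm_annihilationFrame
    (hΨ : ∀ (n : ℕ) (p : Fin n × Fin 2 → ℤ), totalMomentum p ≠ q →
      (planeWaves _).repr (component Ψ n) p = 0) (f : OneBody)
    (s : Σ n, Fin n × Fin 2 → ℤ) :
    ENNReal.ofReal (‖⟪annihilationFrame f s, Ψ⟫_ℂ‖ ^ 2)
      = ∑' k, ENNReal.ofReal (‖(planeWaves _).repr f k‖ ^ 2)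
        * ENNReal.ofReal (occupationDensity Ψ s k) := by
  have h := Complex.hasSum_re (hasSum_occupationDensity hΨ f f s)
  have h1 : ∀ k, (conj ((planeWaves _).repr f k) * (planeWaves _).repr f k
      * (occupationDensity Ψ s k : ℂ)).re
      = ‖(planeWaves _).repr f k‖ ^ 2 * occupationDensity Ψ s k := fun k => by
    rw [Complex.conj_mul', ← Complex.ofReal_pow, ← Complex.ofReal_mul, Complex.ofReal_re]
  have h2 : (⟪Ψ, annihilationFrame f s⟫_ℂ * ⟪annihilationFrame f s, Ψ⟫_ℂ).re
      = ‖⟪annihilationFrame f s, Ψ⟫_ℂ‖ ^ 2 := by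
    rw [← inner_conj_symm Ψ, Complex.conj_mul', ← Complex.ofReal_pow, Complex.ofReal_re]
  rw [h2] at h
  simp only [h1] at h
  rw [← tsum_ofReal_of_hasSum
    (fun k => mul_nonneg (sq_nonneg _) (occupationDensity_nonneg Ψ s k)) h]
  simp only [ENNReal.ofReal_mul (sq_nonneg _)]

end TotalMomentum

/-- Exchange of two sums: nonnegativity of `T` and summability of `‖a k‖ c k` make the double series
absolutely summable. -/
lemma hasSum_of_hasSum_fibers {Q κ : Type*} {T : Q → κ → ℝ} (hT : ∀ q k, 0 ≤ T q k) {c : κ → ℝ}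
    (hc : ∀ k, HasSum (fun q => T q k) (c k)) {a : κ → ℂ} (ha : Summable fun k => ‖a k‖ * c k)
    {R : Q → ℂ} (hR : ∀ q, HasSum (fun k => a k * (T q k : ℂ)) (R q)) {v : ℂ}
    (hv : HasSum (fun k => a k * (c k : ℂ)) v) : HasSum R v := by
  have h1 : Summable fun z : κ × Q => a z.1 * (T z.2 z.1 : ℂ) := by
    refine Summable.of_norm ?_
    rw [summable_prod_of_nonneg fun z => norm_nonneg _]
    have h2 : ∀ k q, ‖a k * (T q k : ℂ)‖ = ‖a k‖ * T q k := fun k q => by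
      rw [norm_mul, Complex.norm_real, Real.norm_of_nonneg (hT q k)]
    simp only [h2]
    refine ⟨fun k => (hc k).summable.mul_left _, ?_⟩
    simpa only [tsum_mul_left, fun k => (hc k).tsum_eq] using ha
  have h3 := h1.hasSum.prod_fiberwise fun k =>
    (Complex.hasSum_ofReal.mpr (hc k)).mul_left (a k)
  have h4 := h1.hasSum
  rw [h3.unique hv, ← (Equiv.prodComm Q κ).hasSum_iff] at h4
  exact h4.prod_fiberwise hR

/-- States that are diagonal in a basis of vectors with definite total momentum have diagonal
one-body density matrices. -/
lemma isOneBodyDensityMatrix_diagonalOperator {Γ : Fock →L[ℂ] Fock} (d₀ : Diagonalization Γ)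
    (hd₀ : ∀ j, 0 ≤ d₀.weight j)
    (hmom : ∀ j, ∃ q, ∀ (n : ℕ) (p : Fin n × Fin 2 → ℤ), totalMomentum p ≠ q →
      (planeWaves _).repr (component (d₀.basis j) n) p = 0)
    {c : (Fin 2 → ℤ) → ℝ} (hc0 : ∀ k, 0 ≤ c k)
    (hc : ∀ k, ∑' j, ENNReal.ofReal (d₀.weight j) * occupationForm k (d₀.basis j)
      = ENNReal.ofReal (c k)) {M : ℝ} (hM : ∀ k, ‖(c k : ℂ)‖ ≤ M) :
    IsOneBodyDensityMatrix Γ (diagonalOperator (planeWaves (Fin 2)) (fun k => (c k : ℂ)) M hM) := by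
  have hcM : ∀ k, c k ≤ M := fun k => by
    have := hM k
    rwa [Complex.norm_real, Real.norm_of_nonneg (hc0 k)] at this
  have hM0 : 0 ≤ M := (hc0 0).trans (hcM 0)
  refine ⟨⟨d₀⟩, fun d f g => ?_⟩
  -- The form of `a†(f) a(f)` has expectation `∑ |f̂(k)|² c k ≤ M ‖f‖²`. This finiteness transfers
  -- the computation from `d₀` to an arbitrary diagonalization.
  have hframe : ∀ f : OneBody, ∑' j, ENNReal.ofReal (d₀.weight j)
      * Diagonalization.frameForm (annihilationFrame f) (d₀.basis j) ≠ ⊤ := fun f => by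
    have h1 : ∀ j, ENNReal.ofReal (d₀.weight j)
        * Diagonalization.frameForm (annihilationFrame f) (d₀.basis j)
        = ∑' k, ENNReal.ofReal (‖(planeWaves _).repr f k‖ ^ 2)
          * (ENNReal.ofReal (d₀.weight j) * occupationForm k (d₀.basis j)) := fun j => by
      obtain ⟨q, hq⟩ := hmom j
      rw [Diagonalization.frameForm]
      simp only [ofReal_sq_norm_annihilationFrame hq]
      rw [ENNReal.tsum_comm, ← ENNReal.tsum_mul_left]
      congr 1
      funext k
      rw [ENNReal.tsum_mul_left, tsum_occupationDensity, mul_left_comm]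
    simp only [h1]
    rw [ENNReal.tsum_comm]
    simp only [ENNReal.tsum_mul_left, hc]
    refine ne_top_of_le_ne_top (b := ENNReal.ofReal (‖f‖ ^ 2) * ENNReal.ofReal M)
      (ENNReal.mul_ne_top ENNReal.ofReal_ne_top ENNReal.ofReal_ne_top) ?_
    rw [← tsum_ofReal_of_hasSum (fun _ => sq_nonneg _) (hasSum_sq_norm_repr f),
      ← ENNReal.tsum_mul_right]
    exact ENNReal.tsum_le_tsum fun k => mul_le_mul_right (ENNReal.ofReal_le_ofReal (hcM k)) _
  have h0 : HasSum (fun q : d₀.ι × Σ n, Fin n × Fin 2 → ℤ => (d₀.weight q.1 : ℂ) *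
      (⟪d₀.basis q.1, annihilationFrame g q.2⟫_ℂ * ⟪annihilationFrame f q.2, d₀.basis q.1⟫_ℂ))
      ⟪f, diagonalOperator (planeWaves (Fin 2)) (fun k => (c k : ℂ)) M hM g⟫_ℂ := by
    refine hasSum_of_hasSum_fibers
      (T := fun q k => d₀.weight q.1 * occupationDensity (d₀.basis q.1) q.2 k)
      (a := fun k => conj ((planeWaves _).repr f k) * (planeWaves _).repr g k)
      (fun q k => mul_nonneg (hd₀ _) (occupationDensity_nonneg _ _ _)) (c := c) (fun k => ?_) ?_
      (fun q => ?_) ?_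
    · refine hasSum_of_tsum_ofReal
        (fun q => mul_nonneg (hd₀ _) (occupationDensity_nonneg _ _ _)) (hc0 k) ?_
      rw [← hc, ENNReal.tsum_prod']
      simp only [ENNReal.ofReal_mul (hd₀ _), ENNReal.tsum_mul_left, tsum_occupationDensity]
    · refine Summable.of_nonneg_of_le (fun k => mul_nonneg (norm_nonneg _) (hc0 k)) (fun k => ?_)
        ((hasSum_conj_repr_mul_repr f g).summable.norm.mul_right M)
      exact mul_le_mul_of_nonneg_left (hcM k) (norm_nonneg _)
    · obtain ⟨p, hp⟩ := hmom q.1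
      refine ((hasSum_occupationDensity hp f g q.2).mul_left (d₀.weight q.1 : ℂ)).congr_fun
        fun k => ?_
      push_cast
      ring
    · refine (hasSum_conj_repr_mul_repr f _).congr_fun fun k => ?_
      rw [repr_diagonalOperator]
      ring
  have h1 := Diagonalization.hasSum_weight_mul_inner_mul_inner d₀ hd₀ d (annihilationFrame g)
    (annihilationFrame f) (hframe g) (hframe f)
  rw [h0.tsum_eq] at h1
  let e : (Σ q : d.ι × ℕ, Fin q.2 × Fin 2 → ℤ) ≃ d.ι × Σ n, Fin n × Fin 2 → ℤ :=
    { toFun := fun z => (z.1.1, ⟨z.1.2, z.2⟩)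
      invFun := fun z => ⟨(z.1, z.2.1), z.2.2⟩
      left_inv := fun _ => rfl
      right_inv := fun _ => rfl }
  refine HasSum.sigma (e.hasSum_iff.mpr h1) fun q => ?_
  exact (hasSum_annihilationFrame f g (d.basis q.1) q.2).mul_left (d.weight q.1 : ℂ)

end DensityMatrix

/-! ## One-body density matrices of the Gibbs states -/

section GibbsDensityMatrix

variable {w : EuclideanSpace ℝ (Fin 2) → ℝ} {lam ε : ℝ}

lemma occupationForm_occupationVector (k : Fin 2 → ℤ) (m : (Fin 2 → ℤ) →₀ ℕ) :
    occupationForm k (occupationVector m) = m k := by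
  rw [occupationForm, tsum_eq_single m]
  · rw [inner_self_eq_norm_sq_to_K, orthonormal_occupationVector.1 m]
    simp
  · intro m' hm
    rw [orthonormal_occupationVector.2 hm]
    simp

lemma totalMomentum_eq_occupation {n : ℕ} (p : Fin n × Fin 2 → ℤ) :
    totalMomentum p = (occupation p).sum fun k a => a • k :=
  sum_momentum (fun k => k) p

lemma norm_ofReal_le {c M : ℝ} (h0 : 0 ≤ c) (h : c ≤ M) : ‖(c : ℂ)‖ ≤ M := by
  rwa [Complex.norm_real, Real.norm_of_nonneg h0]

lemma norm_bose_le (hlam : 0 < lam) (k : Fin 2 → ℤ) :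
    ‖((bose (lam * oneBodyEnergy k) : ℝ) : ℂ)‖ ≤ freeNumber lam :=
  norm_ofReal_le (bose_pos (mul_oneBodyEnergy_pos hlam k)).le (bose_le_freeNumber hlam k)

lemma isOneBodyDensityMatrix_freeGibbs (hlam : 0 < lam) :
    IsOneBodyDensityMatrix (freeGibbs lam) (diagonalOperator (planeWaves (Fin 2))
      (fun k => ((bose (lam * oneBodyEnergy k) : ℝ) : ℂ)) _ (norm_bose_le hlam)) := by
  refine isOneBodyDensityMatrix_diagonalOperator (freeDiagonalization hlam.le)
    (freeWeight_nonneg hlam.le) (fun j => ?_)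
    (fun k => (bose_pos (mul_oneBodyEnergy_pos hlam k)).le) (fun k => ?_) _
  · let m : (Fin 2 → ℤ) →₀ ℕ := j
    refine ⟨m.sum fun k a => a • k, fun n p hp => ?_⟩
    change (planeWaves _).repr (component (occupationBasis m) n) p = 0
    rw [coe_occupationBasis]
    refine repr_component_occupationVector fun h => hp ?_
    rw [totalMomentum_eq_occupation, h]
  · rw [tsum_freeDiagonalization]
    simp only [occupationForm_occupationVector]
    exact tsum_freeWeight_mul hlam (tsum_boltzmann_mul_apply (mul_oneBodyEnergy_pos hlam) k)

namespace FockEigenbasis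

variable {hw : IsInteraction w} {hs : Summable (coupling w ε)} {hlam : 0 < lam}

lemma occupationForm_basis (B : FockEigenbasis (interactionFunction hw hs hlam) lam) (i : B.ι)
    (k : Fin 2 → ℤ) : occupationForm k (B.basis i) = ENNReal.ofReal (B.meanOccupation i k) := by
  rw [← tsum_ofReal_of_hasSum (fun m => mul_nonneg (B.overlap_nonneg i m) (Nat.cast_nonneg _))
    (B.hasSum_meanOccupation i k), occupationForm]
  congr 1
  funext m
  rw [ENNReal.ofReal_mul (B.overlap_nonneg i m), ENNReal.ofReal_natCast, mul_comm]
  rfl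

lemma repr_component_basis (B : FockEigenbasis (interactionFunction hw hs hlam) lam) (i : B.ι)
    {n : ℕ} {p : Fin n × Fin 2 → ℤ} (hp : totalMomentum p ≠ B.total i) :
    (planeWaves _).repr (component (B.basis i) n) p = 0 := by
  by_cases hn : n = B.number i
  · subst hn
    rw [B.component_basis]
    exact (B.wave_mem i).2 p hp
  · rw [B.basis_eq, component_single_of_ne _ hn, map_zero]
    rfl

lemma gibbsOccupation_nonneg (B : FockEigenbasis (interactionFunction hw hs hlam) lam)
    (k : Fin 2 → ℤ) : 0 ≤ B.gibbsOccupation k :=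
  tsum_nonneg fun i => mul_nonneg (B.gibbsWeight_nonneg i) (B.meanOccupation_nonneg i k)

lemma gibbsOccupation_le (B : FockEigenbasis (interactionFunction hw hs hlam) lam)
    (k : Fin 2 → ℤ) : B.gibbsOccupation k ≤ ∑' i, B.gibbsWeight i * B.number i :=
  hasSum_le (fun i => mul_le_mul_of_nonneg_left (B.meanOccupation_le i k) (B.gibbsWeight_nonneg i))
    (B.hasSum_gibbsOccupation k) B.summable_gibbsWeight_mul_number.hasSum

lemma norm_gibbsOccupation_le (B : FockEigenbasis (interactionFunction hw hs hlam) lam)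
    (k : Fin 2 → ℤ) : ‖(B.gibbsOccupation k : ℂ)‖ ≤ ∑' i, B.gibbsWeight i * B.number i :=
  norm_ofReal_le (B.gibbsOccupation_nonneg k) (B.gibbsOccupation_le k)

lemma isOneBodyDensityMatrix_interactingGibbs
    (B : FockEigenbasis (interactionFunction hw hs hlam) lam) :
    IsOneBodyDensityMatrix (interactingGibbs w lam ε) (diagonalOperator (planeWaves (Fin 2))
      (fun k => (B.gibbsOccupation k : ℂ)) _ B.norm_gibbsOccupation_le) := by
  refine isOneBodyDensityMatrix_diagonalOperator B.gibbsDiagonalization B.gibbsWeight_nonneg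
    (fun i => ⟨B.total i, fun n p hp => ?_⟩) B.gibbsOccupation_nonneg (fun k => ?_) _
  · exact B.repr_component_basis i hp
  · change ∑' i : B.ι, ENNReal.ofReal (B.gibbsWeight i) * occupationForm k (B.basis i) = _
    rw [← tsum_ofReal_of_hasSum (fun i =>
      mul_nonneg (B.gibbsWeight_nonneg i) (B.meanOccupation_nonneg i k))
      (B.hasSum_gibbsOccupation k)]
    simp only [occupationForm_basis, ENNReal.ofReal_mul (B.gibbsWeight_nonneg _)]

end FockEigenbasis

/-- An operator diagonal in plane waves commutes with `h`, so the weighted Hilbert–Schmidt norm is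
the ℓ² norm of `h_k d_k`, the supremum over finite sets of modes. -/
lemma weightedHSNorm_le {D : OneBody →L[ℂ] OneBody} {d : (Fin 2 → ℤ) → ℝ}
    (hD : ∀ k, D (planeWaves (Fin 2) k) = (d k : ℂ) • planeWaves (Fin 2) k) {R : ℝ} (hR : 0 ≤ R)
    (h : ∀ S : Finset (Fin 2 → ℤ), ∑ k ∈ S, (oneBodyEnergy k * d k) ^ 2 ≤ R ^ 2) :
    weightedHSNorm D ≤ ENNReal.ofReal R := by
  have h1 : ∀ k, ∑' l, ENNReal.ofReal (oneBodyEnergy k * oneBodyEnergy l *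
      ‖⟪planeWaves (Fin 2) k, D (planeWaves (Fin 2) l)⟫_ℂ‖ ^ 2)
      = ENNReal.ofReal ((oneBodyEnergy k * d k) ^ 2) := fun k => by
    rw [tsum_eq_single k]
    · rw [hD, inner_smul_right, inner_self_eq_norm_sq_to_K, (planeWaves (Fin 2)).orthonormal.1 k]
      congr 1
      simp only [RCLike.ofReal_one, one_pow, mul_one, Complex.norm_real, Real.norm_eq_abs, sq_abs]
      ring
    · intro l hl
      rw [hD, inner_smul_right, (planeWaves (Fin 2)).orthonormal.2 hl.symm]
      simp
  have h2 : ∑' k, ENNReal.ofReal ((oneBodyEnergy k * d k) ^ 2) ≤ ENNReal.ofReal (R ^ 2) := by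
    rw [ENNReal.tsum_eq_iSup_sum]
    refine iSup_le fun S => ?_
    rw [← ENNReal.ofReal_sum_of_nonneg fun k _ => sq_nonneg _]
    exact ENNReal.ofReal_le_ofReal (h S)
  rw [weightedHSNorm]
  simp only [h1]
  refine (ENNReal.rpow_le_rpow h2 (by norm_num)).trans (le_of_eq ?_)
  rw [ENNReal.ofReal_rpow_of_nonneg (sq_nonneg R) (by norm_num), ← Real.sqrt_eq_rpow,
    Real.sqrt_sq hR]

lemma FockEigenbasis.mul_weightedHSNorm_le {hw : IsInteraction w} {hs : Summable (coupling w ε)}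
    {hlam : 0 < lam} (B : FockEigenbasis (interactionFunction hw hs hlam) lam) :
    ENNReal.ofReal lam * weightedHSNorm (diagonalOperator (planeWaves (Fin 2))
        (fun k => (B.gibbsOccupation k : ℂ)) _ B.norm_gibbsOccupation_le
      - diagonalOperator (planeWaves (Fin 2))
        (fun k => ((bose (lam * oneBodyEnergy k) : ℝ) : ℂ)) _ (norm_bose_le hlam))
      ≤ ENNReal.ofReal (1 + 2 * (counterterm w ε + meanInteraction w lam ε)) := by
  set K := 1 + 2 * (counterterm w ε + meanInteraction w lam ε) with hK
  have hK0 : 0 ≤ K := by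
    have := counterterm_nonneg hw hs
    have := meanInteraction_nonneg hw (lam := lam) (ε := ε)
    positivity
  refine (mul_le_mul_right (weightedHSNorm_le
    (d := fun k => B.gibbsOccupation k - bose (lam * oneBodyEnergy k)) (R := K / lam)
    (fun k => ?_) (div_nonneg hK0 hlam.le) fun S => ?_) _).trans (le_of_eq ?_)
  · rw [sub_apply, diagonalOperator_apply_basis, diagonalOperator_apply_basis, ← sub_smul]
    push_cast
    rfl
  · have h := B.sum_sq_gibbsOccupation_sub_le S
    rw [div_pow, le_div_iff₀ (by positivity), Finset.sum_mul]
    refine le_trans (le_of_eq (Finset.sum_congr rfl fun k _ => ?_)) h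
    ring
  · rw [← ENNReal.ofReal_mul hlam.le]
    congr 1
    field_simp

lemma exists_interaction_eigenbasis (hw : IsInteraction w) (hs : Summable (coupling w ε))
    (hlam : 0 < lam) : Nonempty (FockEigenbasis (interactionFunction hw hs hlam) lam) :=
  exists_fockEigenbasis _ (fun _ σ x => renormalizedPotential_relabel σ x)
    (fun _ a x => renormalizedPotential_add_diagonalShift hlam a x) hlam

/-- The energies are of order `|log ε|²` when `ε = lam ^ η`. -/
lemma exists_counterterm_add_meanInteraction_le (hw : IsInteraction w) {η : ℝ} (hη₀ : 0 < η)
    (hη : η < 1 / 2) {lam₀ : ℝ} (h₀ : 0 < lam₀) (h₁ : lam₀ < 1) :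
    ∃ C, 0 ≤ C ∧ ∀ lam, 0 < lam → lam ≤ lam₀ →
      1 ≤ C * |Real.log (lam ^ η)| ^ 2 ∧ Summable (coupling w (lam ^ η)) ∧
      counterterm w (lam ^ η) + meanInteraction w lam (lam ^ η)
        ≤ C * |Real.log (lam ^ η)| ^ 2 := by
  obtain ⟨C₁, hC₁, h1⟩ := exists_counterterm_le hw
  obtain ⟨A, hA, h2⟩ := exists_sum_coupling_le hw
  have hl : 0 < -(η * Real.log lam₀) := by
    have := mul_pos hη₀ (neg_pos.mpr (Real.log_neg h₀ h₁))
    linarith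
  set l := -(η * Real.log lam₀) with hl_def
  -- This choice gives `λ² ε⁻² = λ^{1+δ}`, exactly the power that controls `N₀`; positivity of `δ`
  -- is the condition `η < 1/2`.
  set δ := 1 - 2 * η with hδ
  have hδ0 : 0 < δ := by linarith
  set C₂ := A * (108 / δ) with hC₂
  have hC₂0 : 0 ≤ C₂ := by positivity
  -- Since `λ ≤ λ₀ < 1`, the logarithm `t = |log ε|` is at least `l > 0`. The three summands convert
  -- `(1 + t)²`, the constant `C₂` and the constant `1` into multiples of `t²`.
  refine ⟨C₁ * (1 / l + 1) ^ 2 + C₂ / l ^ 2 + 1 / l ^ 2, by positivity, fun lam hlam hle => ?_⟩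
  set t := -(η * Real.log lam) with ht
  have hlt : l ≤ t := by
    have := mul_le_mul_of_nonneg_left (Real.log_le_log hlam hle) hη₀.le
    linarith
  have ht0 : 0 < t := hl.trans_le hlt
  have hlog : |Real.log (lam ^ η)| = t := by
    rw [Real.log_rpow hlam, ← abs_neg, abs_of_pos ht0]
  have hexp : lam ^ η = Real.exp (-t) := by
    rw [Real.rpow_def_of_pos hlam, ht, neg_neg, mul_comm]
  have hε1 : lam ^ η ≤ 1 := by
    rw [hexp]
    exact Real.exp_le_one_iff.mpr (by linarith)
  obtain ⟨hs, hA'⟩ := h2 (lam ^ η) (Real.rpow_pos_of_pos hlam η) hε1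
  have h3 : 1 ≤ t ^ 2 / l ^ 2 := by
    rw [le_div_iff₀ (by positivity), one_mul]
    exact pow_le_pow_left₀ hl.le hlt 2
  have h4 : (1 + t) ^ 2 ≤ (1 / l + 1) ^ 2 * t ^ 2 := by
    rw [← mul_pow]
    refine pow_le_pow_left₀ (by linarith) ?_ 2
    have : 1 ≤ t / l := by
      rw [le_div_iff₀ hl, one_mul]
      exact hlt
    have h5 : (1 / l + 1) * t = t / l + t := by ring
    linarith
  have h5 : counterterm w (lam ^ η) ≤ C₁ * (1 / l + 1) ^ 2 * t ^ 2 := by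
    have h6 := h1 t ht0.le
    rw [← hexp] at h6
    refine h6.trans ?_
    rw [mul_assoc]
    exact mul_le_mul_of_nonneg_left h4 hC₁
  have h6 : meanInteraction w lam (lam ^ η) ≤ C₂ := by
    have h7 := rpow_mul_freeNumber_le hlam hδ0 (by linarith : δ ≤ 1)
    have h8 : lam ^ 2 * ((lam ^ η) ^ 2)⁻¹ = lam ^ (1 + δ) := by
      rw [← Real.rpow_natCast, ← Real.rpow_natCast, ← Real.rpow_mul hlam.le,
        ← Real.rpow_neg hlam.le, ← Real.rpow_add hlam]
      congr 1
      push_cast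
      linarith
    have h9 : 0 ≤ freeNumber lam := freeNumber_nonneg lam
    calc meanInteraction w lam (lam ^ η)
        ≤ lam ^ 2 / 2 * (freeNumber lam * (A * ((lam ^ η) ^ 2)⁻¹)) := by
          rw [meanInteraction]
          gcongr
      _ = A * (lam ^ 2 * ((lam ^ η) ^ 2)⁻¹ * freeNumber lam) / 2 := by ring
      _ = A * (lam ^ (1 + δ) * freeNumber lam) / 2 := by rw [h8]
      _ ≤ A * (108 / δ) / 2 := by gcongr
      _ ≤ C₂ := half_le_self hC₂0
  have h7 : C₂ ≤ C₂ / l ^ 2 * t ^ 2 := by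
    calc C₂ = C₂ * 1 := (mul_one _).symm
      _ ≤ C₂ * (t ^ 2 / l ^ 2) := by gcongr
      _ = C₂ / l ^ 2 * t ^ 2 := by ring
  have h8 : t ^ 2 / l ^ 2 = 1 / l ^ 2 * t ^ 2 := by ring
  have h9 : 0 ≤ C₁ * (1 / l + 1) ^ 2 * t ^ 2 := by positivity
  rw [hlog, add_mul, add_mul]
  refine ⟨?_, hs, ?_⟩ <;> linarith [h3.trans_eq h8]

end GibbsDensityMatrix

end BoseGas

end

/-! ### The three estimates with a common constant -/

theorem mainTheorem6 (w : EuclideanSpace ℝ (Fin 2) → ℝ) (hw : IsInteraction w)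
    (η : ℝ) (hη₀ : 0 < η) (hη : η < 1 / 2) (lam₀ : ℝ) (hlam₀ : lam₀ < 1) :
    ∃ C : ℝ, ∀ lam : ℝ, 0 < lam → lam ≤ lam₀ → ∀ ε : ℝ, ε = lam ^ η →
      (partitionFunction (freeHamiltonian lam) ≠ 0 ∧
        partitionFunction (freeHamiltonian lam) ≠ ⊤ ∧
        partitionFunction (interactingHamiltonian w lam ε) ≠ 0 ∧
        partitionFunction (interactingHamiltonian w lam ε) ≠ ⊤ ∧
        |Real.log ((partitionFunction (interactingHamiltonian w lam ε)).toReal /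
          (partitionFunction (freeHamiltonian lam)).toReal)| ≤ C * |Real.log ε| ^ 2) ∧
      relEntropy (interactingGibbs w lam ε) (freeGibbs lam)
          + ENNReal.ofReal (lam ^ 2)
            * expect (interactingGibbs w lam ε) (numberVarianceForm (freeNumber lam))
        ≤ ENNReal.ofReal (C * |Real.log ε| ^ 2) ∧
      ∃ γ γ₀ : OneBody →L[ℂ] OneBody,
        IsOneBodyDensityMatrix (interactingGibbs w lam ε) γ ∧
        IsOneBodyDensityMatrix (freeGibbs lam) γ₀ ∧
        ENNReal.ofReal lam * weightedHSNorm (γ - γ₀) ≤ ENNReal.ofReal (C * |Real.log ε| ^ 2) := by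
  rcases le_or_gt lam₀ 0 with h | h
  · exact ⟨0, fun lam h1 h2 => absurd (h1.trans_le h2) h.not_gt⟩
  obtain ⟨C, hC, hbound⟩ := exists_counterterm_add_meanInteraction_le hw hη₀ hη h hlam₀
  -- With `K ≤ C |log ε|²` and `1 ≤ C |log ε|²`, the three bounds `K`, `4K` and `1 + 2K` are all at
  -- most `4 C |log ε|²`.
  refine ⟨4 * C, ?_⟩
  rintro lam hlam hle ε rfl
  obtain ⟨h1, hs, hK⟩ := hbound lam hlam hle
  obtain ⟨B⟩ := exists_interaction_eigenbasis hw hs hlam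
  have hK0 := add_nonneg (counterterm_nonneg hw hs)
    (meanInteraction_nonneg hw (lam := lam) (ε := lam ^ η))
  refine ⟨⟨freePartition_ne_zero hlam.le, freePartition_ne_top hlam, B.partitionFunction_ne_zero,
    B.partitionFunction_ne_top, B.abs_log_div_le.trans (by linarith)⟩,
    B.relEntropy_add_variance_le.trans (ENNReal.ofReal_le_ofReal (by linarith)), _, _,
    B.isOneBodyDensityMatrix_interactingGibbs, isOneBodyDensityMatrix_freeGibbs hlam,
    B.mul_weightedHSNorm_le.trans (ENNReal.ofReal_le_ofReal (by linarith))⟩
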